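/- Let $X$ be a compact $(n+1)$-dimensional smooth manifold with boundary and $g$ a nontrapping asymptotically hyperbolic metric on its interior $X^\circ$. That is, for a boundary defining function $x$, the tensor $\bar g=x^2g$ extends to a smooth Riemannian metric on $X$ with $|dx|_{\bar g}=1$ on $\partial X$, and $x\to 0$ along every geodesic, both forwards and backwards. Let $X^2_0=[X^2;\partial\mathrm{diag}]$, where $\partial\mathrm{diag}=\{(p,p): p\in\partial X\}$, be the $0$-blown-up double space with front face $\mathrm{FF}$, lifted diagonal $\mathrm{diag}_0$ and blowdown map $\beta:X^2_0\to X^2$. Let ${}^0T^*X$ be the bundle whose smooth sections are the forms $\alpha/x$ with $\alpha$ a smooth one-form on $X$. Let ${}^\Phi T^*X^2_0=\beta^*({}^0T^*X\times{}^0T^*X)$, with projection ${}^\Phi\pi:{}^\Phi T^*X^2_0\to X^2_0$. Put $p(z,\zeta)=|\zeta|_g^2-1$ and $\Sigma=\{p=0\}$. Let $\Sigma_L\subset{}^\Phi T^*X^2_0$ be the zero set of $p$ (extended smoothly to ${}^0T^*X$) in the left variables, and let $N^*\mathrm{diag}_0\subset{}^\Phi T^*X^2_0$ be the conormal bundle of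 $\mathrm{diag}_0$. Let $\Lambda_+\subset{}^\Phi T^*X^2_0$ be the closure of the forward bicharacteristic relation, i.e. of the set of all $(z,\zeta,z',-\zeta')$ over $X^\circ\times X^\circ$ such that $(z,\zeta)\in\Sigma$ is reached from $(z',\zeta')$ in the forward direction along an integral curve of the Hamilton vector field $H_p$. Put $\partial_{\mathrm{diag}}\Lambda_+=N^*\mathrm{diag}_0\cap\Sigma_L$. Then $\partial_{\mathrm{diag}}\Lambda_+\subset\Lambda_+$, and there is an open neighbourhood $U$ of $N^*\mathrm{diag}_0\cap\Sigma_L$ in ${}^\Phi T^*X^2_0$ such that: 1. $\Lambda_+\cap U$ is a smooth (embedded) $2(n+1)$-dimensional manifold with corners of codimension two, that is, it is locally parametrized by relatively open subsets of $[0,\infty)^2\times\mathbb R^{2n}$. Its boundary faces, given by the vanishing of the first and of the second corner coordinate, are $\partial_{\mathrm{diag}}\Lambda_+$ and the part of $\Lambda_+\cap U$ lying over $\mathrm{FF}$. 2. ${}^\Phi\pi$ restricts to a diffeomorphism from the interior of $\Lambda_+\cap U$ (the complement of these two faces) onto its image, an open subset of $X^2_0$. 3. At each point of $\partial_{\mathrm{diag}}\Lambda_+$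 the rank of $d({}^\Phi\pi|_{\Lambda_+\cap U})$ drops by exactly $n$, i.e. equals $n+2$. 4. $\det d({}^\Phi\pi|_{\Lambda_+\cap U})$ vanishes to order precisely $n$ at $\partial_{\mathrm{diag}}\Lambda_+$. That is, every point of $\Lambda_+\cap U$ has a neighbourhood with local coordinates as in item 1, and local coordinates on $X^2_0$ around its projection, in which $c\,r^n\le|\det d({}^\Phi\pi|_{\Lambda_+\cap U})|\le C\,r^n$ for some constants $0<c\le C$, where $r$ is the first corner coordinate, which defines $\partial_{\mathrm{diag}}\Lambda_+$. -/

import Mathlib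

open scoped Manifold ContDiff Topology
open Set Filter Bundle

noncomputable section

/-- The model vector space `ℝ^{n+1}`; the coordinate with index `0` is the one that is
nonnegative on the half-space. -/
abbrev EMod (n : ℕ) : Type := EuclideanSpace ℝ (Fin (n + 1))

/-- The model with corners of `(n+1)`-dimensional manifolds with boundary. -/
abbrev halfModel (n : ℕ) : ModelWithCorners ℝ (EMod n) (EuclideanHalfSpace (n + 1)) :=
  𝓡∂ (n + 1)

section Charts

variable {n : ℕ} {X : Type*} [TopologicalSpace X] [ChartedSpace (EuclideanHalfSpace (n + 1)) X]
  [IsManifold (halfModel n) ∞ X]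

variable (n X) in
/-- The total space of the cotangent bundle `T^*X`. -/
abbrev CotBundle : Type _ :=
  TotalSpace (EMod n →L[ℝ] ℝ)
    (fun z : X => TangentSpace (halfModel n) z →L[ℝ] Bundle.Trivial X ℝ z)

/-- The domain of the chart of `X` centred at `p`. -/
def chartDom (n : ℕ) {X : Type*} [TopologicalSpace X]
    [ChartedSpace (EuclideanHalfSpace (n + 1)) X] (p : X) : Set X :=
  (chartAt (EuclideanHalfSpace (n + 1)) p).source

/-- The coordinates of the chart of `X` centred at `p`. -/
def coord (n : ℕ) {X : Type*} [TopologicalSpace X]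
    [ChartedSpace (EuclideanHalfSpace (n + 1)) X] (p z : X) : EMod n :=
  extChartAt (halfModel n) p z

/-- The coordinate vector field `∂_i` of the chart centred at `p`, at the point `z`. -/
def coordFrame (p z : X) (i : Fin (n + 1)) : TangentSpace (halfModel n) z :=
  (trivializationAt (EMod n) (TangentSpace (halfModel n) : X → Type _) p).symmL ℝ z
    (EuclideanSpace.single i (1 : ℝ) : EMod n)

/-- The components in the chart centred at `p` of a tangent vector at `z`. -/
def tangentCoord (p z : X) (w : TangentSpace (halfModel n) z) : EMod n :=
  (trivializationAt (EMod n) (TangentSpace (halfModel n) : X → Type _) p).continuousLinearMapAt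
    ℝ z w

/-- The components `ζ_i = ζ(∂_i)` in the chart centred at `p` of a covector at `z`. -/
def cotangentCoord (p z : X) (ζ : TangentSpace (halfModel n) z →L[ℝ] ℝ) : EMod n :=
  WithLp.toLp 2 (fun i => ζ (coordFrame p z i))

/-- `∑ g^{ij} ξ_i ξ_j` at the point `z`, for the metric with components
`g_{ij} = B_z(∂_i, ∂_j)` in the chart centred at `p`. -/
def cometricInChart (B : ∀ z : X, TangentSpace (halfModel n) z → TangentSpace (halfModel n) z → ℝ)
    (p z : X) (ξ : EMod n) : ℝ :=
  ∑ i, ∑ j,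
    (Matrix.of (fun k l : Fin (n + 1) => B z (coordFrame p z k) (coordFrame p z l)))⁻¹ i j
      * ξ i * ξ j

/-- The dual squared length `|ζ|²` of a covector for the metric `B`. -/
def dualNormSq (B : ∀ z : X, TangentSpace (halfModel n) z → TangentSpace (halfModel n) z → ℝ)
    (z : X) (ζ : TangentSpace (halfModel n) z →L[ℝ] ℝ) : ℝ :=
  cometricInChart B z z (cotangentCoord z z ζ)

end Charts

/-- An asymptotically hyperbolic metric `g = x⁻² ḡ` on the interior of a manifold `X` with
boundary: `x` is a boundary defining function, `ḡ = x² g` is a Riemannian metric that is smooth up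
to the boundary, and `|dx|_ḡ = 1` at `∂X`. -/
structure AHMetric (n : ℕ) (X : Type*) [TopologicalSpace X]
    [ChartedSpace (EuclideanHalfSpace (n + 1)) X] [IsManifold (halfModel n) ∞ X] where
  /-- the boundary defining function -/
  x : X → ℝ
  /-- the compactified metric `x² g` -/
  gbar : ContMDiffRiemannianMetric (halfModel n) ∞ (EMod n)
    (TangentSpace (halfModel n) : X → Type _)
  x_smooth : ContMDiff (halfModel n) 𝓘(ℝ, ℝ) ∞ x
  x_nonneg : ∀ z, 0 ≤ x z
  x_eq_zero : ∀ z, x z = 0 ↔ z ∈ (halfModel n).boundary X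
  dx_ne_zero : ∀ z ∈ (halfModel n).boundary X, mfderiv (halfModel n) 𝓘(ℝ, ℝ) x z ≠ 0
  dx_norm : ∀ z ∈ (halfModel n).boundary X,
    dualNormSq (fun z v w => gbar.inner z v w) z (mfderiv (halfModel n) 𝓘(ℝ, ℝ) x z) = 1

namespace AHMetric

variable {n : ℕ} {X : Type*} [TopologicalSpace X] [ChartedSpace (EuclideanHalfSpace (n + 1)) X]
  [IsManifold (halfModel n) ∞ X] (A : AHMetric n X)

/-- The compactified metric `ḡ`. -/
def compactMetric (z : X) (v w : TangentSpace (halfModel n) z) : ℝ := A.gbar.inner z v w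

/-- The asymptotically hyperbolic metric `g = x⁻² ḡ` (meaningful on the interior). -/
def metric (z : X) (v w : TangentSpace (halfModel n) z) : ℝ :=
  (A.x z ^ 2)⁻¹ * A.gbar.inner z v w

/-- The differential of the boundary defining function. -/
def dx (z : X) (v : TangentSpace (halfModel n) z) : ℝ :=
  mfderiv (halfModel n) 𝓘(ℝ, ℝ) A.x z v

/-! ### Bicharacteristics -/

/-- The symbol `p = g^{ij} ζ_i ζ_j - 1` in the canonical coordinates `(q, ξ)` of `T^*X` induced by
the chart centred at `p₀`. -/
def symbolInChart (p₀ : X) (u : EMod n × EMod n) : ℝ :=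
  cometricInChart A.metric p₀ ((extChartAt (halfModel n) p₀).symm u.1) u.2 - 1

/-- `γ` is a (null) bicharacteristic: an integral curve in `Σ = {p = 0} ⊆ T^*X°` of the Hamilton
vector field `H_p = ∑ ∂p/∂ζ_i ∂_{z_i} - ∂p/∂z_i ∂_{ζ_i}`, defined for all times. -/
structure IsBicharacteristic (γ : ℝ → CotBundle n X) : Prop where
  continuous_proj : Continuous (fun t => (γ t).proj)
  mem_interior : ∀ t, (γ t).proj ∈ (halfModel n).interior X
  mem_char : ∀ t, dualNormSq A.metric (γ t).proj (γ t).2 - 1 = 0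
  hasDerivAt_position : ∀ (t : ℝ) (p₀ : X), (γ t).proj ∈ chartDom n p₀ → ∀ i : Fin (n + 1),
    HasDerivAt (fun s => coord n p₀ (γ s).proj i)
      (fderiv ℝ (A.symbolInChart p₀)
        (coord n p₀ (γ t).proj, cotangentCoord p₀ (γ t).proj (γ t).2)
        (0, EuclideanSpace.single i (1 : ℝ))) t
  hasDerivAt_momentum : ∀ (t : ℝ) (p₀ : X), (γ t).proj ∈ chartDom n p₀ → ∀ i : Fin (n + 1),
    HasDerivAt (fun s => cotangentCoord p₀ (γ s).proj (γ s).2 i)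
      (-fderiv ℝ (A.symbolInChart p₀)
        (coord n p₀ (γ t).proj, cotangentCoord p₀ (γ t).proj (γ t).2)
        (EuclideanSpace.single i (1 : ℝ), 0)) t

/-- Every geodesic reaches spatial infinity both forwards and backwards. -/
def Nontrapping : Prop :=
  ∀ γ : ℝ → CotBundle n X, A.IsBicharacteristic γ →
    Tendsto (fun t => A.x (γ t).proj) atTop (𝓝 0) ∧
    Tendsto (fun t => A.x (γ t).proj) atBot (𝓝 0)

/-! ### The blown-up double space -/

/-- The `0`-blown-up double space `X²₀ = [X²; ∂diag]` as a set: the points of `X²` off `∂diag`,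
together with the inward pointing spherical normal bundle of `∂diag`. The normal space
`T_{(p,p)}X² / T_{(p,p)}∂diag` is identified with `ℝ × T_pX` through
`(v, v') ↦ (dx(v'), v - v')`, whose kernel is `T_{(p,p)}∂diag`; so a normal vector `(a, w)` is
inward pointing iff `dx(v') = a ≥ 0` and `dx(v) = a + dx(w) ≥ 0`. A ray is represented by its vector
of unit length. -/
inductive DoubleSpace : Type _
  | off (z z' : X) (h : ¬ (z = z' ∧ z ∈ (halfModel n).boundary X)) : DoubleSpace
  | front (p : X) (hp : p ∈ (halfModel n).boundary X) (a : ℝ) (w : TangentSpace (halfModel n) p)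
      (ha : 0 ≤ a) (hw : 0 ≤ a + A.dx p w) (hunit : a ^ 2 + A.compactMetric p w w = 1) :
      DoubleSpace

namespace DoubleSpace

variable {A}

/-- The left component of the blowdown map `β : X²₀ → X²`. -/
def left : A.DoubleSpace → X
  | off z _ _ => z
  | front p _ _ _ _ _ _ => p

/-- The right component of the blowdown map `β : X²₀ → X²`. -/
def right : A.DoubleSpace → X
  | off _ z' _ => z'
  | front p _ _ _ _ _ _ => p

/-- The front face `FF`. -/
def FF : Set A.DoubleSpace :=
  {b | match b with
    | off _ _ _ => False
    | front _ _ _ _ _ _ _ => True}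

/-- The right face `FR`, the lift of `X × ∂X`. -/
def FR : Set A.DoubleSpace :=
  {b | match b with
    | off _ z' _ => z' ∈ (halfModel n).boundary X
    | front _ _ a _ _ _ _ => a = 0}

/-- The normal coordinates `(x(z'), v(z) - v(z'))` to `∂diag`, where `v` are the coordinates of the
chart centred at `p₀`. At the front face they are defined up to a positive factor. -/
def normalCoord (p₀ : X) : A.DoubleSpace → ℝ × EMod n
  | off z z' _ => (A.x z', coord n p₀ z - coord n p₀ z')
  | front p _ a w _ _ _ => (a, tangentCoord p₀ p w)

/-- The part of `X²₀` over the product of the chart domain at `p₀` with itself. -/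
def overChart (p₀ : X) : Set A.DoubleSpace :=
  {b | b.left ∈ chartDom n p₀ ∧ b.right ∈ chartDom n p₀}

/-- The blow-up topology: the coarsest one for which `β` and the angular variables of polar
coordinates around `∂diag` are continuous. -/
instance : TopologicalSpace A.DoubleSpace :=
  TopologicalSpace.generateFrom
    ({V | ∃ O : Set (X × X), IsOpen O ∧ V = {b | (b.left, b.right) ∈ O}} ∪
     {V | ∃ (p₀ : X) (O : Set (ℝ × EMod n)), IsOpen O ∧
        V = overChart p₀ ∩
          {b | ‖normalCoord p₀ b‖⁻¹ • normalCoord p₀ b ∈ O}})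

/-- Domain of the projective coordinates below. -/
def projDom (p₀ : X) : Set A.DoubleSpace := overChart p₀ \ FR

/-- Projective coordinates `(v', V) = (v(z'), (v(z) - v(z')) / x(z'))` on `X²₀` away from `FR`. The
lifted diagonal is `V = 0`, so their domains cover a neighbourhood of it. In terms of the coordinates
`s = x/x'`, `x'`, `y'`, `Y = (y'-y)/x'` for a chart `v = (x, y)` one has `V = (s - 1, -Y)`; over the
interior they are an affine change, for fixed `z'`, of the product coordinates. -/
def projCoord (p₀ : X) (b : A.DoubleSpace) : EMod n × EMod n :=
  (coord n p₀ b.right, (normalCoord p₀ b).1⁻¹ • (normalCoord p₀ b).2)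

end DoubleSpace

/-! ### The bundle `^ΦT^*X²₀` -/

/-- The bundle `^ΦT^*X²₀ = β^*(⁰T^*X × ⁰T^*X)`. The fibre of `⁰T^*X` consists of the covectors
`α / x` with `α ∈ T^*X`; such an element is represented by `α`. -/
structure PhiCotangent where
  /-- the base point, i.e. the bundle projection `^Φπ` -/
  base : A.DoubleSpace
  /-- the left `0`-covector `α / x` -/
  α : TangentSpace (halfModel n) base.left →L[ℝ] ℝ
  /-- the right `0`-covector `α' / x'` -/
  α' : TangentSpace (halfModel n) base.right →L[ℝ] ℝ

/-- The topology of `^ΦT^*X²₀` as a subspace of `X²₀ × T^*X × T^*X`. -/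
instance : TopologicalSpace A.PhiCotangent :=
  TopologicalSpace.induced
    (fun q : A.PhiCotangent =>
      (q.base, (⟨q.base.left, q.α⟩ : CotBundle n X), (⟨q.base.right, q.α'⟩ : CotBundle n X)))
    inferInstance

/-- Domain of the coordinates `phiCoord` of `^ΦT^*X²₀`. -/
def phiDom (p₀ : X) : Set A.PhiCotangent := {q | q.base ∈ DoubleSpace.projDom p₀}

/-- Coordinates on `^ΦT^*X²₀`: projective coordinates of the base point, and the coefficients of the
two `0`-covectors with respect to `dv_i / x` and `dv'_i / x'`. -/
def phiCoord (p₀ : X) (q : A.PhiCotangent) : (EMod n × EMod n) × (EMod n × EMod n) :=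
  (DoubleSpace.projCoord p₀ q.base,
    (cotangentCoord p₀ q.base.left q.α, cotangentCoord p₀ q.base.right q.α'))

/-- The characteristic variety `Σ_L`, the zero set of `p_L`. Here `|α / x|²_g = |α|²_ḡ` over the
interior, and the right-hand side is smooth on all of `^ΦT^*X²₀`. -/
def SigmaL : Set A.PhiCotangent :=
  {q | dualNormSq A.compactMetric q.base.left q.α - 1 = 0}

/-- The conormal bundle `N^*diag₀ ⊆ ^ΦT^*X²₀` of the lifted diagonal. The lifted diagonal consists of
the points `(z, z)` with `z` in the interior and, over each `p ∈ ∂X`, of the class of the normal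
vectors `(v, v)` with `dx(v) > 0`. -/
def conormalDiag : Set A.PhiCotangent :=
  {q | (∃ (p : X) (h : ¬ (p = p ∧ p ∈ (halfModel n).boundary X))
          (α : TangentSpace (halfModel n) p →L[ℝ] ℝ),
          q = ⟨DoubleSpace.off p p h, α, -α⟩) ∨
       (∃ (p : X) (hp : p ∈ (halfModel n).boundary X) (ha : (0 : ℝ) ≤ 1)
          (hw : 0 ≤ 1 + A.dx p 0) (hunit : (1 : ℝ) ^ 2 + A.compactMetric p 0 0 = 1)
          (α : TangentSpace (halfModel n) p →L[ℝ] ℝ),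
          q = ⟨DoubleSpace.front p hp 1 0 ha hw hunit, α, -α⟩)}

/-- The forward bicharacteristic relation
`{(z, ζ, z', -ζ') | (z, ζ) ∈ Σ is reached from (z', ζ') along H_p in the forward direction}`,
as a subset of `^ΦT^*X²₀`; a covector `ζ` at an interior point is the `0`-covector `(x ζ) / x`. -/
def FBR : Set A.PhiCotangent :=
  {q | ∃ (γ : ℝ → CotBundle n X) (T : ℝ), A.IsBicharacteristic γ ∧ 0 ≤ T ∧
      ∃ h : ¬ ((γ T).proj = (γ 0).proj ∧ (γ T).proj ∈ (halfModel n).boundary X),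
        q = ⟨DoubleSpace.off (γ T).proj (γ 0).proj h,
              A.x (γ T).proj • (γ T).2, -(A.x (γ 0).proj • (γ 0).2)⟩}

/-- `Λ₊`, the closure of the forward bicharacteristic relation in `^ΦT^*X²₀`. -/
def LambdaPlus : Set A.PhiCotangent := closure A.FBR

/-- `∂_diag Λ₊ = N^*diag₀ ∩ Σ_L`. -/
def diagFace : Set A.PhiCotangent := A.conormalDiag ∩ A.SigmaL

end AHMetric

/-! ### Submanifolds with corners of codimension two -/

/-- The model corner `([0,∞) × ℝⁿ) × ([0,∞) × ℝⁿ)` of codimension two in `ℝ^{2n+2}`. -/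
def modelCorner (n : ℕ) : Set (EMod n × EMod n) := {u | 0 ≤ u.1 0 ∧ 0 ≤ u.2 0}

namespace AHMetric

variable {n : ℕ} {X : Type*} [TopologicalSpace X] [ChartedSpace (EuclideanHalfSpace (n + 1)) X]
  [IsManifold (halfModel n) ∞ X] (A : AHMetric n X)

/-- `h`, defined on the relatively open subset `O ∩ modelCorner n` of the model corner, is a smooth
local parametrization of the subset `S` of `^ΦT^*X²₀`: it is a homeomorphism onto the relatively open
subset `S ∩ W` of `S`, and a smooth immersion in the coordinates attached to `p₀`. -/
structure IsCornerParam (S : Set A.PhiCotangent) (p₀ : X) (O : Set (EMod n × EMod n))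
    (W : Set A.PhiCotangent) (h : EMod n × EMod n → A.PhiCotangent) : Prop where
  isOpen_source : IsOpen O
  isOpen_nhd : IsOpen W
  nhd_subset : W ⊆ A.phiDom p₀
  image_eq : h '' (O ∩ modelCorner n) = S ∩ W
  isEmbedding : Topology.IsEmbedding ((O ∩ modelCorner n).domRestrict h)
  contDiffOn : ContDiffOn ℝ ∞ (fun u => A.phiCoord p₀ (h u)) (O ∩ modelCorner n)
  immersion : ∀ u ∈ O ∩ modelCorner n, Function.Injective
    (fderivWithin ℝ (fun u => A.phiCoord p₀ (h u)) (O ∩ modelCorner n) u)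

/-- The differential at `u` of the projection `^Φπ`, read in the coordinates of a parametrization `h`
and the projective coordinates of `X²₀` attached to `p₀`. -/
def projDeriv (p₀ : X) (O : Set (EMod n × EMod n)) (h : EMod n × EMod n → A.PhiCotangent)
    (u : EMod n × EMod n) : EMod n × EMod n →L[ℝ] EMod n × EMod n :=
  fderivWithin ℝ (fun u => DoubleSpace.projCoord p₀ (h u).base) (O ∩ modelCorner n) u

/-- The projection `^Φπ` maps the subset `S` of `^ΦT^*X²₀` diffeomorphically onto its image, an open
subset of `X²₀`: it is injective on `S`, with open image, and its inverse is smooth in coordinates.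
(The projection itself is smooth, as it is a coordinate projection.) -/
structure IsProjDiffeo (S : Set A.PhiCotangent) : Prop where
  injOn : InjOn PhiCotangent.base S
  isOpen_image : IsOpen (PhiCotangent.base '' S)
  smooth_inverse : ∀ p₀ : X, ∃ F : EMod n × EMod n → (EMod n × EMod n) × (EMod n × EMod n),
    ContDiffOn ℝ ∞ F
      (DoubleSpace.projCoord p₀ '' (PhiCotangent.base '' S ∩ DoubleSpace.projDom p₀)) ∧
    ∀ q ∈ S, q.base ∈ DoubleSpace.projDom p₀ →
      F (DoubleSpace.projCoord p₀ q.base) = A.phiCoord p₀ q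

end AHMetric

end

open scoped Manifold ContDiff Topology
open Set Filter Bundle

/-! Near the diagonal `Λ₊` is swept out by short geodesics, and the theorem describes the
exponential map in polar coordinates around the zero covector. The point is to find variables in
which this map stays smooth up to the front face. In a chart, let `v'` be the initial position and
`x'` the value of `x` there; write the position as `v' + x' V` and use the rescaled momentum `α = x
ζ` and the ratio `ρ = x / x'`. Hamilton's equations for `(V, α, ρ)` (`scaledField`) are smooth up to
`x' = 0`, and `V` is one of the projective coordinates of `X²₀`.

By homogeneity, the value of `V` reached after time `t` from the unit momentum `a` depends only on
`v'` and `w = t a`. It is `W(v', w)` (`disp`, `disp_eq`) with `W` smooth, `W(v', 0) = 0`, and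
derivative in `w` at `0` equal to twice the cometric (`fderivWithin_disp_zero`). So `(v', w) ↦ (v',
W)` has invertible derivative for small `w`, with uniform bounds up to the boundary
(`IsGoodRadius`), and near `∂_diag Λ₊` the set `Λ₊` consists of the points `relPoint (t, v', a)`
with `t ≥ 0`, `|a| = 1`. With local polar coordinates `w = r R σ`, `σ = (1, u₁, …, uₙ)`, the
projection is the blow-down `(r, σ) ↦ r σ` followed by a map with invertible derivative. Hence its
determinant is `r ^ n` times a factor bounded away from `0` and `∞` (`abs_det_cornerProjDeriv`), and
at `r = 0` it loses the `n` directions of `σ` (`finrank_range`). The momentum component still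
records `σ` at `r = 0`, which makes the parametrization an embedding and an immersion
(`tendsto_of_corner`, `immersion_corner`). For `r > 0` and `x' > 0` the inverse function theorem
gives the diffeomorphism (`exists_section`).

Two further facts are needed. The flow must depend smoothly on parameters that range over a
half-space; this is proved by differentiating the fixed point of the Picard contraction within sets
that need not be open (`contDiffOn_fixedPoint`, `exists_smooth_flow`). And since `Λ₊` is the closure
of a relation involving arbitrarily long times, long trajectories must not accumulate at `∂_diag Λ₊`
(`disjoint_diagFace_closure_longFBR`). The tool is that `f = 1/x` satisfies `f'' ≥ 2 f` along
bicharacteristics near `∂X` (`exists_convexity`). Over the boundary this forbids a trajectory from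
returning to nearly the same `x` with nearly the same momentum (`exists_no_return`). Over the
interior it bounds the return time, so that an accumulation would yield a periodic trajectory,
against nontrapping. -/

noncomputable section

/-! ### Smoothness of superposition operators on spaces of continuous maps. -/

section Superposition

universe u

variable {K : Type*} [TopologicalSpace K] [CompactSpace K]
variable {Z : Type u} [NormedAddCommGroup Z] [NormedSpace ℝ Z]
variable {Y : Type u} [NormedAddCommGroup Y] [NormedSpace ℝ Y]

open Classical in
/-- The superposition operator `ζ ↦ F ∘ ζ` on continuous maps. -/
def superposition (F : Z → Y) (ζ : C(K, Z)) : C(K, Y) :=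
  if h : Continuous (F ∘ ζ) then ⟨F ∘ ζ, h⟩ else 0

/-- The continuous maps with values in a set. -/
def mapsInto (K : Type*) [TopologicalSpace K] {Z : Type*} [TopologicalSpace Z] (Ω : Set Z) :
    Set C(K, Z) := {ζ | ∀ s, ζ s ∈ Ω}

theorem superposition_apply {F : Z → Y} {Ω : Set Z} (hF : ContinuousOn F Ω) {ζ : C(K, Z)}
    (hζ : ζ ∈ mapsInto K Ω) (s : K) : superposition F ζ s = F (ζ s) := by
  have h : Continuous (F ∘ ζ) := hF.comp_continuous ζ.continuous hζ
  rw [superposition, dif_pos h]; rfl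

/-- Postcomposition is continuous for the compact-open topology, and maps into `Ω` carry the
topology of `C(K, Ω)` because the inclusion of `Ω` is inducing. -/
theorem continuousOn_superposition {F : Z → Y} {Ω : Set Z} (hF : ContinuousOn F Ω) :
    ContinuousOn (superposition F : C(K, Z) → C(K, Y)) (mapsInto K Ω) := by
  rw [continuousOn_iff_continuous_domRestrict]
  let R : mapsInto K Ω → C(K, Ω) := fun ζ => ⟨fun s => ⟨ζ.1 s, ζ.2 s⟩, by
    exact ζ.1.continuous.subtype_mk _⟩
  have hR : Continuous R := by
    have := ContinuousMap.isInducing_postcomp (X := K) (⟨Subtype.val, continuous_subtype_val⟩ : C(Ω, Z))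
      Topology.IsInducing.subtypeVal
    rw [this.continuous_iff]
    exact continuous_subtype_val
  let g : C(Ω, Y) := ⟨Ω.domRestrict F, continuousOn_iff_continuous_domRestrict.1 hF⟩
  have := (ContinuousMap.continuous_postcomp (X := K) g).comp hR
  convert this using 1
  ext ζ s
  simp only [Set.domRestrict_apply, Function.comp_apply]
  rw [superposition_apply hF ζ.2]
  rfl

set_option synthInstance.maxHeartbeats 200000 in
/-- Pointwise application of a continuous family of linear maps. -/
def pointwiseApply : C(K, Z →L[ℝ] Y) →L[ℝ] (C(K, Z) →L[ℝ] C(K, Y)) :=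
  LinearMap.mkContinuous₂
    (LinearMap.mk₂ ℝ (fun (L : C(K, Z →L[ℝ] Y)) (ζ : C(K, Z)) =>
      (⟨fun s => L s (ζ s), L.continuous.clm_apply ζ.continuous⟩ : C(K, Y)))
      (by intros; ext; simp) (by intros; ext; simp) (by intros; ext; simp) (by intros; ext; simp)) 1
    (by
      intro L ζ
      rw [one_mul, ContinuousMap.norm_le _ (by positivity)]
      intro s
      exact ((L s).le_opNorm _).trans (mul_le_mul (L.norm_coe_le_norm s) (ζ.norm_coe_le_norm s)
        (norm_nonneg _) (norm_nonneg L)))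

set_option synthInstance.maxHeartbeats 200000 in
theorem pointwiseApply_apply (L : C(K, Z →L[ℝ] Y)) (ζ : C(K, Z)) (s : K) :
    pointwiseApply L ζ s = L s (ζ s) := rfl

-- The mean value inequality on the segment from `ζ s` to `η s` bounds the remainder uniformly in
-- `s`, because `superposition F'` is continuous in the sup norm. Convexity of `Ω` supplies the
-- segments and replaces openness.
set_option synthInstance.maxHeartbeats 200000 in
theorem hasFDerivWithinAt_superposition {F : Z → Y} {F' : Z → Z →L[ℝ] Y} {Ω : Set Z}
    (hΩ : Convex ℝ Ω) (hF : ∀ z ∈ Ω, HasFDerivWithinAt F (F' z) Ω z) (hF' : ContinuousOn F' Ω)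
    {ζ : C(K, Z)} (hζ : ζ ∈ mapsInto K Ω) :
    HasFDerivWithinAt (superposition F) (pointwiseApply (superposition F' ζ)) (mapsInto K Ω) ζ := by
  have hFc : ContinuousOn F Ω := fun z hz => (hF z hz).continuousWithinAt
  rw [hasFDerivWithinAt_iff_isLittleO, Asymptotics.isLittleO_iff]
  intro c hc
  have h1 := (continuousOn_superposition (K := K) hF') ζ hζ
  obtain ⟨δ, hδ, h2⟩ := Metric.continuousWithinAt_iff.1 h1 c hc
  filter_upwards [self_mem_nhdsWithin, mem_nhdsWithin_of_mem_nhds (Metric.ball_mem_nhds ζ hδ)]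
    with η hη hball
  rw [ContinuousMap.norm_le _ (by positivity)]
  intro s
  simp only [ContinuousMap.sub_apply, pointwiseApply_apply, superposition_apply hFc hη,
    superposition_apply hFc hζ, superposition_apply hF' hζ]
  have hseg : ∀ z ∈ segment ℝ (ζ s) (η s), HasFDerivWithinAt F (F' z) (segment ℝ (ζ s) (η s)) z :=
    fun z hz => (hF z (hΩ.segment_subset (hζ s) (hη s) hz)).mono (hΩ.segment_subset (hζ s) (hη s))
  have hb : ∀ z ∈ segment ℝ (ζ s) (η s), ‖F' z - F' (ζ s)‖ ≤ c := by
    intro z hz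
    obtain ⟨a, b, ha, hb, hab, rfl⟩ := hz
    -- A point of the segment is the value at `s` of the continuous map `a • ζ + b • η`, which is at
    -- least as close to `ζ` as `η` is. This turns continuity of `superposition F'` into a pointwise
    -- bound.
    have hmem : a • ζ + b • η ∈ mapsInto K Ω := fun t => hΩ (hζ t) (hη t) ha hb hab
    have hd : dist (a • ζ + b • η) ζ < δ := by
      rw [dist_eq_norm]
      have : a • ζ + b • η - ζ = b • (η - ζ) := by
        have : a = 1 - b := by linarith
        rw [this]; module
      rw [this, norm_smul, Real.norm_of_nonneg hb]
      have h3 : ‖η - ζ‖ < δ := by rwa [← dist_eq_norm]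
      nlinarith [norm_nonneg (η - ζ)]
    have h4 := h2 hmem hd
    rw [dist_eq_norm] at h4
    have h5 := (ContinuousMap.norm_coe_le_norm _ s).trans h4.le
    simpa [superposition_apply hF' hmem, superposition_apply hF' hζ] using h5
  have := (convex_segment (ζ s) (η s)).norm_image_sub_le_of_norm_hasFDerivWithin_le' hseg hb
    (left_mem_segment ℝ _ _) (right_mem_segment ℝ _ _)
  refine this.trans ?_
  gcongr
  simpa using ContinuousMap.norm_coe_le_norm (η - ζ) s

-- The derivative is `superposition F'` followed by a bounded linear map, so each induction step
-- gains one order. The target `Y` is quantified after `k` because the induction hypothesis is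
-- applied to `Z →L[ℝ] Y`.
set_option synthInstance.maxHeartbeats 200000 in
theorem contDiffOn_superposition_nat {Ω : Set Z} (hΩ : Convex ℝ Ω) (hu : UniqueDiffOn ℝ Ω) (k : ℕ) :
    ∀ {Y : Type u} [NormedAddCommGroup Y] [NormedSpace ℝ Y] {F : Z → Y}, ContDiffOn ℝ k F Ω →
      ContDiffOn ℝ k (superposition F : C(K, Z) → C(K, Y)) (mapsInto K Ω) := by
  induction k with
  | zero =>
    intro Y _ _ F hF
    exact contDiffOn_zero.2 (continuousOn_superposition hF.continuousOn)
  | succ k ih =>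
    intro Y _ _ F hF
    have hF1 := (contDiffOn_succ_iff_hasFDerivWithinAt_of_uniqueDiffOn (n := (k : ℕ∞ω)) hu).1
      (by exact_mod_cast hF)
    obtain ⟨-, F', hF', hd⟩ := hF1
    have h1 := ih hF'
    have h2 : ∀ ζ ∈ mapsInto K Ω, HasFDerivWithinAt (superposition F : C(K, Z) → C(K, Y))
        (pointwiseApply (superposition F' ζ)) (mapsInto K Ω) ζ := fun ζ hζ =>
      hasFDerivWithinAt_superposition hΩ hd hF'.continuousOn hζ
    have h3 : ContDiffOn ℝ k (fun ζ : C(K, Z) =>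
        (pointwiseApply (superposition F' ζ) : C(K, Z) →L[ℝ] C(K, Y))) (mapsInto K Ω) :=
      ContDiff.comp_contDiffOn (g := fun L : C(K, Z →L[ℝ] Y) => pointwiseApply L)
        (ContinuousLinearMap.contDiff _) h1
    push_cast
    rw [contDiffOn_succ_iff_hasFDerivWithinAt (by simp)]
    intro ζ hζ
    refine ⟨mapsInto K Ω, ?_, by simp, _, h2, h3⟩
    rw [insert_eq_of_mem hζ]; exact self_mem_nhdsWithin

theorem contDiffOn_superposition {Ω : Set Z} (hΩ : Convex ℝ Ω) (hu : UniqueDiffOn ℝ Ω) {F : Z → Y}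
    (hF : ContDiffOn ℝ ∞ F Ω) :
    ContDiffOn ℝ ∞ (superposition F : C(K, Z) → C(K, Y)) (mapsInto K Ω) :=
  contDiffOn_infty.2 fun k => contDiffOn_superposition_nat hΩ hu k (contDiffOn_infty.1 hF k)

end Superposition

/-! ### Smooth dependence of fixed points of contractions on parameters. -/

section FixedPoint

variable {P V : Type*} [NormedAddCommGroup P] [NormedSpace ℝ P] [NormedAddCommGroup V]
  [NormedSpace ℝ V] [CompleteSpace V]

/-- The derivative of a fixed point with respect to a parameter. -/
def fixedPointDeriv (D : P × V →L[ℝ] V) : P →L[ℝ] V :=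
  (Ring.inverse (1 - D.comp (ContinuousLinearMap.inr ℝ P V))).comp
    (D.comp (ContinuousLinearMap.inl ℝ P V))

/-- Differentiating `Ψ (l, y l) = y l` gives `(1 - D₂) y' = D₁`, and the contraction bound makes `1
- D₂` invertible by the Neumann series. Derivatives are taken within `Λ`, so parameters on the
boundary of a half-space are allowed, where the implicit function theorem does not apply. -/
theorem hasFDerivWithinAt_fixedPoint {Λ : Set P} {B : Set V} (hB : IsOpen B)
    {Ψ : P × V → V} {y : P → V} (hy : ∀ l ∈ Λ, y l ∈ B) (hfix : ∀ l ∈ Λ, Ψ (l, y l) = y l)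
    (hlip : ∀ l ∈ Λ, ∀ v ∈ B, ∀ w ∈ B, ‖Ψ (l, v) - Ψ (l, w)‖ ≤ 2⁻¹ * ‖v - w‖)
    {l : P} (hl : l ∈ Λ) {D : P × V →L[ℝ] V} (hD : HasFDerivWithinAt Ψ D (Λ ×ˢ B) (l, y l)) :
    ‖D.comp (ContinuousLinearMap.inr ℝ P V)‖ < 1 ∧
      HasFDerivWithinAt y (fixedPointDeriv D) Λ l := by
  set D₁ := D.comp (ContinuousLinearMap.inl ℝ P V)
  set D₂ := D.comp (ContinuousLinearMap.inr ℝ P V)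
  have hDs : ∀ a b, D (a, b) = D₁ a + D₂ b := by
    intro a b; simp [D₁, D₂, ← map_add]
  have hD2 : ‖D₂‖ ≤ 2⁻¹ := by
    have h1 : HasFDerivAt (fun v => Ψ (l, v)) D₂ (y l) := by
      have h2 : HasFDerivWithinAt (fun v => Ψ (l, v)) D₂ B (y l) := by
        have h3 : HasFDerivWithinAt (fun v : V => (l, v)) (ContinuousLinearMap.inr ℝ P V) B (y l) :=
          (hasFDerivAt_prodMk_right l (y l)).hasFDerivWithinAt
        exact hD.comp (y l) h3 (fun v hv => ⟨hl, hv⟩)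
      exact h2.hasFDerivAt (hB.mem_nhds (hy l hl))
    have := h1.le_of_lip' (C := 2⁻¹) (by norm_num) ?_
    · exact this
    · filter_upwards [hB.mem_nhds (hy l hl)] with v hv using hlip l hl v hv _ (hy l hl)
  have hlt : ‖D₂‖ < 1 := lt_of_le_of_lt hD2 (by norm_num)
  refine ⟨hlt, ?_⟩
  have hunit : IsUnit (1 - D₂) := isUnit_one_sub_of_norm_lt_one hlt
  -- `y` is continuous
  have hcont : ContinuousWithinAt y Λ l := by
    have h1 : Tendsto (fun m => 2 * ‖Ψ (m, y l) - Ψ (l, y l)‖) (𝓝[Λ] l) (𝓝 0) := by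
      have h2 : ContinuousWithinAt (fun m => Ψ (m, y l)) Λ l := by
        have := hD.continuousWithinAt.comp (f := fun m => (m, y l)) (s := Λ) (x := l)
          (by fun_prop) (fun m hm => ⟨hm, hy l hl⟩)
        exact this
      have h3 := ((h2.sub_const (Ψ (l, y l))).norm).const_mul 2
      have h3' : Tendsto _ _ _ := h3
      simpa using h3'
    rw [ContinuousWithinAt, tendsto_iff_norm_sub_tendsto_zero]
    refine tendsto_of_tendsto_of_tendsto_of_le_of_le' tendsto_const_nhds h1
      (Eventually.of_forall fun _ => norm_nonneg _) ?_
    filter_upwards [self_mem_nhdsWithin] with m hm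
    have h4 : y m - y l = (Ψ (m, y m) - Ψ (m, y l)) + (Ψ (m, y l) - Ψ (l, y l)) := by
      rw [hfix m hm, hfix l hl]; abel
    have h5 : ‖y m - y l‖ ≤ ‖Ψ (m, y m) - Ψ (m, y l)‖ + ‖Ψ (m, y l) - Ψ (l, y l)‖ := by
      conv_lhs => rw [h4]
      exact norm_add_le _ _
    have h6 := hlip m hm _ (hy m hm) _ (hy l hl)
    linarith
  have htend : Tendsto (fun m => (m, y m)) (𝓝[Λ] l) (𝓝[Λ ×ˢ B] (l, y l)) := by
    refine tendsto_nhdsWithin_iff.2 ⟨?_, ?_⟩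
    · exact (tendsto_id.mono_left nhdsWithin_le_nhds).prodMk_nhds hcont
    · filter_upwards [self_mem_nhdsWithin] with m hm using ⟨hm, hy m hm⟩
  have ho := (hasFDerivWithinAt_iff_isLittleO.1 hD).comp_tendsto htend
  -- the defect
  have ho' : (fun m => (1 - D₂) (y m - y l) - D₁ (m - l)) =o[𝓝[Λ] l]
      (fun m => (m - l, y m - y l)) := by
    refine ho.congr' ?_ (Eventually.of_forall fun m => by simp)
    filter_upwards [self_mem_nhdsWithin] with m hm
    simp only [Function.comp_apply, hfix m hm, hfix l hl, Prod.mk_sub_mk, hDs]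
    simp only [sub_apply, one_apply_eq_self]
    abel
  set Q := Ring.inverse (1 - D₂)
  have hQ : Q * (1 - D₂) = 1 := Ring.inverse_mul_cancel _ hunit
  have hQa : ∀ v, Q ((1 - D₂) v) = v := fun v => by
    have := congrArg (fun L : V →L[ℝ] V => L v) hQ
    simpa using this
  have h7 : (fun m => (y m - y l) - Q (D₁ (m - l))) =o[𝓝[Λ] l] (fun m => (m - l, y m - y l)) := by
    have := (Q.isBigO_comp (fun m => (1 - D₂) (y m - y l) - D₁ (m - l)) (𝓝[Λ] l)).trans_isLittleO ho'
    refine this.congr_left fun m => ?_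
    rw [map_sub, hQa]
  -- With the constant `1/2` in the little-o, the term `‖y m - y l‖` on the right is absorbed on the
  -- left. So `y m - y l = O(m - l)`, and the remainder becomes `o(m - l)`.
  have h8 : (fun m => y m - y l) =O[𝓝[Λ] l] (fun m => m - l) := by
    have hc := Asymptotics.isLittleO_iff.1 h7 (show (0 : ℝ) < 2⁻¹ by norm_num)
    refine Asymptotics.IsBigO.of_bound (2 * (‖Q.comp D₁‖ + 1)) ?_
    filter_upwards [hc] with m hm
    have h9 : ‖Q (D₁ (m - l))‖ ≤ ‖Q.comp D₁‖ * ‖m - l‖ := (Q.comp D₁).le_opNorm _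
    have h10 : ‖y m - y l‖ ≤ ‖(y m - y l) - Q (D₁ (m - l))‖ + ‖Q (D₁ (m - l))‖ := by
      have := norm_add_le ((y m - y l) - Q (D₁ (m - l))) (Q (D₁ (m - l)))
      simpa using this
    have h11 : ‖(m - l, y m - y l)‖ ≤ ‖m - l‖ + ‖y m - y l‖ := by
      rw [Prod.norm_def]
      exact max_le (by simp) (by simp)
    nlinarith [norm_nonneg (m - l)]
  rw [hasFDerivWithinAt_iff_isLittleO]
  have h12 : (fun m => (m - l, y m - y l)) =O[𝓝[Λ] l] (fun m => m - l) :=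
    (Asymptotics.isBigO_refl _ _).prod_left h8
  exact (h7.trans_isBigO h12)

/-- The formula for `y'` is a smooth expression in `D (l, y l)`, inversion being smooth at units, so
regularity of order `k` of `y` gives order `k + 1`. -/
theorem contDiffOn_fixedPoint {Λ : Set P} (hΛ : UniqueDiffOn ℝ Λ) {B : Set V} (hB : IsOpen B)
    {Ψ : P × V → V} (hΨ : ContDiffOn ℝ ∞ Ψ (Λ ×ˢ B)) {y : P → V} (hy : ∀ l ∈ Λ, y l ∈ B)
    (hfix : ∀ l ∈ Λ, Ψ (l, y l) = y l)
    (hlip : ∀ l ∈ Λ, ∀ v ∈ B, ∀ w ∈ B, ‖Ψ (l, v) - Ψ (l, w)‖ ≤ 2⁻¹ * ‖v - w‖) :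
    ContDiffOn ℝ ∞ y Λ := by
  have hu : UniqueDiffOn ℝ (Λ ×ˢ B) := hΛ.prod hB.uniqueDiffOn
  set D : P × V → (P × V →L[ℝ] V) := fderivWithin ℝ Ψ (Λ ×ˢ B)
  have hDs : ContDiffOn ℝ ∞ D (Λ ×ˢ B) := hΨ.fderivWithin hu (by simp)
  have hd : ∀ l ∈ Λ, ‖(D (l, y l)).comp (ContinuousLinearMap.inr ℝ P V)‖ < 1 ∧
      HasFDerivWithinAt y (fixedPointDeriv (D (l, y l))) Λ l := fun l hl =>
    hasFDerivWithinAt_fixedPoint hB hy hfix hlip hl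
      ((hΨ.differentiableOn (by simp)) (l, y l) ⟨hl, hy l hl⟩).hasFDerivWithinAt
  refine contDiffOn_infty.2 fun k => ?_
  induction k with
  | zero => exact contDiffOn_zero.2 fun l hl => (hd l hl).2.continuousWithinAt
  | succ k ih =>
    push_cast
    rw [contDiffOn_succ_iff_hasFDerivWithinAt_of_uniqueDiffOn hΛ]
    refine ⟨by simp, fun l => fixedPointDeriv (D (l, y l)), ?_, fun l hl => (hd l hl).2⟩
    have h1 : ContDiffOn ℝ k (fun l => D (l, y l)) Λ :=
      (contDiffOn_infty.1 hDs k).comp (contDiffOn_id.prodMk ih) (fun l hl => ⟨hl, hy l hl⟩)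
    have h2 : ContDiffOn ℝ k (fun l => (1 : V →L[ℝ] V) -
        (D (l, y l)).comp (ContinuousLinearMap.inr ℝ P V)) Λ :=
      contDiffOn_const.sub (h1.clm_comp contDiffOn_const)
    have h3 : ContDiffOn ℝ k (fun l => Ring.inverse ((1 : V →L[ℝ] V) -
        (D (l, y l)).comp (ContinuousLinearMap.inr ℝ P V))) Λ := by
      intro l hl
      obtain ⟨w, hw⟩ := isUnit_one_sub_of_norm_lt_one (hd l hl).1
      have := contDiffAt_ringInverse (n := (k : ℕ∞ω)) ℝ w
      rw [hw] at this
      exact this.comp_contDiffWithinAt l (h2 l hl)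
    exact h3.clm_comp (h1.clm_comp contDiffOn_const)

end FixedPoint

/-! ### Smooth dependence of solutions of differential equations on parameters. -/

section SmoothODE

universe u

variable {P : Type u} [NormedAddCommGroup P] [NormedSpace ℝ P]
variable {Y : Type u} [NormedAddCommGroup Y] [NormedSpace ℝ Y]

/-- The extension of a continuous map on `[0, 1]` that is constant on each side. -/
def unitExtend (f : C(Icc (0 : ℝ) 1, Y)) (s : ℝ) : Y := f (projIcc 0 1 zero_le_one s)

theorem continuous_unitExtend (f : C(Icc (0 : ℝ) 1, Y)) : Continuous (unitExtend f) :=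
  f.continuous.comp continuous_projIcc

theorem unitExtend_of_mem (f : C(Icc (0 : ℝ) 1, Y)) {s : ℝ} (hs : s ∈ Icc (0 : ℝ) 1) :
    unitExtend f s = f ⟨s, hs⟩ := by
  rw [unitExtend, projIcc_of_mem]

/-- The primitive vanishing at `0`. -/
def unitPrimitive [CompleteSpace Y] : C(Icc (0 : ℝ) 1, Y) →L[ℝ] C(Icc (0 : ℝ) 1, Y) :=
  LinearMap.mkContinuous
    { toFun := fun f => ⟨fun s => ∫ t in (0 : ℝ)..s, unitExtend f t,
        (intervalIntegral.continuous_primitive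
          (fun a b => (continuous_unitExtend f).intervalIntegrable a b) 0).comp
            continuous_subtype_val⟩
      map_add' := by
        intro f g
        ext s
        simp only [ContinuousMap.coe_mk, ContinuousMap.add_apply]
        rw [← intervalIntegral.integral_add ((continuous_unitExtend f).intervalIntegrable _ _)
          ((continuous_unitExtend g).intervalIntegrable _ _)]
        rfl
      map_smul' := by
        intro c f
        ext s
        simp only [ContinuousMap.coe_mk, ContinuousMap.smul_apply, RingHom.id_apply]
        rw [← intervalIntegral.integral_smul]
        rfl } 1
    (by
      intro f
      rw [one_mul, ContinuousMap.norm_le _ (norm_nonneg f)]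
      intro s
      have := intervalIntegral.norm_integral_le_of_norm_le_const (a := (0 : ℝ)) (b := s)
        (f := unitExtend f) (C := ‖f‖) (fun t _ => f.norm_coe_le_norm _)
      refine this.trans ?_
      have h1 : |(s : ℝ) - 0| ≤ 1 := by rw [sub_zero, abs_of_nonneg s.2.1]; exact s.2.2
      nlinarith [norm_nonneg f])

theorem norm_unitPrimitive_le [CompleteSpace Y] (f : C(Icc (0 : ℝ) 1, Y)) :
    ‖unitPrimitive f‖ ≤ ‖f‖ := by
  have : ‖(unitPrimitive (Y := Y))‖ ≤ 1 := LinearMap.mkContinuous_norm_le _ zero_le_one _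
  calc ‖unitPrimitive f‖ ≤ ‖(unitPrimitive (Y := Y))‖ * ‖f‖ := unitPrimitive.le_opNorm f
    _ ≤ 1 * ‖f‖ := by gcongr
    _ = ‖f‖ := one_mul _

/-- The continuous map `s ↦ (l, v s)`, as a linear function of `(l, v)`. -/
def pairWithConst : P × C(Icc (0 : ℝ) 1, Y) →L[ℝ] C(Icc (0 : ℝ) 1, P × Y) :=
  LinearMap.mkContinuous
    { toFun := fun q => ⟨fun s => (q.1, q.2 s), by fun_prop⟩
      map_add' := by intros; ext <;> simp
      map_smul' := by intros; ext <;> simp } 1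
    (by
      intro q
      rw [one_mul, ContinuousMap.norm_le _ (norm_nonneg q)]
      intro s
      simp only [LinearMap.coe_mk, AddHom.coe_mk, ContinuousMap.coe_mk]
      rw [Prod.norm_def, Prod.norm_def]
      exact max_le_max le_rfl (q.2.norm_coe_le_norm s))

/-- The Picard operator of `y' = F (l, y)`, `y 0 = 0` on `[0, 1]`. -/
def picardMap [CompleteSpace Y] (F : P × Y → Y) (l : P) (v : C(Icc (0 : ℝ) 1, Y)) :
    C(Icc (0 : ℝ) 1, Y) :=
  unitPrimitive (superposition F (pairWithConst (l, v)))

theorem apply_mem_ball {R : ℝ} {v : C(Icc (0 : ℝ) 1, Y)} (hv : v ∈ Metric.ball 0 R)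
    (s : Icc (0 : ℝ) 1) : v s ∈ Metric.ball (0 : Y) R := by
  rw [mem_ball_zero_iff] at hv ⊢
  exact (v.norm_coe_le_norm s).trans_lt hv

theorem pairWithConst_mem {Λ : Set P} {R : ℝ} {q : P × C(Icc (0 : ℝ) 1, Y)}
    (hq : q ∈ Λ ×ˢ Metric.ball 0 R) :
    pairWithConst q ∈ mapsInto (Icc (0 : ℝ) 1) (Λ ×ˢ Metric.ball (0 : Y) R) :=
  fun s => ⟨hq.1, apply_mem_ball hq.2 s⟩

theorem superposition_pairWithConst {Λ : Set P} {R : ℝ} {F : P × Y → Y}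
    (hF : ContinuousOn F (Λ ×ˢ Metric.ball 0 R)) {l : P} (hl : l ∈ Λ) {v : C(Icc (0 : ℝ) 1, Y)}
    (hv : v ∈ Metric.ball 0 R) (s : Icc (0 : ℝ) 1) :
    superposition F (pairWithConst (l, v)) s = F (l, v s) :=
  superposition_apply hF (pairWithConst_mem ⟨hl, hv⟩) s

/-- The Picard operator is a superposition operator between two bounded linear maps. -/
theorem contDiffOn_picardMap [CompleteSpace Y] {Λ : Set P} (hΛ : Convex ℝ Λ)
    (hu : UniqueDiffOn ℝ Λ) {R : ℝ} {F : P × Y → Y}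
    (hF : ContDiffOn ℝ ∞ F (Λ ×ˢ Metric.ball 0 R)) :
    ContDiffOn ℝ ∞ (fun q : P × C(Icc (0 : ℝ) 1, Y) => picardMap F q.1 q.2)
      (Λ ×ˢ Metric.ball 0 R) := by
  have h1 := contDiffOn_superposition (K := Icc (0 : ℝ) 1)
    (hΛ.prod (convex_ball (0 : Y) R)) (hu.prod Metric.isOpen_ball.uniqueDiffOn) hF
  have h3 : ContDiff ℝ ∞ (fun q : P × C(Icc (0 : ℝ) 1, Y) => pairWithConst q) :=
    ContinuousLinearMap.contDiff (pairWithConst (P := P) (Y := Y))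
  have h2 : ContDiffOn ℝ ∞ (fun q : P × C(Icc (0 : ℝ) 1, Y) => superposition F (pairWithConst q))
      (Λ ×ˢ Metric.ball 0 R) :=
    h1.comp h3.contDiffOn fun q hq => pairWithConst_mem hq
  exact (unitPrimitive (Y := Y)).contDiff.comp_contDiffOn h2

theorem picardMap_sub_le [CompleteSpace Y] {Λ : Set P} {R : ℝ} {F : P × Y → Y}
    (hF : ContinuousOn F (Λ ×ˢ Metric.ball 0 R)) {l : P} (hl : l ∈ Λ)
    (hlip : ∀ v ∈ Metric.ball (0 : Y) R, ∀ w ∈ Metric.ball (0 : Y) R,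
      ‖F (l, v) - F (l, w)‖ ≤ 2⁻¹ * ‖v - w‖) {v w : C(Icc (0 : ℝ) 1, Y)}
    (hv : v ∈ Metric.ball 0 R) (hw : w ∈ Metric.ball 0 R) :
    ‖picardMap F l v - picardMap F l w‖ ≤ 2⁻¹ * ‖v - w‖ := by
  rw [picardMap, picardMap, ← map_sub]
  refine (norm_unitPrimitive_le _).trans ?_
  rw [ContinuousMap.norm_le _ (by positivity)]
  intro s
  rw [ContinuousMap.sub_apply, superposition_pairWithConst hF hl hv,
    superposition_pairWithConst hF hl hw]
  refine (hlip _ (apply_mem_ball hv s) _ (apply_mem_ball hw s)).trans ?_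
  gcongr
  exact (v - w).norm_coe_le_norm s

theorem picardMap_le [CompleteSpace Y] {Λ : Set P} {R : ℝ} (hR : 0 < R) {F : P × Y → Y}
    (hF : ContinuousOn F (Λ ×ˢ Metric.ball 0 R)) {l : P} (hl : l ∈ Λ)
    (hb : ∀ v ∈ Metric.ball (0 : Y) R, ‖F (l, v)‖ ≤ R / 2) {v : C(Icc (0 : ℝ) 1, Y)}
    (hv : v ∈ Metric.ball 0 R) : ‖picardMap F l v‖ ≤ R / 2 := by
  refine (norm_unitPrimitive_le _).trans ?_
  rw [ContinuousMap.norm_le _ (by positivity)]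
  intro s
  rw [superposition_pairWithConst hF hl hv]
  exact hb _ (apply_mem_ball hv s)

theorem exists_picardMap_eq [CompleteSpace Y] {Λ : Set P} {R : ℝ} (hR : 0 < R) {F : P × Y → Y}
    (hF : ContinuousOn F (Λ ×ˢ Metric.ball 0 R)) {l : P} (hl : l ∈ Λ)
    (hb : ∀ v ∈ Metric.ball (0 : Y) R, ‖F (l, v)‖ ≤ R / 2)
    (hlip : ∀ v ∈ Metric.ball (0 : Y) R, ∀ w ∈ Metric.ball (0 : Y) R,
      ‖F (l, v) - F (l, w)‖ ≤ 2⁻¹ * ‖v - w‖) :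
    ∃ v ∈ Metric.ball (0 : C(Icc (0 : ℝ) 1, Y)) R, picardMap F l v = v := by
  -- The open ball is not complete; the contraction principle is applied on the closed ball of half
  -- the radius, which contains the image.
  have hcb : Metric.closedBall (0 : C(Icc (0 : ℝ) 1, Y)) (R / 2) ⊆ Metric.ball 0 R :=
    Metric.closedBall_subset_ball (by linarith)
  have hm : MapsTo (picardMap F l) (Metric.closedBall (0 : C(Icc (0 : ℝ) 1, Y)) (R / 2))
      (Metric.closedBall 0 (R / 2)) := fun v hv => by
    rw [mem_closedBall_zero_iff]; exact picardMap_le hR hF hl hb (hcb hv)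
  have hc : ContractingWith 2⁻¹ (hm.restrict _ _ _) := by
    refine ⟨by rw [← NNReal.coe_lt_coe]; push_cast; norm_num, LipschitzWith.of_dist_le_mul ?_⟩
    intro v w
    rw [Subtype.dist_eq, Subtype.dist_eq, dist_eq_norm, dist_eq_norm]
    simpa using picardMap_sub_le hF hl hlip (hcb v.2) (hcb w.2)
  obtain ⟨v, hv, hfv, -⟩ := hc.exists_fixedPoint' (Metric.isClosed_closedBall.isComplete) hm
    (x := 0) (by simp; positivity) (edist_ne_top _ _)
  exact ⟨v, hcb hv, hfv⟩

/-- The solution is the fixed point of the Picard contraction in `C([0, 1], Y)`, smooth in `l` by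
`contDiffOn_fixedPoint`; evaluation at `s` is linear. The parameter set may have boundary. -/
theorem exists_smooth_flow [CompleteSpace Y] {Λ : Set P} (hΛ : Convex ℝ Λ)
    (hu : UniqueDiffOn ℝ Λ) {R : ℝ} (hR : 0 < R) {F : P × Y → Y}
    (hF : ContDiffOn ℝ ∞ F (Λ ×ˢ Metric.ball 0 R))
    (hb : ∀ l ∈ Λ, ∀ v ∈ Metric.ball (0 : Y) R, ‖F (l, v)‖ ≤ R / 2)
    (hlip : ∀ l ∈ Λ, ∀ v ∈ Metric.ball (0 : Y) R, ∀ w ∈ Metric.ball (0 : Y) R,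
      ‖F (l, v) - F (l, w)‖ ≤ 2⁻¹ * ‖v - w‖) :
    ∃ y : P → ℝ → Y, (∀ l ∈ Λ, y l 0 = 0 ∧ ∀ s ∈ Icc (0 : ℝ) 1, y l s ∈ Metric.ball (0 : Y) R ∧
        HasDerivWithinAt (y l) (F (l, y l s)) (Icc 0 1) s) ∧
      ∀ s ∈ Icc (0 : ℝ) 1, ContDiffOn ℝ ∞ (fun l => y l s) Λ := by
  have hFc := hF.continuousOn
  have hex : ∀ l ∈ Λ, ∃ v ∈ Metric.ball (0 : C(Icc (0 : ℝ) 1, Y)) R, picardMap F l v = v :=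
    fun l hl => exists_picardMap_eq hR hFc hl (hb l hl) (hlip l hl)
  choose! Z hZB hZ using hex
  have hZs : ContDiffOn ℝ ∞ Z Λ := contDiffOn_fixedPoint hu Metric.isOpen_ball
    (contDiffOn_picardMap hΛ hu hF) hZB hZ
    fun l hl v hv w hw => picardMap_sub_le hFc hl (hlip l hl) hv hw
  -- Defined by the integral, `y l` is a function on `ℝ` to which the fundamental theorem of
  -- calculus applies; on `[0, 1]` it coincides with the fixed point.
  set y : P → ℝ → Y := fun l s =>
    ∫ t in (0 : ℝ)..s, unitExtend (superposition F (pairWithConst (l, Z l))) t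
  have hyZ : ∀ l ∈ Λ, ∀ s, ∀ hs : s ∈ Icc (0 : ℝ) 1, y l s = Z l ⟨s, hs⟩ := by
    intro l hl s hs
    conv_rhs => rw [← hZ l hl]
    rfl
  refine ⟨y, fun l hl => ⟨by simp [y], fun s hs => ⟨?_, ?_⟩⟩, fun s hs => ?_⟩
  · rw [hyZ l hl s hs]; exact apply_mem_ball (hZB l hl) _
  · have h1 := ((continuous_unitExtend (superposition F
      (pairWithConst (l, Z l)))).integral_hasStrictDerivAt 0 s).hasDerivAt
    rw [unitExtend_of_mem _ hs, superposition_pairWithConst hFc hl (hZB l hl)] at h1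
    rw [hyZ l hl s hs]
    exact h1.hasDerivWithinAt
  · have h1 : ContDiffOn ℝ ∞
        (fun l => (ContinuousMap.evalCLM ℝ (⟨s, hs⟩ : Icc (0 : ℝ) 1)) (Z l)) Λ :=
      (ContinuousLinearMap.contDiff _).comp_contDiffOn hZs
    exact h1.congr fun l hl => hyZ l hl s hs

end SmoothODE

/-! ### Charts, boundary points, and components of vectors and covectors. -/

section ChartGeometry

variable {n : ℕ} {X : Type*} [TopologicalSpace X] [ChartedSpace (EuclideanHalfSpace (n + 1)) X]

/-- The inverse of the chart centred at `p`. -/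
def chartInv (p : X) : EMod n → X := (extChartAt (halfModel n) p).symm

/-- The image of the chart centred at `p`. -/
def chartTgt (n : ℕ) {X : Type*} [TopologicalSpace X]
    [ChartedSpace (EuclideanHalfSpace (n + 1)) X] (p : X) : Set (EMod n) :=
  (extChartAt (halfModel n) p).target

/-- The closed half-space. -/
def halfSpace (n : ℕ) : Set (EMod n) := {v | 0 ≤ v 0}

theorem range_halfModel : range (halfModel n) = halfSpace n := by
  have := range_euclideanHalfSpace (n + 1)
  exact this

theorem convex_halfSpace : Convex ℝ (halfSpace n) := by
  rw [← range_halfModel]; exact (halfModel n).convex_range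

theorem isClosed_halfSpace : IsClosed (halfSpace n) := by
  rw [← range_halfModel]; exact (halfModel n).isClosed_range

theorem uniqueDiffOn_halfSpace : UniqueDiffOn ℝ (halfSpace n) := by
  rw [← range_halfModel]; exact (halfModel n).uniqueDiffOn

theorem isOpen_chartDom (p : X) : IsOpen (chartDom n p) := (chartAt _ p).open_source

theorem mem_chartDom_self (p : X) : p ∈ chartDom n p := mem_chart_source _ p

theorem chartTgt_subset (p : X) : chartTgt n p ⊆ halfSpace n := by
  rw [← range_halfModel]; exact extChartAt_target_subset_range p

theorem exists_isOpen_chartTgt (p : X) :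
    ∃ O : Set (EMod n), IsOpen O ∧ chartTgt n p = O ∩ halfSpace n := by
  refine ⟨_, (chartAt (EuclideanHalfSpace (n + 1)) p).open_target.preimage
    (halfModel n).continuous_symm, ?_⟩
  rw [chartTgt, extChartAt_target, range_halfModel]

theorem uniqueDiffOn_chartTgt (p : X) : UniqueDiffOn ℝ (chartTgt n p) := by
  obtain ⟨O, hO, h⟩ := exists_isOpen_chartTgt (n := n) p
  rw [h, inter_comm]
  exact uniqueDiffOn_halfSpace.inter hO

theorem coord_mem {p z : X} (hz : z ∈ chartDom n p) : coord n p z ∈ chartTgt n p :=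
  (extChartAt (halfModel n) p).map_source (by rwa [extChartAt_source])

theorem chartInv_coord {p z : X} (hz : z ∈ chartDom n p) : chartInv p (coord n p z) = z :=
  (extChartAt (halfModel n) p).left_inv (by rwa [extChartAt_source])

theorem chartInv_mem {p : X} {v : EMod n} (hv : v ∈ chartTgt n p) : chartInv p v ∈ chartDom n p := by
  have := (extChartAt (halfModel n) p).map_target hv
  rwa [extChartAt_source] at this

theorem coord_chartInv {p : X} {v : EMod n} (hv : v ∈ chartTgt n p) :
    coord n p (chartInv p v) = v :=
  (extChartAt (halfModel n) p).right_inv hv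

theorem coord_injOn {p z z' : X} (hz : z ∈ chartDom n p) (hz' : z' ∈ chartDom n p)
    (h : coord n p z = coord n p z') : z = z' := by
  rw [← chartInv_coord hz, h, chartInv_coord hz']

theorem continuousOn_coord (p : X) : ContinuousOn (coord n p) (chartDom n p) := by
  have := continuousOn_extChartAt (I := halfModel n) p
  rwa [extChartAt_source] at this

theorem continuousOn_chartInv (p : X) : ContinuousOn (chartInv p) (chartTgt n p) :=
  continuousOn_extChartAt_symm p

theorem continuousAt_coord {p z : X} (hz : z ∈ chartDom n p) : ContinuousAt (coord n p) z :=
  (continuousOn_coord p).continuousAt ((isOpen_chartDom p).mem_nhds hz)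

variable [IsManifold (halfModel n) ∞ X]

/-- Interior points may be tested in any chart of the atlas, and the interior of the half-space is
where the coordinate `0` is positive. -/
theorem mem_boundary_iff {p z : X} (hz : z ∈ chartDom n p) :
    z ∈ (halfModel n).boundary X ↔ coord n p z 0 = 0 := by
  have h := ModelWithCorners.isInteriorPoint_iff_of_mem_atlas (I := halfModel n) (n := ∞) (M := X)
    (by simp) (chart_mem_atlas _ p) (x := z) hz
  have h0 : 0 ≤ coord n p z 0 := chartTgt_subset p (coord_mem hz)
  have h1 : (halfModel n).IsInteriorPoint z ↔ 0 < coord n p z 0 := by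
    have h2 := interior_range_modelWithCornersEuclideanHalfSpace (n + 1)
    rw [h]
    constructor
    · intro h3
      have : coord n p z ∈ interior (range (halfModel n)) :=
        OpenPartialHomeomorph.interior_extend_target_subset_interior_range _ h3
      rw [h2] at this
      exact this
    · intro h3
      have : coord n p z ∈ interior (range (halfModel n)) := by rw [h2]; exact h3
      exact OpenPartialHomeomorph.mem_interior_extend_target _
        ((chartAt (EuclideanHalfSpace (n + 1)) p).map_source hz) this
  have h2 := (halfModel n).isInteriorPoint_iff_not_isBoundaryPoint z
  constructor
  · intro h3
    by_contra h4
    exact (h2.1 (h1.2 (lt_of_le_of_ne h0 (Ne.symm h4)))) h3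
  · intro h3
    by_contra h4
    have := h1.1 (h2.2 h4)
    linarith

theorem mem_interior_iff {p z : X} (hz : z ∈ chartDom n p) :
    z ∈ (halfModel n).interior X ↔ 0 < coord n p z 0 := by
  rw [← ModelWithCorners.compl_boundary, mem_compl_iff, mem_boundary_iff hz]
  have h0 : 0 ≤ coord n p z 0 := chartTgt_subset p (coord_mem hz)
  exact ⟨fun h => lt_of_le_of_ne h0 (Ne.symm h), fun h => h.ne'⟩

/-- The frame of the chart centred at `p` as a linear map. -/
def frame (p z : X) : EMod n →L[ℝ] TangentSpace (halfModel n) z :=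
  (trivializationAt (EMod n) (TangentSpace (halfModel n) : X → Type _) p).symmL ℝ z

theorem coordFrame_eq (p z : X) (i : Fin (n + 1)) :
    coordFrame p z i = frame p z (EuclideanSpace.single i (1 : ℝ)) := rfl

theorem mem_baseSet {p z : X} (hz : z ∈ chartDom n p) :
    z ∈ (trivializationAt (EMod n) (TangentSpace (halfModel n) : X → Type _) p).baseSet := by
  rw [TangentBundle.trivializationAt_baseSet]; exact hz

theorem frame_tangentCoord {p z : X} (hz : z ∈ chartDom n p) (w : TangentSpace (halfModel n) z) :
    frame p z (tangentCoord p z w) = w :=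
  Trivialization.symmL_continuousLinearMapAt _ (mem_baseSet hz) w

theorem tangentCoord_frame {p z : X} (hz : z ∈ chartDom n p) (a : EMod n) :
    tangentCoord p z (frame p z a) = a :=
  Trivialization.continuousLinearMapAt_symmL _ (mem_baseSet hz) a

theorem sum_single (a : EMod n) : ∑ i, a i • (EuclideanSpace.single i (1 : ℝ) : EMod n) = a := by
  ext j
  simp [Finset.sum_apply, Pi.single_apply]

theorem inner_eq_sum (a b : EMod n) : inner ℝ a b = ∑ i, a i * b i := by
  simp [PiLp.inner_apply, mul_comm]

theorem inner_cotangentCoord (p z : X) (ζ : TangentSpace (halfModel n) z →L[ℝ] ℝ) (a : EMod n) :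
    inner ℝ (cotangentCoord p z ζ) a = ζ (frame p z a) := by
  rw [inner_eq_sum]
  conv_rhs => rw [← sum_single a]
  simp only [map_sum, map_smul, cotangentCoord, coordFrame_eq, smul_eq_mul, mul_comm]

/-- The covector at `z` with given components in the chart centred at `p`. -/
def covec (p z : X) (ξ : EMod n) : TangentSpace (halfModel n) z →L[ℝ] ℝ :=
  (innerSL ℝ ξ).comp
    ((trivializationAt (EMod n) (TangentSpace (halfModel n) : X → Type _) p).continuousLinearMapAt ℝ z)

theorem covec_apply (p z : X) (ξ : EMod n) (w : TangentSpace (halfModel n) z) :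
    covec p z ξ w = inner ℝ ξ (tangentCoord p z w) := rfl

theorem cotangentCoord_covec {p z : X} (hz : z ∈ chartDom n p) (ξ : EMod n) :
    cotangentCoord p z (covec p z ξ) = ξ := by
  refine ext_inner_right ℝ fun a => ?_
  rw [inner_cotangentCoord, covec_apply, tangentCoord_frame hz]

theorem covec_cotangentCoord {p z : X} (hz : z ∈ chartDom n p)
    (ζ : TangentSpace (halfModel n) z →L[ℝ] ℝ) : covec p z (cotangentCoord p z ζ) = ζ := by
  ext w
  rw [covec_apply, inner_cotangentCoord, frame_tangentCoord hz]

theorem cotangentCoord_injective {p z : X} (hz : z ∈ chartDom n p) :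
    Function.Injective (cotangentCoord (n := n) p z) := fun a b h => by
  rw [← covec_cotangentCoord hz a, h, covec_cotangentCoord hz]

theorem cotangentCoord_smul (p z : X) (c : ℝ) (ζ : TangentSpace (halfModel n) z →L[ℝ] ℝ) :
    cotangentCoord p z (c • ζ) = c • cotangentCoord p z ζ := by
  ext i; simp [cotangentCoord]

theorem cotangentCoord_neg (p z : X) (ζ : TangentSpace (halfModel n) z →L[ℝ] ℝ) :
    cotangentCoord p z (-ζ) = -cotangentCoord p z ζ := by
  ext i; simp [cotangentCoord]

end ChartGeometry

/-! ### The metric and the cometric in a chart. -/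

namespace AHMetric

variable {n : ℕ} {X : Type*} [TopologicalSpace X] [ChartedSpace (EuclideanHalfSpace (n + 1)) X]
  [IsManifold (halfModel n) ∞ X] (A : AHMetric n X)

/-- The boundary defining function in the chart centred at `p`. -/
def xc (p : X) (v : EMod n) : ℝ := A.x (chartInv p v)

theorem xc_coord {p z : X} (hz : z ∈ chartDom n p) : A.xc p (coord n p z) = A.x z := by
  rw [xc, chartInv_coord hz]

theorem xc_nonneg (p : X) (v : EMod n) : 0 ≤ A.xc p v := A.x_nonneg _

theorem x_eq_zero_iff {p z : X} (hz : z ∈ chartDom n p) : A.x z = 0 ↔ coord n p z 0 = 0 := by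
  rw [A.x_eq_zero, mem_boundary_iff hz]

theorem x_pos_iff {p z : X} (hz : z ∈ chartDom n p) : 0 < A.x z ↔ 0 < coord n p z 0 := by
  have h0 : 0 ≤ coord n p z 0 := chartTgt_subset p (coord_mem hz)
  rw [lt_iff_le_and_ne, lt_iff_le_and_ne, ne_comm, Ne, A.x_eq_zero_iff hz, ne_comm]
  simp [h0, A.x_nonneg]

theorem x_pos_iff_mem_interior (z : X) : 0 < A.x z ↔ z ∈ (halfModel n).interior X := by
  rw [mem_interior_iff (mem_chartDom_self z), A.x_pos_iff (mem_chartDom_self z)]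

theorem xc_eq_zero_iff {p : X} {v : EMod n} (hv : v ∈ chartTgt n p) : A.xc p v = 0 ↔ v 0 = 0 := by
  rw [xc, A.x_eq_zero_iff (chartInv_mem hv), coord_chartInv hv]

theorem xc_pos_iff {p : X} {v : EMod n} (hv : v ∈ chartTgt n p) : 0 < A.xc p v ↔ 0 < v 0 := by
  rw [xc, A.x_pos_iff (chartInv_mem hv), coord_chartInv hv]

theorem contDiffOn_xc (p : X) : ContDiffOn ℝ ∞ (A.xc p) (chartTgt n p) := by
  rw [← contMDiffOn_iff_contDiffOn]
  exact A.x_smooth.comp_contMDiffOn (contMDiffOn_extChartAt_symm p)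

/-- The components of `ḡ` in the chart centred at `p`. -/
def gComp (p z : X) (i j : Fin (n + 1)) : ℝ := A.gbar.inner z (coordFrame p z i) (coordFrame p z j)

theorem contMDiffOn_coordFrame (p : X) (i : Fin (n + 1)) :
    ContMDiffOn (halfModel n) ((halfModel n).prod 𝓘(ℝ, EMod n)) ∞
      (fun z : X => (⟨z, coordFrame p z i⟩ : TotalSpace (EMod n) (TangentSpace (halfModel n) : X → Type _)))
      (chartDom n p) := by
  intro z hz
  have h := (trivializationAt (EMod n) (TangentSpace (halfModel n) : X → Type _) p).contMDiffOn_symm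
    (n := ∞) (IB := halfModel n)
  have h2 : ContMDiffOn (halfModel n) ((halfModel n).prod 𝓘(ℝ, EMod n)) ∞
      (fun z : X => (z, (EuclideanSpace.single i (1 : ℝ) : EMod n))) (chartDom n p) :=
    contMDiffOn_id.prodMk contMDiffOn_const
  have h3 := h.comp h2 (fun z hz => by
    rw [mem_preimage, Trivialization.mem_target]; exact mem_baseSet hz)
  refine (h3 z hz).congr ?_ ?_
  · intro y hy
    rw [Function.comp_apply, ← Trivialization.mk_symm _ (mem_baseSet hy), coordFrame,
      Trivialization.symmL_apply _ (mem_baseSet hy)]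
  · rw [Function.comp_apply, ← Trivialization.mk_symm _ (mem_baseSet hz), coordFrame,
      Trivialization.symmL_apply _ (mem_baseSet hz)]

theorem contMDiffOn_gComp (p : X) (i j : Fin (n + 1)) :
    ContMDiffOn (halfModel n) 𝓘(ℝ, ℝ) ∞ (fun z => A.gComp p z i j) (chartDom n p) := by
  have h1 := A.gbar.contMDiff.contMDiffOn (s := chartDom n p)
  have h2 : ContMDiffOn (halfModel n) ((halfModel n).prod 𝓘(ℝ, ℝ)) ∞
      (fun z : X => (⟨z, A.gComp p z i j⟩ : TotalSpace ℝ (Bundle.Trivial X ℝ))) (chartDom n p) :=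
    ContMDiffOn.clm_bundle_apply₂ (F₁ := EMod n) (F₂ := EMod n) (F₃ := ℝ) h1
      (contMDiffOn_coordFrame p i) (contMDiffOn_coordFrame p j)
  intro z hz
  have := h2 z hz
  rw [contMDiffWithinAt_totalSpace] at this
  exact this.2

/-- The metric `ḡ` in the chart centred at `p`, as a field of self-adjoint operators. -/
def lower (p : X) (v : EMod n) : EMod n →L[ℝ] EMod n :=
  ∑ i, ∑ j, A.gComp p (chartInv p v) i j •
    ((EuclideanSpace.proj i : EMod n →L[ℝ] ℝ).smulRight (EuclideanSpace.single j (1 : ℝ) : EMod n))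

theorem contDiffOn_lower (p : X) : ContDiffOn ℝ ∞ (A.lower p) (chartTgt n p) := by
  refine ContDiffOn.sum fun i _ => ContDiffOn.sum fun j _ =>
    ContDiffOn.smul (f := fun v => A.gComp p (chartInv p v) i j) ?_ contDiffOn_const
  rw [← contMDiffOn_iff_contDiffOn]
  exact (A.contMDiffOn_gComp p i j).comp (contMDiffOn_extChartAt_symm p) fun v hv => chartInv_mem hv

theorem inner_lower (p : X) (v a b : EMod n) : inner ℝ (A.lower p v a) b =
    A.gbar.inner (chartInv p v) (frame p (chartInv p v) a) (frame p (chartInv p v) b) := by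
  conv_rhs => rw [← sum_single a, ← sum_single b]
  simp only [map_sum, map_smul, lower, sum_apply, sum_inner,
    smul_apply, ContinuousLinearMap.smulRight_apply, inner_smul_left,
    gComp, coordFrame_eq, smul_eq_mul,
    EuclideanSpace.inner_single_left, Finset.mul_sum]
  rw [Finset.sum_comm]
  refine Finset.sum_congr rfl fun i _ => Finset.sum_congr rfl fun j _ => ?_
  simp
  ring

theorem lower_symm (p : X) (v a b : EMod n) :
    inner ℝ (A.lower p v a) b = inner ℝ a (A.lower p v b) := by
  rw [real_inner_comm (A.lower p v b) a, inner_lower, inner_lower, A.gbar.symm]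

theorem frame_injective {p z : X} (hz : z ∈ chartDom n p) : Function.Injective (frame (n := n) p z) :=
  fun a b h => by rw [← tangentCoord_frame hz a, h, tangentCoord_frame hz]

theorem lower_pos {p : X} {v : EMod n} (hv : v ∈ chartTgt n p) {a : EMod n} (ha : a ≠ 0) :
    0 < inner ℝ (A.lower p v a) a := by
  rw [inner_lower]
  refine A.gbar.pos _ _ fun h => ha ?_
  exact frame_injective (chartInv_mem hv) (by rw [h, map_zero])

theorem isUnit_lower {p : X} {v : EMod n} (hv : v ∈ chartTgt n p) : IsUnit (A.lower p v) := by
  have hinj : Function.Injective (A.lower p v) := by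
    refine (injective_iff_map_eq_zero _).2 fun a ha => ?_
    by_contra h
    have := A.lower_pos hv h
    rw [ha, inner_zero_left] at this
    exact lt_irrefl _ this
  rw [ContinuousLinearMap.isUnit_iff_bijective]
  exact ⟨hinj, (LinearMap.injective_iff_surjective (f := (A.lower p v).toLinearMap)).1 hinj⟩

/-- The cometric of `ḡ` in the chart centred at `p`. -/
def raise (p : X) (v : EMod n) : EMod n →L[ℝ] EMod n := Ring.inverse (A.lower p v)

theorem contDiffOn_raise (p : X) : ContDiffOn ℝ ∞ (A.raise p) (chartTgt n p) := by
  intro v hv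
  obtain ⟨w, hw⟩ := A.isUnit_lower hv
  have := contDiffAt_ringInverse (n := ∞) ℝ w
  rw [hw] at this
  exact this.comp_contDiffWithinAt v (A.contDiffOn_lower p v hv)

theorem lower_raise {p : X} {v : EMod n} (hv : v ∈ chartTgt n p) (a : EMod n) :
    A.lower p v (A.raise p v a) = a := by
  have := congrArg (fun L : EMod n →L[ℝ] EMod n => L a) (Ring.mul_inverse_cancel _ (A.isUnit_lower hv))
  simpa [raise] using this

theorem raise_lower {p : X} {v : EMod n} (hv : v ∈ chartTgt n p) (a : EMod n) :
    A.raise p v (A.lower p v a) = a := by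
  have := congrArg (fun L : EMod n →L[ℝ] EMod n => L a) (Ring.inverse_mul_cancel _ (A.isUnit_lower hv))
  simpa [raise] using this

theorem raise_symm {p : X} {v : EMod n} (hv : v ∈ chartTgt n p) (a b : EMod n) :
    inner ℝ (A.raise p v a) b = inner ℝ a (A.raise p v b) := by
  conv_lhs => rw [← A.lower_raise hv b]
  rw [← lower_symm, A.lower_raise hv]

theorem raise_pos {p : X} {v : EMod n} (hv : v ∈ chartTgt n p) {a : EMod n} (ha : a ≠ 0) :
    0 < inner ℝ a (A.raise p v a) := by
  have h : A.raise p v a ≠ 0 := fun h => ha (by rw [← A.lower_raise hv a, h, map_zero])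
  have := A.lower_pos hv h
  rwa [A.lower_raise hv] at this

end AHMetric

section Cometric

variable {n : ℕ} {X : Type*} [TopologicalSpace X] [ChartedSpace (EuclideanHalfSpace (n + 1)) X]
  [IsManifold (halfModel n) ∞ X]

/-- A vector `w` solving `M w = ξ` replaces the computation of the inverse matrix; in the
applications `w` is a multiple of `A.raise p v ξ`. -/
theorem cometricInChart_eq_of_mulVec
    (B : ∀ z : X, TangentSpace (halfModel n) z → TangentSpace (halfModel n) z → ℝ) (p z : X)
    (hu : IsUnit (Matrix.of (fun k l : Fin (n + 1) => B z (coordFrame p z k) (coordFrame p z l))))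
    (ξ w : EMod n)
    (h : ∀ k, ∑ l, B z (coordFrame p z k) (coordFrame p z l) * w l = ξ k) :
    cometricInChart B p z ξ = inner ℝ ξ w := by
  set M := Matrix.of (fun k l : Fin (n + 1) => B z (coordFrame p z k) (coordFrame p z l))
  have h1 : M.mulVec w.ofLp = ξ.ofLp := by
    ext k
    rw [← h k]; rfl
  have h2 : M⁻¹.mulVec ξ.ofLp = w.ofLp := by
    rw [← h1, Matrix.mulVec_mulVec, Matrix.nonsing_inv_mul _ ((Matrix.isUnit_iff_isUnit_det _).1 hu),
      Matrix.one_mulVec]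
  rw [cometricInChart, inner_eq_sum]
  refine Finset.sum_congr rfl fun i _ => ?_
  rw [← h2, Matrix.mulVec, dotProduct, Finset.mul_sum]
  refine Finset.sum_congr rfl fun j _ => ?_
  ring

end Cometric

namespace AHMetric

variable {n : ℕ} {X : Type*} [TopologicalSpace X] [ChartedSpace (EuclideanHalfSpace (n + 1)) X]
  [IsManifold (halfModel n) ∞ X] (A : AHMetric n X)

theorem sum_gComp (p z : X) (w : EMod n) (k : Fin (n + 1)) :
    ∑ l, A.gComp p z k l * w l = A.gbar.inner z (coordFrame p z k) (frame p z w) := by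
  conv_rhs => rw [← sum_single w]
  simp only [map_sum, map_smul, gComp, coordFrame_eq, smul_eq_mul, mul_comm]

theorem isUnit_gComp {p z : X} (hz : z ∈ chartDom n p) :
    IsUnit (Matrix.of (fun k l : Fin (n + 1) => A.gComp p z k l)) := by
  rw [← Matrix.mulVec_injective_iff_isUnit]
  intro a b hab
  rw [← sub_eq_zero]
  set w : EMod n := WithLp.toLp 2 (a - b)
  have h1 : ∀ k, A.gbar.inner z (coordFrame p z k) (frame p z w) = 0 := by
    intro k
    rw [← sum_gComp]
    have := congrFun hab k
    simp only [Matrix.mulVec, dotProduct, Matrix.of_apply] at this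
    simp only [w, Pi.sub_apply, mul_sub, Finset.sum_sub_distrib, this, sub_self]
  have h2 : A.gbar.inner z (frame p z w) (frame p z w) = 0 := by
    conv_lhs => enter [1]; rw [← sum_single w]
    simp only [map_sum, map_smul, sum_apply, smul_apply]
    exact Finset.sum_eq_zero fun k _ => by
      have := h1 k
      rw [coordFrame_eq] at this
      rw [this, smul_zero]
  have h3 : w = 0 := by
    by_contra h
    have h4 := A.gbar.pos z (frame p z w) (fun h5 => h (frame_injective hz (by rw [h5, map_zero])))
    rw [h2] at h4
    exact lt_irrefl _ h4
  have := congrArg WithLp.ofLp h3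
  exact this

theorem cometricInChart_compactMetric {p z : X} (hz : z ∈ chartDom n p) (ξ : EMod n) :
    cometricInChart A.compactMetric p z ξ = inner ℝ ξ (A.raise p (coord n p z) ξ) := by
  refine cometricInChart_eq_of_mulVec _ p z (A.isUnit_gComp hz) ξ _ fun k => ?_
  refine (A.sum_gComp p z _ k).trans ?_
  have h := A.inner_lower p (coord n p z) (EuclideanSpace.single k 1) (A.raise p (coord n p z) ξ)
  rw [lower_symm, A.lower_raise (coord_mem hz), chartInv_coord hz] at h
  rw [coordFrame_eq, ← h, EuclideanSpace.inner_single_left]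
  simp

theorem cometricInChart_metric {p z : X} (hz : z ∈ chartDom n p) (hx : 0 < A.x z) (ξ : EMod n) :
    cometricInChart A.metric p z ξ = A.x z ^ 2 * inner ℝ ξ (A.raise p (coord n p z) ξ) := by
  have hc : (A.x z ^ 2)⁻¹ ≠ 0 := by positivity
  have hM : (Matrix.of (fun k l : Fin (n + 1) => A.metric z (coordFrame p z k) (coordFrame p z l)))
      = (Units.mk0 _ hc) • Matrix.of (fun k l : Fin (n + 1) => A.gComp p z k l) := by
    ext k l
    rfl
  rw [cometricInChart_eq_of_mulVec _ p z _ ξ (A.x z ^ 2 • A.raise p (coord n p z) ξ),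
    inner_smul_right]
  · intro k
    have h : ∑ l, A.gComp p z k l * A.raise p (coord n p z) ξ l = ξ k := by
      refine (A.sum_gComp p z _ k).trans ?_
      have h := A.inner_lower p (coord n p z) (EuclideanSpace.single k 1)
        (A.raise p (coord n p z) ξ)
      rw [lower_symm, A.lower_raise (coord_mem hz), chartInv_coord hz] at h
      rw [coordFrame_eq, ← h, EuclideanSpace.inner_single_left]
      simp
    rw [← h]
    refine Finset.sum_congr rfl fun l _ => ?_
    simp only [metric, PiLp.smul_apply, smul_eq_mul, gComp]
    field_simp
  · rw [hM]
    exact (A.isUnit_gComp hz).smul _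

/-- `|ζ|²_ḡ` in the chart centred at `p`. -/
def quad (p : X) (v ξ : EMod n) : ℝ := inner ℝ ξ (A.raise p v ξ)

theorem quad_smul (p : X) (v ξ : EMod n) (c : ℝ) : A.quad p v (c • ξ) = c ^ 2 * A.quad p v ξ := by
  simp only [quad, map_smul, inner_smul_left, inner_smul_right, conj_trivial]
  ring

/-- The right side, `ζ` evaluated on its metric dual, does not involve the chart. This is the source
of `quad_chart_indep`. -/
theorem quad_eq_apply {p z : X} (hz : z ∈ chartDom n p) {ζ : TangentSpace (halfModel n) z →L[ℝ] ℝ}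
    {w : TangentSpace (halfModel n) z} (h : ∀ u, A.gbar.inner z w u = ζ u) :
    A.quad p (coord n p z) (cotangentCoord p z ζ) = ζ w := by
  have h1 : A.lower p (coord n p z) (tangentCoord p z w) = cotangentCoord p z ζ := by
    refine ext_inner_right ℝ fun a => ?_
    rw [inner_lower, chartInv_coord hz, frame_tangentCoord hz, h, inner_cotangentCoord]
  rw [quad, ← h1, A.raise_lower (coord_mem hz), h1, inner_cotangentCoord, frame_tangentCoord hz]

theorem quad_chart_indep {p p' z : X} (hz : z ∈ chartDom n p) (hz' : z ∈ chartDom n p')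
    (ζ : TangentSpace (halfModel n) z →L[ℝ] ℝ) :
    A.quad p (coord n p z) (cotangentCoord p z ζ) =
      A.quad p' (coord n p' z) (cotangentCoord p' z ζ) := by
  set w : TangentSpace (halfModel n) z := frame p z (A.raise p (coord n p z) (cotangentCoord p z ζ))
  have h : ∀ u, A.gbar.inner z w u = ζ u := by
    intro u
    have h1 := A.inner_lower p (coord n p z) (A.raise p (coord n p z) (cotangentCoord p z ζ))
      (tangentCoord p z u)
    rw [A.lower_raise (coord_mem hz), chartInv_coord hz, frame_tangentCoord hz,
      inner_cotangentCoord, frame_tangentCoord hz] at h1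
    exact h1.symm
  rw [A.quad_eq_apply hz h, A.quad_eq_apply hz' h]

theorem dualNormSq_compactMetric {p z : X} (hz : z ∈ chartDom n p)
    (ζ : TangentSpace (halfModel n) z →L[ℝ] ℝ) :
    dualNormSq A.compactMetric z ζ = A.quad p (coord n p z) (cotangentCoord p z ζ) := by
  rw [dualNormSq, A.cometricInChart_compactMetric (mem_chartDom_self z),
    A.quad_chart_indep hz (mem_chartDom_self z)]
  rfl

theorem dualNormSq_metric {p z : X} (hz : z ∈ chartDom n p) (hx : 0 < A.x z)
    (ζ : TangentSpace (halfModel n) z →L[ℝ] ℝ) :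
    dualNormSq A.metric z ζ = A.x z ^ 2 * A.quad p (coord n p z) (cotangentCoord p z ζ) := by
  rw [dualNormSq, A.cometricInChart_metric (mem_chartDom_self z) hx,
    A.quad_chart_indep hz (mem_chartDom_self z)]
  rfl

theorem symbolInChart_eq {p : X} {v : EMod n} (hv : v ∈ chartTgt n p) (hx : 0 < A.xc p v)
    (ξ : EMod n) : A.symbolInChart p (v, ξ) = A.xc p v ^ 2 * A.quad p v ξ - 1 := by
  have h := A.cometricInChart_metric (chartInv_mem hv) hx ξ
  rw [coord_chartInv hv] at h
  rw [symbolInChart]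
  exact congrArg (· - 1) h

theorem mem_SigmaL_iff {p : X} {q : A.PhiCotangent} (hq : q.base.left ∈ chartDom n p) :
    q ∈ A.SigmaL ↔ A.quad p (coord n p q.base.left) (cotangentCoord p q.base.left q.α) = 1 := by
  rw [← A.dualNormSq_compactMetric hq, SigmaL, mem_setOf_eq, sub_eq_zero]

theorem quad_pos {p : X} {v : EMod n} (hv : v ∈ chartTgt n p) {ξ : EMod n} (hξ : ξ ≠ 0) :
    0 < A.quad p v ξ := A.raise_pos hv hξ

end AHMetric

/-! ### The topology of the cotangent bundle in terms of components. -/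

section CotangentTopology

variable {n : ℕ} {X : Type*} [TopologicalSpace X] [ChartedSpace (EuclideanHalfSpace (n + 1)) X]
  [IsManifold (halfModel n) ∞ X]

/-- The trivialization of the cotangent bundle over the chart centred at `p`. -/
def cotTriv (p : X) : Trivialization (EMod n →L[ℝ] ℝ)
    (TotalSpace.proj : CotBundle n X → X) :=
  trivializationAt (EMod n →L[ℝ] ℝ)
    (fun z : X => TangentSpace (halfModel n) z →L[ℝ] Bundle.Trivial X ℝ z) p

theorem cotTriv_baseSet (p : X) : (cotTriv (n := n) p).baseSet = chartDom n p := by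
  rw [cotTriv, hom_trivializationAt_baseSet]
  simp [TangentBundle.trivializationAt_baseSet, chartDom]

theorem cotTriv_apply_snd (p z : X) (ζ : TangentSpace (halfModel n) z →L[ℝ] ℝ) (a : EMod n) :
    (cotTriv p (⟨z, ζ⟩ : CotBundle n X)).2 a = ζ (frame p z a) := by
  rw [cotTriv, hom_trivializationAt_apply]
  simp [ContinuousLinearMap.inCoordinates, frame]

theorem cotangentCoord_eq_cotTriv (p : X) (s : CotBundle n X) :
    cotangentCoord p s.proj s.2 =
      (InnerProductSpace.toDual ℝ (EMod n)).symm (cotTriv p s).2 := by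
  refine ext_inner_right ℝ fun a => ?_
  rw [inner_cotangentCoord, InnerProductSpace.toDual_symm_apply, cotTriv_apply_snd p s.proj s.2]

theorem continuousAt_cotangentCoord {p : X} {s : CotBundle n X} (hs : s.proj ∈ chartDom n p) :
    ContinuousAt (fun s : CotBundle n X => cotangentCoord p s.proj s.2) s := by
  have h1 : ContinuousAt (cotTriv (n := n) p) s :=
    (cotTriv p).continuousAt ((cotTriv p).mem_source.2 (by rwa [cotTriv_baseSet]))
  have h2 := (InnerProductSpace.toDual ℝ (EMod n)).symm.continuous.continuousAt.comp
    (continuousAt_snd.comp h1)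
  exact h2.congr (Eventually.of_forall fun s => (cotangentCoord_eq_cotTriv p s).symm)

/-- The trivialization `cotTriv` has a continuous inverse, so a family of covectors is continuous as
soon as its base points and components are. -/
theorem continuousAt_mk_covec {Y : Type*} [TopologicalSpace Y] {p : X} {S : Set Y} {y₀ : Y}
    {f : Y → X} {ξ : Y → EMod n} (hf : ContinuousWithinAt f S y₀) (hξ : ContinuousWithinAt ξ S y₀)
    (h0 : f y₀ ∈ chartDom n p) :
    ContinuousWithinAt (fun y => (⟨f y, covec p (f y) (ξ y)⟩ : CotBundle n X)) S y₀ := by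
  have hbase : ∀ᶠ y in 𝓝[S] y₀, f y ∈ chartDom n p := hf ((isOpen_chartDom p).mem_nhds h0)
  have key : ∀ z ∈ chartDom n p, ∀ a : EMod n, (⟨z, covec p z a⟩ : CotBundle n X) =
      (cotTriv p).toOpenPartialHomeomorph.symm (z, InnerProductSpace.toDual ℝ (EMod n) a) := by
    intro z hz a
    have hsrc : (⟨z, covec p z a⟩ : CotBundle n X) ∈ (cotTriv (n := n) p).source :=
      (cotTriv p).mem_source.2 (by rwa [cotTriv_baseSet])
    have h1 : cotTriv p (⟨z, covec p z a⟩ : CotBundle n X) =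
        (z, InnerProductSpace.toDual ℝ (EMod n) a) := by
      refine Prod.ext ((cotTriv p).coe_fst hsrc) ?_
      ext b
      rw [cotTriv_apply_snd, covec_apply, tangentCoord_frame hz]
      rfl
    rw [← h1]
    exact ((cotTriv p).toOpenPartialHomeomorph.left_inv hsrc).symm
  have h2 : ContinuousWithinAt (fun y => (cotTriv p).toOpenPartialHomeomorph.symm
      (f y, InnerProductSpace.toDual ℝ (EMod n) (ξ y))) S y₀ := by
    refine ContinuousAt.comp_continuousWithinAt (f := fun y =>
      (f y, InnerProductSpace.toDual ℝ (EMod n) (ξ y))) ?_ (hf.prodMk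
        ((InnerProductSpace.toDual ℝ (EMod n)).continuous.continuousAt.comp_continuousWithinAt hξ))
    exact (cotTriv p).toOpenPartialHomeomorph.continuousAt_symm
      ((cotTriv p).mem_target.2 (by rwa [cotTriv_baseSet]))
  refine h2.congr_of_eventuallyEq ?_ (key _ h0 _)
  filter_upwards [hbase] with y hy using key _ hy _

theorem continuous_cot_proj : Continuous (TotalSpace.proj : CotBundle n X → X) :=
  FiberBundle.continuous_proj _ _

end CotangentTopology

/-! ### Changes of chart. -/

section Transition

variable {n : ℕ} {X : Type*} [TopologicalSpace X] [ChartedSpace (EuclideanHalfSpace (n + 1)) X]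

theorem hasDerivWithinAt_iff_components {f : ℝ → EMod n} {f' : EMod n} {s : Set ℝ} {t : ℝ} :
    HasDerivWithinAt f f' s t ↔ ∀ i, HasDerivWithinAt (fun u => f u i) (f' i) s t := by
  constructor
  · intro h i
    exact (EuclideanSpace.proj (𝕜 := ℝ) i).hasFDerivAt.comp_hasDerivWithinAt t h
  · intro h
    have h1 : HasDerivWithinAt (fun u => (f u).ofLp) f'.ofLp s t := hasDerivWithinAt_pi.2 h
    have h2 := (PiLp.continuousLinearEquiv 2 ℝ (fun _ : Fin (n + 1) => ℝ)).symm.hasFDerivAt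
      |>.comp_hasDerivWithinAt t h1
    exact h2

/-- The change of coordinates from the chart centred at `p` to the one centred at `p'`. -/
def chTrans (p p' : X) (v : EMod n) : EMod n := coord n p' (chartInv p v)

/-- The image in the chart centred at `p` of the domain of the chart centred at `p'`. -/
def transDom (n : ℕ) {X : Type*} [TopologicalSpace X]
    [ChartedSpace (EuclideanHalfSpace (n + 1)) X] (p p' : X) : Set (EMod n) :=
  {v | v ∈ chartTgt n p ∧ chartInv p v ∈ chartDom n p'}

theorem coord_mem_transDom {p p' z : X} (hz : z ∈ chartDom n p) (hz' : z ∈ chartDom n p') :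
    coord n p z ∈ transDom n p p' :=
  ⟨coord_mem hz, by rwa [chartInv_coord hz]⟩

theorem chTrans_coord {p p' z : X} (hz : z ∈ chartDom n p) :
    chTrans p p' (coord n p z) = coord n p' z := by
  rw [chTrans, chartInv_coord hz]

theorem transDom_nhdsWithin {p p' : X} {v : EMod n} (hv : v ∈ transDom n p p') :
    transDom n p p' ∈ 𝓝[halfSpace n] v := by
  have h0 : chartTgt n p ∈ 𝓝[halfSpace n] v := by
    obtain ⟨O, hO, h⟩ := exists_isOpen_chartTgt (n := n) p
    rw [h, inter_comm]
    exact inter_mem_nhdsWithin _ (hO.mem_nhds (by have := hv.1; rw [h] at this; exact this.1))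
  have h1 : ContinuousWithinAt (chartInv p) (halfSpace n) v :=
    ((continuousOn_chartInv p) v hv.1).mono_of_mem_nhdsWithin h0
  filter_upwards [h0, h1 ((isOpen_chartDom p').mem_nhds hv.2)] with w hw hw' using ⟨hw, hw'⟩

theorem chartTgt_nhds {p : X} {v : EMod n} (hv : v ∈ chartTgt n p) (h0 : 0 < v 0) :
    chartTgt n p ∈ 𝓝 v := by
  obtain ⟨O, hO, h⟩ := exists_isOpen_chartTgt (n := n) p
  rw [h] at hv ⊢
  have : {w : EMod n | 0 < w 0} ∈ 𝓝 v :=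
    (isOpen_lt continuous_const (by fun_prop)).mem_nhds h0
  filter_upwards [hO.mem_nhds hv.1, this] with w hw hw' using ⟨hw, le_of_lt hw'⟩

theorem halfSpace_nhds {v : EMod n} (h0 : 0 < v 0) : halfSpace n ∈ 𝓝 v := by
  have : {w : EMod n | 0 < w 0} ∈ 𝓝 v :=
    (isOpen_lt continuous_const (by fun_prop)).mem_nhds h0
  filter_upwards [this] with w hw' using le_of_lt hw'

variable [IsManifold (halfModel n) ∞ X]

theorem contDiffOn_chTrans (p p' : X) : ContDiffOn ℝ ∞ (chTrans p p') (transDom n p p') := by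
  have h := contDiffOn_ext_coord_change (n := ∞) (I := halfModel n) p' p
  refine h.mono fun v hv => ?_
  rw [PartialEquiv.trans_source, PartialEquiv.symm_source, mem_inter_iff, mem_preimage,
    extChartAt_source]
  exact hv

/-- The trivializations of the tangent bundle attached to two charts differ by the derivative of the
coordinate change, taken within the half-space so that boundary points are included. -/
theorem tangentCoord_frame_eq {p p' z : X} (hz : z ∈ chartDom n p) (hz' : z ∈ chartDom n p')
    (e : EMod n) :
    tangentCoord p' z (frame p z e) =
      fderivWithin ℝ (chTrans p p') (halfSpace n) (coord n p z) e := by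
  rw [← range_halfModel]
  have h1 := TangentBundle.continuousLinearMapAt_trivializationAt (I := halfModel n) hz'
  have h2 := TangentBundle.symmL_trivializationAt (I := halfModel n) hz
  have h3 := tangentBundleCore_coordChange (halfModel n) X (achart _ p) (achart _ p') z
  have h4 : (tangentBundleCore (halfModel n) X).coordChange (achart _ p) (achart _ p') z e =
      tangentCoord p' z (frame p z e) := by
    have hz1 : z ∈ (tangentBundleCore (halfModel n) X).baseSet (achart _ p) := hz
    have hz2 : z ∈ (tangentBundleCore (halfModel n) X).baseSet (achart _ p') := hz'
    rw [tangentCoord, frame, Trivialization.continuousLinearMapAt_apply,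
      Trivialization.linearMapAt_apply, if_pos (mem_baseSet hz'),
      Trivialization.symmL_apply _ (mem_baseSet hz)]
    change _ = ((tangentBundleCore (halfModel n) X).localTriv (achart _ p') ⟨z, _⟩).2
    rw [VectorBundleCore.localTriv_apply]
    have h6 := (tangentBundleCore (halfModel n) X).localTriv_symm_apply (achart _ p) hz1 e
    have h7 : (trivializationAt (EMod n) (TangentSpace (halfModel n) : X → Type _) p).symm z e =
      (tangentBundleCore (halfModel n) X).coordChange (achart _ p)
        ((tangentBundleCore (halfModel n) X).indexAt z) z e := h6
    rw [h7]
    rw [(tangentBundleCore (halfModel n) X).coordChange_comp]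
    exact ⟨⟨hz1, (tangentBundleCore (halfModel n) X).mem_baseSet_at z⟩, hz2⟩
  rw [← h4, h3]
  rfl

end Transition

/-! ### The Hamilton vector field in a chart. -/

namespace AHMetric

variable {n : ℕ} {X : Type*} [TopologicalSpace X] [ChartedSpace (EuclideanHalfSpace (n + 1)) X]
  [IsManifold (halfModel n) ∞ X] (A : AHMetric n X)

/-- The Euclidean gradient of the boundary defining function in the chart centred at `p`. -/
def gradX (p : X) (v : EMod n) : EMod n :=
  (InnerProductSpace.toDual ℝ (EMod n)).symm (fderivWithin ℝ (A.xc p) (chartTgt n p) v)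

theorem inner_gradX (p : X) (v a : EMod n) :
    inner ℝ (A.gradX p v) a = fderivWithin ℝ (A.xc p) (chartTgt n p) v a := by
  rw [gradX, InnerProductSpace.toDual_symm_apply]

/-- The Euclidean gradient of `v ↦ |ξ|²_ḡ` in the chart centred at `p`. -/
def gradQuad (p : X) (v ξ : EMod n) : EMod n :=
  (InnerProductSpace.toDual ℝ (EMod n)).symm
    ((innerSL ℝ ξ).comp ((fderivWithin ℝ (A.raise p) (chartTgt n p) v).flip ξ))

theorem inner_gradQuad (p : X) (v ξ a : EMod n) : inner ℝ (A.gradQuad p v ξ) a =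
    inner ℝ ξ (fderivWithin ℝ (A.raise p) (chartTgt n p) v a ξ) := by
  rw [gradQuad, InnerProductSpace.toDual_symm_apply]
  rfl

theorem contDiffOn_gradX (p : X) : ContDiffOn ℝ ∞ (A.gradX p) (chartTgt n p) :=
  (InnerProductSpace.toDual ℝ (EMod n)).symm.contDiff.comp_contDiffOn
    ((A.contDiffOn_xc p).fderivWithin (uniqueDiffOn_chartTgt p) (by simp))

set_option synthInstance.maxHeartbeats 200000 in
theorem contDiffOn_gradQuad (p : X) :
    ContDiffOn ℝ ∞ (fun u : EMod n × EMod n => A.gradQuad p u.1 u.2) (chartTgt n p ×ˢ univ) := by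
  refine (InnerProductSpace.toDual ℝ (EMod n)).symm.contDiff.comp_contDiffOn ?_
  have h1 : ContDiffOn ℝ ∞ (fun u : EMod n × EMod n =>
      fderivWithin ℝ (A.raise p) (chartTgt n p) u.1) (chartTgt n p ×ˢ univ) :=
    ((A.contDiffOn_raise p).fderivWithin (uniqueDiffOn_chartTgt p) (by simp)).comp
      contDiffOn_fst fun _ hu => hu.1
  exact contDiffOn_clm_apply.2 fun y =>
    contDiffOn_snd.inner ℝ ((h1.clm_apply contDiffOn_const).clm_apply contDiffOn_snd)

theorem contDiffOn_raise_apply (p : X) :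
    ContDiffOn ℝ ∞ (fun u : EMod n × EMod n => A.raise p u.1 u.2) (chartTgt n p ×ˢ univ) :=
  ((A.contDiffOn_raise p).comp contDiffOn_fst fun _ hu => hu.1).clm_apply contDiffOn_snd

theorem contDiffOn_quad (p : X) :
    ContDiffOn ℝ ∞ (fun u : EMod n × EMod n => A.quad p u.1 u.2) (chartTgt n p ×ˢ univ) :=
  contDiffOn_snd.inner ℝ (A.contDiffOn_raise_apply p)

/-- The position component of the Hamilton vector field in the chart centred at `p`. -/
def velocity (p : X) (v ξ : EMod n) : EMod n := (2 * A.xc p v ^ 2) • A.raise p v ξ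

/-- The momentum component of the Hamilton vector field in the chart centred at `p`. -/
def force (p : X) (v ξ : EMod n) : EMod n :=
  -((2 * A.xc p v * A.quad p v ξ) • A.gradX p v + A.xc p v ^ 2 • A.gradQuad p v ξ)

theorem hasFDerivAt_xc {p : X} {v : EMod n} (hv : v ∈ chartTgt n p) (h0 : 0 < v 0) :
    HasFDerivAt (A.xc p) (fderivWithin ℝ (A.xc p) (chartTgt n p) v) v :=
  (((A.contDiffOn_xc p).differentiableOn (by simp)) v hv).hasFDerivWithinAt.hasFDerivAt
    (chartTgt_nhds hv h0)

theorem hasFDerivAt_raise {p : X} {v : EMod n} (hv : v ∈ chartTgt n p) (h0 : 0 < v 0) :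
    HasFDerivAt (A.raise p) (fderivWithin ℝ (A.raise p) (chartTgt n p) v) v :=
  (((A.contDiffOn_raise p).differentiableOn (by simp)) v hv).hasFDerivWithinAt.hasFDerivAt
    (chartTgt_nhds hv h0)

/-- Over the interior the symbol equals `x² |ξ|²_ḡ - 1` in a full neighbourhood, so the unrestricted
derivative can be computed. The symmetry of `raise` produces the factor `2` in `velocity`. -/
theorem hasFDerivAt_symbolInChart {p : X} {v : EMod n} (hv : v ∈ chartTgt n p) (h0 : 0 < v 0)
    (ξ : EMod n) : HasFDerivAt (A.symbolInChart p)
      ((innerSL ℝ (-A.force p v ξ)).comp (ContinuousLinearMap.fst ℝ (EMod n) (EMod n)) +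
        (innerSL ℝ (A.velocity p v ξ)).comp (ContinuousLinearMap.snd ℝ (EMod n) (EMod n)))
      (v, ξ) := by
  have h1 : HasFDerivAt (fun u : EMod n × EMod n => A.xc p u.1) _ (v, ξ) :=
    HasFDerivAt.comp (g := A.xc p) (v, ξ) (A.hasFDerivAt_xc hv h0) hasFDerivAt_fst
  have h2 : HasFDerivAt (fun u : EMod n × EMod n => A.raise p u.1) _ (v, ξ) :=
    HasFDerivAt.comp (g := A.raise p) (v, ξ) (A.hasFDerivAt_raise hv h0) hasFDerivAt_fst
  have h3 := h2.clm_apply (hasFDerivAt_snd (p := (v, ξ)))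
  have h4 := (hasFDerivAt_snd (p := (v, ξ))).inner ℝ h3
  have h5 := ((h1.pow 2).mul h4).sub_const (1 : ℝ)
  have h6 : A.symbolInChart p =ᶠ[𝓝 (v, ξ)]
      fun u => A.xc p u.1 ^ 2 * inner ℝ u.2 (A.raise p u.1 u.2) - 1 := by
    have e1 : ∀ᶠ u : EMod n × EMod n in 𝓝 (v, ξ), u.1 ∈ chartTgt n p :=
      continuousAt_fst (chartTgt_nhds hv h0)
    have e2 : ∀ᶠ u : EMod n × EMod n in 𝓝 (v, ξ), 0 < u.1 0 :=
      (isOpen_lt continuous_const (by fun_prop)).mem_nhds h0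
    filter_upwards [e1, e2] with u hu1 hu2
    exact A.symbolInChart_eq hu1 ((A.xc_pos_iff hu1).2 hu2) u.2
  refine (h5.congr_of_eventuallyEq h6).congr_fderiv ?_
  refine ContinuousLinearMap.ext fun w => ?_
  simp only [force, velocity, neg_neg, add_apply, ContinuousLinearMap.comp_apply,
    ContinuousLinearMap.coe_fst', ContinuousLinearMap.coe_snd', innerSL_apply_apply, smul_apply,
    inner_add_left, inner_smul_left, inner_gradX, inner_gradQuad, smul_eq_mul, conj_trivial, quad,
    ContinuousLinearMap.prod_apply, fderivInnerCLM_apply, ContinuousLinearMap.flip_apply,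
    inner_add_right, A.raise_symm hv]
  have hs : inner ℝ w.2 (A.raise p v ξ) = inner ℝ ξ (A.raise p v w.2) := by
    rw [← A.raise_symm hv, real_inner_comm]
  rw [hs]
  simp
  ring

/-- `γ` satisfies the Hamilton equations in the chart centred at `p` at the time `t`, with
derivatives taken within `s`. -/
structure HamAt (γ : ℝ → CotBundle n X) (p : X) (s : Set ℝ) (t : ℝ) : Prop where
  pos : HasDerivWithinAt (fun u => coord n p (γ u).proj)
    (A.velocity p (coord n p (γ t).proj) (cotangentCoord p (γ t).proj (γ t).2)) s t
  mom : HasDerivWithinAt (fun u => cotangentCoord p (γ u).proj (γ u).2)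
    (A.force p (coord n p (γ t).proj) (cotangentCoord p (γ t).proj (γ t).2)) s t

theorem isBicharacteristic_iff (γ : ℝ → CotBundle n X) : A.IsBicharacteristic γ ↔
    Continuous (fun t => (γ t).proj) ∧ (∀ t, 0 < A.x (γ t).proj) ∧
    (∀ t, dualNormSq A.metric (γ t).proj (γ t).2 = 1) ∧
    ∀ t p, (γ t).proj ∈ chartDom n p → A.HamAt γ p univ t := by
  have key : ∀ t p, 0 < A.x (γ t).proj → (γ t).proj ∈ chartDom n p → (A.HamAt γ p univ t ↔
      (∀ i : Fin (n + 1), HasDerivAt (fun s => coord n p (γ s).proj i)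
      (fderiv ℝ (A.symbolInChart p)
        (coord n p (γ t).proj, cotangentCoord p (γ t).proj (γ t).2)
        (0, EuclideanSpace.single i (1 : ℝ))) t) ∧
      (∀ i : Fin (n + 1), HasDerivAt (fun s => cotangentCoord p (γ s).proj (γ s).2 i)
      (-fderiv ℝ (A.symbolInChart p)
        (coord n p (γ t).proj, cotangentCoord p (γ t).proj (γ t).2)
        (EuclideanSpace.single i (1 : ℝ), 0)) t)) := by
    intro t p hx hp
    have hf := (A.hasFDerivAt_symbolInChart (coord_mem hp) ((A.x_pos_iff hp).1 hx)
      (cotangentCoord p (γ t).proj (γ t).2)).fderiv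
    rw [hf]
    constructor
    · intro h
      refine ⟨fun i => ?_, fun i => ?_⟩
      · have := hasDerivWithinAt_iff_components.1 h.pos i
        rw [hasDerivWithinAt_univ] at this
        simpa [EuclideanSpace.inner_single_right] using this
      · have := hasDerivWithinAt_iff_components.1 h.mom i
        rw [hasDerivWithinAt_univ] at this
        simpa [EuclideanSpace.inner_single_right] using this
    · intro h
      refine ⟨hasDerivWithinAt_iff_components.2 fun i => ?_,
        hasDerivWithinAt_iff_components.2 fun i => ?_⟩
      · rw [hasDerivWithinAt_univ]
        simpa [EuclideanSpace.inner_single_right] using h.1 i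
      · rw [hasDerivWithinAt_univ]
        simpa [EuclideanSpace.inner_single_right] using h.2 i
  constructor
  · intro h
    have hx : ∀ t, 0 < A.x (γ t).proj := fun t => (A.x_pos_iff_mem_interior _).2 (h.mem_interior t)
    exact ⟨h.continuous_proj, hx, fun t => sub_eq_zero.1 (h.mem_char t), fun t p hp =>
      (key t p (hx t) hp).2 ⟨h.hasDerivAt_position t p hp, h.hasDerivAt_momentum t p hp⟩⟩
  · rintro ⟨h1, h2, h3, h4⟩
    exact ⟨h1, fun t => (A.x_pos_iff_mem_interior _).1 (h2 t), fun t => sub_eq_zero.2 (h3 t),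
      fun t p hp => ((key t p (h2 t) hp).1 (h4 t p hp)).1,
      fun t p hp => ((key t p (h2 t) hp).1 (h4 t p hp)).2⟩

end AHMetric

/-! ### Invariance of Hamilton's equations under changes of chart. -/

section Tilt

variable {n : ℕ}

/-- The transpose of `L` applied to `ξ`. -/
def transposeApply (ξ : EMod n) (L : EMod n →L[ℝ] EMod n) : EMod n :=
  WithLp.toLp 2 fun i => inner ℝ ξ (L (EuclideanSpace.single i (1 : ℝ)))

theorem inner_transposeApply (ξ : EMod n) (L : EMod n →L[ℝ] EMod n) (b : EMod n) :
    inner ℝ b (transposeApply ξ L) = inner ℝ ξ (L b) := by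
  rw [inner_eq_sum]
  conv_rhs => rw [← sum_single b]
  simp only [map_sum, map_smul, inner_sum, inner_smul_right, transposeApply]

theorem hasDerivAt_transposeApply {ξ : EMod n} {L : ℝ → EMod n →L[ℝ] EMod n}
    {L' : EMod n →L[ℝ] EMod n} {t : ℝ} (h : HasDerivAt L L' t) :
    HasDerivAt (fun u => transposeApply ξ (L u)) (transposeApply ξ L') t := by
  rw [← hasDerivWithinAt_univ, hasDerivWithinAt_iff_components]
  intro i
  rw [hasDerivWithinAt_univ]
  have h1 := h.clm_apply (hasDerivAt_const t (EuclideanSpace.single i (1 : ℝ) : EMod n))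
  have h2 := (hasDerivAt_const t ξ).inner ℝ h1
  simpa [transposeApply] using h2

end Tilt

theorem isOpen_pos {n : ℕ} : IsOpen {w : EMod n | 0 < w 0} :=
  isOpen_lt continuous_const (by fun_prop)

section TransitionMore

variable {n : ℕ} {X : Type*} [TopologicalSpace X] [ChartedSpace (EuclideanHalfSpace (n + 1)) X]
  [IsManifold (halfModel n) ∞ X]

theorem transDom_nhds {p p' : X} {v : EMod n} (hv : v ∈ transDom n p p') (h0 : 0 < v 0) :
    transDom n p p' ∈ 𝓝 v := by
  have := transDom_nhdsWithin hv
  rwa [nhdsWithin_eq_nhds.2 (halfSpace_nhds h0)] at this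

theorem contDiffAt_chTrans {p p' : X} {v : EMod n} (hv : v ∈ transDom n p p') (h0 : 0 < v 0) :
    ContDiffAt ℝ ∞ (chTrans p p') v :=
  (contDiffOn_chTrans p p').contDiffAt (transDom_nhds hv h0)

theorem fderivWithin_chTrans {p p' : X} {v : EMod n} (h0 : 0 < v 0) :
    fderivWithin ℝ (chTrans p p') (halfSpace n) v = fderiv ℝ (chTrans p p') v :=
  fderivWithin_of_mem_nhds (halfSpace_nhds h0)

theorem inner_cotangentCoord_change {p p' z : X} (hz : z ∈ chartDom n p) (hz' : z ∈ chartDom n p')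
    (ζ : TangentSpace (halfModel n) z →L[ℝ] ℝ) (a : EMod n) :
    inner ℝ (cotangentCoord p' z ζ) a = inner ℝ (cotangentCoord p z ζ)
      (fderivWithin ℝ (chTrans p' p) (halfSpace n) (coord n p' z) a) := by
  rw [inner_cotangentCoord, inner_cotangentCoord, ← tangentCoord_frame_eq hz' hz,
    frame_tangentCoord hz]

theorem cotangentCoord_change {p p' z : X} (hz : z ∈ chartDom n p) (hz' : z ∈ chartDom n p')
    (ζ : TangentSpace (halfModel n) z →L[ℝ] ℝ) :
    cotangentCoord p' z ζ = transposeApply (cotangentCoord p z ζ)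
      (fderivWithin ℝ (chTrans p' p) (halfSpace n) (coord n p' z)) := by
  refine ext_inner_left ℝ fun a => ?_
  rw [inner_transposeApply, ← inner_cotangentCoord_change hz hz', real_inner_comm]

end TransitionMore

namespace AHMetric

variable {n : ℕ} {X : Type*} [TopologicalSpace X] [ChartedSpace (EuclideanHalfSpace (n + 1)) X]
  [IsManifold (halfModel n) ∞ X] (A : AHMetric n X)

/-- The vector `frame (raise ζ)` represents `ζ` for `ḡ`, a characterization free of the chart. -/
theorem inner_frame_raise {p z : X} (hz : z ∈ chartDom n p)
    (ζ : TangentSpace (halfModel n) z →L[ℝ] ℝ) (u : TangentSpace (halfModel n) z) :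
    A.gbar.inner z (frame p z (A.raise p (coord n p z) (cotangentCoord p z ζ))) u = ζ u := by
  have h1 := A.inner_lower p (coord n p z) (A.raise p (coord n p z) (cotangentCoord p z ζ))
    (tangentCoord p z u)
  rw [A.lower_raise (coord_mem hz), chartInv_coord hz, frame_tangentCoord hz,
    inner_cotangentCoord, frame_tangentCoord hz] at h1
  exact h1.symm

theorem frame_raise_chart_indep {p p' z : X} (hz : z ∈ chartDom n p) (hz' : z ∈ chartDom n p')
    (ζ : TangentSpace (halfModel n) z →L[ℝ] ℝ) :
    frame p z (A.raise p (coord n p z) (cotangentCoord p z ζ)) =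
      frame p' z (A.raise p' (coord n p' z) (cotangentCoord p' z ζ)) := by
  rw [← sub_eq_zero]
  by_contra h
  have key : ∀ u, A.gbar.inner z (frame p z (A.raise p (coord n p z) (cotangentCoord p z ζ)) -
      frame p' z (A.raise p' (coord n p' z) (cotangentCoord p' z ζ))) u = 0 := by
    intro u
    rw [map_sub, sub_apply, A.inner_frame_raise hz, A.inner_frame_raise hz', sub_self]
  have h1 := A.gbar.pos z _ h
  rw [key] at h1
  exact lt_irrefl _ h1

theorem velocity_change {p p' z : X} (hz : z ∈ chartDom n p) (hz' : z ∈ chartDom n p')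
    (ζ : TangentSpace (halfModel n) z →L[ℝ] ℝ) :
    fderivWithin ℝ (chTrans p p') (halfSpace n) (coord n p z)
      (A.velocity p (coord n p z) (cotangentCoord p z ζ)) =
      A.velocity p' (coord n p' z) (cotangentCoord p' z ζ) := by
  rw [← tangentCoord_frame_eq hz hz', velocity, velocity, map_smul, A.frame_raise_chart_indep hz hz',
    A.xc_coord hz, A.xc_coord hz', ← map_smul, tangentCoord_frame hz']

theorem symbolInChart_coord {p z : X} (hz : z ∈ chartDom n p) (hx : 0 < A.x z)
    (ζ : TangentSpace (halfModel n) z →L[ℝ] ℝ) :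
    A.symbolInChart p (coord n p z, cotangentCoord p z ζ) = dualNormSq A.metric z ζ - 1 := by
  rw [A.symbolInChart_eq (coord_mem hz) (by rwa [A.xc_coord hz]), A.xc_coord hz,
    A.dualNormSq_metric hz hx]

theorem symbolInChart_change {p p' : X} {w : EMod n} (hw : w ∈ transDom n p' p) (h0 : 0 < w 0)
    (ξ : EMod n) : A.symbolInChart p'
      (w, transposeApply ξ (fderivWithin ℝ (chTrans p' p) (halfSpace n) w)) =
      A.symbolInChart p (chTrans p' p w, ξ) := by
  set z := chartInv p' w
  have hz' : z ∈ chartDom n p' := chartInv_mem hw.1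
  have hz : z ∈ chartDom n p := hw.2
  have hzw : coord n p' z = w := coord_chartInv hw.1
  have hx : 0 < A.x z := (A.x_pos_iff hz').2 (by rwa [hzw])
  have h1 := A.symbolInChart_coord hz hx (covec p z ξ)
  have h2 := A.symbolInChart_coord hz' hx (covec p z ξ)
  rw [cotangentCoord_change hz hz', cotangentCoord_covec hz, hzw] at h2
  rw [cotangentCoord_covec hz] at h1
  rw [h2, ← h1, ← hzw, chTrans_coord hz']

/-- Differentiating the invariance of the symbol in the position variable. -/
theorem force_change {p p' z : X} (hz : z ∈ chartDom n p) (hz' : z ∈ chartDom n p')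
    (hx : 0 < A.x z) (ζ : TangentSpace (halfModel n) z →L[ℝ] ℝ) (a : EMod n) :
    inner ℝ (A.force p' (coord n p' z) (cotangentCoord p' z ζ)) a =
      inner ℝ (A.force p (coord n p z) (cotangentCoord p z ζ))
        (fderiv ℝ (chTrans p' p) (coord n p' z) a) +
      inner ℝ (cotangentCoord p z ζ) (fderiv ℝ (fderiv ℝ (chTrans p' p)) (coord n p' z) a
        (A.velocity p' (coord n p' z) (cotangentCoord p' z ζ))) := by
  set w := coord n p' z
  set v := coord n p z
  set ξ := cotangentCoord p z ζ
  set ξ' := cotangentCoord p' z ζ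
  set μ := chTrans (n := n) p' p
  have hw : w ∈ transDom n p' p := coord_mem_transDom hz' hz
  have hw0 : 0 < w 0 := (A.x_pos_iff hz').1 hx
  have hμw : μ w = v := chTrans_coord hz'
  have hμ : ContDiffAt ℝ ∞ μ w := contDiffAt_chTrans hw hw0
  have hline : HasDerivAt (fun τ : ℝ => w + τ • a) a 0 := by
    simpa using ((hasDerivAt_id (0 : ℝ)).smul_const a).const_add w
  have hline0 : w + (0 : ℝ) • a = w := by simp
  have hd1 : HasDerivAt (fun τ : ℝ => fderiv ℝ μ (w + τ • a)) (fderiv ℝ (fderiv ℝ μ) w a) 0 := by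
    have h1 : HasFDerivAt (fderiv ℝ μ) (fderiv ℝ (fderiv ℝ μ) w) (w + (0 : ℝ) • a) := by
      rw [hline0]
      exact ((hμ.fderiv_right (m := 1) (by norm_cast)).differentiableAt (by simp)).hasFDerivAt
    exact h1.comp_hasDerivAt (0 : ℝ) hline
  have hd2 := hasDerivAt_transposeApply (ξ := ξ) hd1
  have hξ' : transposeApply ξ (fderiv ℝ μ (w + (0 : ℝ) • a)) = ξ' := by
    rw [hline0, ← fderivWithin_chTrans hw0]
    exact (cotangentCoord_change hz hz' ζ).symm
  -- The identity `symbolInChart_change` is differentiated along `w + τ • a` with `ξ` fixed. On this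
  -- side the momentum moves as well, which produces the second derivative of the coordinate change.
  have hL : HasDerivAt (fun τ : ℝ => A.symbolInChart p'
      (w + τ • a, transposeApply ξ (fderiv ℝ μ (w + τ • a))))
      (inner ℝ (-A.force p' w ξ') a + inner ℝ (A.velocity p' w ξ')
        (transposeApply ξ (fderiv ℝ (fderiv ℝ μ) w a))) 0 := by
    have h1 := A.hasFDerivAt_symbolInChart hw.1 hw0 ξ'
    refine (h1.comp_hasDerivAt_of_eq (0 : ℝ) (hline.prodMk hd2) (by rw [hξ', hline0])).congr_deriv ?_
    rfl
  have hR : HasDerivAt (fun τ : ℝ => A.symbolInChart p (μ (w + τ • a), ξ))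
      (inner ℝ (-A.force p v ξ) (fderiv ℝ μ w a) + inner ℝ (A.velocity p v ξ) 0) 0 := by
    have h1 := A.hasFDerivAt_symbolInChart (coord_mem hz) ((A.x_pos_iff hz).1 hx) ξ
    have h3 : HasFDerivAt μ (fderiv ℝ μ w) (w + (0 : ℝ) • a) := by
      rw [hline0]; exact (hμ.differentiableAt (by simp)).hasFDerivAt
    have h6 : HasDerivAt (fun τ : ℝ => μ (w + τ • a)) (fderiv ℝ μ w a) 0 :=
      HasFDerivAt.comp_hasDerivAt (l := μ) (f := fun τ : ℝ => w + τ • a) (0 : ℝ) h3 hline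
    have h4 : HasDerivAt (fun τ : ℝ => (μ (w + τ • a), ξ)) (fderiv ℝ μ w a, 0) 0 :=
      h6.prodMk (hasDerivAt_const (0 : ℝ) ξ)
    have h5 := h1.comp_hasDerivAt_of_eq (0 : ℝ) h4 (by rw [hline0, hμw])
    refine h5.congr_deriv ?_
    rfl
  have heq : (fun τ : ℝ => A.symbolInChart p'
      (w + τ • a, transposeApply ξ (fderiv ℝ μ (w + τ • a)))) =ᶠ[𝓝 0]
      fun τ : ℝ => A.symbolInChart p (μ (w + τ • a), ξ) := by
    have hc : Tendsto (fun τ : ℝ => w + τ • a) (𝓝 0) (𝓝 w) := by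
      have := hline.continuousAt.tendsto
      rwa [hline0] at this
    have e1 := hc (transDom_nhds hw hw0)
    have e2 : ∀ᶠ τ : ℝ in 𝓝 0, 0 < (w + τ • a) 0 :=
      hc (isOpen_pos.mem_nhds hw0)
    filter_upwards [e1, e2] with τ h1 h2
    rw [← fderivWithin_chTrans h2]
    exact A.symbolInChart_change h1 h2 ξ
  have := hL.unique (hR.congr_of_eventuallyEq heq)
  rw [inner_neg_left, inner_neg_left, inner_zero_right, inner_transposeApply] at this
  linarith

-- The new momentum is the transposed Jacobian applied to the old one. Its derivative contains the
-- second derivative of the coordinate change in the direction of the velocity; by symmetry of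
-- second derivatives this is exactly the extra term of `force_change`.
variable {A} in
set_option maxHeartbeats 800000 in
theorem HamAt.change {γ : ℝ → CotBundle n X} {p p' : X} {s : Set ℝ} {t : ℝ}
    (h : A.HamAt γ p s t) (hp : (γ t).proj ∈ chartDom n p) (hp' : (γ t).proj ∈ chartDom n p')
    (hx : 0 < A.x (γ t).proj) (hc : ContinuousWithinAt (fun u => (γ u).proj) s t) :
    A.HamAt γ p' s t := by
  have hv := coord_mem_transDom hp hp'
  have hv0 := (A.x_pos_iff hp).1 hx
  have hw := coord_mem_transDom hp' hp
  have hw0 := (A.x_pos_iff hp').1 hx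
  have e1 : ∀ᶠ u in 𝓝[s] t, (γ u).proj ∈ chartDom n p := hc ((isOpen_chartDom p).mem_nhds hp)
  have e2 : ∀ᶠ u in 𝓝[s] t, (γ u).proj ∈ chartDom n p' := hc ((isOpen_chartDom p').mem_nhds hp')
  have hpos : HasDerivWithinAt (fun u => coord n p' (γ u).proj)
      (A.velocity p' (coord n p' (γ t).proj) (cotangentCoord p' (γ t).proj (γ t).2)) s t := by
    have h1 : HasFDerivAt (chTrans p p') (fderiv ℝ (chTrans p p') (coord n p (γ t).proj))
      (coord n p (γ t).proj) := ((contDiffAt_chTrans hv hv0).differentiableAt (by simp)).hasFDerivAt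
    have h2 := h1.comp_hasDerivWithinAt t h.pos
    rw [← fderivWithin_chTrans hv0, A.velocity_change hp hp'] at h2
    refine h2.congr_of_eventuallyEq ?_ (chTrans_coord hp).symm
    filter_upwards [e1] with u hu using (chTrans_coord hu).symm
  refine ⟨hpos, hasDerivWithinAt_iff_components.2 fun i => ?_⟩
  set a : EMod n := EuclideanSpace.single i 1
  have hcomp : ∀ b : EMod n, b i = inner ℝ b a := fun b => by
    simp [a, EuclideanSpace.inner_single_right]
  simp only [hcomp]
  have hμ : ContDiffAt ℝ ∞ (chTrans p' p) (coord n p' (γ t).proj) := contDiffAt_chTrans hw hw0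
  have h3 : HasFDerivAt (fderiv ℝ (chTrans p' p))
      (fderiv ℝ (fderiv ℝ (chTrans p' p)) (coord n p' (γ t).proj)) (coord n p' (γ t).proj) :=
    ((hμ.fderiv_right (m := 1) (by norm_cast)).differentiableAt (by simp)).hasFDerivAt
  have h4 := (h3.comp_hasDerivWithinAt t hpos).clm_apply (hasDerivWithinAt_const t s a)
  have h5 := h.mom.inner ℝ h4
  have hsymm : IsSymmSndFDerivAt ℝ (chTrans p' p) (coord n p' (γ t).proj) :=
    hμ.isSymmSndFDerivAt (by
      rw [minSmoothness_of_isRCLikeNormedField]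
      exact WithTop.coe_le_coe.2 (le_top : (2 : ℕ∞) ≤ ⊤))
  rw [A.force_change hp hp' hx, hsymm.eq]
  have heq : ∀ u, (γ u).proj ∈ chartDom n p → (γ u).proj ∈ chartDom n p' →
      0 < A.x (γ u).proj → inner ℝ (cotangentCoord p' (γ u).proj (γ u).2) a =
      inner ℝ (cotangentCoord p (γ u).proj (γ u).2)
        (fderiv ℝ (chTrans p' p) (coord n p' (γ u).proj) a) := by
    intro u h1 h2 h6
    rw [← fderivWithin_chTrans ((A.x_pos_iff h2).1 h6), inner_cotangentCoord_change h1 h2]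
  have e3 : ∀ᶠ u in 𝓝[s] t, 0 < A.x (γ u).proj :=
    (A.x_smooth.continuous.continuousAt.comp_continuousWithinAt hc).eventually_const_lt hx
  refine (h5.congr_of_eventuallyEq ?_ (heq t hp hp' hx)).congr_deriv ?_
  · filter_upwards [e1, e2, e3] with u h1 h2 h6 using heq u h1 h2 h6
  · simp
    ring

end AHMetric

/-! ### Uniform estimates in a half-ball, and the rescaled vector field. -/

section Compactness

variable {E F : Type*} [NormedAddCommGroup E] [NormedSpace ℝ E] [NormedAddCommGroup F]
  [NormedSpace ℝ F]

/-- A function that is `C^1` on a set is bounded and Lipschitz on compact convex subsets. -/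
theorem exists_bound_lipschitz {f : E → F} {D C : Set E} (hf : ContDiffOn ℝ 1 f D)
    (hD : UniqueDiffOn ℝ D) (hC : IsCompact C) (hconv : Convex ℝ C) (hCD : C ⊆ D) :
    ∃ M > 0, (∀ x ∈ C, ‖f x‖ ≤ M) ∧ ∀ x ∈ C, ∀ y ∈ C, ‖f x - f y‖ ≤ M * ‖x - y‖ := by
  obtain ⟨M₁, h1⟩ := hC.exists_bound_of_continuousOn (hf.continuousOn.mono hCD)
  obtain ⟨M₂, h2⟩ := hC.exists_bound_of_continuousOn
    ((hf.continuousOn_fderivWithin hD (by simp)).mono hCD)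
  refine ⟨max (max M₁ M₂) 1, by positivity, fun x hx => (h1 x hx).trans (by simp), ?_⟩
  intro x hx y hy
  refine hconv.norm_image_sub_le_of_norm_hasFDerivWithin_le (f' := fderivWithin ℝ f D)
    (fun z hz => ((hf.differentiableOn (by simp)) z (hCD hz)).hasFDerivWithinAt.mono hCD)
    (fun z hz => (h2 z hz).trans (by simp)) hy hx

end Compactness

namespace AHMetric

variable {n : ℕ} {X : Type*} [TopologicalSpace X] [ChartedSpace (EuclideanHalfSpace (n + 1)) X]
  [IsManifold (halfModel n) ∞ X] (A : AHMetric n X)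

/-- `⟨dx, α⟩_ḡ` in the chart centred at `p`. -/
def slope (p : X) (v α : EMod n) : ℝ := inner ℝ (A.gradX p v) (A.raise p v α)

/-- The momentum component of the Hamilton vector field for the rescaled momentum `α = x ζ`. -/
def scaledForce (p : X) (v α : EMod n) : EMod n :=
  (2 * A.slope p v α) • α - (2 * A.quad p v α) • A.gradX p v - A.xc p v • A.gradQuad p v α

/-- The vector field governing `(V, α, ρ)`, where `v = v' + x' V` and `ρ = x / x'`, as a function
of `(v, α, ρ)`. -/
def scaledField (p : X) (u : EMod n × EMod n × ℝ) : EMod n × EMod n × ℝ :=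
  ((2 * u.2.2) • A.raise p u.1 u.2.1, A.scaledForce p u.1 u.2.1, 2 * A.slope p u.1 u.2.1 * u.2.2)

theorem contDiffOn_slope (p : X) :
    ContDiffOn ℝ ∞ (fun u : EMod n × EMod n => A.slope p u.1 u.2) (chartTgt n p ×ˢ univ) :=
  ((A.contDiffOn_gradX p).comp contDiffOn_fst fun _ hu => hu.1).inner ℝ (A.contDiffOn_raise_apply p)

theorem contDiffOn_scaledForce (p : X) :
    ContDiffOn ℝ ∞ (fun u : EMod n × EMod n => A.scaledForce p u.1 u.2) (chartTgt n p ×ˢ univ) := by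
  have h1 := (A.contDiffOn_gradX p).comp (contDiffOn_fst (F := EMod n))
    fun (u : EMod n × EMod n) (hu : u ∈ chartTgt n p ×ˢ univ) => hu.1
  have h2 := (A.contDiffOn_xc p).comp (contDiffOn_fst (F := EMod n))
    fun (u : EMod n × EMod n) (hu : u ∈ chartTgt n p ×ˢ univ) => hu.1
  exact (((contDiffOn_const.mul (A.contDiffOn_slope p)).smul contDiffOn_snd).sub
    ((contDiffOn_const.mul (A.contDiffOn_quad p)).smul h1)).sub (h2.smul (A.contDiffOn_gradQuad p))

theorem contDiffOn_scaledField (p : X) :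
    ContDiffOn ℝ ∞ (A.scaledField p) (chartTgt n p ×ˢ univ) := by
  have h0 : ContDiffOn ℝ ∞ (fun u : EMod n × EMod n × ℝ => (u.1, u.2.1)) (chartTgt n p ×ˢ univ) :=
    contDiffOn_fst.prodMk (contDiff_snd.fst.contDiffOn)
  have h3 : ContDiffOn ℝ ∞ (fun u : EMod n × EMod n × ℝ => u.2.2) (chartTgt n p ×ˢ univ) :=
    contDiff_snd.snd.contDiffOn
  have hm : MapsTo (fun u : EMod n × EMod n × ℝ => (u.1, u.2.1)) (chartTgt n p ×ˢ univ)
    (chartTgt n p ×ˢ univ) := fun u hu => ⟨hu.1, mem_univ _⟩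
  exact ((contDiffOn_const.mul h3).smul ((A.contDiffOn_raise_apply p).comp h0 hm)).prodMk
    (((A.contDiffOn_scaledForce p).comp h0 hm).prodMk
      ((contDiffOn_const.mul ((A.contDiffOn_slope p).comp h0 hm)).mul h3))

/-- The intersection of the half-space with a closed ball around the centre of the chart. -/
def halfBall (p : X) (δ : ℝ) : Set (EMod n) := Metric.closedBall (coord n p p) δ ∩ halfSpace n

theorem isCompact_halfBall (p : X) (δ : ℝ) : IsCompact (halfBall (n := n) p δ) :=
  (isCompact_closedBall _ _).inter_right isClosed_halfSpace

theorem convex_halfBall (p : X) (δ : ℝ) : Convex ℝ (halfBall (n := n) p δ) :=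
  (convex_closedBall _ _).inter convex_halfSpace

theorem exists_halfBall_subset (p : X) : ∃ δ > 0, halfBall (n := n) p δ ⊆ chartTgt n p := by
  obtain ⟨O, hO, h⟩ := exists_isOpen_chartTgt (n := n) p
  have hp : coord n p p ∈ O := by
    have := coord_mem (n := n) (mem_chartDom_self p); rw [h] at this; exact this.1
  obtain ⟨δ, hδ, hb⟩ := Metric.nhds_basis_closedBall.mem_iff.1 (hO.mem_nhds hp)
  exact ⟨δ, hδ, by rw [h]; exact inter_subset_inter_left _ hb⟩

/-- As `x` is Lipschitz and vanishes together with the coordinate `0`, it is at most a multiple of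
that coordinate. Hence a displacement of size `x` times a small constant cannot leave the
half-space. -/
theorem exists_xc_le (p : X) : ∃ δ > 0, ∃ C > 0, halfBall (n := n) p δ ⊆ chartTgt n p ∧
    ∀ v ∈ halfBall (n := n) p δ, A.xc p v ≤ C * v 0 := by
  obtain ⟨δ, hδ, hsub⟩ := exists_halfBall_subset (n := n) p
  obtain ⟨M, hM, hb, hl⟩ := exists_bound_lipschitz ((A.contDiffOn_xc p).of_le (by norm_cast))
    (uniqueDiffOn_chartTgt p) (isCompact_halfBall p δ) (convex_halfBall p δ) hsub
  have he0 : 0 ≤ coord n p p 0 := chartTgt_subset p (coord_mem (mem_chartDom_self p))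
  have hcomp : ∀ v : EMod n, |v 0 - coord n p p 0| ≤ ‖v - coord n p p‖ := fun v =>
    PiLp.norm_apply_le (v - coord n p p) 0
  have hmono : ∀ δ' ≤ δ, halfBall (n := n) p δ' ⊆ halfBall p δ := fun δ' h =>
    inter_subset_inter_left _ (Metric.closedBall_subset_closedBall h)
  rcases he0.lt_or_eq with hpos | hzero
  · refine ⟨min δ (coord n p p 0 / 2), by positivity, 2 * M / coord n p p 0, by positivity,
      (hmono _ (min_le_left _ _)).trans hsub, fun v hv => ?_⟩
    have h1 : ‖v - coord n p p‖ ≤ coord n p p 0 / 2 := by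
      have := hv.1; rw [mem_closedBall_iff_norm] at this; exact this.trans (min_le_right _ _)
    have h2 : coord n p p 0 / 2 ≤ v 0 := by
      have := (abs_le.1 ((hcomp v).trans h1)).1; linarith
    have h3 : A.xc p v ≤ M := (le_abs_self _).trans (hb v (hmono _ (min_le_left _ _) hv))
    rw [div_mul_eq_mul_div, le_div_iff₀ hpos]
    nlinarith [A.xc_nonneg p v]
  · refine ⟨δ / 2, by positivity, M, hM, (hmono _ (by linarith)).trans hsub, fun v hv => ?_⟩
    have h1 : ‖v - coord n p p‖ ≤ δ / 2 := by
      have := hv.1; rwa [mem_closedBall_iff_norm] at this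
    have hv0 : 0 ≤ v 0 := hv.2
    -- `v₁` is the orthogonal projection of `v` to the boundary hyperplane, where `x = 0`. The
    -- radius `δ / 2` for `v` keeps `v₁` in the half-ball of radius `δ`.
    set v₁ : EMod n := v - EuclideanSpace.single 0 (v 0)
    have hd : ‖v - v₁‖ = v 0 := by
      simp [v₁, abs_of_nonneg hv0]
    have hv1 : v₁ ∈ halfBall p δ := by
      refine ⟨?_, by simp [v₁, halfSpace]⟩
      rw [mem_closedBall_iff_norm]
      have h2 : v 0 ≤ δ / 2 := by
        have := (abs_le.1 ((hcomp v).trans h1)).2; linarith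
      have h3 : ‖v₁ - coord n p p‖ ≤ ‖v - coord n p p‖ + ‖v₁ - v‖ := by
        have := norm_add_le (v - coord n p p) (v₁ - v)
        simpa using this
      rw [norm_sub_rev v₁ v, hd] at h3
      linarith
    have h4 := hl v (hmono _ (by linarith) hv) v₁ hv1
    rw [hd] at h4
    have h5 : A.xc p v₁ = 0 := (A.xc_eq_zero_iff (hsub hv1)).2 (by simp [v₁])
    rw [h5, sub_zero] at h4
    exact (le_abs_self _).trans h4

/-- Take the minimum of the positive form over the compact Euclidean unit sphere and extend by
homogeneity. -/
theorem exists_quad_ge (p : X) {δ : ℝ} (hδ : halfBall (n := n) p δ ⊆ chartTgt n p) :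
    ∃ c > 0, ∀ v ∈ halfBall (n := n) p δ, ∀ a, c * ‖a‖ ^ 2 ≤ A.quad p v a := by
  have hK : IsCompact (halfBall (n := n) p δ ×ˢ Metric.sphere (0 : EMod n) 1) :=
    (isCompact_halfBall p δ).prod (isCompact_sphere _ _)
  have hc : ContinuousOn (fun u : EMod n × EMod n => A.quad p u.1 u.2)
      (halfBall (n := n) p δ ×ˢ Metric.sphere (0 : EMod n) 1) :=
    (A.contDiffOn_quad p).continuousOn.mono (prod_mono hδ (subset_univ _))
  obtain ⟨c, hc0, hc1⟩ : ∃ c > 0, ∀ u ∈ halfBall (n := n) p δ ×ˢ Metric.sphere (0 : EMod n) 1,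
      c ≤ A.quad p u.1 u.2 := by
    rcases (halfBall (n := n) p δ ×ˢ Metric.sphere (0 : EMod n) 1).eq_empty_or_nonempty with h | h
    · exact ⟨1, one_pos, by simp [h]⟩
    · obtain ⟨u, hu, hm⟩ := hK.exists_isMinOn h hc
      refine ⟨A.quad p u.1 u.2, A.quad_pos (hδ hu.1) ?_, fun w hw => hm hw⟩
      intro h0
      have := hu.2
      rw [h0, mem_sphere_zero_iff_norm, norm_zero] at this
      norm_num at this
  refine ⟨c, hc0, fun v hv a => ?_⟩
  rcases eq_or_ne a 0 with rfl | ha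
  · simp [quad]
  · have hna : 0 < ‖a‖ := norm_pos_iff.2 ha
    have h1 := hc1 (v, ‖a‖⁻¹ • a) ⟨hv, by
      rw [mem_sphere_zero_iff_norm, norm_smul, norm_inv, norm_norm, inv_mul_cancel₀ hna.ne']⟩
    rw [quad_smul] at h1
    have h2 : ‖a‖ ^ 2 * c ≤ ‖a‖ ^ 2 * (‖a‖⁻¹ ^ 2 * A.quad p v a) := by gcongr
    have h3 : ‖a‖ ^ 2 * (‖a‖⁻¹ ^ 2 * A.quad p v a) = A.quad p v a := by
      field_simp
    linarith

end AHMetric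

/-! ### Existence of the rescaled local flow up to the boundary. -/

namespace AHMetric

variable {n : ℕ} {X : Type*} [TopologicalSpace X] [ChartedSpace (EuclideanHalfSpace (n + 1)) X]
  [IsManifold (halfModel n) ∞ X] (A : AHMetric n X)

/-- Parameters `(r, v', a)`: a time scale, an initial position and an initial momentum. -/
def flowDom (p : X) (ε δ R : ℝ) : Set (ℝ × EMod n × EMod n) :=
  Ioo (-ε) ε ×ˢ ((Metric.ball (coord n p p) δ ∩ halfSpace n) ×ˢ Metric.ball 0 R)

/-- Rescaling of the three components of the vector field. -/
def scaleField (κ r : ℝ) (u : EMod n × EMod n × ℝ) : EMod n × EMod n × ℝ :=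
  (κ • u.1, r • u.2.1, r * u.2.2)

theorem norm_scaleField_le {κ r : ℝ} (h : |r| ≤ |κ|) (u : EMod n × EMod n × ℝ) :
    ‖scaleField κ r u‖ ≤ |κ| * ‖u‖ := by
  have h1 : ‖u.1‖ ≤ ‖u‖ := norm_fst_le u
  have h2 : ‖u.2.1‖ ≤ ‖u‖ := (norm_fst_le u.2).trans (norm_snd_le u)
  have h3 : ‖u.2.2‖ ≤ ‖u‖ := (norm_snd_le u.2).trans (norm_snd_le u)
  change max ‖κ • u.1‖ (max ‖r • u.2.1‖ ‖r * u.2.2‖) ≤ _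
  rw [norm_smul, norm_smul, norm_mul, Real.norm_eq_abs κ, Real.norm_eq_abs r]
  refine max_le ?_ (max_le ?_ ?_)
  · exact mul_le_mul_of_nonneg_left h1 (abs_nonneg _)
  · exact mul_le_mul h h2 (norm_nonneg _) (abs_nonneg _)
  · exact mul_le_mul h h3 (norm_nonneg _) (abs_nonneg _)

theorem scaleField_sub (κ r : ℝ) (u w : EMod n × EMod n × ℝ) :
    scaleField κ r u - scaleField κ r w = scaleField κ r (u - w) := by
  simp [scaleField, smul_sub, mul_sub]

/-- A smooth family of solutions, on the unit time interval, of the rescaled Hamilton equations in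
the chart centred at `p`. -/
structure LocalFlow (p : X) where
  ε : ℝ
  δ : ℝ
  δ' : ℝ
  R : ℝ
  M : ℝ
  sol : ℝ × EMod n × EMod n → ℝ → EMod n × EMod n × ℝ
  ε_pos : 0 < ε
  ε_le : ε ≤ 1
  δ_pos : 0 < δ
  δ_le : δ ≤ δ'
  R_pos : 0 < R
  sub : halfBall p δ' ⊆ chartTgt n p
  lip : ∀ u ∈ halfBall p δ' ×ˢ Metric.closedBall (0 : EMod n) (R + 1) ×ˢ Icc (0 : ℝ) 2,
    ∀ w ∈ halfBall p δ' ×ˢ Metric.closedBall (0 : EMod n) (R + 1) ×ˢ Icc (0 : ℝ) 2,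
    ‖A.scaledField p u - A.scaledField p w‖ ≤ M * ‖u - w‖
  unit_lt : ∀ v ∈ halfBall p δ', ∀ a, A.quad p v a = 1 → ‖a‖ < R
  mem : ∀ l ∈ flowDom p ε δ R, ∀ s ∈ Icc (0 : ℝ) 1,
    l.2.1 + (A.xc p l.2.1 * l.1) • (sol l s).1 ∈ halfBall p δ'
  mom_le : ∀ l ∈ flowDom p ε δ R, ∀ s ∈ Icc (0 : ℝ) 1, ‖(sol l s).2.1‖ ≤ R + 1
  ρ_mem : ∀ l ∈ flowDom p ε δ R, ∀ s ∈ Icc (0 : ℝ) 1, (sol l s).2.2 ∈ Ioo (0 : ℝ) 2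
  init : ∀ l ∈ flowDom p ε δ R, sol l 0 = (0, l.2.2, 1)
  ode : ∀ l ∈ flowDom p ε δ R, ∀ s ∈ Icc (0 : ℝ) 1,
    HasDerivWithinAt (sol l) (scaleField 1 l.1 (A.scaledField p
      (l.2.1 + (A.xc p l.2.1 * l.1) • (sol l s).1, (sol l s).2.1, (sol l s).2.2))) (Icc 0 1) s
  smooth : ∀ s ∈ Icc (0 : ℝ) 1, ContDiffOn ℝ ∞ (fun l => sol l s) (flowDom p ε δ R)

theorem convex_flowDom (p : X) (ε δ R : ℝ) : Convex ℝ (flowDom (n := n) p ε δ R) :=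
  (convex_Ioo _ _).prod (((convex_ball _ _).inter convex_halfSpace).prod (convex_ball _ _))

theorem uniqueDiffOn_ball_inter_halfSpace (c : EMod n) (δ : ℝ) :
    UniqueDiffOn ℝ (Metric.ball c δ ∩ halfSpace n) := by
  rw [inter_comm]
  exact uniqueDiffOn_halfSpace.inter Metric.isOpen_ball

theorem uniqueDiffOn_flowDom (p : X) (ε δ R : ℝ) : UniqueDiffOn ℝ (flowDom (n := n) p ε δ R) :=
  (isOpen_Ioo.uniqueDiffOn).prod ((uniqueDiffOn_ball_inter_halfSpace _ _).prod
    Metric.isOpen_ball.uniqueDiffOn)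

/-- The position unknown `V` is the displacement divided by both `x'` and the time scale `r`, so it
has a non-zero limit as `r → 0`; its equation carries no factor `r`, whereas those of `α` and `ρ`
do. For a contraction on the unit interval one solves for `(κ V, α - a, ρ - 1)` in the unit ball,
with `κ` small; `G` recovers the arguments of the field. -/
theorem exists_localFlow (p : X) : Nonempty (A.LocalFlow p) := by
  obtain ⟨δ, hδ, C, hC, hsub, hxC⟩ := A.exists_xc_le p
  obtain ⟨c, hc, hquad⟩ := A.exists_quad_ge p hsub
  -- Unit covectors satisfy `c ‖a‖² ≤ 1`, while `c R² = c⁻¹ + 2 + c > 1`.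
  set R : ℝ := c⁻¹ + 1 with hR
  have hRp : 0 < R := by positivity
  set K : Set (EMod n × EMod n × ℝ) :=
    halfBall p δ ×ˢ Metric.closedBall (0 : EMod n) (R + 1) ×ˢ Icc (0 : ℝ) 2 with hK
  have hKc : IsCompact K :=
    (isCompact_halfBall p δ).prod ((isCompact_closedBall _ _).prod isCompact_Icc)
  have hKconv : Convex ℝ K :=
    (convex_halfBall p δ).prod ((convex_closedBall _ _).prod (convex_Icc _ _))
  have hKsub : K ⊆ chartTgt n p ×ˢ univ := prod_mono hsub (subset_univ _)
  obtain ⟨M, hM, hMb, hMl⟩ := exists_bound_lipschitz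
    ((A.contDiffOn_scaledField p).of_le (by norm_cast))
    ((uniqueDiffOn_chartTgt p).prod uniqueDiffOn_univ) hKc hKconv hKsub
  -- This makes the rescaled field bounded by `1/2` and Lipschitz with constant `1/2`.
  set κ : ℝ := (2 * M)⁻¹ with hκ
  have hκp : 0 < κ := by positivity
  have hκM : κ * M = 2⁻¹ := by rw [hκ]; field_simp
  set X₀ : ℝ := C * (‖coord n p p‖ + δ) with hX0
  have hX0p : 0 < X₀ := by positivity
  have hxX : ∀ v ∈ halfBall (n := n) p δ, A.xc p v ≤ X₀ := by
    intro v hv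
    refine (hxC v hv).trans (mul_le_mul_of_nonneg_left ?_ hC.le)
    have h1 : v 0 ≤ ‖v‖ := (le_abs_self _).trans (PiLp.norm_apply_le v 0)
    have h2 := hv.1
    rw [mem_closedBall_iff_norm] at h2
    have h3 := norm_add_le (coord n p p) (v - coord n p p)
    rw [add_sub_cancel] at h3
    linarith
  -- The bounds on `m` serve, in this order, to have `|r| ≤ κ`, to make `G` nonexpansive in the
  -- unknowns, to keep the position in the ball of radius `δ`, to keep it in the half-space, and to
  -- have `ε ≤ 1`.
  obtain ⟨m, hm, hm1, hm2, hm3, hm4, hm5⟩ : ∃ m > 0, m ≤ 1 ∧ X₀ * m ≤ 1 ∧ X₀ * m ≤ δ / 2 ∧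
      C * m ≤ 1 ∧ κ * m ≤ 1 := by
    refine ⟨min (min 1 X₀⁻¹) (min (min (δ / 2 / X₀) C⁻¹) κ⁻¹), by positivity, ?_, ?_, ?_, ?_, ?_⟩
    · exact (min_le_left _ _).trans (min_le_left _ _)
    · calc _ ≤ X₀ * X₀⁻¹ := mul_le_mul_of_nonneg_left
            ((min_le_left _ _).trans (min_le_right _ _)) hX0p.le
        _ = 1 := mul_inv_cancel₀ hX0p.ne'
    · calc _ ≤ X₀ * (δ / 2 / X₀) := mul_le_mul_of_nonneg_left
            ((min_le_right _ _).trans ((min_le_left _ _).trans (min_le_left _ _))) hX0p.le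
        _ = δ / 2 := by field_simp
    · calc _ ≤ C * C⁻¹ := mul_le_mul_of_nonneg_left
            ((min_le_right _ _).trans ((min_le_left _ _).trans (min_le_right _ _))) hC.le
        _ = 1 := mul_inv_cancel₀ hC.ne'
    · calc _ ≤ κ * κ⁻¹ := mul_le_mul_of_nonneg_left
            ((min_le_right _ _).trans (min_le_right _ _)) hκp.le
        _ = 1 := mul_inv_cancel₀ hκp.ne'
  set ε : ℝ := κ * m with hε
  have hεp : 0 < ε := by positivity
  set D := flowDom (n := n) p ε (δ / 2) R with hD
  have hballsub : Metric.ball (coord n p p) (δ / 2) ∩ halfSpace n ⊆ halfBall p δ :=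
    inter_subset_inter_left _ (Metric.ball_subset_closedBall.trans
      (Metric.closedBall_subset_closedBall (by linarith)))
  let G : (ℝ × EMod n × EMod n) × (EMod n × EMod n × ℝ) → EMod n × EMod n × ℝ := fun q =>
    (q.1.2.1 + (A.xc p q.1.2.1 * q.1.1) • (κ⁻¹ • q.2.1), q.1.2.2 + q.2.2.1, 1 + q.2.2.2)
  have hrm : ∀ l ∈ D, |l.1| ≤ κ * m := fun l hl => (abs_lt.2 hl.1).le
  have hrκ : ∀ l ∈ D, |l.1| ≤ |κ| := fun l hl => by
    rw [abs_of_pos hκp]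
    exact (hrm l hl).trans (by nlinarith)
  have hcoef : ∀ l ∈ D, |A.xc p l.2.1 * l.1 * κ⁻¹| ≤ A.xc p l.2.1 * m := by
    intro l hl
    rw [abs_mul, abs_mul, abs_of_nonneg (A.xc_nonneg p _), abs_of_pos (inv_pos.2 hκp), mul_assoc]
    refine mul_le_mul_of_nonneg_left ?_ (A.xc_nonneg p _)
    rw [← div_eq_mul_inv, div_le_iff₀ hκp]
    linarith [hrm l hl, mul_comm κ m]
  have hGmem : ∀ l ∈ D, ∀ Z ∈ Metric.ball (0 : EMod n × EMod n × ℝ) 1, G (l, Z) ∈ K := by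
    intro l hl Z hZ
    rw [mem_ball_zero_iff] at hZ
    have hZ1 : ‖Z.1‖ < 1 := (norm_fst_le Z).trans_lt hZ
    have hZ2 : ‖Z.2.1‖ < 1 := ((norm_fst_le Z.2).trans (norm_snd_le Z)).trans_lt hZ
    have hZ3 : ‖Z.2.2‖ < 1 := ((norm_snd_le Z.2).trans (norm_snd_le Z)).trans_lt hZ
    have hv := hballsub hl.2.1
    have hx0 := A.xc_nonneg p l.2.1
    have hinc : ‖(A.xc p l.2.1 * l.1) • (κ⁻¹ • Z.1)‖ ≤ A.xc p l.2.1 * m := by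
      rw [smul_smul, norm_smul, Real.norm_eq_abs]
      calc _ ≤ A.xc p l.2.1 * m * 1 := mul_le_mul (hcoef l hl) hZ1.le (norm_nonneg _) (by positivity)
        _ = _ := mul_one _
    refine ⟨⟨?_, ?_⟩, ?_, ?_⟩
    · have h1 : ‖l.2.1 - coord n p p‖ < δ / 2 := mem_ball_iff_norm.1 hl.2.1.1
      have h2 : A.xc p l.2.1 * m ≤ δ / 2 :=
        (mul_le_mul_of_nonneg_right (hxX _ hv) hm.le).trans hm3
      rw [mem_closedBall_iff_norm]
      simp only [G]
      rw [add_sub_right_comm]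
      exact (norm_add_le _ _).trans (by linarith)
    · have h1 : |((A.xc p l.2.1 * l.1) • (κ⁻¹ • Z.1)) 0| ≤ A.xc p l.2.1 * m :=
        (PiLp.norm_apply_le ((A.xc p l.2.1 * l.1) • (κ⁻¹ • Z.1)) 0).trans hinc
      -- The displacement is at most `x' m`, and `x' ≤ C l.2.1 0` with `C m ≤ 1`, so the coordinate
      -- `0` stays nonnegative.
      have h2 : A.xc p l.2.1 * m ≤ l.2.1 0 := by
        calc _ ≤ C * l.2.1 0 * m := mul_le_mul_of_nonneg_right (hxC _ hv) hm.le
          _ = (C * m) * l.2.1 0 := by ring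
          _ ≤ 1 * l.2.1 0 := mul_le_mul_of_nonneg_right hm4 hv.2
          _ = _ := one_mul _
      change 0 ≤ (l.2.1 + (A.xc p l.2.1 * l.1) • (κ⁻¹ • Z.1)) 0
      rw [PiLp.add_apply]
      linarith [(abs_le.1 h1).1]
    · rw [mem_closedBall_zero_iff]
      have h1 : ‖l.2.2‖ < R := mem_ball_zero_iff.1 hl.2.2
      exact (norm_add_le _ _).trans (by linarith)
    · rw [Real.norm_eq_abs, abs_lt] at hZ3
      exact ⟨by linarith [hZ3.1], by linarith [hZ3.2]⟩
  have hGlip : ∀ l ∈ D, ∀ Z Z' : EMod n × EMod n × ℝ, ‖G (l, Z) - G (l, Z')‖ ≤ ‖Z - Z'‖ := by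
    intro l hl Z Z'
    have h0 : G (l, Z) - G (l, Z') =
        ((A.xc p l.2.1 * l.1 * κ⁻¹) • (Z.1 - Z'.1), Z.2.1 - Z'.2.1, Z.2.2 - Z'.2.2) := by
      simp only [G, Prod.mk_sub_mk, add_sub_add_left_eq_sub, smul_smul, smul_sub]
    have h1 : ‖Z.1 - Z'.1‖ ≤ ‖Z - Z'‖ := norm_fst_le (Z - Z')
    have h2 : ‖Z.2 - Z'.2‖ ≤ ‖Z - Z'‖ := norm_snd_le (Z - Z')
    rw [h0, Prod.norm_def]
    refine max_le ?_ h2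
    rw [norm_smul, Real.norm_eq_abs]
    have h3 : A.xc p l.2.1 * m ≤ 1 :=
      (mul_le_mul_of_nonneg_right (hxX _ (hballsub hl.2.1)) hm.le).trans hm2
    calc _ ≤ 1 * ‖Z - Z'‖ := mul_le_mul ((hcoef l hl).trans h3) h1 (norm_nonneg _) zero_le_one
      _ = _ := one_mul _
  have hGs : ContDiffOn ℝ ∞ G (D ×ˢ Metric.ball 0 1) := by
    have hx : ContDiffOn ℝ ∞ (fun q : (ℝ × EMod n × EMod n) × (EMod n × EMod n × ℝ) =>
        A.xc p q.1.2.1) (D ×ˢ Metric.ball 0 1) :=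
      (A.contDiffOn_xc p).comp (contDiff_fst.snd.fst.contDiffOn)
        fun q hq => hsub (hballsub hq.1.2.1)
    refine ContDiffOn.prodMk ?_ (ContDiff.contDiffOn (by fun_prop))
    exact (ContDiff.contDiffOn (by fun_prop)).add ((hx.mul (ContDiff.contDiffOn (by fun_prop))).smul
      (ContDiff.contDiffOn (by fun_prop)))
  let F : (ℝ × EMod n × EMod n) × (EMod n × EMod n × ℝ) → EMod n × EMod n × ℝ := fun q =>
    scaleField κ q.1.1 (A.scaledField p (G q))
  have hFs : ContDiffOn ℝ ∞ F (D ×ˢ Metric.ball 0 1) := by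
    have h1 : ContDiffOn ℝ ∞ (fun q => A.scaledField p (G q)) (D ×ˢ Metric.ball 0 1) :=
      (A.contDiffOn_scaledField p).comp hGs fun q hq => hKsub (hGmem q.1 hq.1 q.2 hq.2)
    have hr : ContDiffOn ℝ ∞ (fun q : (ℝ × EMod n × EMod n) × (EMod n × EMod n × ℝ) => q.1.1)
      (D ×ˢ Metric.ball 0 1) := ContDiff.contDiffOn (by fun_prop)
    exact ((contDiffOn_const (c := κ)).smul h1.fst).prodMk ((hr.smul h1.snd.fst).prodMk (hr.mul h1.snd.snd))
  obtain ⟨y, hy, hys⟩ := exists_smooth_flow (convex_flowDom p ε (δ / 2) R)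
    (uniqueDiffOn_flowDom p ε (δ / 2) R) one_pos hFs
    (fun l hl Z hZ => by
      refine (norm_scaleField_le (hrκ l hl) _).trans ?_
      rw [abs_of_pos hκp]
      calc _ ≤ κ * M := mul_le_mul_of_nonneg_left (hMb _ (hGmem l hl Z hZ)) hκp.le
        _ = 1 / 2 := by rw [hκM]; norm_num)
    (fun l hl Z hZ Z' hZ' => by
      simp only [F, scaleField_sub]
      refine (norm_scaleField_le (hrκ l hl) _).trans ?_
      rw [abs_of_pos hκp]
      calc _ ≤ κ * (M * ‖G (l, Z) - G (l, Z')‖) :=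
            mul_le_mul_of_nonneg_left (hMl _ (hGmem l hl Z hZ) _ (hGmem l hl Z' hZ')) hκp.le
        _ = 2⁻¹ * ‖G (l, Z) - G (l, Z')‖ := by rw [← mul_assoc, hκM]
        _ ≤ _ := mul_le_mul_of_nonneg_left (hGlip l hl Z Z') (by norm_num))
  have hmemK := fun l (hl : l ∈ D) s (hs : s ∈ Icc (0 : ℝ) 1) => hGmem l hl _ ((hy l hl).2 s hs).1
  exact ⟨{
    ε := ε, δ := δ / 2, δ' := δ, R := R, M := M
    sol := fun l s => (κ⁻¹ • (y l s).1, l.2.2 + (y l s).2.1, 1 + (y l s).2.2)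
    ε_pos := hεp
    ε_le := hm5
    δ_pos := by positivity
    δ_le := by linarith
    R_pos := hRp
    sub := hsub
    lip := hMl
    unit_lt := fun v hv a ha => by
      have h1 := hquad v hv a
      rw [ha] at h1
      by_contra! h2
      have h3 : c * R ^ 2 ≤ 1 := (mul_le_mul_of_nonneg_left (pow_le_pow_left₀ hRp.le h2 2)
        hc.le).trans h1
      have h4 : c * R ^ 2 = c⁻¹ + 2 + c := by rw [hR]; field_simp; ring
      have h5 := inv_pos.2 hc
      linarith
    mem := fun l hl s hs => (hmemK l hl s hs).1
    mom_le := fun l hl s hs => mem_closedBall_zero_iff.1 (hmemK l hl s hs).2.1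
    ρ_mem := fun l hl s hs => by
      have h1 := mem_ball_zero_iff.1 ((hy l hl).2 s hs).1
      have h2 : ‖(y l s).2.2‖ < 1 := ((norm_snd_le (y l s).2).trans (norm_snd_le _)).trans_lt h1
      rw [Real.norm_eq_abs, abs_lt] at h2
      exact ⟨by linarith [h2.1], by linarith [h2.2]⟩
    init := fun l hl => by simp [(hy l hl).1]
    ode := fun l hl s hs => by
      have h := ((hy l hl).2 s hs).2
      have hf := (hasFDerivAt_fst.comp_hasDerivWithinAt s h).const_smul κ⁻¹
      have hg := ((hasFDerivAt_fst.comp_hasDerivWithinAt s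
        (hasFDerivAt_snd.comp_hasDerivWithinAt s h))).const_add l.2.2
      have hh := ((hasFDerivAt_snd.comp_hasDerivWithinAt s
        (hasFDerivAt_snd.comp_hasDerivWithinAt s h))).const_add 1
      refine (hf.prodMk (hg.prodMk hh)).congr_deriv ?_
      simp only [F, scaleField, ContinuousLinearMap.coe_fst', ContinuousLinearMap.coe_snd', G,
        smul_smul, inv_mul_cancel₀ hκp.ne', one_smul]
    smooth := fun s hs => by
      have h := hys s hs
      exact ((contDiffOn_const (c := κ⁻¹)).smul h.fst).prodMk
        (((contDiff_snd.snd.contDiffOn).add h.snd.fst).prodMk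
          ((contDiffOn_const (c := (1 : ℝ))).add h.snd.snd)) }⟩

end AHMetric

/-! ### Conservation laws and homogeneity of the rescaled flow. -/

namespace AHMetric

variable {n : ℕ} {X : Type*} [TopologicalSpace X] [ChartedSpace (EuclideanHalfSpace (n + 1)) X]
  [IsManifold (halfModel n) ∞ X] (A : AHMetric n X)

theorem gradQuad_smul (p : X) (v ξ : EMod n) (c : ℝ) :
    A.gradQuad p v (c • ξ) = c ^ 2 • A.gradQuad p v ξ := by
  refine ext_inner_right ℝ fun a => ?_
  simp only [inner_gradQuad, map_smul, inner_smul_left, inner_smul_right, conj_trivial]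
  ring

theorem slope_smul (p : X) (v α : EMod n) (c : ℝ) : A.slope p v (c • α) = c * A.slope p v α := by
  simp [slope, inner_smul_right]

theorem scaledForce_smul (p : X) (v α : EMod n) (c : ℝ) :
    A.scaledForce p v (c • α) = c ^ 2 • A.scaledForce p v α := by
  simp only [scaledForce, slope_smul, quad_smul, gradQuad_smul, smul_sub, smul_smul]
  module

theorem hasDerivWithinAt_xc {p : X} {w : ℝ → EMod n} {w' : EMod n} {S : Set ℝ} {s : ℝ}
    (hw : HasDerivWithinAt w w' S s) (hm : MapsTo w S (chartTgt n p)) (hs : s ∈ S) :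
    HasDerivWithinAt (fun u => A.xc p (w u)) (inner ℝ (A.gradX p (w s)) w') S s := by
  have h := ((((A.contDiffOn_xc p).differentiableOn (by simp)) (w s)
    (hm hs)).hasFDerivWithinAt).comp_hasDerivWithinAt s hw hm
  rwa [← inner_gradX] at h

theorem hasDerivWithinAt_quad {p : X} {w α : ℝ → EMod n} {w' α' : EMod n} {S : Set ℝ} {s : ℝ}
    (hw : HasDerivWithinAt w w' S s) (hα : HasDerivWithinAt α α' S s)
    (hm : MapsTo w S (chartTgt n p)) (hs : s ∈ S) :
    HasDerivWithinAt (fun u => A.quad p (w u) (α u))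
      (inner ℝ (A.gradQuad p (w s) (α s)) w' + 2 * inner ℝ α' (A.raise p (w s) (α s))) S s := by
  have h1 := ((((A.contDiffOn_raise p).differentiableOn (by simp)) (w s)
    (hm hs)).hasFDerivWithinAt).comp_hasDerivWithinAt s hw hm
  have h2 := hα.inner ℝ (h1.clm_apply hα)
  refine h2.congr_deriv ?_
  have h3 := A.raise_symm (hm hs) (α s) α'
  rw [real_inner_comm] at h3
  simp only [Function.comp, inner_gradQuad, inner_add_right]
  linarith

namespace LocalFlow

variable {A} {p : X} (F : A.LocalFlow p)

/-- The parameter domain of the family of solutions. -/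
def dom : Set (ℝ × EMod n × EMod n) := flowDom p F.ε F.δ F.R

/-- The position component of a solution. -/
def pos (l : ℝ × EMod n × EMod n) (s : ℝ) : EMod n :=
  l.2.1 + (A.xc p l.2.1 * l.1) • (F.sol l s).1

/-- The rescaled momentum component of a solution. -/
def mom (l : ℝ × EMod n × EMod n) (s : ℝ) : EMod n := (F.sol l s).2.1

/-- The ratio of the final and initial values of the boundary defining function. -/
def ratio (l : ℝ × EMod n × EMod n) (s : ℝ) : ℝ := (F.sol l s).2.2

variable {F} {l : ℝ × EMod n × EMod n} {s : ℝ}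

theorem mem_halfBall (hl : l ∈ F.dom) : l.2.1 ∈ halfBall p F.δ' :=
  inter_subset_inter_left _ (Metric.ball_subset_closedBall.trans
    (Metric.closedBall_subset_closedBall F.δ_le)) hl.2.1

theorem mem_chartTgt (hl : l ∈ F.dom) : l.2.1 ∈ chartTgt n p := F.sub (mem_halfBall hl)

theorem pos_mem (hl : l ∈ F.dom) (hs : s ∈ Icc (0 : ℝ) 1) : F.pos l s ∈ chartTgt n p :=
  F.sub (F.mem l hl s hs)

theorem pos_zero (hl : l ∈ F.dom) : F.pos l 0 = l.2.1 := by simp [pos, F.init l hl]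

theorem mom_zero (hl : l ∈ F.dom) : F.mom l 0 = l.2.2 := by simp [mom, F.init l hl]

theorem ratio_zero (hl : l ∈ F.dom) : F.ratio l 0 = 1 := by simp [ratio, F.init l hl]

theorem hasDeriv_fst (hl : l ∈ F.dom) (hs : s ∈ Icc (0 : ℝ) 1) :
    HasDerivWithinAt (fun u => (F.sol l u).1) ((2 * F.ratio l s) • A.raise p (F.pos l s) (F.mom l s))
      (Icc 0 1) s :=
  (hasFDerivAt_fst.comp_hasDerivWithinAt s (F.ode l hl s hs)).congr_deriv
    (by simp [scaleField, scaledField, ratio, pos, mom])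

theorem hasDeriv_pos (hl : l ∈ F.dom) (hs : s ∈ Icc (0 : ℝ) 1) :
    HasDerivWithinAt (F.pos l) ((A.xc p l.2.1 * l.1) •
      ((2 * F.ratio l s) • A.raise p (F.pos l s) (F.mom l s))) (Icc 0 1) s :=
  ((hasDeriv_fst hl hs).const_smul (A.xc p l.2.1 * l.1)).const_add l.2.1

theorem hasDeriv_mom (hl : l ∈ F.dom) (hs : s ∈ Icc (0 : ℝ) 1) :
    HasDerivWithinAt (F.mom l) (l.1 • A.scaledForce p (F.pos l s) (F.mom l s)) (Icc 0 1) s :=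
  (hasFDerivAt_fst.comp_hasDerivWithinAt s (hasFDerivAt_snd.comp_hasDerivWithinAt s
    (F.ode l hl s hs))).congr_deriv (by simp [scaleField, scaledField, pos, mom])

theorem hasDeriv_ratio (hl : l ∈ F.dom) (hs : s ∈ Icc (0 : ℝ) 1) :
    HasDerivWithinAt (F.ratio l) (l.1 * (2 * A.slope p (F.pos l s) (F.mom l s) * F.ratio l s))
      (Icc 0 1) s :=
  (hasFDerivAt_snd.comp_hasDerivWithinAt s (hasFDerivAt_snd.comp_hasDerivWithinAt s
    (F.ode l hl s hs))).congr_deriv (by simp [scaleField, scaledField, pos, mom, ratio])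

/-- The ratio `ρ` is an independent unknown, which keeps the system smooth at `x' = 0`. It equals `x
/ x'` because `x - x' ρ` has zero derivative and vanishes initially. -/
theorem xc_pos (hl : l ∈ F.dom) (hs : s ∈ Icc (0 : ℝ) 1) :
    A.xc p (F.pos l s) = A.xc p l.2.1 * F.ratio l s := by
  have hd : ∀ u ∈ Icc (0 : ℝ) 1, HasDerivWithinAt
      (fun u => A.xc p (F.pos l u) - A.xc p l.2.1 * F.ratio l u) 0 (Icc 0 1) u := fun u hu => by
    refine ((A.hasDerivWithinAt_xc (hasDeriv_pos hl hu) (fun _ h => pos_mem hl h) hu).sub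
      ((hasDeriv_ratio hl hu).const_mul _)).congr_deriv ?_
    rw [inner_smul_right, inner_smul_right]
    simp only [slope]
    ring
  have h := constant_of_derivWithin_zero (fun u hu => (hd u hu).differentiableWithinAt)
    (fun u hu => (hd u (Ico_subset_Icc_self hu)).derivWithin
      (uniqueDiffOn_Icc one_pos u (Ico_subset_Icc_self hu))) s hs
  simp only [pos_zero hl, ratio_zero hl, mul_one, sub_self] at h
  linarith

theorem xc_pos_pos (hl : l ∈ F.dom) (hs : s ∈ Icc (0 : ℝ) 1) (hx : 0 < A.xc p l.2.1) :
    0 < A.xc p (F.pos l s) := by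
  rw [xc_pos hl hs]
  exact mul_pos hx (F.ρ_mem l hl s hs).1

/-- Conservation of the symbol: the terms of the derivative cancel once `x = x' ρ` is inserted. -/
theorem quad_mom (hl : l ∈ F.dom) (hs : s ∈ Icc (0 : ℝ) 1) :
    A.quad p (F.pos l s) (F.mom l s) = A.quad p l.2.1 l.2.2 := by
  have hd : ∀ u ∈ Icc (0 : ℝ) 1, HasDerivWithinAt
      (fun u => A.quad p (F.pos l u) (F.mom l u)) 0 (Icc 0 1) u := fun u hu => by
    refine (A.hasDerivWithinAt_quad (hasDeriv_pos hl hu) (hasDeriv_mom hl hu)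
      (fun _ h => pos_mem hl h) hu).congr_deriv ?_
    have hx := xc_pos hl hu
    simp only [inner_smul_right, inner_smul_left, scaledForce, inner_sub_left, conj_trivial]
    simp only [quad, slope, hx]
    ring
  have h := constant_of_derivWithin_zero (fun u hu => (hd u hu).differentiableWithinAt)
    (fun u hu => (hd u (Ico_subset_Icc_self hu)).derivWithin
      (uniqueDiffOn_Icc one_pos u (Ico_subset_Icc_self hu))) s hs
  rwa [pos_zero hl, mom_zero hl] at h

/-- Solutions whose initial velocities agree up to a rescaling of time agree. -/
theorem sol_eq_of_smul_eq {l' : ℝ × EMod n × EMod n} (hl : l ∈ F.dom) (hl' : l' ∈ F.dom)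
    (hv : l.2.1 = l'.2.1) (ha : l.1 • l.2.2 = l'.1 • l'.2.2) (hs : s ∈ Icc (0 : ℝ) 1) :
    l.1 • (F.sol l s).1 = l'.1 • (F.sol l' s).1 ∧ l.1 • F.mom l s = l'.1 • F.mom l' s ∧
      F.ratio l s = F.ratio l' s := by
  -- The triple `(r V, r α, ρ)` solves a system with field `Φ` in which `r` no longer occurs, as
  -- `raise` and `slope` are linear and `scaledForce` is quadratic in the momentum. Its initial
  -- value involves only `r a`, so uniqueness applies; `D` is a region where `Φ` is Lipschitz.
  let D : Set (EMod n × EMod n × ℝ) := {Y | (l.2.1 + A.xc p l.2.1 • Y.1, Y.2.1, Y.2.2) ∈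
    halfBall p F.δ' ×ˢ Metric.closedBall (0 : EMod n) (F.R + 1) ×ˢ Icc (0 : ℝ) 2}
  let Φ : EMod n × EMod n × ℝ → EMod n × EMod n × ℝ := fun Y =>
    A.scaledField p (l.2.1 + A.xc p l.2.1 • Y.1, Y.2.1, Y.2.2)
  have hlip : LipschitzOnWith (Real.toNNReal (|F.M| * (A.xc p l.2.1 + 1))) Φ D := by
    refine LipschitzOnWith.of_dist_le_mul fun Y hY Z hZ => ?_
    rw [dist_eq_norm, dist_eq_norm, Real.coe_toNNReal _ (mul_nonneg (abs_nonneg _)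
      (by linarith [A.xc_nonneg p l.2.1]))]
    refine (F.lip _ hY _ hZ).trans ?_
    rw [mul_assoc]
    refine mul_le_mul (le_abs_self _) ?_ (norm_nonneg _) (abs_nonneg _)
    have h0 : 0 ≤ A.xc p l.2.1 := A.xc_nonneg _ _
    have h1 : ‖Y.1 - Z.1‖ ≤ ‖Y - Z‖ := norm_fst_le (Y - Z)
    have h2 : ‖Y.2 - Z.2‖ ≤ ‖Y - Z‖ := norm_snd_le (Y - Z)
    change max ‖(l.2.1 + A.xc p l.2.1 • Y.1) - (l.2.1 + A.xc p l.2.1 • Z.1)‖ ‖Y.2 - Z.2‖ ≤ _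
    rw [add_sub_add_left_eq_sub, ← smul_sub, norm_smul, Real.norm_eq_abs, abs_of_nonneg h0]
    refine max_le ?_ ?_
    · nlinarith [norm_nonneg (Y - Z)]
    · nlinarith [norm_nonneg (Y - Z)]
  have key : ∀ m ∈ F.dom, m.2.1 = l.2.1 → (∀ u ∈ Icc (0 : ℝ) 1,
      HasDerivWithinAt (fun u => (m.1 • (F.sol m u).1, m.1 • F.mom m u, F.ratio m u))
        (Φ (m.1 • (F.sol m u).1, m.1 • F.mom m u, F.ratio m u)) (Icc 0 1) u) ∧
      ∀ u ∈ Icc (0 : ℝ) 1, (m.1 • (F.sol m u).1, m.1 • F.mom m u, F.ratio m u) ∈ D := by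
    intro m hm hmv
    have hpos : ∀ u, F.pos m u = l.2.1 + A.xc p l.2.1 • (m.1 • (F.sol m u).1) := fun u => by
      rw [pos, hmv, smul_smul]
    refine ⟨fun u hu => ?_, fun u hu => ?_⟩
    · refine (((hasDeriv_fst hm hu).const_smul m.1).prodMk (((hasDeriv_mom hm hu).const_smul
        m.1).prodMk (hasDeriv_ratio hm hu))).congr_deriv ?_
      simp only [Φ]
      rw [← hpos]
      simp only [scaledField, map_smul, scaledForce_smul, slope_smul]
      refine Prod.ext (by simp only; module) (Prod.ext (by simp only; module) ?_)
      simp only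
      ring
    · refine ⟨?_, ?_, ?_⟩
      · simp only [← hpos]
        exact F.mem m hm u hu
      -- Since `|r| < ε ≤ 1`, the multiplied momentum stays in the same ball.
      · rw [mem_closedBall_zero_iff, norm_smul]
        have h1 : |m.1| < F.ε := abs_lt.2 hm.1
        have h2 := F.mom_le m hm u hu
        have h3 := F.ε_le
        have h4 := F.R_pos
        calc ‖m.1‖ * ‖F.mom m u‖ ≤ 1 * (F.R + 1) :=
              mul_le_mul (h1.le.trans h3) h2 (norm_nonneg _) zero_le_one
          _ = _ := one_mul _
      · exact Ioo_subset_Icc_self (F.ρ_mem m hm u hu)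
  have hr : ∀ {f f' : ℝ → EMod n × EMod n × ℝ}, (∀ u ∈ Icc (0 : ℝ) 1,
      HasDerivWithinAt f (f' u) (Icc 0 1) u) → ∀ u ∈ Ico (0 : ℝ) 1,
      HasDerivWithinAt f (f' u) (Ici u) u := fun h u hu =>
    (h u (Ico_subset_Icc_self hu)).mono_of_mem_nhdsWithin (Icc_mem_nhdsGE_of_mem hu)
  have h1 := key l hl rfl
  have h2 := key l' hl' hv.symm
  have h := ODE_solution_unique_of_mem_Icc_right (v := fun _ => Φ) (s := fun _ => D)
    (fun _ _ => hlip) (fun u hu => (h1.1 u hu).continuousWithinAt) (hr h1.1)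
    (fun u hu => h1.2 u (Ico_subset_Icc_self hu))
    (fun u hu => (h2.1 u hu).continuousWithinAt) (hr h2.1)
    (fun u hu => h2.2 u (Ico_subset_Icc_self hu))
    (by simp only [F.init l hl, F.init l' hl', mom_zero hl, mom_zero hl', ratio_zero hl,
          ratio_zero hl', ha, smul_zero]) hs
  simpa only [Prod.mk.injEq] using h

end LocalFlow

end AHMetric

/-! ### Integral curves on sets of times: reversal, gluing, uniqueness. -/

namespace AHMetric

variable {n : ℕ} {X : Type*} [TopologicalSpace X] [ChartedSpace (EuclideanHalfSpace (n + 1)) X]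
  [IsManifold (halfModel n) ∞ X] (A : AHMetric n X)

/-- `γ` is an integral curve of the Hamilton vector field on the set `S` of times. -/
structure IsSegment (γ : ℝ → CotBundle n X) (S : Set ℝ) : Prop where
  cont : ContinuousOn (fun t => (γ t).proj) S
  x_pos : ∀ t ∈ S, 0 < A.x (γ t).proj
  unit : ∀ t ∈ S, dualNormSq A.metric (γ t).proj (γ t).2 = 1
  ham : ∀ t ∈ S, ∀ p, (γ t).proj ∈ chartDom n p → A.HamAt γ p S t

/-- The unit covectors over the interior. -/
def IsState (q : CotBundle n X) : Prop := 0 < A.x q.proj ∧ dualNormSq A.metric q.proj q.2 = 1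

theorem isBicharacteristic_iff_isSegment (γ : ℝ → CotBundle n X) :
    A.IsBicharacteristic γ ↔ A.IsSegment γ univ := by
  rw [isBicharacteristic_iff]
  exact ⟨fun ⟨h1, h2, h3, h4⟩ => ⟨h1.continuousOn, fun t _ => h2 t, fun t _ => h3 t,
    fun t _ p => h4 t p⟩, fun h => ⟨continuousOn_univ.1 h.cont, fun t => h.x_pos t (mem_univ t),
    fun t => h.unit t (mem_univ t), fun t p => h.ham t (mem_univ t) p⟩⟩

/-- The fibrewise reflection of the cotangent bundle. -/
def cotNeg (q : CotBundle n X) : CotBundle n X := ⟨q.proj, -q.2⟩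

theorem cotNeg_cotNeg (q : CotBundle n X) : cotNeg (cotNeg q) = q := by
  obtain ⟨z, ζ⟩ := q
  change (⟨z, - -ζ⟩ : CotBundle n X) = _
  rw [neg_neg]

theorem cot_ext {p : X} {q q' : CotBundle n X} (h : q.proj = q'.proj)
    (hp : q.proj ∈ chartDom n p)
    (hc : cotangentCoord p q.proj q.2 = cotangentCoord p q'.proj q'.2) : q = q' := by
  obtain ⟨z, ζ⟩ := q
  obtain ⟨z', ζ'⟩ := q'
  obtain rfl : z = z' := h
  have h1 : ζ = ζ' := cotangentCoord_injective hp hc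
  rw [h1]

variable {A}

theorem HamAt.mono {γ : ℝ → CotBundle n X} {p : X} {S S' : Set ℝ} {t : ℝ} (h : A.HamAt γ p S t)
    (hS : S ∈ 𝓝[S'] t) : A.HamAt γ p S' t :=
  ⟨h.pos.mono_of_mem_nhdsWithin hS, h.mom.mono_of_mem_nhdsWithin hS⟩

theorem HamAt.union {γ : ℝ → CotBundle n X} {p : X} {S S' : Set ℝ} {t : ℝ} (h : A.HamAt γ p S t)
    (h' : A.HamAt γ p S' t) : A.HamAt γ p (S ∪ S') t :=
  ⟨h.pos.union h'.pos, h.mom.union h'.mom⟩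

theorem HamAt.congr {γ γ' : ℝ → CotBundle n X} {p : X} {S : Set ℝ} {t : ℝ} (h : A.HamAt γ p S t)
    (he : EqOn γ' γ S) (ht : t ∈ S) : A.HamAt γ' p S t := by
  refine ⟨?_, ?_⟩
  · rw [he ht]
    exact h.pos.congr (fun u hu => congrArg (fun q => coord n p q.proj) (he hu))
      (congrArg (fun q => coord n p q.proj) (he ht))
  · rw [he ht]
    exact h.mom.congr (fun u hu => congrArg (fun q : CotBundle n X => cotangentCoord p q.proj q.2) (he hu))
      (congrArg (fun q : CotBundle n X => cotangentCoord p q.proj q.2) (he ht))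

theorem IsSegment.mono {γ : ℝ → CotBundle n X} {S S' : Set ℝ} (h : A.IsSegment γ S) (hS : S' ⊆ S) :
    A.IsSegment γ S' :=
  ⟨h.cont.mono hS, fun t ht => h.x_pos t (hS ht), fun t ht => h.unit t (hS ht), fun t ht p hp =>
    (h.ham t (hS ht) p hp).mono (mem_of_superset self_mem_nhdsWithin hS)⟩

theorem IsSegment.congr {γ γ' : ℝ → CotBundle n X} {S : Set ℝ} (h : A.IsSegment γ S)
    (he : EqOn γ' γ S) : A.IsSegment γ' S := by
  refine ⟨h.cont.congr fun t ht => by simp only [he ht], fun t ht => ?_, fun t ht => ?_,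
    fun t ht p hp => ?_⟩
  · rw [he ht]; exact h.x_pos t ht
  · rw [he ht]; exact h.unit t ht
  · rw [he ht] at hp; exact (h.ham t ht p hp).congr he ht

theorem IsSegment.shift {γ : ℝ → CotBundle n X} {S : Set ℝ} (h : A.IsSegment γ S) (c : ℝ) :
    A.IsSegment (fun t => γ (t + c)) ((fun t => t + c) ⁻¹' S) := by
  refine ⟨h.cont.comp (by fun_prop) fun t ht => ht, fun t ht => h.x_pos _ ht,
    fun t ht => h.unit _ ht, fun t ht p hp => ?_⟩
  have h1 := h.ham _ ht p hp
  have h2 : HasDerivWithinAt (fun t : ℝ => t + c) 1 ((fun t => t + c) ⁻¹' S) t :=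
    (hasDerivWithinAt_id t _).add_const c
  exact ⟨(HasDerivWithinAt.scomp (g₁ := fun u => coord n p (γ u).proj) t h1.pos h2
    fun t ht => ht).congr_deriv (one_smul _ _),
    (HasDerivWithinAt.scomp (g₁ := fun u => cotangentCoord p (γ u).proj (γ u).2) t h1.mom h2
    fun t ht => ht).congr_deriv (one_smul _ _)⟩

theorem dualNormSq_metric_neg {z : X} (hx : 0 < A.x z) (ζ : TangentSpace (halfModel n) z →L[ℝ] ℝ) :
    dualNormSq A.metric z (-ζ) = dualNormSq A.metric z ζ := by
  rw [A.dualNormSq_metric (mem_chartDom_self z) hx, A.dualNormSq_metric (mem_chartDom_self z) hx,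
    cotangentCoord_neg, ← neg_one_smul ℝ (cotangentCoord z z ζ), quad_smul]
  norm_num

theorem IsState.neg {q : CotBundle n X} (h : A.IsState q) : A.IsState (cotNeg q) :=
  ⟨h.1, (dualNormSq_metric_neg h.1 _).trans h.2⟩

theorem IsSegment.isState {γ : ℝ → CotBundle n X} {S : Set ℝ} (h : A.IsSegment γ S) {t : ℝ}
    (ht : t ∈ S) : A.IsState (γ t) := ⟨h.x_pos t ht, h.unit t ht⟩

theorem IsSegment.reverse {γ : ℝ → CotBundle n X} {S : Set ℝ} (h : A.IsSegment γ S) :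
    A.IsSegment (fun t => cotNeg (γ (-t))) ((fun t => -t) ⁻¹' S) := by
  refine ⟨h.cont.comp (by fun_prop) fun t ht => ht, fun t ht => h.x_pos _ ht,
    fun t ht => ((h.isState ht).neg).2, fun t ht p hp => ?_⟩
  have h1 := h.ham _ ht p hp
  have h2 : HasDerivWithinAt (fun t : ℝ => -t) (-1) ((fun t => -t) ⁻¹' S) t :=
    (hasDerivWithinAt_id t _).neg
  refine ⟨(HasDerivWithinAt.scomp (g₁ := fun u => coord n p (γ u).proj) t h1.pos h2
    fun t ht => ht).congr_deriv ?_,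
    ((HasDerivWithinAt.scomp (g₁ := fun u => cotangentCoord p (γ u).proj (γ u).2) t h1.mom h2
    fun t ht => ht).neg.congr (fun u _ => ?_) ?_).congr_deriv ?_⟩
  · simp only [cotNeg, cotangentCoord_neg, velocity, map_neg]
    module
  · simp only [cotNeg, cotangentCoord_neg]; rfl
  · simp only [cotNeg, cotangentCoord_neg]; rfl
  · simp only [cotNeg, cotangentCoord_neg]
    rw [← neg_one_smul ℝ (cotangentCoord p _ _)]
    simp only [force, quad_smul, gradQuad_smul]
    module

/-- Curves that are integral curves to the left and to the right of every time. -/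
theorem IsSegment.glue {γ : ℝ → CotBundle n X} {S : Set ℝ}
    (h : ∀ t ∈ S, ∃ S₁ S₂, A.IsSegment γ S₁ ∧ A.IsSegment γ S₂ ∧ t ∈ S₁ ∧ t ∈ S₂ ∧
      S₁ ∈ 𝓝[S ∩ Iic t] t ∧ S₂ ∈ 𝓝[S ∩ Ici t] t) : A.IsSegment γ S := by
  have hS : ∀ t, S = (S ∩ Iic t) ∪ (S ∩ Ici t) := fun t => by
    rw [← inter_union_distrib_left, Iic_union_Ici, inter_univ]
  refine ⟨fun t ht => ?_, fun t ht => ?_, fun t ht => ?_, fun t ht p hp => ?_⟩ <;>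
    obtain ⟨S₁, S₂, h1, h2, m1, m2, n1, n2⟩ := h t ht
  · rw [hS t]
    exact ((h1.cont t m1).mono_of_mem_nhdsWithin n1).union
      ((h2.cont t m2).mono_of_mem_nhdsWithin n2)
  · exact h1.x_pos t m1
  · exact h1.unit t m1
  · rw [hS t]
    exact ((h1.ham t m1 p hp).mono n1).union ((h2.ham t m2 p hp).mono n2)

theorem contDiffAt_hamField {p : X} {v : EMod n} (hv : v ∈ chartTgt n p) (h0 : 0 < v 0) (ξ : EMod n) :
    ContDiffAt ℝ ∞ (fun u : EMod n × EMod n => (A.velocity p u.1 u.2, A.force p u.1 u.2)) (v, ξ) := by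
  have hn : chartTgt n p ×ˢ univ ∈ 𝓝 (v, ξ) := prod_mem_nhds (chartTgt_nhds hv h0) univ_mem
  have hx := ((A.contDiffOn_xc p).comp (contDiffOn_fst (F := EMod n))
    fun (u : EMod n × EMod n) (hu : u ∈ chartTgt n p ×ˢ univ) => hu.1)
  have hg := ((A.contDiffOn_gradX p).comp (contDiffOn_fst (F := EMod n))
    fun (u : EMod n × EMod n) (hu : u ∈ chartTgt n p ×ˢ univ) => hu.1)
  exact (((contDiffOn_const.mul (hx.pow 2)).smul (A.contDiffOn_raise_apply p)).prodMk
    (((contDiffOn_const.mul hx).mul (A.contDiffOn_quad p)).smul hg |>.add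
      ((hx.pow 2).smul (A.contDiffOn_gradQuad p))).neg).contDiffAt hn

/-- Integral curves are determined by their initial values. -/
theorem IsSegment.eqOn [T2Space X] {γ γ' : ℝ → CotBundle n X} {T : ℝ} (h : A.IsSegment γ (Icc 0 T))
    (h' : A.IsSegment γ' (Icc 0 T)) (h0 : γ 0 = γ' 0) : EqOn γ γ' (Icc 0 T) := by
  -- Continuous induction. The set of times of agreement is closed, by passing to the limit first in
  -- the positions and then in the components of the momenta; it is open to the right, by uniqueness
  -- for the locally Lipschitz Hamilton field in a chart.
  refine IsClosed.Icc_subset_of_forall_mem_nhdsWithin (s := {t | γ t = γ' t}) ?_ h0 ?_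
  · refine isClosed_of_closure_subset fun t ht => ?_
    have htI : t ∈ Icc 0 T := closure_minimal inter_subset_right isClosed_Icc ht
    refine ⟨?_, htI⟩
    rw [mem_closure_iff_nhdsWithin_neBot] at ht
    have hsub : 𝓝[{t | γ t = γ' t} ∩ Icc 0 T] t ≤ 𝓝[Icc 0 T] t := nhdsWithin_mono _ inter_subset_right
    have hproj : (γ t).proj = (γ' t).proj := by
      refine tendsto_nhds_unique_of_eventuallyEq ((h.cont t htI).mono_left hsub)
        ((h'.cont t htI).mono_left hsub) ?_
      filter_upwards [self_mem_nhdsWithin] with u hu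
      rw [hu.1]
    have hp := mem_chartDom_self (n := n) (γ t).proj
    refine cot_ext hproj hp ?_
    refine tendsto_nhds_unique_of_eventuallyEq
      ((h.ham t htI _ hp).mom.continuousWithinAt.mono_left hsub)
      ((h'.ham t htI _ (hproj ▸ hp)).mom.continuousWithinAt.mono_left hsub) ?_
    filter_upwards [self_mem_nhdsWithin] with u hu
    rw [hu.1]
  · rintro t ⟨he : γ t = γ' t, ht⟩
    have htI := Ico_subset_Icc_self ht
    set p := (γ t).proj with hpdef
    have hp : (γ t).proj ∈ chartDom n p := mem_chartDom_self _
    have hp' : (γ' t).proj ∈ chartDom n p := he ▸ hp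
    obtain ⟨K, s, hs, hK⟩ := ((contDiffAt_hamField (A := A) (coord_mem hp)
      ((A.x_pos_iff hp).1 (h.x_pos t htI)) (cotangentCoord p (γ t).proj (γ t).2)).of_le
        (by norm_cast : (1 : WithTop ℕ∞) ≤ ∞)).exists_lipschitzOnWith
    have key : ∀ c : ℝ → CotBundle n X, A.IsSegment c (Icc 0 T) → c t = γ t →
        ∀ᶠ u in 𝓝[Icc 0 T] t, (c u).proj ∈ chartDom n p ∧
          (coord n p (c u).proj, cotangentCoord p (c u).proj (c u).2) ∈ s := by
      intro c hc hct
      have h1 : (c t).proj ∈ chartDom n p := hct ▸ hp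
      have h2 := hc.ham t htI p h1
      have h3 := h2.pos.continuousWithinAt.prodMk h2.mom.continuousWithinAt
      exact inter_mem (hc.cont t htI ((isOpen_chartDom p).mem_nhds h1)) (h3 (by beta_reduce; rw [hct]; exact hs))
    have hev := inter_mem (key γ h rfl) (key γ' h' he.symm)
    have hge : 𝓝[≥] t ≤ 𝓝[Icc 0 T] t := nhdsWithin_le_iff.2 (Icc_mem_nhdsGE_of_mem ht)
    obtain ⟨b, hb, hbs⟩ := mem_nhdsGE_iff_exists_Icc_subset.1
      (inter_mem (hge hev) (Icc_mem_nhdsGE_of_mem ht))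
    have hsol : ∀ c : ℝ → CotBundle n X, A.IsSegment c (Icc 0 T) →
        (∀ u ∈ Icc t b, (c u).proj ∈ chartDom n p) →
        ContinuousOn (fun u => (coord n p (c u).proj, cotangentCoord p (c u).proj (c u).2)) (Icc t b) ∧
        ∀ u ∈ Ico t b, HasDerivWithinAt
          (fun u => (coord n p (c u).proj, cotangentCoord p (c u).proj (c u).2))
          (A.velocity p (coord n p (c u).proj) (cotangentCoord p (c u).proj (c u).2),
            A.force p (coord n p (c u).proj) (cotangentCoord p (c u).proj (c u).2)) (Ici u) u := by
      intro c hc hcp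
      have hd : ∀ u ∈ Icc t b, HasDerivWithinAt
          (fun u => (coord n p (c u).proj, cotangentCoord p (c u).proj (c u).2))
          (A.velocity p (coord n p (c u).proj) (cotangentCoord p (c u).proj (c u).2),
            A.force p (coord n p (c u).proj) (cotangentCoord p (c u).proj (c u).2)) (Icc t b) u :=
        fun u hu => by
          have h1 := hc.ham u (hbs hu).2 p (hcp u hu)
          exact (h1.pos.prodMk h1.mom).mono fun w hw => (hbs hw).2
      exact ⟨fun u hu => (hd u hu).continuousWithinAt, fun u hu =>
        (hd u (Ico_subset_Icc_self hu)).mono_of_mem_nhdsWithin (Icc_mem_nhdsGE_of_mem hu)⟩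
    have s1 := hsol γ h fun u hu => (hbs hu).1.1.1
    have s2 := hsol γ' h' fun u hu => (hbs hu).1.2.1
    have heq := ODE_solution_unique_of_mem_Icc_right
      (v := fun _ (u : EMod n × EMod n) => (A.velocity p u.1 u.2, A.force p u.1 u.2))
      (s := fun _ => s) (K := K) (fun _ _ => hK)
      s1.1 s1.2 (fun u hu => (hbs (Ico_subset_Icc_self hu)).1.1.2)
      s2.1 s2.2 (fun u hu => (hbs (Ico_subset_Icc_self hu)).1.2.2)
      (congrArg (fun q : CotBundle n X => (coord n p q.proj, cotangentCoord p q.proj q.2)) he)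
    refine nhdsWithin_mono t Ioi_subset_Ici_self (mem_of_superset (Icc_mem_nhdsGE hb) fun u hu => ?_)
    have h3 := heq hu
    simp only [Prod.mk.injEq] at h3
    have h4 := coord_injOn (hbs hu).1.1.1 (hbs hu).1.2.1 h3.1
    exact cot_ext h4 (hbs hu).1.1.1 h3.2

end AHMetric

/-! ### From the rescaled flow back to bicharacteristics. -/

namespace AHMetric

variable {n : ℕ} {X : Type*} [TopologicalSpace X] [ChartedSpace (EuclideanHalfSpace (n + 1)) X]
  [IsManifold (halfModel n) ∞ X] (A : AHMetric n X)

/-- The parameters of a covector, for the time scale `r`. -/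
def param (p : X) (r : ℝ) (q : CotBundle n X) : ℝ × EMod n × EMod n :=
  (r, coord n p q.proj, A.x q.proj • cotangentCoord p q.proj q.2)

namespace LocalFlow

variable {A} {p : X} (F : A.LocalFlow p)

/-- The points to which the local flow applies. -/
def nbhd : Set X := {z | z ∈ chartDom n p ∧ coord n p z ∈ Metric.ball (coord n p p) F.δ}

theorem isOpen_nbhd : IsOpen F.nbhd :=
  (continuousOn_coord p).isOpen_inter_preimage (isOpen_chartDom p) Metric.isOpen_ball

theorem mem_nbhd_self : p ∈ F.nbhd := ⟨mem_chartDom_self p, Metric.mem_ball_self F.δ_pos⟩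

theorem quad_param {q : CotBundle n X} (hq : A.IsState q) (hp : q.proj ∈ chartDom n p) (r : ℝ) :
    A.quad p (A.param p r q).2.1 (A.param p r q).2.2 = 1 := by
  rw [param, quad_smul, ← A.dualNormSq_metric hp hq.1, hq.2]

theorem param_mem {q : CotBundle n X} (hq : A.IsState q) (hp : q.proj ∈ F.nbhd) {r : ℝ}
    (hr : |r| < F.ε) : A.param p r q ∈ F.dom := by
  have h1 : coord n p q.proj ∈ Metric.ball (coord n p p) F.δ ∩ halfSpace n :=
    ⟨hp.2, chartTgt_subset p (coord_mem hp.1)⟩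
  refine ⟨abs_lt.1 hr, h1, mem_ball_zero_iff.2 (F.unit_lt _ ?_ _ (quad_param hq hp.1 r))⟩
  exact inter_subset_inter_left _ (Metric.ball_subset_closedBall.trans
    (Metric.closedBall_subset_closedBall F.δ_le)) h1

/-- The covector reached at the time `s` in the time scale of the parameters. -/
def point (l : ℝ × EMod n × EMod n) (s : ℝ) : CotBundle n X :=
  ⟨chartInv p (F.pos l s), covec p _ ((A.xc p (F.pos l s))⁻¹ • F.mom l s)⟩

variable {F} {l : ℝ × EMod n × EMod n}

theorem coord_point (hl : l ∈ F.dom) {s : ℝ} (hs : s ∈ Icc (0 : ℝ) 1) :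
    coord n p (F.point l s).proj = F.pos l s := coord_chartInv (pos_mem hl hs)

theorem point_mem_chartDom (hl : l ∈ F.dom) {s : ℝ} (hs : s ∈ Icc (0 : ℝ) 1) :
    (F.point l s).proj ∈ chartDom n p := chartInv_mem (pos_mem hl hs)

theorem cotangentCoord_point (hl : l ∈ F.dom) {s : ℝ} (hs : s ∈ Icc (0 : ℝ) 1) :
    cotangentCoord p (F.point l s).proj (F.point l s).2 =
      (A.xc p (F.pos l s))⁻¹ • F.mom l s :=
  cotangentCoord_covec (chartInv_mem (pos_mem hl hs)) _

/-- With `t = r s` and `ζ = α / x` the rescaled equations become Hamilton's equations in the chart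
centred at `p`; all other charts follow from `HamAt.change`. -/
theorem isSegment_point (hl : l ∈ F.dom) (hr : 0 < l.1) (hx : 0 < A.xc p l.2.1)
    (hq : A.quad p l.2.1 l.2.2 = 1) :
    A.IsSegment (fun t => F.point l (t / l.1)) (Icc 0 l.1) := by
  have hm : ∀ t ∈ Icc 0 l.1, t / l.1 ∈ Icc (0 : ℝ) 1 := fun t ht =>
    ⟨div_nonneg ht.1 hr.le, (div_le_one hr).2 ht.2⟩
  have hxp : ∀ t ∈ Icc 0 l.1, 0 < A.x (F.point l (t / l.1)).proj := fun t ht =>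
    xc_pos_pos hl (hm t ht) hx
  have hs : ∀ t, HasDerivWithinAt (fun t : ℝ => t / l.1) (l.1⁻¹) (Icc 0 l.1) t := fun t => by
    simpa using (hasDerivWithinAt_id t (Icc 0 l.1)).div_const l.1
  have hpos : ∀ t ∈ Icc 0 l.1, HasDerivWithinAt (fun t => F.pos l (t / l.1)) _ (Icc 0 l.1) t :=
    fun t ht => HasDerivWithinAt.scomp (g₁ := F.pos l) t (hasDeriv_pos hl (hm t ht)) (hs t) hm
  have hmom : ∀ t ∈ Icc 0 l.1, HasDerivWithinAt (fun t => F.mom l (t / l.1)) _ (Icc 0 l.1) t :=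
    fun t ht => HasDerivWithinAt.scomp (g₁ := F.mom l) t (hasDeriv_mom hl (hm t ht)) (hs t) hm
  have hcont : ContinuousOn (fun t => (F.point l (t / l.1)).proj) (Icc 0 l.1) :=
    (continuousOn_chartInv p).comp (fun t ht => (hpos t ht).continuousWithinAt)
      fun t ht => pos_mem hl (hm t ht)
  refine ⟨hcont, hxp, fun t ht => ?_, fun t ht p' hp' => ?_⟩
  · have hX := xc_pos_pos hl (hm t ht) hx
    rw [A.dualNormSq_metric (point_mem_chartDom hl (hm t ht)) (hxp t ht),
      cotangentCoord_point hl (hm t ht), coord_point hl (hm t ht), quad_smul, quad_mom hl (hm t ht), hq]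
    change A.xc p (F.pos l (t / l.1)) ^ 2 * _ = 1
    field_simp
  · refine HamAt.change ?_ (point_mem_chartDom hl (hm t ht)) hp' (hxp t ht) (hcont t ht)
    have hX := xc_pos_pos hl (hm t ht) hx
    have hXρ := xc_pos hl (hm t ht)
    refine ⟨?_, ?_⟩
    · refine ((hpos t ht).congr (fun u hu => coord_point hl (hm u hu))
        (coord_point hl (hm t ht))).congr_deriv ?_
      rw [cotangentCoord_point hl (hm t ht), coord_point hl (hm t ht), velocity, map_smul, smul_smul,
        smul_smul, smul_smul]
      congr 1
      have h1 : A.xc p l.2.1 * F.ratio l (t / l.1) = A.xc p (F.pos l (t / l.1)) := hXρ.symm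
      field_simp
      linear_combination h1
    · have hX' := (A.hasDerivWithinAt_xc (hpos t ht) (fun u hu => pos_mem hl (hm u hu)) ht).inv hX.ne'
      refine ((hX'.smul (hmom t ht)).congr (fun u hu => cotangentCoord_point hl (hm u hu))
        (cotangentCoord_point hl (hm t ht))).congr_deriv ?_
      rw [cotangentCoord_point hl (hm t ht), coord_point hl (hm t ht), force, quad_smul, gradQuad_smul,
        scaledForce, inner_smul_right, inner_smul_right, inner_smul_right]
      have h2 : inner ℝ (A.gradX p (F.pos l (t / l.1)))
        (A.raise p (F.pos l (t / l.1)) (F.mom l (t / l.1))) =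
          A.slope p (F.pos l (t / l.1)) (F.mom l (t / l.1)) := rfl
      have h3 : l.1⁻¹ * (A.xc p l.2.1 * l.1 * (2 * F.ratio l (t / l.1) *
          A.slope p (F.pos l (t / l.1)) (F.mom l (t / l.1)))) =
          2 * A.xc p (F.pos l (t / l.1)) * A.slope p (F.pos l (t / l.1)) (F.mom l (t / l.1)) := by
        rw [hXρ]; field_simp
      rw [h2, h3]
      simp only [Pi.inv_apply, smul_sub, smul_smul]
      match_scalars <;> field_simp <;> ring

theorem pos_of_fst_eq_zero (h : l.1 = 0) (s : ℝ) : F.pos l s = l.2.1 := by simp [pos, h]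

/-- For `r = 0` momentum and ratio are constant and `V` moves uniformly. Its value at `s = 1` gives
the derivative of the displacement at the zero covector. -/
theorem sol_of_fst_eq_zero (hl : l ∈ F.dom) (h : l.1 = 0) {s : ℝ} (hs : s ∈ Icc (0 : ℝ) 1) :
    F.mom l s = l.2.2 ∧ F.ratio l s = 1 ∧ (F.sol l s).1 = (2 * s) • A.raise p l.2.1 l.2.2 := by
  have h1 := constant_of_derivWithin_zero (fun u hu => (hasDeriv_mom hl hu).differentiableWithinAt)
    (fun u hu => ((hasDeriv_mom hl (Ico_subset_Icc_self hu)).derivWithin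
      (uniqueDiffOn_Icc one_pos u (Ico_subset_Icc_self hu))).trans (by rw [h, zero_smul]))
  have h2 := constant_of_derivWithin_zero (fun u hu => (hasDeriv_ratio hl hu).differentiableWithinAt)
    (fun u hu => ((hasDeriv_ratio hl (Ico_subset_Icc_self hu)).derivWithin
      (uniqueDiffOn_Icc one_pos u (Ico_subset_Icc_self hu))).trans (by rw [h, zero_mul]))
  rw [mom_zero hl] at h1
  rw [ratio_zero hl] at h2
  refine ⟨h1 s hs, h2 s hs, ?_⟩
  have hd : ∀ u ∈ Icc (0 : ℝ) 1, HasDerivWithinAt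
      (fun u => (F.sol l u).1 - (2 * u) • A.raise p l.2.1 l.2.2) 0 (Icc 0 1) u := fun u hu => by
    have h4 : HasDerivWithinAt (fun u : ℝ => (2 * u) • A.raise p l.2.1 l.2.2)
        ((2 * 1 : ℝ) • A.raise p l.2.1 l.2.2) (Icc 0 1) u :=
      ((hasDerivWithinAt_id u _).const_mul 2).smul_const _
    refine ((hasDeriv_fst hl hu).sub h4).congr_deriv ?_
    rw [h1 u hu, h2 u hu, pos_of_fst_eq_zero h, sub_self]
  have h3 := constant_of_derivWithin_zero (fun u hu => (hd u hu).differentiableWithinAt)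
    (fun u hu => (hd u (Ico_subset_Icc_self hu)).derivWithin
      (uniqueDiffOn_Icc one_pos u (Ico_subset_Icc_self hu))) s hs
  simp only [F.init l hl, mul_zero, zero_smul, sub_zero, sub_eq_zero] at h3
  exact h3

theorem point_param_of_eq {q : CotBundle n X} (hq : A.IsState q) (hp : q.proj ∈ F.nbhd) {r s : ℝ}
    (h1 : F.pos (A.param p r q) s = coord n p q.proj)
    (h2 : F.mom (A.param p r q) s = A.x q.proj • cotangentCoord p q.proj q.2) :
    F.point (A.param p r q) s = q := by
  have h3 : (F.point (A.param p r q) s).proj = q.proj := by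
    change chartInv p _ = _
    rw [h1, chartInv_coord hp.1]
  refine cot_ext (p := p) h3 (h3 ▸ hp.1) ?_
  have h4 : cotangentCoord p (F.point (A.param p r q) s).proj (F.point (A.param p r q) s).2 =
      (A.xc p (F.pos (A.param p r q) s))⁻¹ • F.mom (A.param p r q) s :=
    cotangentCoord_covec (h3 ▸ hp.1 : (F.point (A.param p r q) s).proj ∈ chartDom n p) _
  rw [h4, h1, h2, A.xc_coord hp.1, smul_smul, inv_mul_cancel₀ hq.1.ne', one_smul]

theorem point_zero {q : CotBundle n X} (hq : A.IsState q) (hp : q.proj ∈ F.nbhd) {r : ℝ}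
    (hr : |r| < F.ε) : F.point (A.param p r q) 0 = q :=
  point_param_of_eq hq hp (pos_zero (F.param_mem hq hp hr)) (mom_zero (F.param_mem hq hp hr))

theorem point_of_zero {q : CotBundle n X} (hq : A.IsState q) (hp : q.proj ∈ F.nbhd) {s : ℝ}
    (hs : s ∈ Icc (0 : ℝ) 1) : F.point (A.param p 0 q) s = q :=
  point_param_of_eq hq hp (pos_of_fst_eq_zero rfl s) (sol_of_fst_eq_zero (F.param_mem hq hp
    (by rw [abs_zero]; exact F.ε_pos)) rfl hs).1

theorem exists_segment {q : CotBundle n X} (hq : A.IsState q) (hp : q.proj ∈ F.nbhd) {r : ℝ}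
    (h0 : 0 < r) (hr : r < F.ε) :
    A.IsSegment (fun t => F.point (A.param p r q) (t / r)) (Icc 0 r) ∧
      F.point (A.param p r q) (0 / r) = q := by
  have hr' : |r| < F.ε := by rwa [abs_of_pos h0]
  refine ⟨isSegment_point (F.param_mem hq hp hr') h0 ?_ (quad_param hq hp.1 r), ?_⟩
  · change 0 < A.xc p (coord n p q.proj)
    rw [A.xc_coord hp.1]
    exact hq.1
  · rw [zero_div]
    exact point_zero hq hp hr'

theorem contDiffOn_pos (s : ℝ) (hs : s ∈ Icc (0 : ℝ) 1) :
    ContDiffOn ℝ ∞ (fun l => F.pos l s) F.dom := by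
  have hx : ContDiffOn ℝ ∞ (fun l : ℝ × EMod n × EMod n => A.xc p l.2.1) F.dom :=
    (A.contDiffOn_xc p).comp contDiff_snd.fst.contDiffOn fun l hl => mem_chartTgt hl
  exact (contDiff_snd.fst.contDiffOn).add ((hx.mul contDiff_fst.contDiffOn).smul (F.smooth s hs).fst)

theorem contDiffOn_mom (s : ℝ) (hs : s ∈ Icc (0 : ℝ) 1) :
    ContDiffOn ℝ ∞ (fun l => F.mom l s) F.dom := (F.smooth s hs).snd.fst

theorem continuousOn_point (s : ℝ) (hs : s ∈ Icc (0 : ℝ) 1) :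
    ContinuousOn (fun l => F.point l s) (F.dom ∩ {l | 0 < A.xc p l.2.1}) := by
  intro l hl
  have h1 := ((contDiffOn_pos (F := F) s hs).continuousOn.mono inter_subset_left) l hl
  have h2 := ((contDiffOn_mom (F := F) s hs).continuousOn.mono inter_subset_left) l hl
  have h3 : ContinuousWithinAt (fun l => A.xc p (F.pos l s)) (F.dom ∩ {l | 0 < A.xc p l.2.1}) l :=
    ContinuousWithinAt.comp (g := A.xc p) ((A.contDiffOn_xc p).continuousOn _ (pos_mem hl.1 hs)) h1
      fun l hl => pos_mem hl.1 hs
  have h4 : ContinuousWithinAt (fun l => chartInv p (F.pos l s)) (F.dom ∩ {l | 0 < A.xc p l.2.1}) l :=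
    ContinuousWithinAt.comp (g := chartInv p) (continuousOn_chartInv p _ (pos_mem hl.1 hs)) h1
      fun l hl => pos_mem hl.1 hs
  exact continuousAt_mk_covec h4 ((h3.inv₀ (xc_pos_pos hl.1 hs hl.2).ne').smul h2)
    (chartInv_mem (pos_mem hl.1 hs))

end LocalFlow

/-- A choice of a local flow around every point. -/
def localFlow (p : X) : A.LocalFlow p := Classical.choice (A.exists_localFlow p)

/-- Local flows exist around boundary points too, so compactness of `X` makes the existence time
independent of the distance to `∂X`. Completeness of the flow follows from this. -/
theorem exists_uniform_localFlow [CompactSpace X] :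
    ∃ ε > 0, ∀ z : X, ∃ p, z ∈ (A.localFlow p).nbhd ∧ ε < (A.localFlow p).ε := by
  obtain ⟨t, ht⟩ := isCompact_univ.elim_finite_subcover (fun p => (A.localFlow p).nbhd)
    (fun p => (A.localFlow p).isOpen_nbhd)
    (fun z _ => mem_iUnion.2 ⟨z, (A.localFlow z).mem_nbhd_self⟩)
  have h : ∃ ε > 0, ∀ p ∈ t, ε < (A.localFlow p).ε := by
    have := Filter.eventually_all_finset (l := 𝓝[>] (0 : ℝ)) t
      (p := fun p ε => ε < (A.localFlow p).ε)
    have h2 := (this.2 fun p _ => (eventually_lt_nhds (A.localFlow p).ε_pos).filter_mono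
      nhdsWithin_le_nhds).and self_mem_nhdsWithin
    obtain ⟨ε, h3, h4⟩ := h2.exists
    exact ⟨ε, h4, h3⟩
  obtain ⟨ε, hε, h⟩ := h
  refine ⟨ε, hε, fun z => ?_⟩
  obtain ⟨p, hp, hz⟩ := mem_iUnion₂.1 (ht (mem_univ z))
  exact ⟨p, hz, h p hp⟩

end AHMetric

/-! ### The global Hamilton flow and its continuity. -/

namespace AHMetric

variable {n : ℕ} {X : Type*} [TopologicalSpace X] [ChartedSpace (EuclideanHalfSpace (n + 1)) X]
  [IsManifold (halfModel n) ∞ X] {A : AHMetric n X}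

theorem exists_uniform_segment [CompactSpace X] (A : AHMetric n X) : ∃ ε > 0, ∀ q, A.IsState q →
    ∃ γ, A.IsSegment γ (Icc 0 ε) ∧ γ 0 = q := by
  obtain ⟨ε, hε, h⟩ := A.exists_uniform_localFlow
  refine ⟨ε, hε, fun q hq => ?_⟩
  obtain ⟨p, hp, hlt⟩ := h q.proj
  exact ⟨_, LocalFlow.exists_segment hq hp hε hlt⟩

/-- Segments of the uniform length `ε` are concatenated, each starting at the end state of the
previous one. -/
theorem exists_forward_segment [CompactSpace X] {q : CotBundle n X} (hq : A.IsState q) :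
    ∃ γ, A.IsSegment γ (Ici 0) ∧ γ 0 = q := by
  obtain ⟨ε, hε, h⟩ := A.exists_uniform_segment
  choose! c hc hc0 using h
  let nxt : {q // A.IsState q} → {q // A.IsState q} := fun q =>
    ⟨c q ε, (hc q q.2).isState ⟨hε.le, le_rfl⟩⟩
  let st : ℕ → {q // A.IsState q} := fun k => nxt^[k] ⟨q, hq⟩
  have hst : ∀ k, (st (k + 1) : CotBundle n X) = c (st k) ε := fun k => by
    simp only [st, Function.iterate_succ_apply']
    rfl
  let γ : ℝ → CotBundle n X := fun t => c (st ⌊t / ε⌋₊) (t - ⌊t / ε⌋₊ * ε)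
  have hγ : ∀ k : ℕ, ∀ t ∈ Icc (k * ε) ((k + 1) * ε), γ t = c (st k) (t - k * ε) := by
    intro k t ht
    rcases ht.2.lt_or_eq with h1 | h1
    · have h2 : ⌊t / ε⌋₊ = k := by
        rw [Nat.floor_eq_iff (div_nonneg (le_trans (by positivity) ht.1) hε.le)]
        exact ⟨(le_div_iff₀ hε).2 ht.1, (div_lt_iff₀ hε).2 h1⟩
      simp only [γ, h2]
    · have h2 : t / ε = ((k + 1 : ℕ) : ℝ) := by
        rw [h1]; push_cast; field_simp
      have h3 : ⌊t / ε⌋₊ = k + 1 := by rw [h2, Nat.floor_natCast]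
      simp only [γ, h3]
      have h4 : t - ((k + 1 : ℕ) : ℝ) * ε = 0 := by rw [h1]; push_cast; ring
      have h5 : t - k * ε = ε := by rw [h1]; ring
      rw [h4, h5, hc0 _ (st (k + 1)).2, hst]
  have hseg : ∀ k : ℕ, A.IsSegment γ (Icc (k * ε) ((k + 1) * ε)) := fun k => by
    have h1 := (hc (st k) (st k).2).shift (-(k * ε))
    refine (h1.mono fun t ht => ?_).congr fun t ht => by simp only [hγ k t ht, sub_eq_add_neg]
    exact ⟨by linarith [ht.1], by linarith [ht.2]⟩
  refine ⟨γ, IsSegment.glue fun t ht => ?_, ?_⟩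
  · have ht0 : 0 ≤ t / ε := div_nonneg ht hε.le
    have hI : t ∈ Ico ((⌊t / ε⌋₊ : ℝ) * ε) ((⌊t / ε⌋₊ + 1) * ε) :=
      ⟨(le_div_iff₀ hε).1 (Nat.floor_le ht0), (div_lt_iff₀ hε).1 (Nat.lt_floor_add_one _)⟩
    have hS₂ : Icc ((⌊t / ε⌋₊ : ℝ) * ε) ((⌊t / ε⌋₊ + 1) * ε) ∈ 𝓝[Ici 0 ∩ Ici t] t :=
      nhdsWithin_mono _ inter_subset_right (Icc_mem_nhdsGE_of_mem hI)
    rcases (mem_Ici.1 ht).eq_or_lt with h0 | h0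
    · refine ⟨_, _, hseg 0, hseg ⌊t / ε⌋₊, ?_, Ico_subset_Icc_self hI, ?_, hS₂⟩
      · rw [← h0]; simp [hε.le]
      · refine mem_of_superset self_mem_nhdsWithin fun u hu => ?_
        have : u = 0 := le_antisymm (hu.2.trans h0.symm.le) hu.1
        simp [this, hε.le]
    -- To the left of `t` the relevant piece has index `⌈t / ε⌉ - 1`, which differs from `⌊t / ε⌋`
    -- exactly at the multiples of `ε`.
    · have hpos : 0 < ⌈t / ε⌉₊ := Nat.ceil_pos.2 (div_pos h0 hε)
      obtain ⟨j, hj⟩ := Nat.exists_eq_succ_of_ne_zero hpos.ne'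
      have hJ : t ∈ Ioc ((j : ℝ) * ε) ((j + 1) * ε) := by
        constructor
        · have h2 : j < ⌈t / ε⌉₊ := by omega
          exact (lt_div_iff₀ hε).1 (Nat.lt_ceil.1 h2)
        · have h2 := Nat.le_ceil (t / ε)
          rw [hj] at h2
          push_cast at h2
          exact (div_le_iff₀ hε).1 h2
      exact ⟨_, _, hseg j, hseg ⌊t / ε⌋₊, Ioc_subset_Icc_self hJ, Ico_subset_Icc_self hI,
        nhdsWithin_mono _ inter_subset_right (Icc_mem_nhdsLE_of_mem hJ), hS₂⟩
  · have h1 := hγ 0 0 (by simp [hε.le])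
    rw [h1]
    simp only [Nat.cast_zero, zero_mul, sub_zero]
    rw [hc0 _ (st 0).2]
    rfl

/-- Every unit covector over the interior lies on a bicharacteristic. -/
theorem exists_isSegment_univ [CompactSpace X] {q : CotBundle n X} (hq : A.IsState q) :
    ∃ γ, A.IsSegment γ univ ∧ γ 0 = q := by
  obtain ⟨γ₁, h1, h10⟩ := exists_forward_segment hq
  obtain ⟨γ₂, h2, h20⟩ := exists_forward_segment hq.neg
  -- Backward time is forward time for the reflected covector.
  have h2' : A.IsSegment (fun t => cotNeg (γ₂ (-t))) (Iic 0) :=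
    h2.reverse.mono fun t ht => show 0 ≤ -t from neg_nonneg.2 ht
  let γ : ℝ → CotBundle n X := fun t => if 0 ≤ t then γ₁ t else cotNeg (γ₂ (-t))
  have e1 : A.IsSegment γ (Ici 0) := h1.congr fun t ht => if_pos ht
  have e2 : A.IsSegment γ (Iic 0) := h2'.congr fun t ht => by
    rcases (mem_Iic.1 ht).eq_or_lt with h | h
    · simp only [γ, h, le_refl, if_true, neg_zero, h10, h20, cotNeg_cotNeg]
    · simp only [γ, not_le.2 h, if_false]
  refine ⟨γ, IsSegment.glue fun t _ => ?_, by simp [γ, h10]⟩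
  simp only [univ_inter]
  rcases lt_trichotomy t 0 with h | h | h
  · exact ⟨_, _, e2, e2, h.le, h.le, mem_nhdsWithin_of_mem_nhds (Iic_mem_nhds h),
      mem_nhdsWithin_of_mem_nhds (Iic_mem_nhds h)⟩
  · subst h
    exact ⟨_, _, e2, e1, self_mem_Iic, self_mem_Ici, self_mem_nhdsWithin, self_mem_nhdsWithin⟩
  · exact ⟨_, _, e1, e1, h.le, h.le, mem_nhdsWithin_of_mem_nhds (Ici_mem_nhds h),
      mem_nhdsWithin_of_mem_nhds (Ici_mem_nhds h)⟩

open Classical in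
variable (A) in
/-- The Hamilton flow. -/
def flow (q : CotBundle n X) : ℝ → CotBundle n X :=
  if h : ∃ γ, A.IsSegment γ univ ∧ γ 0 = q then h.choose else fun _ => q

theorem isSegment_flow [CompactSpace X] {q : CotBundle n X} (hq : A.IsState q) :
    A.IsSegment (A.flow q) univ := by
  have h := exists_isSegment_univ hq
  rw [flow, dif_pos h]
  exact h.choose_spec.1

theorem flow_zero [CompactSpace X] {q : CotBundle n X} (hq : A.IsState q) : A.flow q 0 = q := by
  have h := exists_isSegment_univ hq
  rw [flow, dif_pos h]
  exact h.choose_spec.2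

variable [T2Space X]

theorem eq_flow [CompactSpace X] {γ : ℝ → CotBundle n X} {T : ℝ} (h : A.IsSegment γ (Icc 0 T))
    {t : ℝ} (ht : t ∈ Icc 0 T) : γ t = A.flow (γ 0) t := by
  have h0 : A.IsState (γ 0) := h.isState ⟨le_rfl, ht.1.trans ht.2⟩
  exact h.eqOn ((isSegment_flow h0).mono (subset_univ _)) (flow_zero h0).symm ht

theorem flow_flow [CompactSpace X] {q : CotBundle n X} (hq : A.IsState q) {s t : ℝ} (ht : 0 ≤ t) :
    A.flow (A.flow q s) t = A.flow q (t + s) := by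
  have h := ((isSegment_flow hq).shift s).mono (S' := Icc 0 t) (by simp)
  have h1 := eq_flow h ⟨ht, le_rfl⟩
  simpa using h1.symm

theorem flow_eq_point [CompactSpace X] {p : X} {F : A.LocalFlow p} {q : CotBundle n X}
    (hq : A.IsState q) (hp : q.proj ∈ F.nbhd) {t : ℝ} (h0 : 0 ≤ t) (ht : t < F.ε) :
    A.flow q t = F.point (A.param p t q) 1 := by
  rcases h0.eq_or_lt with rfl | h0
  · rw [flow_zero hq, LocalFlow.point_of_zero hq hp ⟨zero_le_one, le_rfl⟩]
  · obtain ⟨h1, h2⟩ := LocalFlow.exists_segment hq hp h0 ht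
    have h3 := eq_flow h1 ⟨h0.le, le_rfl⟩
    simp only [h2, div_self h0.ne'] at h3
    exact h3.symm

/-- For short times the flow is `LocalFlow.point`, which is continuous in its parameters, and these
times are uniform by compactness. -/
theorem continuousOn_flow_of_le [CompactSpace X] (A : AHMetric n X) : ∃ ε > 0,
    ContinuousOn (fun u : ℝ × CotBundle n X => A.flow u.2 u.1) (Icc 0 ε ×ˢ {q | A.IsState q}) := by
  obtain ⟨ε, hε, h⟩ := A.exists_uniform_localFlow
  refine ⟨ε, hε, fun u hu => ?_⟩
  obtain ⟨p, hp, hlt⟩ := h u.2.proj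
  set F := A.localFlow p
  have hev : ∀ᶠ w : ℝ × CotBundle n X in 𝓝[Icc 0 ε ×ˢ {q | A.IsState q}] u, w.2.proj ∈ F.nbhd :=
    nhdsWithin_le_nhds ((continuous_cot_proj.comp continuous_snd).continuousAt.preimage_mem_nhds
      (F.isOpen_nbhd.mem_nhds hp))
  have hlast : (1 : ℝ) ∈ Icc (0 : ℝ) 1 := ⟨zero_le_one, le_rfl⟩
  have hmem : ∀ w : ℝ × CotBundle n X, w ∈ Icc 0 ε ×ˢ {q | A.IsState q} → w.2.proj ∈ F.nbhd →
      A.param p w.1 w.2 ∈ F.dom ∩ {l | 0 < A.xc p l.2.1} := fun w hw hwp => by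
    refine ⟨F.param_mem hw.2 hwp (by rw [abs_of_nonneg hw.1.1]; exact hw.1.2.trans_lt hlt), ?_⟩
    change 0 < A.xc p (coord n p w.2.proj)
    rw [A.xc_coord hwp.1]
    exact hw.2.1
  have h1 : ContinuousWithinAt (fun w : ℝ × CotBundle n X => A.param p w.1 w.2)
      (Icc 0 ε ×ˢ {q | A.IsState q}) u := by
    refine ContinuousAt.continuousWithinAt ?_
    refine continuousAt_fst.prodMk (ContinuousAt.prodMk ?_ (ContinuousAt.fun_smul ?_ ?_))
    · exact ContinuousAt.comp (g := coord n p) (f := fun w : ℝ × CotBundle n X => w.2.proj)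
        (continuousAt_coord hp.1) (continuous_cot_proj.comp continuous_snd).continuousAt
    · exact (A.x_smooth.continuous.comp (continuous_cot_proj.comp continuous_snd)).continuousAt
    · exact ContinuousAt.comp (g := fun q : CotBundle n X => cotangentCoord p q.proj q.2)
        (continuousAt_cotangentCoord hp.1) continuousAt_snd
  have h2 : ContinuousWithinAt (fun w : ℝ × CotBundle n X => F.point (A.param p w.1 w.2) 1)
      (Icc 0 ε ×ˢ {q | A.IsState q}) u := by
    refine Tendsto.comp (LocalFlow.continuousOn_point 1 hlast _ (hmem u hu hp))
      (tendsto_nhdsWithin_iff.2 ⟨h1, ?_⟩)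
    filter_upwards [hev, self_mem_nhdsWithin] with w hw1 hw2 using hmem w hw2 hw1
  refine h2.congr_of_eventuallyEq ?_ (flow_eq_point hu.2 hp hu.1.1 (hu.1.2.trans_lt hlt))
  filter_upwards [hev, self_mem_nhdsWithin] with w hw1 hw2
  exact flow_eq_point hw2.2 hw1 hw2.1.1 (hw2.1.2.trans_lt hlt)

/-- The Hamilton flow is continuous in forward time. -/
theorem continuousOn_flow [CompactSpace X] (A : AHMetric n X) :
    ContinuousOn (fun u : ℝ × CotBundle n X => A.flow u.2 u.1) (Ici 0 ×ˢ {q | A.IsState q}) := by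
  obtain ⟨ε, hε, h⟩ := A.continuousOn_flow_of_le
  -- The group law doubles the time interval on which continuity is known.
  have key : ∀ k : ℕ, ContinuousOn (fun u : ℝ × CotBundle n X => A.flow u.2 u.1)
      (Icc 0 (2 ^ k * ε) ×ˢ {q | A.IsState q}) := by
    intro k
    induction k with
    | zero => simpa using h
    | succ k ih =>
      have hm : MapsTo (fun u : ℝ × CotBundle n X => (u.1 / 2, u.2))
          (Icc 0 (2 ^ (k + 1) * ε) ×ˢ {q | A.IsState q}) (Icc 0 (2 ^ k * ε) ×ˢ {q | A.IsState q}) :=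
        fun u hu => ⟨⟨by linarith [hu.1.1], by have := hu.1.2; rw [pow_succ] at this; linarith⟩, hu.2⟩
      have h1 : ContinuousOn (fun u : ℝ × CotBundle n X => A.flow u.2 (u.1 / 2))
          (Icc 0 (2 ^ (k + 1) * ε) ×ˢ {q | A.IsState q}) := ih.comp (by fun_prop) hm
      have h2 : ContinuousOn (fun u : ℝ × CotBundle n X => A.flow (A.flow u.2 (u.1 / 2)) (u.1 / 2))
          (Icc 0 (2 ^ (k + 1) * ε) ×ˢ {q | A.IsState q}) :=
        ih.comp (f := fun u : ℝ × CotBundle n X => (u.1 / 2, A.flow u.2 (u.1 / 2)))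
          ((by fun_prop : ContinuousOn (fun u : ℝ × CotBundle n X => u.1 / 2) _).prodMk h1)
          fun u hu => ⟨(hm hu).1, (isSegment_flow hu.2).isState (mem_univ _)⟩
      refine h2.congr fun u hu => ?_
      beta_reduce
      rw [flow_flow hu.2 (show 0 ≤ u.1 / 2 from (hm hu).1.1), add_halves]
  intro u hu
  obtain ⟨k, hk⟩ := pow_unbounded_of_one_lt (u.1 / ε) (one_lt_two (α := ℝ))
  have hlt : u.1 < 2 ^ k * ε := (div_lt_iff₀ hε).1 hk
  refine (key k u ⟨⟨hu.1, hlt.le⟩, hu.2⟩).mono_of_mem_nhdsWithin ?_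
  have : ∀ᶠ w : ℝ × CotBundle n X in 𝓝[Ici 0 ×ˢ {q | A.IsState q}] u, w.1 < 2 ^ k * ε :=
    nhdsWithin_le_nhds (continuousAt_fst.eventually_lt_const hlt)
  filter_upwards [this, self_mem_nhdsWithin] with w hw1 hw2
  exact ⟨⟨hw2.1, hw1.le⟩, hw2.2⟩

/-- The element of `^ΦT^*X²₀` over the interior defined by a pair of covectors, the second of which
enters with the opposite sign. -/
def phiPair (A : AHMetric n X) (s s' : CotBundle n X) (h : 0 < A.x s.proj) : A.PhiCotangent :=
  ⟨DoubleSpace.off s.proj s'.proj fun hb => h.ne' ((A.x_eq_zero _).2 hb.2),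
    A.x s.proj • s.2, -(A.x s'.proj • s'.2)⟩

/-- The forward bicharacteristic relation in terms of the Hamilton flow. -/
theorem mem_FBR_iff [CompactSpace X] {q : A.PhiCotangent} : q ∈ A.FBR ↔
    ∃ (s : CotBundle n X) (T : ℝ) (hs : A.IsState s), 0 ≤ T ∧
      q = A.phiPair (A.flow s T) s ((isSegment_flow hs).isState (mem_univ T)).1 := by
  constructor
  · rintro ⟨γ, T, hγ, hT, h, rfl⟩
    rw [isBicharacteristic_iff_isSegment] at hγ
    have h1 := eq_flow (hγ.mono (subset_univ (Icc 0 T))) ⟨hT, le_rfl⟩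
    refine ⟨γ 0, T, hγ.isState (mem_univ _), hT, ?_⟩
    change A.phiPair (γ T) (γ 0) (hγ.x_pos T (mem_univ _)) = _
    congr 1
  · rintro ⟨s, T, hs, hT, rfl⟩
    have h0 : A.phiPair (A.flow s T) s ((isSegment_flow hs).isState (mem_univ T)).1 =
        A.phiPair (A.flow s T) (A.flow s 0) ((isSegment_flow hs).isState (mem_univ T)).1 := by
      congr 1
      exact (flow_zero hs).symm
    rw [h0]
    exact ⟨A.flow s, T, (isBicharacteristic_iff_isSegment A _).2 (isSegment_flow hs), hT, _, rfl⟩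

end AHMetric

/-! ### Coordinates on the blown-up double space and on its bundle. -/

namespace AHMetric

variable {n : ℕ} {X : Type*} [TopologicalSpace X] [ChartedSpace (EuclideanHalfSpace (n + 1)) X]
  [IsManifold (halfModel n) ∞ X] (A : AHMetric n X)

/-- The manifold derivative is computed within the range of the model and `gradX` within the chart
target; at points of the target the two agree. -/
theorem mfderiv_x_frame {p z : X} (hz : z ∈ chartDom n p) (V : EMod n) :
    mfderiv (halfModel n) 𝓘(ℝ, ℝ) A.x z (frame p z V) = inner ℝ (A.gradX p (coord n p z)) V := by
  have hv := coord_mem hz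
  have hT : chartTgt n p ∈ 𝓝[halfSpace n] (coord n p z) :=
    mem_of_superset (transDom_nhdsWithin (coord_mem_transDom hz hz)) fun w hw => hw.1
  have h1 : fderivWithin ℝ (A.xc p) (chartTgt n p) (coord n p z) =
      fderivWithin ℝ (A.xc p) (halfSpace n) (coord n p z) := by
    refine fderivWithin_of_mem_nhdsWithin ?_ (uniqueDiffOn_chartTgt p _ hv) ?_
    · exact mem_of_superset self_mem_nhdsWithin (chartTgt_subset p)
    · exact ((((A.contDiffOn_xc p).differentiableOn (by simp)) _ hv)).mono_of_mem_nhdsWithin hT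
  rw [inner_gradX, h1, ← range_halfModel]
  have h2 : (frame p z : EMod n →L[ℝ] TangentSpace (halfModel n) z) = _ :=
    TangentBundle.symmL_trivializationAt (I := halfModel n) hz
  have hzs : (extChartAt (halfModel n) p).symm (extChartAt (halfModel n) p z) = z :=
    chartInv_coord hz
  have hu : UniqueMDiffWithinAt 𝓘(ℝ, EMod n) (range (halfModel n)) (coord n p z) :=
    ((halfModel n).uniqueDiffOn _ (mem_range_self _)).uniqueMDiffWithinAt
  have h3 := mfderiv_comp_mfderivWithin_of_eq (I := 𝓘(ℝ, EMod n)) (I' := halfModel n)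
    (I'' := 𝓘(ℝ, ℝ)) (g := A.x)
    (f := (extChartAt (halfModel n) p).symm) (y := z)
    (A.x_smooth.mdifferentiableAt (by simp)) (mdifferentiableWithinAt_extChartAt_symm hv) hu hzs
  rw [mfderivWithin_eq_fderivWithin] at h3
  have h4 : fderivWithin ℝ (A.xc p) (range (halfModel n)) (coord n p z) = _ := h3
  rw [h4, h2]
  rfl

theorem cotangentCoord_mfderiv_x {p z : X} (hz : z ∈ chartDom n p) :
    cotangentCoord p z (mfderiv (halfModel n) 𝓘(ℝ, ℝ) A.x z) = A.gradX p (coord n p z) := by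
  refine ext_inner_right ℝ fun a => ?_
  exact (inner_cotangentCoord p z _ a).trans (A.mfderiv_x_frame hz a)

theorem quad_gradX {p z : X} (hz : z ∈ chartDom n p) (hb : z ∈ (halfModel n).boundary X) :
    A.quad p (coord n p z) (A.gradX p (coord n p z)) = 1 := by
  rw [← A.cotangentCoord_mfderiv_x hz]
  exact (A.dualNormSq_compactMetric hz _).symm.trans (A.dx_norm z hb)

theorem dx_frame {p z : X} (hz : z ∈ chartDom n p) (V : EMod n) :
    A.dx z (frame p z V) = inner ℝ (A.gradX p (coord n p z)) V := A.mfderiv_x_frame hz V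

namespace DoubleSpace

variable {A}

/-- The angular variables of polar coordinates around `∂diag`. -/
def polarCoord (p : X) (b : A.DoubleSpace) : ℝ × EMod n := ‖normalCoord p b‖⁻¹ • normalCoord p b

theorem continuous_blowdown : Continuous (fun b : A.DoubleSpace => (b.left, b.right)) :=
  continuous_def.2 fun O hO =>
    TopologicalSpace.isOpen_generateFrom_of_mem (Or.inl ⟨O, hO, rfl⟩)

theorem continuous_left : Continuous (left : A.DoubleSpace → X) :=
  continuous_fst.comp continuous_blowdown

theorem continuous_right : Continuous (right : A.DoubleSpace → X) :=
  continuous_snd.comp continuous_blowdown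

theorem isOpen_overChart (p : X) : IsOpen (overChart p : Set A.DoubleSpace) :=
  ((isOpen_chartDom p).preimage continuous_left).inter
    ((isOpen_chartDom p).preimage continuous_right)

theorem continuousOn_polarCoord (p : X) :
    ContinuousOn (polarCoord p) (overChart p : Set A.DoubleSpace) :=
  (continuousOn_open_iff (isOpen_overChart p)).2 fun O hO =>
    TopologicalSpace.isOpen_generateFrom_of_mem (Or.inr ⟨p, O, hO, rfl⟩)

theorem normalCoord_fst_pos {p : X} {b : A.DoubleSpace} :
    0 < (normalCoord p b).1 ↔ b ∉ (FR : Set A.DoubleSpace) := by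
  cases b with
  | off z z' h =>
    change 0 < A.x z' ↔ ¬ z' ∈ (halfModel n).boundary X
    rw [← A.x_eq_zero]
    exact ⟨fun h => h.ne', fun h => (A.x_nonneg z').lt_of_ne' h⟩
  | front q hq a w ha hw hu =>
    change 0 < a ↔ ¬ a = 0
    exact ⟨fun h => h.ne', fun h => ha.lt_of_ne' h⟩

/-- Off `FR` the first angular variable is positive, and angular variables are continuous for the
blow-up topology; hence `projDom` is open. -/
theorem projDom_eq (p : X) : (projDom p : Set A.DoubleSpace) =
    overChart p ∩ polarCoord p ⁻¹' {y | 0 < y.1} := by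
  ext b
  rw [projDom, Set.mem_sdiff, ← normalCoord_fst_pos (p := p)]
  refine and_congr_right fun _ => ?_
  change _ ↔ 0 < ‖normalCoord p b‖⁻¹ * (normalCoord p b).1
  constructor
  · intro h
    have : 0 < ‖normalCoord p b‖ := norm_pos_iff.2 fun h0 => by simp [h0] at h
    positivity
  · intro h
    exact pos_of_mul_pos_right h (inv_nonneg.2 (norm_nonneg _))

theorem isOpen_projDom (p : X) : IsOpen (projDom p : Set A.DoubleSpace) := by
  rw [projDom_eq]
  exact (continuousOn_polarCoord p).isOpen_inter_preimage (isOpen_overChart p)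
    (isOpen_lt continuous_const continuous_fst)

/-- Projective coordinates are quotients of angular variables, in which the normalizing factor
cancels. -/
theorem continuousOn_projCoord (p : X) :
    ContinuousOn (projCoord p) (projDom p : Set A.DoubleSpace) := by
  have h1 : ContinuousOn (fun b : A.DoubleSpace => coord n p b.right) (projDom p) :=
    (continuousOn_coord p).comp continuous_right.continuousOn fun b hb => hb.1.2
  have h2 : ContinuousOn (polarCoord p) (projDom p : Set A.DoubleSpace) :=
    (continuousOn_polarCoord p).mono sdiff_subset
  have h3 : ∀ b ∈ (projDom p : Set A.DoubleSpace), (polarCoord p b).1 ≠ 0 := fun b hb => by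
    rw [projDom_eq] at hb
    exact hb.2.ne'
  refine (h1.prodMk ((h2.fst.inv₀ h3).smul h2.snd)).congr fun b hb => ?_
  refine Prod.ext rfl ?_
  have h4 := h3 b hb
  change (‖normalCoord p b‖⁻¹ * (normalCoord p b).1) ≠ 0 at h4
  change (normalCoord p b).1⁻¹ • (normalCoord p b).2 =
    (‖normalCoord p b‖⁻¹ * (normalCoord p b).1)⁻¹ • (‖normalCoord p b‖⁻¹ • (normalCoord p b).2)
  have h5 : ‖normalCoord p b‖⁻¹ ≠ 0 := left_ne_zero_of_mul h4
  rw [smul_smul, mul_inv, mul_comm ‖normalCoord p b‖⁻¹⁻¹, mul_assoc, inv_mul_cancel₀ h5, mul_one]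

theorem tangentCoord_smul (p z : X) (c : ℝ) (w : TangentSpace (halfModel n) z) :
    tangentCoord p z (c • w) = c • tangentCoord p z w := map_smul _ _ _

theorem injOn_projCoord (p : X) : InjOn (projCoord p) (projDom p : Set A.DoubleSpace) := by
  intro b hb b' hb' he
  have he1 : b.right = b'.right := coord_injOn hb.1.2 hb'.1.2 (congrArg Prod.fst he)
  have he2 : (normalCoord p b).1⁻¹ • (normalCoord p b).2 =
    (normalCoord p b').1⁻¹ • (normalCoord p b').2 := congrArg Prod.snd he
  have hp := (normalCoord_fst_pos (p := p)).2 hb.2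
  have hp' := (normalCoord_fst_pos (p := p)).2 hb'.2
  cases b with
  | off z z' h =>
    cases b' with
    | off y y' h' =>
      obtain rfl : z' = y' := he1
      have h1 : coord n p z - coord n p z' = coord n p y - coord n p z' :=
        smul_right_injective _ (inv_ne_zero hp.ne') he2
      have h2 : z = y := coord_injOn hb.1.1 hb'.1.1 (by simpa using h1)
      subst h2
      rfl
    | front q hq a w ha hw hu =>
      obtain rfl : z' = q := he1
      exact absurd ((A.x_eq_zero _).2 hq) hp.ne'
  | front q hq a w ha hw hu =>
    cases b' with
    | off y y' h' =>
      obtain rfl : q = y' := he1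
      exact absurd ((A.x_eq_zero _).2 hq) hp'.ne'
    | front q' hq' a' w' ha' hw' hu' =>
      obtain rfl : q = q' := he1
      change a⁻¹ • tangentCoord p q w = a'⁻¹ • tangentCoord p q w' at he2
      change 0 < a at hp
      change 0 < a' at hp'
      have h1 : a⁻¹ • w = a'⁻¹ • w' := by
        rw [← tangentCoord_smul, ← tangentCoord_smul] at he2
        have hq0 : q ∈ chartDom n p := hb.1.1
        rw [← frame_tangentCoord hq0 (a⁻¹ • w), he2, frame_tangentCoord hq0]
      have h2 : w = (a * a'⁻¹) • w' := by
        rw [mul_smul, ← h1, smul_smul, mul_inv_cancel₀ hp.ne', one_smul]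
      -- Proportional vectors of unit length with positive first entries coincide.
      have h3 : a ^ 2 = a' ^ 2 := by
        have h4 : A.compactMetric q w w = (a * a'⁻¹) ^ 2 * A.compactMetric q w' w' := by
          rw [h2]
          simp only [compactMetric, map_smul, smul_apply, smul_eq_mul]
          ring
        have h5 : A.compactMetric q w' w' = 1 - a' ^ 2 := by linarith
        rw [h4, h5] at hu
        field_simp at hu
        nlinarith
      obtain rfl : a = a' := (pow_left_inj₀ ha ha' two_ne_zero).1 h3
      have h6 : w = w' := by rw [h2, mul_inv_cancel₀ hp.ne', one_smul]
      subst h6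
      rfl

end DoubleSpace

theorem continuous_phiEmbed : Continuous (fun q : A.PhiCotangent =>
    (q.base, (⟨q.base.left, q.α⟩ : CotBundle n X), (⟨q.base.right, q.α'⟩ : CotBundle n X))) :=
  continuous_induced_dom

theorem continuous_base : Continuous (PhiCotangent.base : A.PhiCotangent → A.DoubleSpace) :=
  A.continuous_phiEmbed.fst

theorem continuous_leftCovec :
    Continuous (fun q : A.PhiCotangent => (⟨q.base.left, q.α⟩ : CotBundle n X)) :=
  A.continuous_phiEmbed.snd.fst

theorem continuous_rightCovec :
    Continuous (fun q : A.PhiCotangent => (⟨q.base.right, q.α'⟩ : CotBundle n X)) :=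
  A.continuous_phiEmbed.snd.snd

theorem isOpen_phiDom (p : X) : IsOpen (A.phiDom p) :=
  (DoubleSpace.isOpen_projDom p).preimage A.continuous_base

theorem continuousAt_phiCoord {p : X} {q : A.PhiCotangent} (hq : q ∈ A.phiDom p) :
    ContinuousAt (A.phiCoord p) q := by
  have h1 : ContinuousAt (fun q : A.PhiCotangent => DoubleSpace.projCoord p q.base) q :=
    ContinuousAt.comp (g := DoubleSpace.projCoord p) ((DoubleSpace.continuousOn_projCoord p).continuousAt
      ((DoubleSpace.isOpen_projDom p).mem_nhds hq)) A.continuous_base.continuousAt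
  refine h1.prodMk (ContinuousAt.prodMk ?_ ?_)
  · exact ContinuousAt.comp (g := fun s : CotBundle n X => cotangentCoord p s.proj s.2)
      (f := fun q : A.PhiCotangent => (⟨q.base.left, q.α⟩ : CotBundle n X))
      (continuousAt_cotangentCoord (s := ⟨q.base.left, q.α⟩) hq.1.1) A.continuous_leftCovec.continuousAt
  · exact ContinuousAt.comp (g := fun s : CotBundle n X => cotangentCoord p s.proj s.2)
      (f := fun q : A.PhiCotangent => (⟨q.base.right, q.α'⟩ : CotBundle n X))
      (continuousAt_cotangentCoord (s := ⟨q.base.right, q.α'⟩) hq.1.2)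
      A.continuous_rightCovec.continuousAt

theorem injOn_phiCoord (p : X) : InjOn (A.phiCoord p) (A.phiDom p) := by
  intro q hq q' hq' he
  have h1 : q.base = q'.base := DoubleSpace.injOn_projCoord p hq hq' (congrArg Prod.fst he)
  obtain ⟨b, α, α'⟩ := q
  obtain ⟨b', β, β'⟩ := q'
  obtain rfl : b = b' := h1
  have h2 := congrArg Prod.snd he
  have h3 : α = β := cotangentCoord_injective hq.1.1 (congrArg Prod.fst h2)
  have h4 : α' = β' := cotangentCoord_injective hq.1.2 (congrArg Prod.snd h2)
  rw [h3, h4]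

end AHMetric

/-! ### Functions that are convex where they are large. -/

section Growth

/-- A function whose derivative is nonnegative increases once it is large and increasing, provided
that it is convex where it is large. -/
theorem le_of_convex_of_large {f g h : ℝ → ℝ} {L T₀ : ℝ} (hf : ∀ t, HasDerivAt f (g t) t)
    (hg : ∀ t, HasDerivAt g (h t) t) (hL : ∀ t, L < f t → 0 ≤ h t) (h0 : L < f T₀) (h1 : 0 < g T₀)
    {t : ℝ} (ht : T₀ ≤ t) : f T₀ ≤ f t := by
  have hfc : Continuous f := continuous_iff_continuousAt.2 fun t => (hf t).continuousAt
  have hgc : Continuous g := continuous_iff_continuousAt.2 fun t => (hg t).continuousAt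
  have key : Icc T₀ t ⊆ {u | f T₀ ≤ f u ∧ g T₀ ≤ g u} := by
    -- Continuous induction on the times at which `f` and `g` are not below their values at `T₀`. At
    -- such a time `f > L`, so `g` is nondecreasing for a while, hence positive, and then `f` is
    -- nondecreasing too.
    refine IsClosed.Icc_subset_of_forall_mem_nhdsWithin ?_ ⟨le_rfl, le_rfl⟩ ?_
    · exact ((isClosed_le continuous_const hfc).inter (isClosed_le continuous_const hgc)).inter
        isClosed_Icc
    · rintro x ⟨⟨hx1, hx2⟩, -⟩
      have hev : ∀ᶠ y in 𝓝[≥] x, L < f y :=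
        nhdsWithin_le_nhds (hfc.continuousAt.eventually_const_lt (h0.trans_le hx1))
      obtain ⟨b, hb, hbs⟩ := mem_nhdsGE_iff_exists_Icc_subset.1 hev
      have hgm : MonotoneOn g (Icc x b) := monotoneOn_of_deriv_nonneg (convex_Icc _ _)
        hgc.continuousOn (fun y _ => (hg y).differentiableAt.differentiableWithinAt)
        fun y hy => by
          rw [(hg y).deriv]
          exact hL y (hbs (interior_subset hy))
      have hgx : ∀ y ∈ Icc x b, g x ≤ g y := fun y hy => hgm ⟨le_rfl, hy.1.trans hy.2⟩ hy hy.1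
      have hfm : MonotoneOn f (Icc x b) := monotoneOn_of_deriv_nonneg (convex_Icc _ _)
        hfc.continuousOn (fun y _ => (hf y).differentiableAt.differentiableWithinAt)
        fun y hy => by
          rw [(hf y).deriv]
          linarith [hgx y (interior_subset hy)]
      refine mem_of_superset (Icc_mem_nhdsGT hb) fun y hy => ⟨hx1.trans ?_, hx2.trans (hgx y hy)⟩
      exact hfm ⟨le_rfl, hy.1.trans hy.2⟩ hy hy.1
  exact (key ⟨ht, le_rfl⟩).1

/-- Before the first time at which `f ≤ L` the derivative is not positive, by
`le_of_convex_of_large`. Then `h ≥ 2 f` makes `g² - 2 f²` nonincreasing, and comparison with that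
time gives `g(0)² ≥ 2 f(0)² - 2 L² ≥ f(0)²`. -/
theorem deriv_le_neg_of_exists_le {f g h : ℝ → ℝ} {L : ℝ} (hf : ∀ t, HasDerivAt f (g t) t)
    (hg : ∀ t, HasDerivAt g (h t) t) (hpos : ∀ t, 0 < f t) (hL0 : 0 < L)
    (hL : ∀ t, L < f t → 2 * f t ≤ h t) (h0 : 2 * L ≤ f 0) {t : ℝ} (ht : 0 ≤ t) (hft : f t ≤ L) :
    g 0 ≤ -f 0 := by
  have hfc : Continuous f := continuous_iff_continuousAt.2 fun t => (hf t).continuousAt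
  have hgc : Continuous g := continuous_iff_continuousAt.2 fun t => (hg t).continuousAt
  set S : Set ℝ := {u | 0 ≤ u ∧ f u ≤ L} with hS
  have hSc : IsClosed S := (isClosed_le continuous_const continuous_id).inter
    (isClosed_le hfc continuous_const)
  have hSb : BddBelow S := ⟨0, fun u hu => hu.1⟩
  have h1 : sInf S ∈ S := hSc.csInf_mem ⟨t, ht, hft⟩ hSb
  set t₁ := sInf S with ht₁
  have hlarge : ∀ u, 0 ≤ u → u < t₁ → L < f u := fun u hu hut => by
    by_contra! hle
    exact absurd (csInf_le hSb ⟨hu, hle⟩) (not_le.2 hut)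
  have hneg : ∀ u, 0 ≤ u → u < t₁ → g u ≤ 0 := fun u hu hut => by
    by_contra! hgu
    have := le_of_convex_of_large hf hg (fun t ht => by linarith [hL t ht, hpos t])
      (hlarge u hu hut) hgu hut.le
    linarith [hlarge u hu hut, h1.2]
  have ht0 : 0 < t₁ := by
    refine h1.1.lt_of_ne fun h => ?_
    have := h1.2
    rw [← h] at this
    linarith
  have hd : ∀ u, HasDerivAt (fun u => g u ^ 2 - 2 * f u ^ 2) (2 * g u * (h u - 2 * f u)) u :=
    fun u => (((hg u).pow 2).sub (((hf u).pow 2).const_mul 2)).congr_deriv (by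
      simp only [Nat.add_one_sub_one, pow_one, Nat.cast_ofNat]; ring)
  have hanti : AntitoneOn (fun u => g u ^ 2 - 2 * f u ^ 2) (Icc 0 t₁) :=
    antitoneOn_of_deriv_nonpos (convex_Icc _ _) (by fun_prop)
      (fun u _ => (hd u).differentiableAt.differentiableWithinAt) fun u hu => by
        rw [interior_Icc] at hu
        rw [(hd u).deriv]
        have h2 := hneg u hu.1.le hu.2
        have h3 := hL u (hlarge u hu.1.le hu.2)
        nlinarith
  have h2 := hanti ⟨le_rfl, ht0.le⟩ ⟨ht0.le, le_rfl⟩ ht0.le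
  simp only at h2
  have h3 := hneg 0 le_rfl ht0
  have h4 := h1.2
  have h5 := hpos t₁
  have h6 := hpos 0
  by_contra! h7
  nlinarith [sq_nonneg (g t₁)]

/-- A function that is uniformly convex where it is large cannot return, after a definite time, to
nearly the same large value with nearly the same logarithmic derivative. -/
theorem exists_no_return {L ε B : ℝ} (hL : 0 < L) (hε : 0 < ε) (hB : 0 ≤ B) : ∃ η > 0,
    ∀ (f g h : ℝ → ℝ) (T : ℝ), (∀ t, HasDerivAt f (g t) t) → (∀ t, HasDerivAt g (h t) t) →
      (∀ t, 0 < f t) → (∀ t, L < f t → 2 * f t ≤ h t) → ε ≤ T → η⁻¹ < f 0 → |f T / f 0 - 1| < η →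
      |g 0 / f 0| ≤ B → |g T / f T - g 0 / f 0| < η → False := by
  -- Since `|g(0)| ≤ B f(0)`, for `t ≤ s` one has `g(0) t ≥ -f(0) / 2`: as long as `f` is convex it
  -- loses at most half of its initial value on `[0, s]`.
  set s : ℝ := min ε (2 * (B + 1))⁻¹ with hs
  have hs0 : 0 < s := by positivity
  have hsB : B * s ≤ 1 / 2 := by
    have h1 : s ≤ (2 * (B + 1))⁻¹ := min_le_right _ _
    have h2 : B * s ≤ B * (2 * (B + 1))⁻¹ := mul_le_mul_of_nonneg_left h1 hB
    refine h2.trans ?_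
    rw [← div_eq_mul_inv, div_le_iff₀ (by positivity)]
    linarith
  -- The first two bounds give `f(0), f(T) ≥ 2 L`. The third makes the change of `g` permitted by
  -- the hypotheses, at most `η (B + 2) f(0)`, smaller than `s f(0)`.
  refine ⟨min (min (1 / 2) (4 * L)⁻¹) (s / (2 * (B + 2))), by positivity, ?_⟩
  set η := min (min (1 / 2) (4 * L)⁻¹) (s / (2 * (B + 2))) with hη
  have hη0 : 0 < η := by positivity
  have hη1 : η ≤ 1 / 2 := (min_le_left _ _).trans (min_le_left _ _)
  have hη2 : 4 * L ≤ η⁻¹ := by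
    rw [le_inv_comm₀ (by positivity) hη0]
    exact (min_le_left _ _).trans (min_le_right _ _)
  have hη3 : η * (B + 2) < s := by
    have h1 : η ≤ s / (2 * (B + 2)) := min_le_right _ _
    rw [le_div_iff₀ (by positivity)] at h1
    nlinarith
  intro f g h T hf hg hpos hLf hT hf0 hfT ha hba
  have hfc : Continuous f := continuous_iff_continuousAt.2 fun t => (hf t).continuousAt
  have hgc : Continuous g := continuous_iff_continuousAt.2 fun t => (hg t).continuousAt
  have p0 := hpos 0
  have pT := hpos T
  set a := g 0 / f 0 with hadef
  set b := g T / f T with hbdef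
  have hg0 : g 0 = a * f 0 := by rw [hadef]; field_simp
  have hgT : g T = b * f T := by rw [hbdef]; field_simp
  have hr := abs_lt.1 hfT
  have hab := abs_lt.1 hba
  have hfT1 : f 0 / 2 ≤ f T := by
    have h1 : 1 / 2 ≤ f T / f 0 := by linarith [hr.1]
    rw [le_div_iff₀ p0] at h1
    linarith
  -- If `f` dips to `L`, it leaves with logarithmic derivative at most `-1` and, by time reversal,
  -- returns with one at least `1`; these are not `η`-close. Otherwise `g' ≥ 2 f` throughout, and
  -- `g` grows by at least `s f(0)`.
  by_cases hex : ∃ t ∈ Icc 0 T, f t ≤ L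
  · obtain ⟨t, ht, hft⟩ := hex
    have h1 := deriv_le_neg_of_exists_le hf hg hpos hL hLf (by linarith) ht.1 hft
    have hrev : ∀ t, HasDerivAt (fun t : ℝ => T - t) (-1) t := fun t =>
      (hasDerivAt_id t).const_sub T
    have h2 := deriv_le_neg_of_exists_le (f := fun t => f (T - t)) (g := fun t => -g (T - t))
      (h := fun t => h (T - t)) (L := L)
      (fun t => (HasDerivAt.scomp t (hf (T - t)) (hrev t)).congr_deriv (by simp))
      (fun t => (HasDerivAt.scomp t (hg (T - t)) (hrev t)).neg.congr_deriv (by simp))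
      (fun t => hpos _) hL (fun t => hLf _) (by simp only [sub_zero]; linarith)
      (t := T - t) (by linarith [ht.2]) (by simpa using hft)
    simp only [sub_zero] at h2
    rw [hg0] at h1
    rw [hgT] at h2
    have h3 : a ≤ -1 := by by_contra! hc; nlinarith
    have h4 : 1 ≤ b := by by_contra! hc; nlinarith
    linarith [hab.2]
  · push Not at hex
    have hT0 : 0 ≤ T := hε.le.trans hT
    have hsT : s ≤ T := (min_le_left _ _).trans hT
    have hgm : MonotoneOn g (Icc 0 T) := monotoneOn_of_deriv_nonneg (convex_Icc _ _)
      hgc.continuousOn (fun y _ => (hg y).differentiableAt.differentiableWithinAt)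
      fun y hy => by
        rw [(hg y).deriv]
        linarith [hLf y (hex y (interior_subset hy)), hpos y]
    have haB := abs_le.1 ha
    have hfs : ∀ t ∈ Icc 0 s, f 0 / 2 ≤ f t := by
      intro t ht
      have h1 : MonotoneOn (fun t => f t - g 0 * t) (Icc 0 T) :=
        monotoneOn_of_deriv_nonneg (convex_Icc _ _) (by fun_prop)
          (fun y _ => ((hf y).sub ((hasDerivAt_id y).const_mul
            (g 0))).differentiableAt.differentiableWithinAt)
          fun y hy => by
            have h2 : HasDerivAt (fun t => f t - g 0 * t) (g y - g 0 * 1) y :=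
              (hf y).sub ((hasDerivAt_id y).const_mul (g 0))
            rw [h2.deriv]
            have := hgm ⟨le_rfl, hT0⟩ (interior_subset hy) (interior_subset hy).1
            linarith
      have h2 := h1 ⟨le_rfl, hT0⟩ ⟨ht.1, ht.2.trans hsT⟩ ht.1
      simp only [mul_zero, sub_zero] at h2
      have h3 : a * t ≥ -(1 / 2) := by nlinarith [ht.1, ht.2]
      have h4 : g 0 * t = (a * t) * f 0 := by rw [hg0]; ring
      nlinarith
    have h1 : MonotoneOn (fun t => g t - f 0 * t) (Icc 0 s) :=
      monotoneOn_of_deriv_nonneg (convex_Icc _ _) (by fun_prop)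
        (fun y _ => ((hg y).sub ((hasDerivAt_id y).const_mul
          (f 0))).differentiableAt.differentiableWithinAt)
        fun y hy => by
          have h2 : HasDerivAt (fun t => g t - f 0 * t) (h y - f 0 * 1) y :=
            (hg y).sub ((hasDerivAt_id y).const_mul (f 0))
          rw [h2.deriv]
          have hy' : y ∈ Icc 0 s := interior_subset hy
          linarith [hLf y (hex y ⟨hy'.1, hy'.2.trans hsT⟩), hfs y hy']
    have h2 := h1 ⟨le_rfl, hs0.le⟩ ⟨hs0.le, le_rfl⟩ hs0.le
    simp only [mul_zero, sub_zero] at h2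
    have h3 := hgm ⟨hs0.le, hsT⟩ ⟨hT0, le_rfl⟩ hsT
    have hrT : f T = (f T / f 0) * f 0 := by field_simp
    have h4 : b * f T - a * f 0 = f 0 * ((f T / f 0 - 1) * b + (b - a)) := by
      rw [mul_comm b, hrT]
      have : f T / f 0 * f 0 / f 0 = f T / f 0 := by field_simp
      rw [this]; ring
    have hb : |b| ≤ B + 1 := by rw [abs_le]; constructor <;> linarith [hab.1, hab.2]
    have h5 : (f T / f 0 - 1) * b ≤ η * (B + 1) := by
      calc _ ≤ |(f T / f 0 - 1) * b| := le_abs_self _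
        _ = |f T / f 0 - 1| * |b| := abs_mul _ _
        _ ≤ _ := mul_le_mul hfT.le hb (abs_nonneg _) hη0.le
    have h6 : f 0 * ((f T / f 0 - 1) * b + (b - a)) ≤ f 0 * (η * (B + 2)) :=
      mul_le_mul_of_nonneg_left (by linarith [hab.2]) p0.le
    rw [hgT, hg0] at *
    nlinarith

end Growth

/-! ### Convexity of `1/x` along bicharacteristics near the boundary. -/

namespace AHMetric

variable {n : ℕ} {X : Type*} [TopologicalSpace X] [ChartedSpace (EuclideanHalfSpace (n + 1)) X]
  [IsManifold (halfModel n) ∞ X] {A : AHMetric n X}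

/-- The components of the rescaled momentum `x ζ`. -/
def scaledMom (A : AHMetric n X) (p : X) (s : CotBundle n X) : EMod n :=
  A.x s.proj • cotangentCoord p s.proj s.2

theorem quad_scaledMom {p : X} {s : CotBundle n X} (hs : A.IsState s) (hp : s.proj ∈ chartDom n p) :
    A.quad p (coord n p s.proj) (A.scaledMom p s) = 1 := by
  rw [scaledMom, quad_smul, ← A.dualNormSq_metric hp hs.1, hs.2]

theorem IsSegment.hasDerivAt_coord {γ : ℝ → CotBundle n X} (h : A.IsSegment γ univ) {p : X} {t : ℝ}
    (hp : (γ t).proj ∈ chartDom n p) : HasDerivAt (fun t => coord n p (γ t).proj)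
      ((2 * A.xc p (coord n p (γ t).proj)) • A.raise p (coord n p (γ t).proj) (A.scaledMom p (γ t)))
      t := by
  refine (hasDerivWithinAt_univ.1 (h.ham t (mem_univ t) p hp).pos).congr_deriv ?_
  rw [velocity, scaledMom, map_smul, smul_smul, A.xc_coord hp]
  congr 1
  ring

theorem IsSegment.hasDerivAt_x {γ : ℝ → CotBundle n X} (h : A.IsSegment γ univ) {p : X} {t : ℝ}
    (hp : (γ t).proj ∈ chartDom n p) : HasDerivAt (fun t => A.x (γ t).proj)
      (2 * A.x (γ t).proj * A.slope p (coord n p (γ t).proj) (A.scaledMom p (γ t))) t := by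
  have hx := (A.x_pos_iff hp).1 (h.x_pos t (mem_univ t))
  have h1 := (A.hasFDerivAt_xc (coord_mem hp) hx).comp_hasDerivAt t (h.hasDerivAt_coord hp)
  rw [← inner_gradX] at h1
  have h2 : ∀ᶠ u in 𝓝 t, (γ u).proj ∈ chartDom n p :=
    (continuousOn_univ.1 h.cont).continuousAt.preimage_mem_nhds ((isOpen_chartDom p).mem_nhds hp)
  refine (h1.congr_of_eventuallyEq ?_).congr_deriv ?_
  · filter_upwards [h2] with u hu using (A.xc_coord hu).symm
  · rw [inner_smul_right, A.xc_coord hp]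
    rfl

theorem IsSegment.hasDerivAt_scaledMom {γ : ℝ → CotBundle n X} (h : A.IsSegment γ univ) {p : X}
    {t : ℝ} (hp : (γ t).proj ∈ chartDom n p) : HasDerivAt (fun t => A.scaledMom p (γ t))
      (A.scaledForce p (coord n p (γ t).proj) (A.scaledMom p (γ t))) t := by
  refine ((h.hasDerivAt_x hp).smul
    (hasDerivWithinAt_univ.1 (h.ham t (mem_univ t) p hp).mom)).congr_deriv ?_
  simp only [scaledForce, force, scaledMom, quad_smul, gradQuad_smul, slope_smul, A.xc_coord hp]
  module

/-- The derivative of `⟨dx, α⟩` along the Hamilton flow. -/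
def slopeDeriv (A : AHMetric n X) (p : X) (u : EMod n × EMod n) : ℝ :=
  fderivWithin ℝ (fun u : EMod n × EMod n => A.slope p u.1 u.2) (chartTgt n p ×ˢ univ) u
    ((2 * A.xc p u.1) • A.raise p u.1 u.2, A.scaledForce p u.1 u.2)

theorem IsSegment.hasDerivAt_slope {γ : ℝ → CotBundle n X} (h : A.IsSegment γ univ) {p : X}
    {t : ℝ} (hp : (γ t).proj ∈ chartDom n p) :
    HasDerivAt (fun t => A.slope p (coord n p (γ t).proj) (A.scaledMom p (γ t)))
      (A.slopeDeriv p (coord n p (γ t).proj, A.scaledMom p (γ t))) t := by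
  have hx := (A.x_pos_iff hp).1 (h.x_pos t (mem_univ t))
  have hm : (coord n p (γ t).proj, A.scaledMom p (γ t)) ∈
    chartTgt n p ×ˢ (univ : Set (EMod n)) := ⟨coord_mem hp, mem_univ _⟩
  have h1 := (((A.contDiffOn_slope p).differentiableOn (by simp)) _ hm).hasFDerivWithinAt.hasFDerivAt
    (prod_mem_nhds (chartTgt_nhds (coord_mem hp) hx) univ_mem)
  exact h1.comp_hasDerivAt t ((h.hasDerivAt_coord hp).prodMk (h.hasDerivAt_scaledMom hp))

theorem continuousOn_slopeDeriv (A : AHMetric n X) (p : X) :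
    ContinuousOn (A.slopeDeriv p) (chartTgt n p ×ˢ univ) := by
  have h1 := (A.contDiffOn_slope p).continuousOn_fderivWithin
    ((uniqueDiffOn_chartTgt p).prod uniqueDiffOn_univ) (by simp)
  have h2 : ContinuousOn (fun u : EMod n × EMod n => A.xc p u.1) (chartTgt n p ×ˢ univ) :=
    (A.contDiffOn_xc p).continuousOn.comp continuousOn_fst fun u hu => hu.1
  exact h1.clm_apply (((continuousOn_const.mul h2).smul
    (A.contDiffOn_raise_apply p).continuousOn).prodMk (A.contDiffOn_scaledForce p).continuousOn)

theorem slope_add (A : AHMetric n X) (p : X) (v α β : EMod n) :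
    A.slope p v (α + β) = A.slope p v α + A.slope p v β := by
  simp [slope, inner_add_right]

/-- Where `x = 0` only the momentum moves. The slope is linear in it, and the slope of `dx` itself
is `|dx|²_ḡ = 1`; this is where the normalization of `x` enters. -/
theorem slopeDeriv_of_mem_boundary {p z : X} (hz : z ∈ chartDom n p)
    (hb : z ∈ (halfModel n).boundary X) (μ : EMod n) :
    A.slopeDeriv p (coord n p z, μ) =
      2 * A.slope p (coord n p z) μ ^ 2 - 2 * A.quad p (coord n p z) μ := by
  have hm : ∀ β : EMod n, (coord n p z, β) ∈ chartTgt n p ×ˢ (univ : Set (EMod n)) :=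
    fun β => ⟨coord_mem hz, mem_univ _⟩
  have hx : A.xc p (coord n p z) = 0 := by rw [A.xc_coord hz, A.x_eq_zero]; exact hb
  have hlin : ∀ β, fderivWithin ℝ (fun u : EMod n × EMod n => A.slope p u.1 u.2)
      (chartTgt n p ×ˢ univ) (coord n p z, μ) (0, β) = A.slope p (coord n p z) β := by
    intro β
    have h1 := (((A.contDiffOn_slope p).differentiableOn (by simp)) _ (hm μ)).hasFDerivWithinAt
    have h2 : HasDerivAt (fun t : ℝ => (coord n p z, μ + t • β)) ((0, β) : EMod n × EMod n) 0 := by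
      refine (hasDerivAt_const 0 _).prodMk ?_
      simpa using ((hasDerivAt_id (0 : ℝ)).smul_const β).const_add μ
    have h3 := HasFDerivWithinAt.comp_hasDerivAt_of_eq (0 : ℝ) h1 h2
      (Eventually.of_forall fun t => hm _) (by simp)
    refine h3.unique ?_
    have h4 : HasDerivAt (fun t : ℝ => A.slope p (coord n p z) μ + t * A.slope p (coord n p z) β)
        (A.slope p (coord n p z) β) 0 := by
      simpa using ((hasDerivAt_id (0 : ℝ)).mul_const (A.slope p (coord n p z) β)).const_add
        (A.slope p (coord n p z) μ)
    refine h4.congr_of_eventuallyEq (Eventually.of_forall fun t => ?_)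
    simp only [Function.comp, slope_add, slope_smul]
  have hg : A.slope p (coord n p z) (A.gradX p (coord n p z)) = 1 := A.quad_gradX hz hb
  simp only [slopeDeriv, hx, mul_zero, zero_smul, hlin, scaledForce, sub_zero]
  rw [sub_eq_add_neg, ← neg_smul, slope_add, slope_smul, slope_smul, hg]
  ring

end AHMetric

namespace AHMetric

variable {n : ℕ} {X : Type*} [TopologicalSpace X] [ChartedSpace (EuclideanHalfSpace (n + 1)) X]
  [IsManifold (halfModel n) ∞ X] {A : AHMetric n X}

/-- On unit covectors at the boundary the value is `2 slope² - 2`; the weaker bound with `-1`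
persists nearby, uniformly because momenta range over a compact ball. -/
theorem eventually_slopeDeriv_le {p : X} (hb : p ∈ (halfModel n).boundary X) :
    ∀ᶠ z in 𝓝 p, z ∈ chartDom n p ∧ ∀ μ, A.quad p (coord n p z) μ = 1 →
      A.slopeDeriv p (coord n p z, μ) ≤ 2 * A.slope p (coord n p z) μ ^ 2 - 1 := by
  have hp := mem_chartDom_self (n := n) p
  set F := A.localFlow p
  let Ψ : EMod n × EMod n → ℝ := fun u =>
    A.slopeDeriv p u - 2 * A.slope p u.1 u.2 ^ 2 + 2 * A.quad p u.1 u.2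
  have hΨ : ContinuousOn Ψ (chartTgt n p ×ˢ univ) :=
    ((A.continuousOn_slopeDeriv p).sub (continuousOn_const.mul
      ((A.contDiffOn_slope p).continuousOn.pow 2))).add
        (continuousOn_const.mul (A.contDiffOn_quad p).continuousOn)
  have h1 : ∀ᶠ v in 𝓝 (coord n p p), ∀ μ ∈ Metric.closedBall (0 : EMod n) F.R,
      v ∈ chartTgt n p → Ψ (v, μ) < 1 := by
    refine (isCompact_closedBall _ _).eventually_forall_of_forall_eventually fun μ _ => ?_
    have h2 : Ψ (coord n p p, μ) = 0 := by
      simp only [Ψ, slopeDeriv_of_mem_boundary hp hb]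
      ring
    have h3 := (hΨ (coord n p p, μ) ⟨coord_mem hp, mem_univ _⟩).eventually_lt_const
      (show Ψ (coord n p p, μ) < 1 by rw [h2]; exact one_pos)
    rw [eventually_nhdsWithin_iff] at h3
    filter_upwards [h3] with u hu hm using hu ⟨hm, mem_univ _⟩
  have hmem : ∀ᶠ z in 𝓝 p, z ∈ F.nbhd := F.isOpen_nbhd.mem_nhds F.mem_nbhd_self
  filter_upwards [hmem, (continuousAt_coord hp).eventually h1] with z hz h2
  refine ⟨hz.1, fun μ hμ => ?_⟩
  have h3 : coord n p z ∈ halfBall p F.δ' :=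
    ⟨Metric.closedBall_subset_closedBall F.δ_le (Metric.ball_subset_closedBall hz.2),
      chartTgt_subset p (coord_mem hz.1)⟩
  have h4 := h2 μ (mem_closedBall_zero_iff.2 (F.unit_lt _ h3 _ hμ).le) (coord_mem hz.1)
  simp only [Ψ, hμ] at h4
  linarith

/-- Off the neighbourhoods of boundary points just found, which form an open set, `x` is positive on
a compact set and so bounded below. -/
theorem exists_slopeDeriv_le [CompactSpace X] (A : AHMetric n X) : ∃ m > 0, ∀ z, A.x z < m →
    ∃ p, z ∈ chartDom n p ∧ ∀ μ, A.quad p (coord n p z) μ = 1 →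
      A.slopeDeriv p (coord n p z, μ) ≤ 2 * A.slope p (coord n p z) μ ^ 2 - 1 := by
  let G₀ : X → Set X := fun p => {z | z ∈ chartDom n p ∧ ∀ μ, A.quad p (coord n p z) μ = 1 →
      A.slopeDeriv p (coord n p z, μ) ≤ 2 * A.slope p (coord n p z) μ ^ 2 - 1}
  let G : X → Set X := fun p => interior (G₀ p)
  have hK : IsCompact (⋃ p, G p)ᶜ :=
    (isOpen_iUnion fun p => isOpen_interior).isClosed_compl.isCompact
  have hpos : ∀ z ∈ (⋃ p, G p)ᶜ, 0 < A.x z := fun z hz => by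
    refine (A.x_nonneg z).lt_of_ne' fun h0 => hz (mem_iUnion.2 ⟨z, ?_⟩)
    exact mem_interior_iff_mem_nhds.2 (eventually_slopeDeriv_le ((A.x_eq_zero z).1 h0))
  obtain ⟨m, hm, hmK⟩ : ∃ m > 0, ∀ z ∈ (⋃ p, G p)ᶜ, m ≤ A.x z := by
    rcases ((⋃ p, G p)ᶜ).eq_empty_or_nonempty with h | h
    · exact ⟨1, one_pos, by simp [h]⟩
    · obtain ⟨z, hz, hmin⟩ := hK.exists_isMinOn h A.x_smooth.continuous.continuousOn
      exact ⟨A.x z, hpos z hz, fun w hw => hmin hw⟩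
  refine ⟨m, hm, fun z hz => ?_⟩
  by_contra hne
  refine absurd (hmK z fun hz' => hne ?_) (not_le.2 hz)
  obtain ⟨p, hp⟩ := mem_iUnion.1 hz'
  have hp' : z ∈ G₀ p := interior_subset hp
  exact ⟨p, hp'⟩

theorem IsSegment.hasDerivAt_inv_x {γ : ℝ → CotBundle n X} (h : A.IsSegment γ univ) {p : X} {t : ℝ}
    (hp : (γ t).proj ∈ chartDom n p) : HasDerivAt (fun t => (A.x (γ t).proj)⁻¹)
      (-2 * A.slope p (coord n p (γ t).proj) (A.scaledMom p (γ t)) * (A.x (γ t).proj)⁻¹) t := by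
  have hx := h.x_pos t (mem_univ t)
  refine ((h.hasDerivAt_x hp).inv hx.ne').congr_deriv ?_
  field_simp

/-- Along a bicharacteristic `1 / x` is uniformly convex near the boundary. -/
theorem exists_convexity [CompactSpace X] (A : AHMetric n X) : ∃ L > 0, ∀ γ, A.IsSegment γ univ →
    ∃ g h : ℝ → ℝ, (∀ t, HasDerivAt (fun t => (A.x (γ t).proj)⁻¹) (g t) t) ∧
      (∀ t, HasDerivAt g (h t) t) ∧
      (∀ t, L < (A.x (γ t).proj)⁻¹ → 2 * (A.x (γ t).proj)⁻¹ ≤ h t) ∧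
      ∀ t p, (γ t).proj ∈ chartDom n p → g t =
        -2 * A.slope p (coord n p (γ t).proj) (A.scaledMom p (γ t)) * (A.x (γ t).proj)⁻¹ := by
  obtain ⟨m, hm, hmx⟩ := A.exists_slopeDeriv_le
  refine ⟨m⁻¹, inv_pos.2 hm, fun γ hγ => ?_⟩
  have hg : ∀ t p, (γ t).proj ∈ chartDom n p → deriv (fun t => (A.x (γ t).proj)⁻¹) t =
      -2 * A.slope p (coord n p (γ t).proj) (A.scaledMom p (γ t)) * (A.x (γ t).proj)⁻¹ :=
    fun t p hp => (hγ.hasDerivAt_inv_x hp).deriv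
  -- For `f = 1/x` one has `f' = -2 slope f` and `f'' = (4 slope² - 2 slope') f`, so `slope' ≤ 2
  -- slope² - 1` yields `f'' ≥ 2 f`.
  have hd : ∀ t p, (γ t).proj ∈ chartDom n p → HasDerivAt (deriv (fun t => (A.x (γ t).proj)⁻¹))
      ((-2 * A.slopeDeriv p (coord n p (γ t).proj, A.scaledMom p (γ t)) +
        4 * A.slope p (coord n p (γ t).proj) (A.scaledMom p (γ t)) ^ 2) * (A.x (γ t).proj)⁻¹) t := by
    intro t p hp
    have h1 := ((hγ.hasDerivAt_slope hp).const_mul (-2)).mul (hγ.hasDerivAt_inv_x hp)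
    refine (h1.congr_of_eventuallyEq ?_).congr_deriv (by ring)
    have h2 : ∀ᶠ u in 𝓝 t, (γ u).proj ∈ chartDom n p :=
      (continuousOn_univ.1 hγ.cont).continuousAt.preimage_mem_nhds ((isOpen_chartDom p).mem_nhds hp)
    filter_upwards [h2] with u hu using hg u p hu
  refine ⟨deriv (fun t => (A.x (γ t).proj)⁻¹), deriv (deriv (fun t => (A.x (γ t).proj)⁻¹)),
    fun t => (hγ.hasDerivAt_inv_x (mem_chartDom_self _)).differentiableAt.hasDerivAt,
    fun t => (hd t _ (mem_chartDom_self _)).differentiableAt.hasDerivAt, fun t ht => ?_, hg⟩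
  have hx := hγ.x_pos t (mem_univ t)
  obtain ⟨p, hp, hle⟩ := hmx (γ t).proj ((inv_lt_inv₀ hm hx).1 ht)
  have h1 := hle _ (quad_scaledMom (hγ.isState (mem_univ t)) hp)
  rw [(hd t p hp).deriv]
  exact mul_le_mul_of_nonneg_right (by linarith) (inv_pos.2 hx).le

/-! ### Long trajectories do not accumulate at the diagonal. -/

section Exclusion

variable [CompactSpace X] [T2Space X]

/-- The part of the forward bicharacteristic relation coming from times at least `ε`. -/
def longFBR (A : AHMetric n X) (ε : ℝ) : Set A.PhiCotangent :=
  {q | ∃ (s : CotBundle n X) (T : ℝ) (hs : A.IsState s), ε ≤ T ∧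
    q = A.phiPair (A.flow s T) s ((isSegment_flow hs).isState (mem_univ T)).1}

/-- Rescaling a covector over the interior by `c / x`. -/
def unscale (A : AHMetric n X) (p : X) (c : ℝ) (s : CotBundle n X) : CotBundle n X :=
  ⟨s.proj, covec p s.proj ((c * (A.x s.proj)⁻¹) • cotangentCoord p s.proj s.2)⟩

theorem continuousAt_unscale {p : X} (c : ℝ) {s : CotBundle n X} (hp : s.proj ∈ chartDom n p)
    (hx : 0 < A.x s.proj) : ContinuousAt (A.unscale p c) s := by
  have h1 : ContinuousAt (fun s : CotBundle n X => A.x s.proj) s :=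
    (A.x_smooth.continuous.comp continuous_cot_proj).continuousAt
  have h2 : ContinuousAt (fun s : CotBundle n X =>
      (c * (A.x s.proj)⁻¹) • cotangentCoord p s.proj s.2) s :=
    (continuousAt_const.mul (h1.inv₀ hx.ne')).fun_smul (continuousAt_cotangentCoord hp)
  have h3 := continuousAt_mk_covec (p := p) (S := univ) (y₀ := s)
    (f := fun s : CotBundle n X => s.proj) continuous_cot_proj.continuousAt.continuousWithinAt
    h2.continuousWithinAt hp
  exact continuousWithinAt_univ _ _ |>.1 h3

theorem unscale_eq {p : X} {c : ℝ} {s s' : CotBundle n X} (hp : s.proj ∈ chartDom n p)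
    (h : s'.proj = s.proj) (hc : cotangentCoord p s'.proj s'.2 =
      (c * (A.x s.proj)⁻¹) • cotangentCoord p s.proj s.2) : A.unscale p c s = s' := by
  refine cot_ext (p := p) h.symm hp ?_
  rw [hc]
  exact cotangentCoord_covec hp _

/-- If long trajectories accumulated here, their initial and final states would converge to one
state `s₀`. The trajectory of `s₀` escapes, so at some time `T₀` it is near `∂X` with `1/x`
increasing; nearby trajectories do the same and by convexity do not come back to `p` after `T₀`. So
the times lie in `[ε, T₀]`, and a limit of them is a period of `s₀`, against nontrapping. -/
theorem not_mem_closure_longFBR_of_interior (hA : A.Nontrapping) {ε : ℝ} (hε : 0 < ε) {p : X}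
    (hx : 0 < A.x p) (h : ¬ (p = p ∧ p ∈ (halfModel n).boundary X))
    {α : TangentSpace (halfModel n) p →L[ℝ] ℝ}
    (hα : (⟨DoubleSpace.off p p h, α, -α⟩ : A.PhiCotangent) ∈ A.SigmaL) :
    (⟨DoubleSpace.off p p h, α, -α⟩ : A.PhiCotangent) ∉ closure (A.longFBR ε) := by
  intro hcl
  set q : A.PhiCotangent := ⟨DoubleSpace.off p p h, α, -α⟩ with hq
  have hp := mem_chartDom_self (n := n) p
  obtain ⟨u, huE, hu⟩ := mem_closure_iff_ultrafilter.1 hcl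
  have hE : ∀ b : A.PhiCotangent, ∃ (s : CotBundle n X) (T : ℝ), b ∈ A.longFBR ε →
      ∃ hs : A.IsState s, ε ≤ T ∧
        b = A.phiPair (A.flow s T) s ((isSegment_flow hs).isState (mem_univ T)).1 := fun b => by
    by_cases hb : b ∈ A.longFBR ε
    · obtain ⟨s, T, hs, h1, h2⟩ := hb
      exact ⟨s, T, fun _ => ⟨hs, h1, h2⟩⟩
    · exact ⟨⟨p, 0⟩, 0, fun hb' => absurd hb' hb⟩
  choose s T hsT using hE
  let s₀ : CotBundle n X := A.unscale p 1 ⟨p, α⟩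
  have hs₀c : cotangentCoord p p s₀.2 = (A.x p)⁻¹ • cotangentCoord p p α := by
    change cotangentCoord p p (covec p p ((1 * (A.x p)⁻¹) • cotangentCoord p p α)) = _
    rw [cotangentCoord_covec hp, one_mul]
  have hs₀ : A.IsState s₀ := by
    refine ⟨hx, ?_⟩
    have h1 := (A.mem_SigmaL_iff (p := p) (q := q) hp).1 hα
    have h2 := A.dualNormSq_metric (p := p) (z := p) hp hx s₀.2
    rw [hs₀c, quad_smul] at h2
    change A.quad p (coord n p p) (cotangentCoord p p α) = 1 at h1
    rw [h1] at h2
    refine h2.trans ?_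
    field_simp
  -- The initial covector enters the relation with the opposite sign, hence the factor `-1` in
  -- `unscale`.
  have hlS : Tendsto s u (𝓝 s₀) := by
    have h1 : A.unscale p (-1) ⟨p, -α⟩ = s₀ := by
      refine unscale_eq (s := ⟨p, -α⟩) hp rfl ?_
      change cotangentCoord p p s₀.2 = (-1 * (A.x p)⁻¹) • cotangentCoord p p (-α)
      rw [hs₀c, cotangentCoord_neg]
      module
    have h2 : Tendsto (fun b : A.PhiCotangent => A.unscale p (-1) ⟨b.base.right, b.α'⟩) u (𝓝 s₀) := by
      rw [← h1]
      exact ((continuousAt_unscale (-1) (s := ⟨p, -α⟩) hp hx).tendsto.comp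
        (A.continuous_rightCovec.tendsto q)).mono_left hu
    refine h2.congr' ?_
    have h3 : ∀ᶠ b : A.PhiCotangent in u, b.base.right ∈ chartDom n p :=
      hu ((DoubleSpace.continuous_right.comp A.continuous_base).continuousAt.preimage_mem_nhds
        ((isOpen_chartDom p).mem_nhds hp))
    filter_upwards [h3, huE] with b hb hbE
    obtain ⟨hs, -, hbs⟩ := hsT b hbE
    have e1 : (⟨b.base.right, b.α'⟩ : CotBundle n X) =
      ⟨(s b).proj, -(A.x (s b).proj • (s b).2)⟩ := by
        conv_lhs => rw [hbs]
        rfl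
    rw [e1]
    have hb' : (s b).proj ∈ chartDom n p := by
      have := congrArg TotalSpace.proj e1
      exact this ▸ hb
    refine unscale_eq (s := ⟨(s b).proj, -(A.x (s b).proj • (s b).2)⟩) hb' rfl ?_
    have hxs := hs.1
    refine Eq.trans ?_ (congrArg _ (cotangentCoord_neg p (s b).proj (A.x (s b).proj • (s b).2)).symm)
    rw [cotangentCoord_smul, smul_neg, smul_smul, ← neg_smul]
    have : -(-1 * (A.x (s b).proj)⁻¹ * A.x (s b).proj) = 1 := by field_simp
    rw [this, one_smul]
  have hlT : Tendsto (fun b => A.flow (s b) (T b)) u (𝓝 s₀) := by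
    have h2 : Tendsto (fun b : A.PhiCotangent => A.unscale p 1 ⟨b.base.left, b.α⟩) u (𝓝 s₀) :=
      ((continuousAt_unscale 1 (s := ⟨p, α⟩) hp hx).tendsto.comp
        (A.continuous_leftCovec.tendsto q)).mono_left hu
    refine h2.congr' ?_
    have h3 : ∀ᶠ b : A.PhiCotangent in u, b.base.left ∈ chartDom n p :=
      hu ((DoubleSpace.continuous_left.comp A.continuous_base).continuousAt.preimage_mem_nhds
        ((isOpen_chartDom p).mem_nhds hp))
    filter_upwards [h3, huE] with b hb hbE
    obtain ⟨hs, -, hbs⟩ := hsT b hbE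
    set w := A.flow (s b) (T b) with hw
    have e1 : (⟨b.base.left, b.α⟩ : CotBundle n X) = ⟨w.proj, A.x w.proj • w.2⟩ := by
        conv_lhs => rw [hbs]
        rfl
    rw [e1]
    have hb' : w.proj ∈ chartDom n p := by
      have := congrArg TotalSpace.proj e1
      exact this ▸ hb
    refine unscale_eq (s := ⟨w.proj, A.x w.proj • w.2⟩) hb' rfl ?_
    have hxs : 0 < A.x w.proj := ((isSegment_flow hs).isState (mem_univ (T b))).1
    refine Eq.trans ?_ (congrArg _ (cotangentCoord_smul p w.proj (A.x w.proj) w.2).symm)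
    rw [smul_smul]
    have : 1 * (A.x w.proj)⁻¹ * A.x w.proj = 1 := by field_simp
    rw [this, one_smul]
  have hseg₀ := isSegment_flow hs₀
  obtain ⟨L, hL, hconv⟩ := A.exists_convexity
  obtain ⟨g, k, hf, hg, hk, hgs⟩ := hconv _ hseg₀
  have htop : Tendsto (fun t => (A.x (A.flow s₀ t).proj)⁻¹) atTop atTop := by
    refine Tendsto.inv_tendsto_nhdsGT_zero (tendsto_nhdsWithin_iff.2 ⟨?_, ?_⟩)
    · exact (hA _ ((A.isBicharacteristic_iff_isSegment _).2 hseg₀)).1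
    · exact Eventually.of_forall fun t => hseg₀.x_pos t (mem_univ t)
  -- Above `L` the function `1/x` is convex; above `2 / x(p)` it is too large for the position to be
  -- near `p`.
  set L' := max L (2 * (A.x p)⁻¹) with hL'
  obtain ⟨T₁, hT₁⟩ := eventually_atTop.1 (htop.eventually_gt_atTop L')
  -- A function tending to infinity has positive derivative at arbitrarily late times.
  obtain ⟨T₀, hT₀, hgT₀⟩ : ∃ T₀ ≥ max T₁ 0, 0 < g T₀ := by
    by_contra! hcon
    obtain ⟨t, ht⟩ := (htop.eventually_gt_atTop
      ((A.x (A.flow s₀ (max T₁ 0)).proj)⁻¹)).and (eventually_ge_atTop (max T₁ 0)) |>.exists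
    have hanti : AntitoneOn (fun t => (A.x (A.flow s₀ t).proj)⁻¹) (Ici (max T₁ 0)) :=
      antitoneOn_of_deriv_nonpos (convex_Ici _)
        (fun t _ => (hf t).continuousAt.continuousWithinAt)
        (fun t _ => (hf t).differentiableAt.differentiableWithinAt) fun t ht => by
          rw [(hf t).deriv]
          exact hcon t (interior_subset ht)
    exact absurd (hanti self_mem_Ici ht.2 ht.2) (not_le.2 ht.1)
  have hT₀0 : 0 ≤ T₀ := (le_max_right _ _).trans hT₀
  have hsState : ∀ᶠ b in (u : Filter A.PhiCotangent), A.IsState (s b) := by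
    filter_upwards [huE] with b hb using (hsT b hb).1
  have hflowT₀ : Tendsto (fun b => A.flow (s b) T₀) u (𝓝 (A.flow s₀ T₀)) := by
    refine Tendsto.comp (g := fun v : ℝ × CotBundle n X => A.flow v.2 v.1)
      (A.continuousOn_flow (T₀, s₀) ⟨hT₀0, hs₀⟩) (tendsto_nhdsWithin_iff.2
        ⟨tendsto_const_nhds.prodMk_nhds hlS, ?_⟩)
    filter_upwards [hsState] with b hb using ⟨hT₀0, hb⟩
  have hxT₀ := hseg₀.x_pos T₀ (mem_univ _)
  set p₁ := (A.flow s₀ T₀).proj with hp₁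
  have hp₁m : (A.flow s₀ T₀).proj ∈ chartDom n p₁ := mem_chartDom_self _
  have hfcont : ContinuousAt (fun s : CotBundle n X => (A.x s.proj)⁻¹) (A.flow s₀ T₀) :=
    ((A.x_smooth.continuous.comp continuous_cot_proj).continuousAt).inv₀ hxT₀.ne'
  have hgcont : ContinuousAt (fun s : CotBundle n X =>
      -2 * A.slope p₁ (coord n p₁ s.proj) (A.scaledMom p₁ s) * (A.x s.proj)⁻¹) (A.flow s₀ T₀) := by
    refine ContinuousAt.mul (continuousAt_const.mul ?_) hfcont
    refine ContinuousAt.comp (g := fun v : EMod n × EMod n => A.slope p₁ v.1 v.2)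
      (f := fun s : CotBundle n X => (coord n p₁ s.proj, A.scaledMom p₁ s)) ?_ ?_
    · exact ((A.contDiffOn_slope p₁).continuousOn).continuousAt (prod_mem_nhds
        (chartTgt_nhds (coord_mem hp₁m) ((A.x_pos_iff hp₁m).1 hxT₀)) univ_mem)
    · refine ContinuousAt.prodMk (ContinuousAt.comp (g := coord n p₁) (continuousAt_coord hp₁m)
        continuous_cot_proj.continuousAt) ?_
      exact ((A.x_smooth.continuous.comp continuous_cot_proj).continuousAt).fun_smul
        (continuousAt_cotangentCoord hp₁m)
  have e1 : ∀ᶠ b in (u : Filter A.PhiCotangent), L' < (A.x (A.flow (s b) T₀).proj)⁻¹ :=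
    (hfcont.tendsto.comp hflowT₀).eventually_const_lt (hT₁ T₀ ((le_max_left _ _).trans hT₀))
  have e2 : ∀ᶠ b in (u : Filter A.PhiCotangent), 0 < -2 * A.slope p₁
      (coord n p₁ (A.flow (s b) T₀).proj) (A.scaledMom p₁ (A.flow (s b) T₀)) *
        (A.x (A.flow (s b) T₀).proj)⁻¹ :=
    (hgcont.tendsto.comp hflowT₀).eventually_const_lt (by rw [← hgs T₀ p₁ hp₁m]; exact hgT₀)
  have e3 : ∀ᶠ b in (u : Filter A.PhiCotangent), (A.flow (s b) T₀).proj ∈ chartDom n p₁ :=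
    (continuous_cot_proj.continuousAt.tendsto.comp hflowT₀) ((isOpen_chartDom p₁).mem_nhds hp₁m)
  have e4 : ∀ᶠ b in (u : Filter A.PhiCotangent),
      (A.x (A.flow (s b) (T b)).proj)⁻¹ < 2 * (A.x p)⁻¹ := by
    have hc : ContinuousAt (fun s : CotBundle n X => (A.x s.proj)⁻¹) s₀ :=
      ((A.x_smooth.continuous.comp continuous_cot_proj).continuousAt).inv₀ hx.ne'
    refine (hc.tendsto.comp hlT).eventually_lt_const ?_
    change (A.x p)⁻¹ < 2 * (A.x p)⁻¹
    linarith [inv_pos.2 hx]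
  have e5 : ∀ᶠ b in (u : Filter A.PhiCotangent), T b ∈ Icc ε T₀ := by
    filter_upwards [e1, e2, e3, e4, huE] with b h1 h2 h3 h4 h5
    obtain ⟨hs, hεT, -⟩ := hsT b h5
    refine ⟨hεT, ?_⟩
    by_contra! hlt
    obtain ⟨g', k', hf', hg', hk', hgs'⟩ := hconv _ (isSegment_flow hs)
    have hle := le_of_convex_of_large hf' hg' (fun t ht => by
      have := hk' t ht
      have := inv_pos.2 ((isSegment_flow hs).x_pos t (mem_univ t))
      linarith) ((le_max_left _ _).trans_lt h1) (by rw [hgs' T₀ p₁ h3]; exact h2) hlt.le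
    have := (le_max_right L (2 * (A.x p)⁻¹)).trans_lt h1
    linarith
  obtain ⟨T', hT', hlim⟩ := isCompact_Icc.ultrafilter_le_nhds (u.map T)
    (le_principal_iff.2 e5)
  have hTlim : Tendsto T u (𝓝 T') := hlim
  have hT'0 : 0 ≤ T' := hε.le.trans hT'.1
  have hflowT' : Tendsto (fun b => A.flow (s b) (T b)) u (𝓝 (A.flow s₀ T')) := by
    refine Tendsto.comp (g := fun v : ℝ × CotBundle n X => A.flow v.2 v.1)
      (A.continuousOn_flow (T', s₀) ⟨hT'0, hs₀⟩) (tendsto_nhdsWithin_iff.2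
        ⟨hTlim.prodMk_nhds hlS, ?_⟩)
    filter_upwards [hsState, e5] with b hb hb5 using ⟨hε.le.trans hb5.1, hb⟩
  have hproj : (A.flow s₀ T').proj = s₀.proj := tendsto_nhds_unique
    (continuous_cot_proj.continuousAt.tendsto.comp hflowT')
    (continuous_cot_proj.continuousAt.tendsto.comp hlT)
  have hper : A.flow s₀ T' = s₀ := by
    have hm : (A.flow s₀ T').proj ∈ chartDom n p := hproj ▸ hp
    refine cot_ext hproj hm (tendsto_nhds_unique
      ((continuousAt_cotangentCoord hm).tendsto.comp hflowT')
      ((continuousAt_cotangentCoord (s := s₀) hp).tendsto.comp hlT))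
  -- At the multiples of the period `1/x` is constant, although it tends to infinity.
  have hiter : ∀ j : ℕ, A.flow s₀ (j * T') = s₀ := fun j => by
    induction j with
    | zero => simpa using flow_zero hs₀
    | succ j ih =>
      have h1 := flow_flow hs₀ (s := j * T') hT'0
      rw [ih, hper] at h1
      have h2 : ((j + 1 : ℕ) : ℝ) * T' = T' + j * T' := by
        push_cast
        ring
      rw [h2]
      exact h1.symm
  have hseq : Tendsto (fun j : ℕ => (j : ℝ) * T') atTop atTop :=
    tendsto_natCast_atTop_atTop.atTop_mul_const (hε.trans_le hT'.1)
  have hlim0 := htop.comp hseq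
  simp only [Function.comp_def, hiter] at hlim0
  exact not_tendsto_const_atTop _ _ hlim0

end Exclusion

end AHMetric

namespace AHMetric

variable {n : ℕ} {X : Type*} [TopologicalSpace X] [ChartedSpace (EuclideanHalfSpace (n + 1)) X]
  [IsManifold (halfModel n) ∞ X] {A : AHMetric n X}

theorem phiCoord_phiPair (p : X) {s s' : CotBundle n X} (h : 0 < A.x s.proj) :
    A.phiCoord p (A.phiPair s s' h) =
      ((coord n p s'.proj, (A.x s'.proj)⁻¹ • (coord n p s.proj - coord n p s'.proj)),
        (A.scaledMom p s, -A.scaledMom p s')) := by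
  refine Prod.ext rfl (Prod.ext ?_ ?_)
  · exact cotangentCoord_smul p s.proj _ s.2
  · refine (cotangentCoord_neg p s'.proj (A.x s'.proj • s'.2)).trans ?_
    rw [cotangentCoord_smul]
    rfl

variable [CompactSpace X] [T2Space X]

/-- At such a limit `x' → 0`, the ratio `x / x'` tends to `1` because `V → 0`, and both rescaled
momenta have the same limit, so that the logarithmic derivatives of `1/x` at the two ends become
equal. For times bounded below this is excluded by `exists_no_return`. -/
theorem not_mem_closure_longFBR_of_boundary {ε : ℝ} (hε : 0 < ε) {q : A.PhiCotangent} {p : X}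
    (hb : p ∈ (halfModel n).boundary X) (hq : q ∈ A.phiDom p) (hqr : q.base.right = p)
    (hV : (DoubleSpace.projCoord p q.base).2 = 0)
    (hα : cotangentCoord p q.base.right q.α' = -cotangentCoord p q.base.left q.α) :
    q ∉ closure (A.longFBR ε) := by
  intro hcl
  have hp := mem_chartDom_self (n := n) p
  obtain ⟨u, huE, hu⟩ := mem_closure_iff_ultrafilter.1 hcl
  have hE : ∀ b : A.PhiCotangent, ∃ (s : CotBundle n X) (T : ℝ), b ∈ A.longFBR ε →
      ∃ hs : A.IsState s, ε ≤ T ∧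
        b = A.phiPair (A.flow s T) s ((isSegment_flow hs).isState (mem_univ T)).1 := fun b => by
    by_cases hb : b ∈ A.longFBR ε
    · obtain ⟨s, T, hs, h1, h2⟩ := hb
      exact ⟨s, T, fun _ => ⟨hs, h1, h2⟩⟩
    · exact ⟨⟨p, 0⟩, 0, fun hb' => absurd hb' hb⟩
  choose s T hsT using hE
  set μ := cotangentCoord p q.base.left q.α with hμ
  set e := coord n p p with he
  have hphi : Tendsto (A.phiCoord p) u (𝓝 ((e, 0), (μ, -μ))) := by
    have h1 : A.phiCoord p q = ((e, 0), (μ, -μ)) := by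
      refine Prod.ext (Prod.ext ?_ hV) (Prod.ext rfl hα)
      change coord n p q.base.right = e
      rw [hqr]
    rw [← h1]
    exact (continuousAt_phiCoord A hq).tendsto.mono_left hu
  let w : A.PhiCotangent → CotBundle n X := fun b => A.flow (s b) (T b)
  have hphi' : Tendsto (fun b => ((coord n p (s b).proj,
      (A.x (s b).proj)⁻¹ • (coord n p (w b).proj - coord n p (s b).proj)),
        (A.scaledMom p (w b), -A.scaledMom p (s b)))) u (𝓝 ((e, 0), (μ, -μ))) := by
    refine hphi.congr' ?_
    filter_upwards [huE] with b hbE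
    obtain ⟨hs, -, hbs⟩ := hsT b hbE
    conv_lhs => rw [hbs]
    exact phiCoord_phiPair p _
  have hdom : ∀ᶠ b in (u : Filter A.PhiCotangent),
      (w b).proj ∈ chartDom n p ∧ (s b).proj ∈ chartDom n p := by
    filter_upwards [huE, hu ((A.isOpen_phiDom p).mem_nhds hq)] with b hbE hbD
    obtain ⟨hs, -, hbs⟩ := hsT b hbE
    rw [hbs] at hbD
    exact hbD.1
  have hvr : Tendsto (fun b => coord n p (s b).proj) u (𝓝 e) := hphi'.fst_nhds.fst_nhds
  have hVl : Tendsto (fun b => (A.x (s b).proj)⁻¹ • (coord n p (w b).proj - coord n p (s b).proj)) u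
    (𝓝 0) := hphi'.fst_nhds.snd_nhds
  have hml : Tendsto (fun b => A.scaledMom p (w b)) u (𝓝 μ) := hphi'.snd_nhds.fst_nhds
  have hmr : Tendsto (fun b => A.scaledMom p (s b)) u (𝓝 μ) := by
    simpa using hphi'.snd_nhds.snd_nhds.neg
  have hst : ∀ᶠ b in (u : Filter A.PhiCotangent), A.IsState (s b) := by
    filter_upwards [huE] with b hb using (hsT b hb).1
  have heT : e ∈ chartTgt n p := coord_mem hp
  have hxe : A.xc p e = 0 := by rw [A.xc_coord hp, A.x_eq_zero]; exact hb
  have hvrT : Tendsto (fun b => coord n p (s b).proj) u (𝓝[chartTgt n p] e) :=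
    tendsto_nhdsWithin_iff.2 ⟨hvr, by filter_upwards [hdom] with b hb using coord_mem hb.2⟩
  have hxr : Tendsto (fun b => A.x (s b).proj) u (𝓝 0) := by
    have h1 : Tendsto (A.xc p) (𝓝[chartTgt n p] e) (𝓝 (A.xc p e)) :=
      (A.contDiffOn_xc p).continuousOn e heT
    rw [hxe] at h1
    refine (h1.comp hvrT).congr' ?_
    filter_upwards [hdom] with b hb using A.xc_coord hb.2
  have hdiff : Tendsto (fun b => coord n p (w b).proj - coord n p (s b).proj) u (𝓝 0) := by
    have h1 := hxr.smul hVl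
    rw [zero_smul] at h1
    refine h1.congr' ?_
    filter_upwards [hst] with b hb
    rw [smul_smul, mul_inv_cancel₀ hb.1.ne', one_smul]
  have hvl : Tendsto (fun b => coord n p (w b).proj) u (𝓝 e) := by
    have h1 := hdiff.add hvr
    rw [zero_add] at h1
    simpa using h1
  have hvlT : Tendsto (fun b => coord n p (w b).proj) u (𝓝[chartTgt n p] e) :=
    tendsto_nhdsWithin_iff.2 ⟨hvl, by filter_upwards [hdom] with b hb using coord_mem hb.1⟩
  have hslope : ∀ c : A.PhiCotangent → CotBundle n X,
      Tendsto (fun b => coord n p (c b).proj) u (𝓝[chartTgt n p] e) →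
      Tendsto (fun b => A.scaledMom p (c b)) u (𝓝 μ) →
      Tendsto (fun b => -2 * A.slope p (coord n p (c b).proj) (A.scaledMom p (c b))) u
        (𝓝 (-2 * A.slope p e μ)) := by
    intro c h1 h2
    refine Tendsto.const_mul _ ?_
    have h3 := (A.contDiffOn_slope p).continuousOn (e, μ) ⟨heT, mem_univ _⟩
    refine Tendsto.comp (g := fun v : EMod n × EMod n => A.slope p v.1 v.2) h3
      (f := fun b => (coord n p (c b).proj, A.scaledMom p (c b))) (tendsto_nhdsWithin_iff.2
        ⟨(tendsto_nhds_of_tendsto_nhdsWithin h1).prodMk_nhds h2, ?_⟩)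
    filter_upwards [(tendsto_nhdsWithin_iff.1 h1).2] with b hb using ⟨hb, mem_univ _⟩
  have hsr := hslope s hvrT hmr
  have hsl := hslope w hvlT hml
  obtain ⟨δ, hδ, hsub⟩ := exists_halfBall_subset (n := n) p
  obtain ⟨M, hM, -, hMl⟩ := exists_bound_lipschitz ((A.contDiffOn_xc p).of_le (by norm_cast))
    (uniqueDiffOn_chartTgt p) (isCompact_halfBall p δ) (convex_halfBall p δ) hsub
  have hnear : ∀ c : A.PhiCotangent → CotBundle n X,
      Tendsto (fun b => coord n p (c b).proj) u (𝓝[chartTgt n p] e) →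
      ∀ᶠ b in (u : Filter A.PhiCotangent), coord n p (c b).proj ∈ halfBall p δ := fun c hc => by
    obtain ⟨h1, h2⟩ := tendsto_nhdsWithin_iff.1 hc
    filter_upwards [h1 (Metric.closedBall_mem_nhds e hδ), h2] with b hb1 hb2
    exact ⟨hb1, chartTgt_subset p hb2⟩
  -- From `|x - x'| ≤ M ‖v - v'‖ = M x' ‖V‖`.
  have hratio : Tendsto (fun b => A.x (w b).proj / A.x (s b).proj) u (𝓝 1) := by
    have h1 : Tendsto (fun b => M * ‖(A.x (s b).proj)⁻¹ •
        (coord n p (w b).proj - coord n p (s b).proj)‖) u (𝓝 0) := by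
      simpa using hVl.norm.const_mul M
    rw [tendsto_iff_norm_sub_tendsto_zero]
    refine squeeze_zero' (Eventually.of_forall fun b => norm_nonneg _) ?_ h1
    filter_upwards [hst, hdom, hnear w hvlT, hnear s hvrT] with b h2 h3 h4 h5
    have h6 := hMl _ h4 _ h5
    rw [A.xc_coord h3.1, A.xc_coord h3.2] at h6
    have h7 : A.x (w b).proj / A.x (s b).proj - 1 =
        (A.x (s b).proj)⁻¹ * (A.x (w b).proj - A.x (s b).proj) := by
      have := h2.1.ne'
      field_simp
    rw [h7, norm_mul, norm_smul]
    have h8 := norm_nonneg (A.x (s b).proj)⁻¹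
    nlinarith
  obtain ⟨L, hL, hconv⟩ := A.exists_convexity
  obtain ⟨η, hη, hno⟩ := exists_no_return (B := |-2 * A.slope p e μ| + 1) hL hε (by positivity)
  have e1 : ∀ᶠ b in (u : Filter A.PhiCotangent), A.x (s b).proj < η := hxr.eventually_lt_const hη
  have e2 : ∀ᶠ b in (u : Filter A.PhiCotangent),
      |(A.x (w b).proj / A.x (s b).proj)⁻¹ - 1| < η := by
    have h1 := (hratio.inv₀ one_ne_zero).sub_const 1
    rw [inv_one, sub_self] at h1
    have h2 := h1.abs
    rw [abs_zero] at h2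
    exact h2.eventually_lt_const hη
  have e3 : ∀ᶠ b in (u : Filter A.PhiCotangent),
      |-2 * A.slope p (coord n p (s b).proj) (A.scaledMom p (s b))| < |-2 * A.slope p e μ| + 1 :=
    hsr.abs.eventually_lt_const (by linarith)
  have e4 : ∀ᶠ b in (u : Filter A.PhiCotangent),
      |-2 * A.slope p (coord n p (w b).proj) (A.scaledMom p (w b)) -
        -2 * A.slope p (coord n p (s b).proj) (A.scaledMom p (s b))| < η := by
    have h2 := (hsl.sub hsr).abs
    rw [sub_self, abs_zero] at h2
    exact h2.eventually_lt_const hη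
  obtain ⟨b, h1, h2, h3, h4, hbD, hbE⟩ :=
    (e1.and (e2.and (e3.and (e4.and (hdom.and huE))))).exists
  obtain ⟨hs, hεT, -⟩ := hsT b hbE
  have hseg := isSegment_flow hs
  obtain ⟨g, k, hf, hg, hk, hgs⟩ := hconv _ hseg
  have hx0 := hs.1
  have hxT : 0 < A.x (w b).proj := hseg.x_pos (T b) (mem_univ _)
  have hfl0 := flow_zero hs
  have hg0 : g 0 / (A.x (A.flow (s b) 0).proj)⁻¹ =
      -2 * A.slope p (coord n p (s b).proj) (A.scaledMom p (s b)) := by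
    rw [hgs 0 p (by rw [hfl0]; exact hbD.2), hfl0]
    field_simp
  have hgT : g (T b) / (A.x (A.flow (s b) (T b)).proj)⁻¹ =
      -2 * A.slope p (coord n p (w b).proj) (A.scaledMom p (w b)) := by
    rw [hgs (T b) p hbD.1]
    have hxT' : 0 < A.x (A.flow (s b) (T b)).proj := hxT
    change -2 * A.slope p (coord n p (w b).proj) (A.scaledMom p (w b)) * (A.x (w b).proj)⁻¹ /
      (A.x (w b).proj)⁻¹ = _
    field_simp
  refine hno (fun t => (A.x (A.flow (s b) t).proj)⁻¹) g k (T b) hf hg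
    (fun t => inv_pos.2 (hseg.x_pos t (mem_univ t))) hk hεT ?_ ?_ ?_ ?_
  · simp only [hfl0]
    exact (inv_lt_inv₀ hη hx0).2 h1
  · simp only [hfl0]
    change |(A.x (w b).proj)⁻¹ / (A.x (s b).proj)⁻¹ - 1| < η
    rwa [inv_div_inv, ← inv_div]
  · rw [hg0]
    exact h3.le
  · rw [hg0, hgT]
    exact h4

/-- The elements of the forward bicharacteristic relation corresponding to times bounded below do not
accumulate at the boundary `∂_diag Λ₊`. -/
theorem disjoint_diagFace_closure_longFBR (hA : A.Nontrapping) {ε : ℝ} (hε : 0 < ε)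
    {q : A.PhiCotangent} (hq : q ∈ A.diagFace) : q ∉ closure (A.longFBR ε) := by
  obtain ⟨⟨p, h, α, rfl⟩ | ⟨p, hp, ha, hw, hunit, α, rfl⟩, hq2⟩ := hq
  · refine not_mem_closure_longFBR_of_interior hA hε ?_ h hq2
    exact (A.x_nonneg p).lt_of_ne' fun h0 => h ⟨rfl, (A.x_eq_zero p).1 h0⟩
  · have hp0 := mem_chartDom_self (n := n) p
    refine not_mem_closure_longFBR_of_boundary hε hp ?_ rfl ?_ ?_
    · exact ⟨⟨hp0, hp0⟩, fun h1 => one_ne_zero (α := ℝ) h1⟩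
    · change (1 : ℝ)⁻¹ • tangentCoord p p 0 = 0
      have : tangentCoord p p (0 : TangentSpace (halfModel n) p) = 0 := map_zero _
      rw [this, smul_zero]
    · exact cotangentCoord_neg p p α

end AHMetric

/-! ### Quantitative inverse estimates up to the boundary. -/

section StrictEstimate

variable {E F : Type*} [NormedAddCommGroup E] [NormedSpace ℝ E] [NormedAddCommGroup F]
  [NormedSpace ℝ F]

/-- Strict differentiability at `u₀` within `S`: the mean value inequality only needs small pieces
of `S` around `u₀` to be convex, so boundary points are allowed. -/
theorem exists_strict_estimate {f : E → F} {S : Set E} {u₀ : E}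
    (hc : ∀ᶠ d in 𝓝[>] (0 : ℝ), Convex ℝ (S ∩ Metric.ball u₀ d)) (hu : UniqueDiffOn ℝ S)
    (hf : ContDiffOn ℝ ∞ f S) (h0 : u₀ ∈ S) {η : ℝ} (hη : 0 < η) :
    ∀ᶠ d in 𝓝[>] (0 : ℝ), ∀ u ∈ S ∩ Metric.ball u₀ d, ∀ w ∈ S ∩ Metric.ball u₀ d,
      ‖f u - f w - fderivWithin ℝ f S u₀ (u - w)‖ ≤ η * ‖u - w‖ := by
  have h1 : ContinuousWithinAt (fderivWithin ℝ f S) S u₀ :=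
    hf.continuousOn_fderivWithin hu (by simp) u₀ h0
  obtain ⟨d₀, hd₀, h2⟩ := Metric.continuousWithinAt_iff.1 h1 η hη
  have h3 : ∀ᶠ d in 𝓝[>] (0 : ℝ), d < d₀ := mem_nhdsWithin_of_mem_nhds (Iio_mem_nhds hd₀)
  filter_upwards [hc, h3] with d hd hdd u hu' w hw
  refine Convex.norm_image_sub_le_of_norm_hasFDerivWithin_le' (f' := fderivWithin ℝ f S)
    (s := S ∩ Metric.ball u₀ d) (fun y hy => ?_) (fun y hy => ?_) hd hw hu'
  · exact ((hf.differentiableOn (by simp)) y hy.1).hasFDerivWithinAt.mono inter_subset_left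
  · rw [← dist_eq_norm]
    exact (h2 hy.1 ((Metric.mem_ball.1 hy.2).trans hdd)).le

/-- A smooth family of maps, with injective derivative at one point, is uniformly bi-Lipschitz near
that point. -/
theorem exists_uniform_inverse_bound [FiniteDimensional ℝ E] {K : Set E} {e : E} {ρ : ℝ}
    {W : E × E → E} (hρ : 0 < ρ) (hK : Convex ℝ K) (hu : UniqueDiffOn ℝ K) (he : e ∈ K)
    (hW : ContDiffOn ℝ ∞ W (K ×ˢ Metric.ball 0 ρ))
    (hinj : ∀ b, fderivWithin ℝ W (K ×ˢ Metric.ball 0 ρ) (e, 0) (0, b) = 0 → b = 0) :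
    ∃ c > 0, ∃ C d₁ d₂ : ℝ, 0 < d₁ ∧ ∀ᶠ d in 𝓝[>] (0 : ℝ),
      (∀ v ∈ K ∩ Metric.ball e d, ∀ v' ∈ K ∩ Metric.ball e d, ∀ w ∈ Metric.ball (0 : E) d,
        ∀ w' ∈ Metric.ball (0 : E) d,
          c * ‖w - w'‖ ≤ ‖W (v, w) - W (v', w')‖ + C * ‖v - v'‖) ∧
      (∀ v ∈ K ∩ Metric.ball e d, ∀ w ∈ Metric.ball (0 : E) d,
        d₁ ≤ |((fderivWithin ℝ W (K ×ˢ Metric.ball 0 ρ) (v, w)).comp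
          (ContinuousLinearMap.inr ℝ E E)).det| ∧
        |((fderivWithin ℝ W (K ×ˢ Metric.ball 0 ρ) (v, w)).comp
          (ContinuousLinearMap.inr ℝ E E)).det| ≤ d₂) := by
  set S : Set (E × E) := K ×ˢ Metric.ball 0 ρ with hS
  set L := fderivWithin ℝ W S (e, 0) with hL
  have h0 : ((e, 0) : E × E) ∈ S := ⟨he, Metric.mem_ball_self hρ⟩
  have hSc : Convex ℝ S := hK.prod (convex_ball _ _)
  have hSu : UniqueDiffOn ℝ S := hu.prod Metric.isOpen_ball.uniqueDiffOn
  have hmem : ∀ {d : ℝ} {v w : E}, d ≤ ρ → v ∈ K ∩ Metric.ball e d → w ∈ Metric.ball (0 : E) d →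
      (v, w) ∈ S ∩ Metric.ball (e, 0) d := fun hd hv hw =>
    ⟨⟨hv.1, Metric.ball_subset_ball hd hw⟩, by
      rw [← ball_prod_same]; exact ⟨hv.2, hw⟩⟩
  obtain ⟨k, hk, hanti⟩ := (L.comp (ContinuousLinearMap.inr ℝ E E)).toLinearMap.exists_antilipschitzWith
    (LinearMap.ker_eq_bot'.2 hinj)
  have hk0 : (0 : ℝ) < k := hk
  have hLw : ∀ b, (k : ℝ)⁻¹ * ‖b‖ ≤ ‖L (0, b)‖ := fun b => by
    have := hanti.le_mul_dist b 0
    rw [dist_zero_right, map_zero, dist_zero_right] at this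
    rw [inv_mul_le_iff₀ hk0]
    exact this
  -- The linearization expands `w` by at least `k⁻¹`; an error of half that size leaves the lower
  -- bound `k⁻¹ / 2`.
  have hη : 0 < (k : ℝ)⁻¹ / 2 := by positivity
  have hest := exists_strict_estimate (f := W) (S := S) (u₀ := (e, 0))
    (Eventually.of_forall fun d => hSc.inter (convex_ball _ _)) hSu hW h0 hη
  have hdρ : ∀ᶠ d in 𝓝[>] (0 : ℝ), d < ρ := mem_nhdsWithin_of_mem_nhds (Iio_mem_nhds hρ)
  let D : E × E → ℝ := fun u => |((fderivWithin ℝ W S u).comp (ContinuousLinearMap.inr ℝ E E)).det|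
  have hD : ContinuousWithinAt D S (e, 0) := by
    have h1 : ContinuousWithinAt (fderivWithin ℝ W S) S (e, 0) :=
      hW.continuousOn_fderivWithin hSu (by simp) _ h0
    have h2 : ContinuousWithinAt (fun u => (fderivWithin ℝ W S u).comp
        (ContinuousLinearMap.inr ℝ E E)) S (e, 0) := h1.clm_comp continuousWithinAt_const
    exact (continuous_abs.comp ContinuousLinearMap.continuous_det).continuousAt.comp_continuousWithinAt h2
  have hD0 : 0 < D (e, 0) := by
    refine abs_pos.2 ?_
    have h2 : LinearMap.ker (L.comp (ContinuousLinearMap.inr ℝ E E)).toLinearMap = ⊥ :=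
      LinearMap.ker_eq_bot'.2 hinj
    exact fun h => (LinearMap.bot_lt_ker_of_det_eq_zero h).ne' h2
  obtain ⟨d₀, hd₀, hDd⟩ := Metric.continuousWithinAt_iff.1 hD (D (e, 0) / 2) (by positivity)
  have hdd : ∀ᶠ d in 𝓝[>] (0 : ℝ), d < d₀ := mem_nhdsWithin_of_mem_nhds (Iio_mem_nhds hd₀)
  refine ⟨(k : ℝ)⁻¹ / 2, hη, ‖L‖ + (k : ℝ)⁻¹ / 2, D (e, 0) / 2, 2 * D (e, 0), by positivity, ?_⟩
  filter_upwards [hest, hdρ, hdd] with d h1 h2 h3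
  refine ⟨fun v hv v' hv' w hw w' hw' => ?_, fun v hv w hw => ?_⟩
  · have h4 := h1 _ (hmem h2.le hv hw) _ (hmem h2.le hv' hw')
    rw [show ((v, w) : E × E) - (v', w') = (v - v', 0) + (0, w - w') by simp, map_add] at h4
    have h5 := hLw (w - w')
    have h6 : ‖L (v - v', 0)‖ ≤ ‖L‖ * ‖v - v'‖ := by
      refine (L.le_opNorm _).trans_eq ?_
      rw [Prod.norm_mk, norm_zero, max_eq_left (norm_nonneg _)]
    have h7 : ‖((v - v', 0) : E × E) + (0, w - w')‖ ≤ ‖v - v'‖ + ‖w - w'‖ := by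
      rw [Prod.mk_add_mk, add_zero, zero_add, Prod.norm_mk]
      exact max_le_add_of_nonneg (norm_nonneg _) (norm_nonneg _)
    have h8 : ‖L (0, w - w')‖ ≤ ‖W (v, w) - W (v', w')‖ + ‖L (v - v', 0)‖ +
        ‖W (v, w) - W (v', w') - (L (v - v', 0) + L (0, w - w'))‖ := by
      have h9 : L (0, w - w') = W (v, w) - W (v', w') - L (v - v', 0) -
        (W (v, w) - W (v', w') - (L (v - v', 0) + L (0, w - w'))) := by abel
      calc ‖L (0, w - w')‖ = _ := congrArg norm h9
        _ ≤ _ := (norm_sub_le _ _).trans (add_le_add_left (norm_sub_le _ _) _)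
    nlinarith [mul_le_mul_of_nonneg_left h7 hη.le]
  · have h4 := hmem h2.le hv hw
    have h5 := hDd h4.1 ((Metric.mem_ball.1 h4.2).trans h3)
    rw [Real.dist_eq, abs_lt] at h5
    change D (e, 0) / 2 ≤ D (v, w) ∧ D (v, w) ≤ 2 * D (e, 0)
    exact ⟨by linarith, by linarith⟩

end StrictEstimate

/-! ### The displacement map. -/

namespace AHMetric

variable {n : ℕ} {X : Type*} [TopologicalSpace X] [ChartedSpace (EuclideanHalfSpace (n + 1)) X]
  [IsManifold (halfModel n) ∞ X] {A : AHMetric n X}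

namespace LocalFlow

variable {p : X} (F : A.LocalFlow p)

/-- The displacement `W(v, w)`, relative to `x(v)`, of the bicharacteristic that starts at `v` with
initial momentum `w`, at time one. -/
def disp (u : EMod n × EMod n) : EMod n :=
  (F.ε / 2) • (F.sol (F.ε / 2, u.1, (F.ε / 2)⁻¹ • u.2) 1).1

/-- The positions used for the displacement. -/
def posDom : Set (EMod n) := Metric.ball (coord n p p) F.δ ∩ halfSpace n

/-- The domain of the displacement. -/
def dispDom : Set (EMod n × EMod n) := F.posDom ×ˢ Metric.ball 0 (F.ε / 2 * F.R)

variable {F}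

theorem posDom_subset : F.posDom ⊆ chartTgt n p := fun _ hv =>
  F.sub ⟨Metric.ball_subset_closedBall (Metric.ball_subset_ball F.δ_le hv.1), hv.2⟩

theorem self_mem_posDom : coord n p p ∈ F.posDom :=
  ⟨Metric.mem_ball_self F.δ_pos, chartTgt_subset p (coord_mem (mem_chartDom_self p))⟩

theorem disp_aux {u : EMod n × EMod n} (hu : u ∈ F.dispDom) :
    (F.ε / 2, u.1, (F.ε / 2)⁻¹ • u.2) ∈ F.dom := by
  have hε := F.ε_pos
  refine ⟨⟨by simp only; linarith, by simp only; linarith⟩, hu.1, ?_⟩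
  have h1 : ‖u.2‖ < F.ε / 2 * F.R := mem_ball_zero_iff.1 hu.2
  rw [mem_ball_zero_iff, norm_smul, norm_inv, Real.norm_eq_abs, abs_of_pos (by positivity),
    inv_mul_lt_iff₀ (by positivity)]
  exact h1

theorem contDiffOn_disp : ContDiffOn ℝ ∞ F.disp F.dispDom := by
  have h1 : ContDiffOn ℝ ∞ (fun u : EMod n × EMod n => (F.ε / 2, u.1, (F.ε / 2)⁻¹ • u.2))
      F.dispDom := by fun_prop
  exact (contDiffOn_const (c := F.ε / 2)).smul
    ((F.smooth 1 (right_mem_Icc.2 zero_le_one)).comp h1 fun u hu => disp_aux hu).fst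

/-- By `sol_eq_of_smul_eq` the displacement depends on `(r, a)` only through `w = r a`, and `disp`,
computed at the fixed time scale `ε / 2`, is smooth in `w` also at `w = 0`. All degeneracy is thus
in the polar coordinates of `w`. -/
theorem disp_eq {l : ℝ × EMod n × EMod n} (hl : l ∈ F.dom) (h : (l.2.1, l.1 • l.2.2) ∈ F.dispDom) :
    F.disp (l.2.1, l.1 • l.2.2) = l.1 • (F.sol l 1).1 := by
  refine (sol_eq_of_smul_eq (disp_aux h) hl rfl ?_ (right_mem_Icc.2 zero_le_one)).1
  have hε := F.ε_pos
  exact smul_inv_smul₀ (by positivity) _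

theorem pos_eq_disp {l : ℝ × EMod n × EMod n} (hl : l ∈ F.dom)
    (h : (l.2.1, l.1 • l.2.2) ∈ F.dispDom) :
    F.pos l 1 = l.2.1 + A.xc p l.2.1 • F.disp (l.2.1, l.1 • l.2.2) := by
  rw [disp_eq hl h, smul_smul, pos]

theorem mem_dom_zero {v a : EMod n} (hv : v ∈ F.posDom) (ha : ‖a‖ < F.R) :
    ((0 : ℝ), v, a) ∈ F.dom :=
  ⟨⟨by linarith [F.ε_pos], F.ε_pos⟩, hv, mem_ball_zero_iff.2 ha⟩

theorem zero_mem_ball : (0 : EMod n) ∈ Metric.ball (0 : EMod n) (F.ε / 2 * F.R) := by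
  have hε := F.ε_pos
  have hR := F.R_pos
  exact Metric.mem_ball_self (by positivity)

theorem disp_zero {v : EMod n} (hv : v ∈ F.posDom) : F.disp (v, 0) = 0 := by
  have h1 : (v, (0 : ℝ) • (0 : EMod n)) ∈ F.dispDom := by
    rw [zero_smul]; exact ⟨hv, zero_mem_ball⟩
  have := disp_eq (mem_dom_zero hv (by rw [norm_zero]; exact F.R_pos)) h1
  simpa using this

/-- On the ray `r a` one has `W(v, r a) = r V(r, v, a)`, whose derivative at `r = 0` is `V(0, v, a)
= 2 raise a`. -/
theorem fderivWithin_disp_zero {v : EMod n} (hv : v ∈ F.posDom) (b : EMod n) :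
    fderivWithin ℝ F.disp F.dispDom (v, 0) (0, b) = (2 : ℝ) • A.raise p v b := by
  have key : ∀ a : EMod n, ‖a‖ < F.R →
      fderivWithin ℝ F.disp F.dispDom (v, 0) (0, a) = (2 : ℝ) • A.raise p v a := fun a ha => by
    have hl := mem_dom_zero hv ha
    have hlin : HasDerivAt (fun r : ℝ => ((v, r • a) : EMod n × EMod n)) (0, a) 0 :=
      (hasDerivAt_const _ _).prodMk (by simpa using (hasDerivAt_id (0 : ℝ)).smul_const a)
    have hcont : ContinuousAt (fun r : ℝ => r • a) 0 := by fun_prop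
    have hev : ∀ᶠ r : ℝ in 𝓝 0, (v, r • a) ∈ F.dispDom := by
      have : ∀ᶠ r : ℝ in 𝓝 0, r • a ∈ Metric.ball (0 : EMod n) (F.ε / 2 * F.R) :=
        hcont.eventually_mem (Metric.isOpen_ball.mem_nhds (by
          rw [zero_smul]; exact zero_mem_ball))
      exact this.mono fun r hr => ⟨hv, hr⟩
    have hevd : ∀ᶠ r : ℝ in 𝓝 0, (r, v, a) ∈ F.dom := by
      have : ∀ᶠ r : ℝ in 𝓝 0, r ∈ Ioo (-F.ε) F.ε :=
        Ioo_mem_nhds (by linarith [F.ε_pos]) F.ε_pos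
      exact this.mono fun r hr => ⟨hr, hv, mem_ball_zero_iff.2 ha⟩
    have hd1 : HasDerivAt (fun r : ℝ => F.disp (v, r • a))
        (fderivWithin ℝ F.disp F.dispDom (v, 0) (0, a)) 0 := by
      have h1 : HasFDerivWithinAt F.disp (fderivWithin ℝ F.disp F.dispDom (v, 0)) F.dispDom (v, 0) :=
        ((contDiffOn_disp.differentiableOn (by simp)) (v, 0)
          ⟨hv, zero_mem_ball⟩).hasFDerivWithinAt
      exact h1.comp_hasDerivAt_of_eq (f := fun r : ℝ => ((v, r • a) : EMod n × EMod n))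
        0 hlin hev (by simp)
    have hV : DifferentiableAt ℝ (fun r : ℝ => (F.sol (r, v, a) 1).1) 0 := by
      have h1 := (F.smooth 1 (right_mem_Icc.2 zero_le_one)).fst.differentiableOn (by simp) _ hl
      have h2 : HasDerivAt (fun r : ℝ => ((r, v, a) : ℝ × EMod n × EMod n)) (1, 0) 0 :=
        (hasDerivAt_id (0 : ℝ)).prodMk (hasDerivAt_const _ _)
      exact (h1.hasFDerivWithinAt.comp_hasDerivAt_of_eq
        (f := fun r : ℝ => ((r, v, a) : ℝ × EMod n × EMod n)) 0 h2 hevd rfl).differentiableAt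
    have hd2 : HasDerivAt (fun r : ℝ => r • (F.sol (r, v, a) 1).1)
        ((2 : ℝ) • A.raise p v a) 0 := by
      refine ((hasDerivAt_id (0 : ℝ)).smul hV.hasDerivAt).congr_deriv ?_
      have := (sol_of_fst_eq_zero hl rfl (right_mem_Icc.2 zero_le_one)).2.2
      simp only [id, zero_smul, one_smul, zero_add]
      rw [this, mul_one]
    refine hd1.unique (hd2.congr_of_eventuallyEq ?_)
    filter_upwards [hev, hevd] with r h1 h2
    exact disp_eq h2 h1
  have hR := F.R_pos
  -- Scaling by `t` brings `b` into the ball of momenta covered by the flow; both sides are linear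
  -- in `b`.
  set t : ℝ := F.R / 2 / (‖b‖ + 1) with ht
  have htp : 0 < t := by positivity
  have h1 : ‖t • b‖ < F.R := by
    rw [norm_smul, Real.norm_eq_abs, abs_of_pos htp, ht, div_mul_eq_mul_div,
      div_lt_iff₀ (by positivity)]
    nlinarith [norm_nonneg b]
  have h2 := key _ h1
  have h3 : ((0 : EMod n), t • b) = t • ((0 : EMod n), b) := by simp
  rw [h3, map_smul, map_smul, smul_comm (2 : ℝ) t] at h2
  exact smul_right_injective _ htp.ne' h2

variable (F) in
/-- The derivative of the displacement in the momentum variable. -/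
def dispDeriv (u : EMod n × EMod n) : EMod n →L[ℝ] EMod n :=
  (fderivWithin ℝ F.disp F.dispDom u).comp (ContinuousLinearMap.inr ℝ (EMod n) (EMod n))

variable (F) in
/-- `d` is so small that the displacement is uniformly bi-Lipschitz in momenta of norm less than `d`,
for positions at distance less than `d` from the centre of the chart. -/
structure IsGoodRadius (d c C d₁ d₂ : ℝ) : Prop where
  pos : 0 < d
  c_pos : 0 < c
  d₁_pos : 0 < d₁
  le : d ≤ F.ε / 2 * F.R
  quad_lt : ∀ v ∈ F.posDom ∩ Metric.ball (coord n p p) d, ∀ w ∈ Metric.ball (0 : EMod n) d,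
    A.quad p v w < F.ε ^ 2
  front : ∀ v ∈ F.posDom ∩ Metric.ball (coord n p p) d, ∀ w ∈ Metric.ball (0 : EMod n) d,
    0 ≤ 1 + inner ℝ (A.gradX p v) (F.disp (v, w))
  bound : ∀ v ∈ F.posDom ∩ Metric.ball (coord n p p) d,
    ∀ v' ∈ F.posDom ∩ Metric.ball (coord n p p) d, ∀ w ∈ Metric.ball (0 : EMod n) d,
    ∀ w' ∈ Metric.ball (0 : EMod n) d,
      c * ‖w - w'‖ ≤ ‖F.disp (v, w) - F.disp (v', w')‖ + C * ‖v - v'‖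
  det : ∀ v ∈ F.posDom ∩ Metric.ball (coord n p p) d, ∀ w ∈ Metric.ball (0 : EMod n) d,
    d₁ ≤ |(F.dispDeriv (v, w)).det| ∧ |(F.dispDeriv (v, w)).det| ≤ d₂

-- The derivative of `disp` at `w = 0` is injective because the cometric is positive, so
-- `exists_uniform_inverse_bound` applies. The other conditions hold strictly at the centre with `w
-- = 0`, hence nearby: `quad_lt` will keep travel times below `ε`, and `front` makes the normal
-- vectors `(1, W)` point inward.
variable (F) in
theorem exists_isGoodRadius : ∃ d c C d₁ d₂, F.IsGoodRadius d c C d₁ d₂ := by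
  have hε := F.ε_pos
  have hR := F.R_pos
  have he := F.self_mem_posDom
  obtain ⟨c, hc, C, d₁, d₂, hd₁, hev⟩ := exists_uniform_inverse_bound (K := F.posDom)
    (e := coord n p p) (ρ := F.ε / 2 * F.R) (W := F.disp) (by positivity)
    ((convex_ball _ _).inter convex_halfSpace) (uniqueDiffOn_ball_inter_halfSpace _ _) he
    contDiffOn_disp fun b hb => by
      have h1 := fderivWithin_disp_zero he b
      change fderivWithin ℝ F.disp F.dispDom (coord n p p, 0) (0, b) = 0 at hb
      rw [hb, eq_comm, smul_eq_zero_iff_right two_ne_zero] at h1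
      by_contra hb0
      have := A.raise_pos (posDom_subset he) hb0
      rw [h1, inner_zero_right] at this
      exact this.false
  have h0 : (coord n p p, (0 : EMod n)) ∈ F.dispDom := ⟨he, zero_mem_ball⟩
  have hball : ∀ {P : EMod n × EMod n → Prop}, (∀ᶠ u in 𝓝[F.dispDom] (coord n p p, 0), P u) →
      ∀ᶠ d in 𝓝[>] (0 : ℝ), ∀ v ∈ F.posDom ∩ Metric.ball (coord n p p) d,
        ∀ w ∈ Metric.ball (0 : EMod n) d, P (v, w) := fun {P} hP => by
    obtain ⟨r, hr, hrs⟩ := Metric.mem_nhdsWithin_iff.1 hP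
    have h1 : ∀ᶠ d in 𝓝[>] (0 : ℝ), d < min r (F.ε / 2 * F.R) :=
      mem_nhdsWithin_of_mem_nhds (Iio_mem_nhds (lt_min hr (by positivity)))
    filter_upwards [h1] with d hd v hv w hw
    refine hrs ⟨?_, hv.1, Metric.ball_subset_ball (hd.le.trans (min_le_right _ _)) hw⟩
    rw [← ball_prod_same]
    exact ⟨Metric.ball_subset_ball (hd.le.trans (min_le_left _ _)) hv.2,
      Metric.ball_subset_ball (hd.le.trans (min_le_left _ _)) hw⟩
  have hq : ∀ᶠ u in 𝓝[F.dispDom] (coord n p p, (0 : EMod n)), A.quad p u.1 u.2 < F.ε ^ 2 := by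
    have h1 : ContinuousWithinAt (fun u : EMod n × EMod n => A.quad p u.1 u.2) F.dispDom
        (coord n p p, 0) :=
      (A.contDiffOn_quad p).continuousOn.mono (t := F.dispDom)
        (fun u hu => mk_mem_prod (posDom_subset (mem_prod.1 hu).1) (mem_univ _)) _ h0
    refine h1.eventually_lt_const ?_
    have : A.quad p (coord n p p) 0 = 0 := by simp [quad]
    change A.quad p (coord n p p) 0 < _
    rw [this]
    positivity
  have hf : ∀ᶠ u in 𝓝[F.dispDom] (coord n p p, (0 : EMod n)),
      0 < 1 + inner ℝ (A.gradX p u.1) (F.disp u) := by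
    have h1 : ContinuousWithinAt (fun u : EMod n × EMod n => A.gradX p u.1) F.dispDom
        (coord n p p, 0) :=
      ((A.contDiffOn_gradX p).continuousOn.comp continuousOn_fst
        fun u hu => posDom_subset hu.1) _ h0
    have h2 : ContinuousWithinAt (fun u : EMod n × EMod n =>
        1 + inner ℝ (A.gradX p u.1) (F.disp u)) F.dispDom (coord n p p, 0) :=
      continuousWithinAt_const.add (h1.inner (𝕜 := ℝ) (contDiffOn_disp.continuousOn _ h0))
    refine h2.eventually_const_lt ?_
    change 0 < 1 + inner ℝ (A.gradX p (coord n p p)) (F.disp (coord n p p, 0))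
    rw [disp_zero he, inner_zero_right]
    norm_num
  have hle : ∀ᶠ d in 𝓝[>] (0 : ℝ), d < F.ε / 2 * F.R :=
    mem_nhdsWithin_of_mem_nhds (Iio_mem_nhds (by positivity))
  obtain ⟨d, hd, h1, h2, h3, h4⟩ := (eventually_mem_nhdsWithin.and (hev.and
    ((hball hq).and ((hball hf).and hle)))).exists
  exact ⟨d, c, C, d₁, d₂, hd, hc, hd₁, h4.le, h2, fun v hv w hw => (h3 v hv w hw).le, h1.1, h1.2⟩

end LocalFlow

end AHMetric

/-! ### The inverse of the projective coordinates and its continuity. -/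

section ChartTransition

variable {n : ℕ} {X : Type*} [TopologicalSpace X] [ChartedSpace (EuclideanHalfSpace (n + 1)) X]
  [IsManifold (halfModel n) ∞ X]

theorem transDom_subset {p p' : X} : transDom n p p' ⊆ halfSpace n :=
  fun _ hv => chartTgt_subset p hv.1

theorem uniqueDiffOn_transDom (p p' : X) : UniqueDiffOn ℝ (transDom n p p') := fun v hv =>
  (uniqueDiffOn_halfSpace v (transDom_subset hv)).mono_nhds
    (le_inf inf_le_left (le_principal_iff.2 (transDom_nhdsWithin hv)))

/-- Near the point the domain of the coordinate change coincides with the half-space, which is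
convex. -/
theorem eventually_convex_transDom {p p' : X} {v : EMod n} (hv : v ∈ transDom n p p') :
    ∀ᶠ d in 𝓝[>] (0 : ℝ), Convex ℝ (transDom n p p' ∩ Metric.ball v d) := by
  obtain ⟨r, hr, hs⟩ := Metric.mem_nhdsWithin_iff.1 (transDom_nhdsWithin hv)
  have h1 : ∀ᶠ d in 𝓝[>] (0 : ℝ), d < r := mem_nhdsWithin_of_mem_nhds (Iio_mem_nhds hr)
  filter_upwards [h1] with d hd
  have h2 : transDom n p p' ∩ Metric.ball v d = halfSpace n ∩ Metric.ball v d := by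
    ext w
    exact ⟨fun h => ⟨transDom_subset h.1, h.2⟩,
      fun h => ⟨hs ⟨Metric.ball_subset_ball hd.le h.2, h.1⟩, h.2⟩⟩
  rw [h2]
  exact convex_halfSpace.inter (convex_ball _ _)

theorem tangentCoord_frame_eq' {p p' z : X} (hz : z ∈ chartDom n p) (hz' : z ∈ chartDom n p')
    (e : EMod n) : tangentCoord p' z (frame p z e) =
      fderivWithin ℝ (chTrans p p') (transDom n p p') (coord n p z) e := by
  have hm := coord_mem_transDom hz hz'
  rw [tangentCoord_frame_eq hz hz', fderivWithin_subset transDom_subset (uniqueDiffOn_transDom _ _ _ hm)]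
  exact ((contDiffOn_chTrans p p').differentiableOn (by simp) _ hm).mono_of_mem_nhdsWithin
    (transDom_nhdsWithin hm)

end ChartTransition

namespace AHMetric

variable {n : ℕ} {X : Type*} [TopologicalSpace X] [ChartedSpace (EuclideanHalfSpace (n + 1)) X]
  [IsManifold (halfModel n) ∞ X] {A : AHMetric n X}

theorem gbar_nonneg (q : X) (w : TangentSpace (halfModel n) q) : 0 ≤ A.compactMetric q w w := by
  by_cases h : w = 0
  · rw [h, compactMetric, map_zero]
  · exact (A.gbar.pos q w h).le

theorem compactMetric_smul (q : X) (c : ℝ) (w : TangentSpace (halfModel n) q) :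
    A.compactMetric q (c • w) (c • w) = c ^ 2 * A.compactMetric q w w := by
  simp only [compactMetric, map_smul, smul_apply, smul_eq_mul]
  ring

namespace DoubleSpace

/-- The point of the front face on the ray spanned by the normal vector `(1, w)`. -/
def frontPoint (q : X) (hq : q ∈ (halfModel n).boundary X) (w : TangentSpace (halfModel n) q)
    (hw : 0 ≤ 1 + A.dx q w) : A.DoubleSpace :=
  .front q hq (√(1 + A.compactMetric q w w))⁻¹ ((√(1 + A.compactMetric q w w))⁻¹ • w)
    (inv_nonneg.2 (Real.sqrt_nonneg _))
    (by
      have h1 : A.dx q ((√(1 + A.compactMetric q w w))⁻¹ • w) =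
          (√(1 + A.compactMetric q w w))⁻¹ * A.dx q w := map_smul _ _ _
      have h2 : 0 ≤ (√(1 + A.compactMetric q w w))⁻¹ := inv_nonneg.2 (Real.sqrt_nonneg _)
      rw [h1]
      nlinarith)
    (by
      have h0 := gbar_nonneg (A := A) q w
      rw [compactMetric_smul, inv_pow, Real.sq_sqrt (by linarith)]
      field_simp)

open Classical in
variable (A) in
/-- The inverse of the projective coordinates. -/
def projInv (p : X) (u : EMod n × EMod n) : A.DoubleSpace :=
  if h : chartInv p (u.1 + A.xc p u.1 • u.2) = chartInv p u.1 ∧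
      chartInv p (u.1 + A.xc p u.1 • u.2) ∈ (halfModel n).boundary X then
    if hw : 0 ≤ 1 + A.dx (chartInv p u.1) (frame p (chartInv p u.1) u.2) then
      frontPoint (chartInv p u.1) (h.1 ▸ h.2) (frame p (chartInv p u.1) u.2) hw
    -- A default value: outside `projTgt` the ray may point outward.
    else frontPoint (chartInv p u.1) (h.1 ▸ h.2) 0
      (by rw [show A.dx (chartInv p u.1) 0 = 0 from map_zero _]; norm_num)
  else .off _ _ h

variable (A) in
/-- The image of the projective coordinates. -/
def projTgt (p : X) : Set (EMod n × EMod n) :=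
  {u | u.1 ∈ chartTgt n p ∧ u.1 + A.xc p u.1 • u.2 ∈ chartTgt n p ∧
    (A.xc p u.1 = 0 → 0 ≤ 1 + inner ℝ (A.gradX p u.1) u.2)}

variable {p : X} {u : EMod n × EMod n}

theorem projInv_of_eq_zero (hu : u ∈ projTgt A p) (h : A.xc p u.1 = 0) :
    ∃ hq hw, projInv A p u = frontPoint (chartInv p u.1) hq (frame p (chartInv p u.1) u.2) hw := by
  have h1 : chartInv p (u.1 + A.xc p u.1 • u.2) = chartInv p u.1 := by rw [h, zero_smul, add_zero]
  have h2 : chartInv p u.1 ∈ (halfModel n).boundary X := (A.x_eq_zero _).1 h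
  have h3 : 0 ≤ 1 + A.dx (chartInv p u.1) (frame p (chartInv p u.1) u.2) := by
    rw [A.dx_frame (chartInv_mem hu.1), coord_chartInv hu.1]
    exact hu.2.2 h
  refine ⟨h2, h3, ?_⟩
  rw [projInv, dif_pos ⟨h1, h1 ▸ h2⟩, dif_pos h3]

theorem projInv_of_ne_zero (h : A.xc p u.1 ≠ 0) :
    ∃ hq, projInv A p u = .off (chartInv p (u.1 + A.xc p u.1 • u.2)) (chartInv p u.1) hq := by
  have h1 : ¬ (chartInv p (u.1 + A.xc p u.1 • u.2) = chartInv p u.1 ∧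
      chartInv p (u.1 + A.xc p u.1 • u.2) ∈ (halfModel n).boundary X) := fun h' =>
    h ((A.x_eq_zero _).2 (h'.1 ▸ h'.2))
  exact ⟨h1, by rw [projInv, dif_neg h1]⟩

theorem projInv_left (hu : u ∈ projTgt A p) :
    (projInv A p u).left = chartInv p (u.1 + A.xc p u.1 • u.2) := by
  by_cases h : A.xc p u.1 = 0
  · obtain ⟨_, _, h1⟩ := projInv_of_eq_zero hu h
    rw [h1, h, zero_smul, add_zero]
    rfl
  · obtain ⟨_, h1⟩ := projInv_of_ne_zero h
    rw [h1]
    rfl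

theorem projInv_right (hu : u ∈ projTgt A p) : (projInv A p u).right = chartInv p u.1 := by
  by_cases h : A.xc p u.1 = 0
  · obtain ⟨_, _, h1⟩ := projInv_of_eq_zero hu h
    rw [h1]
    rfl
  · obtain ⟨_, h1⟩ := projInv_of_ne_zero h
    rw [h1]
    rfl

theorem projInv_mem_FF (hu : u ∈ projTgt A p) : projInv A p u ∈ FF ↔ u.1 0 = 0 := by
  rw [← A.xc_eq_zero_iff hu.1]
  by_cases h : A.xc p u.1 = 0
  · obtain ⟨_, _, h1⟩ := projInv_of_eq_zero hu h
    rw [h1]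
    exact iff_of_true trivial h
  · obtain ⟨_, h1⟩ := projInv_of_ne_zero h
    rw [h1]
    exact iff_of_false id h

theorem normalCoord_frontPoint (p₀ : X) {q : X} {hq : q ∈ (halfModel n).boundary X}
    {w : TangentSpace (halfModel n) q} {hw : 0 ≤ 1 + A.dx q w} :
    normalCoord p₀ (frontPoint q hq w hw) =
      (√(1 + A.compactMetric q w w))⁻¹ • ((1 : ℝ), tangentCoord p₀ q w) := by
  change ((√(1 + A.compactMetric q w w))⁻¹,
    tangentCoord p₀ q ((√(1 + A.compactMetric q w w))⁻¹ • w)) = _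
  rw [tangentCoord_smul, Prod.smul_mk, smul_eq_mul, mul_one]

open Classical in
variable (A) in
/-- The quotient of the normal coordinates in the chart centred at `p₀`, in terms of the projective
coordinates in the chart centred at `p`. -/
def quotCoord (p p₀ : X) (u : EMod n × EMod n) : EMod n :=
  if A.xc p u.1 = 0 then fderivWithin ℝ (chTrans p p₀) (transDom n p p₀) u.1 u.2
  else (A.xc p u.1)⁻¹ • (chTrans p p₀ (u.1 + A.xc p u.1 • u.2) - chTrans p p₀ u.1)

/-- The blow-up topology sees normal coordinates only up to a positive factor. The multiple of `(1,
quotCoord)` treats the front face and its complement at once. -/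
theorem exists_normalCoord_projInv {p₀ : X} (hu : u ∈ projTgt A p)
    (h0 : chartInv p u.1 ∈ chartDom n p₀) :
    ∃ κ > (0 : ℝ), normalCoord p₀ (projInv A p u) = κ • ((1 : ℝ), quotCoord A p p₀ u) := by
  by_cases h : A.xc p u.1 = 0
  · obtain ⟨hq, hw, h1⟩ := projInv_of_eq_zero hu h
    have h2 := gbar_nonneg (A := A) (chartInv p u.1) (frame p (chartInv p u.1) u.2)
    have h3 : 0 < (√(1 + A.compactMetric (chartInv p u.1) (frame p (chartInv p u.1) u.2)
        (frame p (chartInv p u.1) u.2)))⁻¹ := inv_pos.2 (Real.sqrt_pos.2 (by linarith))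
    refine ⟨_, h3, ?_⟩
    rw [h1, normalCoord_frontPoint, tangentCoord_frame_eq' (chartInv_mem hu.1) h0,
      coord_chartInv hu.1, quotCoord, if_pos h]
  · obtain ⟨_, h1⟩ := projInv_of_ne_zero h
    refine ⟨A.xc p u.1, (A.xc_nonneg _ _).lt_of_ne' h, ?_⟩
    rw [h1, quotCoord, if_neg h, Prod.smul_mk, smul_inv_smul₀ h, smul_eq_mul, mul_one]
    rfl

theorem projInv_mem_projDom (hu : u ∈ projTgt A p) : projInv A p u ∈ projDom p := by
  refine ⟨⟨?_, ?_⟩, ?_⟩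
  · rw [projInv_left hu]
    exact chartInv_mem hu.2.1
  · rw [projInv_right hu]
    exact chartInv_mem hu.1
  · rw [← normalCoord_fst_pos (p := p)]
    obtain ⟨κ, hκ, h⟩ := exists_normalCoord_projInv hu (chartInv_mem hu.1)
    rw [h]
    simpa using hκ

theorem projCoord_projInv (hu : u ∈ projTgt A p) : projCoord p (projInv A p u) = u := by
  have h0 := chartInv_mem hu.1
  obtain ⟨κ, hκ, h⟩ := exists_normalCoord_projInv hu h0
  refine Prod.ext ?_ ?_
  · change coord n p (projInv A p u).right = _
    rw [projInv_right hu, coord_chartInv hu.1]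
  · change (normalCoord p (projInv A p u)).1⁻¹ • (normalCoord p (projInv A p u)).2 = _
    rw [h]
    change (κ * 1)⁻¹ • κ • quotCoord A p p u = _
    rw [mul_one, inv_smul_smul₀ hκ.ne', quotCoord]
    split_ifs with hx
    · rw [← coord_chartInv hu.1, ← tangentCoord_frame_eq' h0 h0, tangentCoord_frame h0]
    · have hT : ∀ v ∈ chartTgt n p, chTrans p p v = v := fun v hv => coord_chartInv hv
      rw [hT _ hu.1, hT _ hu.2.1, add_sub_cancel_left, inv_smul_smul₀ hx]

theorem projInv_projCoord {b : A.DoubleSpace} (hb : b ∈ projDom p) (h : projCoord p b ∈ projTgt A p) :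
    projInv A p (projCoord p b) = b :=
  injOn_projCoord p (projInv_mem_projDom h) hb (projCoord_projInv h)

/-- At the front face the difference quotient of the coordinate change tends to its derivative even
when the base points vary; this is strict differentiability up to the boundary. -/
theorem continuousWithinAt_quotCoord {p₀ : X} (hu : u ∈ projTgt A p)
    (h1 : chartInv p u.1 ∈ chartDom n p₀)
    (h2 : chartInv p (u.1 + A.xc p u.1 • u.2) ∈ chartDom n p₀) :
    ContinuousWithinAt (quotCoord A p p₀) (projTgt A p) u := by
  set v₀ := u.1 with hv₀
  have hx : ContinuousWithinAt (fun u : EMod n × EMod n => A.xc p u.1) (projTgt A p) u :=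
    ((A.contDiffOn_xc p).continuousOn.comp continuousOn_fst fun _ h => h.1) u hu
  have hm1 : v₀ ∈ transDom n p p₀ := ⟨hu.1, h1⟩
  have hm2 : v₀ + A.xc p v₀ • u.2 ∈ transDom n p p₀ := ⟨hu.2.1, h2⟩
  have hc1 : ContinuousWithinAt (fun u : EMod n × EMod n => u.1) (projTgt A p) u :=
    continuousWithinAt_fst
  have hc2 : ContinuousWithinAt (fun u : EMod n × EMod n => u.1 + A.xc p u.1 • u.2) (projTgt A p) u :=
    hc1.add (hx.smul continuousWithinAt_snd)
  have hmem : ∀ {f : EMod n × EMod n → EMod n}, ContinuousWithinAt f (projTgt A p) u →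
      f u ∈ transDom n p p₀ → (∀ w ∈ projTgt A p, f w ∈ chartTgt n p) →
      Tendsto f (𝓝[projTgt A p] u) (𝓝[transDom n p p₀] (f u)) := fun {f} hf hfu hft => by
    refine tendsto_nhdsWithin_iff.2 ⟨hf, ?_⟩
    have h3 : Tendsto f (𝓝[projTgt A p] u) (𝓝[halfSpace n] (f u)) :=
      tendsto_nhdsWithin_iff.2 ⟨hf, eventually_mem_nhdsWithin.mono
        fun w hw => chartTgt_subset p (hft w hw)⟩
    exact h3 (transDom_nhdsWithin hfu)
  have ht1 := hmem hc1 hm1 fun w hw => hw.1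
  have ht2 := hmem hc2 hm2 fun w hw => hw.2.1
  have hφ := contDiffOn_chTrans (n := n) p p₀
  by_cases h : A.xc p v₀ = 0
  · set L := fderivWithin ℝ (chTrans p p₀) (transDom n p p₀) v₀ with hL
    have hval : quotCoord A p p₀ u = L u.2 := if_pos h
    have hLc : Tendsto (fun w : EMod n × EMod n => L w.2) (𝓝[projTgt A p] u) (𝓝 (L u.2)) :=
      (L.continuous.comp continuous_snd).continuousWithinAt
    have hdiff : Tendsto (fun w => quotCoord A p p₀ w - L w.2) (𝓝[projTgt A p] u) (𝓝 0) := by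
      rw [Metric.tendsto_nhds]
      intro η hη
      set B := ‖u.2‖ + 1 with hB
      have hBp : 0 < B := by positivity
      have hη' : 0 < η / (2 * B) := by positivity
      obtain ⟨d, hd, hest⟩ := (eventually_mem_nhdsWithin.and (exists_strict_estimate
        (eventually_convex_transDom hm1) (uniqueDiffOn_transDom p p₀) hφ hm1 hη')).exists
      have e1 : ∀ᶠ w : EMod n × EMod n in 𝓝[projTgt A p] u,
          w.1 ∈ transDom n p p₀ ∩ Metric.ball v₀ d :=
        ht1 (inter_mem self_mem_nhdsWithin (mem_nhdsWithin_of_mem_nhds (Metric.ball_mem_nhds _ hd)))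
      have e2 : ∀ᶠ w : EMod n × EMod n in 𝓝[projTgt A p] u,
          w.1 + A.xc p w.1 • w.2 ∈ transDom n p p₀ ∩ Metric.ball v₀ d := by
        refine ht2 (inter_mem self_mem_nhdsWithin (mem_nhdsWithin_of_mem_nhds ?_))
        change Metric.ball v₀ d ∈ 𝓝 (v₀ + A.xc p v₀ • u.2)
        rw [h, zero_smul, add_zero]
        exact Metric.ball_mem_nhds _ hd
      have e3 : ∀ᶠ w : EMod n × EMod n in 𝓝[projTgt A p] u, ‖w.2‖ < B :=
        (continuous_snd.norm.continuousWithinAt (s := projTgt A p) (x := u)).eventually_lt_const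
          (by change ‖u.2‖ < B; linarith)
      have e4 : ∀ᶠ w : EMod n × EMod n in 𝓝[projTgt A p] u,
          ‖fderivWithin ℝ (chTrans p p₀) (transDom n p p₀) w.1 - L‖ < η / (2 * B) := by
        have h3 := ((hφ.continuousOn_fderivWithin (uniqueDiffOn_transDom p p₀) (by simp)) v₀ hm1)
        have h4 := (h3.tendsto.comp ht1).sub_const L
        rw [← hL, sub_self] at h4
        have h5 := h4.norm
        rw [norm_zero] at h5
        exact h5.eventually_lt_const hη'
      filter_upwards [e1, e2, e3, e4] with w w1 w2 w3 w4
      rw [dist_zero_right]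
      have key : ‖quotCoord A p p₀ w - L w.2‖ ≤ η / (2 * B) * ‖w.2‖ := by
        rw [quotCoord]
        split_ifs with hw
        · rw [← sub_apply]
          exact (ContinuousLinearMap.le_opNorm _ _).trans
            (mul_le_mul_of_nonneg_right w4.le (norm_nonneg _))
        · have h6 := hest _ w2 _ w1
          rw [add_sub_cancel_left, map_smul] at h6
          have hx0 : 0 < A.xc p w.1 := (A.xc_nonneg _ _).lt_of_ne' hw
          have h7 : (A.xc p w.1)⁻¹ • (chTrans p p₀ (w.1 + A.xc p w.1 • w.2) - chTrans p p₀ w.1) -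
              L w.2 = (A.xc p w.1)⁻¹ • (chTrans p p₀ (w.1 + A.xc p w.1 • w.2) - chTrans p p₀ w.1 -
                A.xc p w.1 • L w.2) := by
            rw [smul_sub _ _ (A.xc p w.1 • L w.2), inv_smul_smul₀ hw]
          rw [h7, norm_smul, norm_inv, Real.norm_eq_abs, abs_of_pos hx0, inv_mul_le_iff₀ hx0]
          refine h6.trans_eq ?_
          rw [norm_smul, Real.norm_eq_abs, abs_of_pos hx0]
          ring
      calc ‖quotCoord A p p₀ w - L w.2‖ ≤ η / (2 * B) * ‖w.2‖ := key
        _ ≤ η / (2 * B) * B := mul_le_mul_of_nonneg_left w3.le hη'.le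
        _ = η / 2 := by field_simp
        _ < η := by linarith
    have := hdiff.add hLc
    simp only [sub_add_cancel, zero_add] at this
    rw [ContinuousWithinAt, hval]
    exact this
  · have e0 : ∀ᶠ w in 𝓝[projTgt A p] u, A.xc p w.1 ≠ 0 := hx.eventually_ne h
    have h3 : ContinuousWithinAt (fun w : EMod n × EMod n => (A.xc p w.1)⁻¹ •
        (chTrans p p₀ (w.1 + A.xc p w.1 • w.2) - chTrans p p₀ w.1)) (projTgt A p) u :=
      (hx.inv₀ h).smul (((hφ.continuousOn _ hm2).tendsto.comp ht2).sub
        ((hφ.continuousOn _ hm1).tendsto.comp ht1))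
    refine h3.congr_of_eventuallyEq (e0.mono fun w hw => if_neg hw) (if_neg h)

/-- The topology is generated by the blowdown map and the angular variables of all charts, so
continuity is tested in every chart `p₀` and not only in `p`. -/
theorem continuousOn_projInv : ContinuousOn (projInv A p) (projTgt A p) := by
  intro u hu
  refine TopologicalSpace.tendsto_nhds_generateFrom_iff.2 ?_
  have hx : ContinuousOn (fun u : EMod n × EMod n => A.xc p u.1) (projTgt A p) :=
    (A.contDiffOn_xc p).continuousOn.comp continuousOn_fst fun _ h => h.1
  have hr : ContinuousWithinAt (fun u : EMod n × EMod n => (projInv A p u).right) (projTgt A p) u :=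
    ((continuousOn_chartInv p).comp continuousOn_fst fun _ h => h.1).congr
      (fun w hw => projInv_right hw) u hu
  have hl : ContinuousWithinAt (fun u : EMod n × EMod n => (projInv A p u).left) (projTgt A p) u :=
    ((continuousOn_chartInv p).comp (continuousOn_fst.add (hx.smul continuousOn_snd))
      fun w hw => hw.2.1).congr (fun w hw => projInv_left hw) u hu
  rintro s (⟨O, hO, rfl⟩ | ⟨p₀, O, hO, rfl⟩) hs
  · exact (hl.prodMk hr) (hO.mem_nhds hs)
  · have e1 := hl ((isOpen_chartDom p₀).mem_nhds hs.1.1)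
    have e2 := hr ((isOpen_chartDom p₀).mem_nhds hs.1.2)
    have hq : ContinuousWithinAt (fun w => ‖((1 : ℝ), quotCoord A p p₀ w)‖⁻¹ •
        ((1 : ℝ), quotCoord A p p₀ w)) (projTgt A p) u := by
      have h1 := (continuousWithinAt_const (b := (1 : ℝ)) (s := projTgt A p) (x := u)).prodMk
        (continuousWithinAt_quotCoord (p₀ := p₀) hu (projInv_right hu ▸ hs.1.2)
          (projInv_left hu ▸ hs.1.1))
      exact (h1.norm.inv₀ (norm_ne_zero_iff.2 fun h => one_ne_zero (congrArg Prod.fst h))).smul h1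
    have key : ∀ w ∈ projTgt A p, (projInv A p w).right ∈ chartDom n p₀ →
        ‖normalCoord p₀ (projInv A p w)‖⁻¹ • normalCoord p₀ (projInv A p w) =
          ‖((1 : ℝ), quotCoord A p p₀ w)‖⁻¹ • ((1 : ℝ), quotCoord A p p₀ w) := fun w hw hw2 => by
      obtain ⟨κ, hκ, h⟩ := exists_normalCoord_projInv (p₀ := p₀) hw (projInv_right hw ▸ hw2)
      rw [h, norm_smul, Real.norm_eq_abs, abs_of_pos hκ, smul_smul]
      congr 1
      field_simp
    have e3 := hq (hO.mem_nhds (by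
      change ‖((1 : ℝ), quotCoord A p p₀ u)‖⁻¹ • ((1 : ℝ), quotCoord A p p₀ u) ∈ O
      rw [← key u hu hs.1.2]; exact hs.2))
    filter_upwards [e1, e2, e3, self_mem_nhdsWithin] with w w1 w2 w3 w4
    refine ⟨⟨w1, w2⟩, ?_⟩
    change ‖normalCoord p₀ (projInv A p w)‖⁻¹ • normalCoord p₀ (projInv A p w) ∈ O
    rw [key w w4 w2]
    exact w3

end DoubleSpace

end AHMetric

/-! ### Parametrization of `Λ₊` near the diagonal by time, position and momentum. -/

namespace AHMetric

variable {n : ℕ} {X : Type*} [TopologicalSpace X] [ChartedSpace (EuclideanHalfSpace (n + 1)) X]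
  [IsManifold (halfModel n) ∞ X] {A : AHMetric n X}

variable (A) in
/-- The inverse of the coordinates `phiCoord`. -/
def phiInv (p : X) (y : (EMod n × EMod n) × (EMod n × EMod n)) : A.PhiCotangent :=
  ⟨DoubleSpace.projInv A p y.1, covec p _ y.2.1, covec p _ y.2.2⟩

theorem phiInv_mem_phiDom {p : X} {y : (EMod n × EMod n) × (EMod n × EMod n)}
    (hy : y.1 ∈ DoubleSpace.projTgt A p) : A.phiInv p y ∈ A.phiDom p :=
  DoubleSpace.projInv_mem_projDom hy

theorem phiCoord_phiInv {p : X} {y : (EMod n × EMod n) × (EMod n × EMod n)}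
    (hy : y.1 ∈ DoubleSpace.projTgt A p) : A.phiCoord p (A.phiInv p y) = y := by
  have h := (DoubleSpace.projInv_mem_projDom hy).1
  exact Prod.ext (DoubleSpace.projCoord_projInv hy) (Prod.ext (cotangentCoord_covec h.1 _)
    (cotangentCoord_covec h.2 _))

theorem continuousOn_phiInv (p : X) :
    ContinuousOn (A.phiInv p) (DoubleSpace.projTgt A p ×ˢ univ) := by
  intro y hy
  have h1 : ContinuousWithinAt (fun y : (EMod n × EMod n) × (EMod n × EMod n) =>
      DoubleSpace.projInv A p y.1) (DoubleSpace.projTgt A p ×ˢ univ) y :=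
    (DoubleSpace.continuousOn_projInv.comp continuousOn_fst fun w hw => hw.1) y hy
  have h := (DoubleSpace.projInv_mem_projDom hy.1).1
  have h2 := continuousAt_mk_covec (n := n)
    (DoubleSpace.continuous_left.continuousAt.comp_continuousWithinAt h1)
    (continuousWithinAt_snd.fst) h.1
  have h3 := continuousAt_mk_covec (n := n)
    (DoubleSpace.continuous_right.continuousAt.comp_continuousWithinAt h1)
    (continuousWithinAt_snd.snd) h.2
  rw [ContinuousWithinAt, nhds_induced, tendsto_comap_iff]
  exact h1.prodMk (h2.prodMk h3)

theorem mem_conormalDiag_iff {p : X} {q : A.PhiCotangent} (hq : q ∈ A.phiDom p) :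
    q ∈ A.conormalDiag ↔ (A.phiCoord p q).1.2 = 0 ∧ (A.phiCoord p q).2.2 = -(A.phiCoord p q).2.1 := by
  constructor
  · rintro (⟨z, h, α, rfl⟩ | ⟨z, hz, ha, hw, hunit, α, rfl⟩)
    · refine ⟨?_, cotangentCoord_neg p z α⟩
      change (A.x z)⁻¹ • (coord n p z - coord n p z) = 0
      rw [sub_self, smul_zero]
    · refine ⟨?_, cotangentCoord_neg p z α⟩
      change (1 : ℝ)⁻¹ • tangentCoord p z 0 = 0
      have : tangentCoord p z (0 : TangentSpace (halfModel n) z) = 0 := map_zero _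
      rw [this, smul_zero]
  · rintro ⟨h1, h2⟩
    have hr : q.base.right ∈ chartDom n p := hq.1.2
    set ξ := (A.phiCoord p q).2.1 with hξ
    set z := q.base.right with hz
    by_cases hb : z ∈ (halfModel n).boundary X
    · have h0 : A.dx z 0 = 0 := map_zero _
      have hw : 0 ≤ 1 + A.dx z 0 := by rw [h0]; norm_num
      have hunit : (1 : ℝ) ^ 2 + A.compactMetric z 0 0 = 1 := by
        rw [compactMetric, map_zero]; norm_num
      refine Or.inr ⟨z, hb, zero_le_one, hw, hunit, covec p z ξ, ?_⟩
      refine A.injOn_phiCoord p hq ⟨⟨hr, hr⟩, fun h => one_ne_zero (α := ℝ) h⟩ ?_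
      refine Prod.ext (Prod.ext rfl ?_) (Prod.ext ?_ ?_)
      · rw [h1]
        change 0 = (1 : ℝ)⁻¹ • tangentCoord p z 0
        have : tangentCoord p z (0 : TangentSpace (halfModel n) z) = 0 := map_zero _
        rw [this, smul_zero]
      · exact (cotangentCoord_covec hr ξ).symm
      · rw [h2]
        change _ = cotangentCoord p z (-covec p z ξ)
        rw [cotangentCoord_neg, cotangentCoord_covec hr ξ]
    · refine Or.inl ⟨z, fun h => hb h.2, covec p z ξ, ?_⟩
      refine A.injOn_phiCoord p hq ⟨⟨hr, hr⟩, hb⟩ ?_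
      refine Prod.ext (Prod.ext rfl ?_) (Prod.ext ?_ ?_)
      · rw [h1]
        change 0 = (A.x z)⁻¹ • (coord n p z - coord n p z)
        rw [sub_self, smul_zero]
      · exact (cotangentCoord_covec hr ξ).symm
      · rw [h2]
        change _ = cotangentCoord p z (-covec p z ξ)
        rw [cotangentCoord_neg, cotangentCoord_covec hr ξ]

namespace LocalFlow

variable {p : X} (F : A.LocalFlow p)

/-- The parameters `(t, v, a)` of the part of `Λ₊` near `∂_diag Λ₊`. -/
def relDom (d : ℝ) : Set (ℝ × EMod n × EMod n) :=
  {l | 0 ≤ l.1 ∧ l.2.1 ∈ F.posDom ∩ Metric.ball (coord n p p) d ∧ ‖l.1 • l.2.2‖ < d ∧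
    A.quad p l.2.1 l.2.2 = 1}

/-- The point of `Λ₊` reached after the time `t` from the position `v` and the momentum `a`. -/
def relPoint (l : ℝ × EMod n × EMod n) : A.PhiCotangent :=
  A.phiInv p ((l.2.1, F.disp (l.2.1, l.1 • l.2.2)), (F.mom l 1, -l.2.2))

variable {F} {d c C d₁ d₂ : ℝ} {l : ℝ × EMod n × EMod n}

theorem ne_zero_of_mem_relDom (hl : l ∈ F.relDom d) : l.2.2 ≠ 0 := fun h => by
  have h1 := hl.2.2.2
  simp [h, quad] at h1

theorem mem_ball_of_mem_relDom (hl : l ∈ F.relDom d) : l.1 • l.2.2 ∈ Metric.ball (0 : EMod n) d :=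
  mem_ball_zero_iff.2 hl.2.2.1

theorem IsGoodRadius.mem_dom (hg : F.IsGoodRadius d c C d₁ d₂) (hl : l ∈ F.relDom d) : l ∈ F.dom := by
  have h1 := hg.quad_lt _ hl.2.1 _ (mem_ball_of_mem_relDom hl)
  rw [quad_smul, hl.2.2.2, mul_one] at h1
  have h2 : l.1 < F.ε := lt_of_pow_lt_pow_left₀ 2 F.ε_pos.le h1
  refine ⟨⟨by linarith [hl.1, F.ε_pos], h2⟩, hl.2.1.1, mem_ball_zero_iff.2 ?_⟩
  exact F.unit_lt _ ⟨Metric.ball_subset_closedBall (Metric.ball_subset_ball F.δ_le hl.2.1.1.1),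
    hl.2.1.1.2⟩ _ hl.2.2.2

theorem IsGoodRadius.mem_dispDom (hg : F.IsGoodRadius d c C d₁ d₂) {v w : EMod n} (hv : v ∈ F.posDom)
    (hw : w ∈ Metric.ball (0 : EMod n) d) : (v, w) ∈ F.dispDom :=
  ⟨hv, Metric.ball_subset_ball hg.le hw⟩

theorem IsGoodRadius.mem_projTgt (hg : F.IsGoodRadius d c C d₁ d₂) (hl : l ∈ F.relDom d) :
    (l.2.1, F.disp (l.2.1, l.1 • l.2.2)) ∈ DoubleSpace.projTgt A p := by
  refine ⟨posDom_subset hl.2.1.1, ?_, fun _ => hg.front _ hl.2.1 _ (mem_ball_of_mem_relDom hl)⟩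
  rw [← pos_eq_disp (hg.mem_dom hl) (hg.mem_dispDom hl.2.1.1 (mem_ball_of_mem_relDom hl))]
  exact pos_mem (hg.mem_dom hl) (right_mem_Icc.2 zero_le_one)

theorem IsGoodRadius.phiCoord_relPoint (hg : F.IsGoodRadius d c C d₁ d₂) (hl : l ∈ F.relDom d) : A.phiCoord p (F.relPoint l) =
    ((l.2.1, F.disp (l.2.1, l.1 • l.2.2)), (F.mom l 1, -l.2.2)) :=
  phiCoord_phiInv (hg.mem_projTgt hl)

theorem IsGoodRadius.relPoint_mem_phiDom (hg : F.IsGoodRadius d c C d₁ d₂) (hl : l ∈ F.relDom d) : F.relPoint l ∈ A.phiDom p :=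
  phiInv_mem_phiDom (hg.mem_projTgt hl)

theorem IsGoodRadius.continuousOn_relPoint (hg : F.IsGoodRadius d c C d₁ d₂) : ContinuousOn F.relPoint (F.relDom d) := by
  have h1 : ContinuousOn (fun l : ℝ × EMod n × EMod n => F.disp (l.2.1, l.1 • l.2.2))
      (F.relDom d) :=
    contDiffOn_disp.continuousOn.comp (f := fun l : ℝ × EMod n × EMod n => (l.2.1, l.1 • l.2.2))
      (by fun_prop) fun l hl => hg.mem_dispDom hl.2.1.1 (mem_ball_of_mem_relDom hl)
  have h2 : ContinuousOn (fun l => F.mom l 1) (F.relDom d) :=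
    (contDiffOn_mom 1 (right_mem_Icc.2 zero_le_one)).continuousOn.mono fun l hl => hg.mem_dom hl
  refine (continuousOn_phiInv p).comp (f := fun l : ℝ × EMod n × EMod n =>
    ((l.2.1, F.disp (l.2.1, l.1 • l.2.2)), (F.mom l 1, -l.2.2))) ?_
    fun l hl => ⟨hg.mem_projTgt hl, mem_univ _⟩
  exact (continuousOn_snd.fst.prodMk h1).prodMk (h2.prodMk continuousOn_snd.snd.neg)

theorem IsGoodRadius.disp_injOn (hg : F.IsGoodRadius d c C d₁ d₂) {v w w' : EMod n} (hv : v ∈ F.posDom ∩ Metric.ball (coord n p p) d)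
    (hw : w ∈ Metric.ball (0 : EMod n) d) (hw' : w' ∈ Metric.ball (0 : EMod n) d)
    (h : F.disp (v, w) = F.disp (v, w')) : w = w' := by
  have h1 := hg.bound v hv v hv w hw w' hw'
  rw [h, sub_self, sub_self, norm_zero, mul_zero, add_zero] at h1
  have h2 := hg.c_pos
  have h3 : ‖w - w'‖ ≤ 0 := by
    by_contra h4
    push Not at h4
    have := mul_pos h2 h4
    linarith
  exact sub_eq_zero.1 (norm_le_zero_iff.1 h3)

theorem IsGoodRadius.relPoint_mem_FF (hg : F.IsGoodRadius d c C d₁ d₂) (hl : l ∈ F.relDom d) :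
    (F.relPoint l).base ∈ DoubleSpace.FF ↔ l.2.1 0 = 0 :=
  DoubleSpace.projInv_mem_FF (hg.mem_projTgt hl)

theorem IsGoodRadius.relPoint_mem_diagFace (hg : F.IsGoodRadius d c C d₁ d₂) (hl : l ∈ F.relDom d) :
    F.relPoint l ∈ A.diagFace ↔ l.1 = 0 := by
  have hq := hg.relPoint_mem_phiDom hl
  have hc := hg.phiCoord_relPoint hl
  rw [diagFace, mem_inter_iff, mem_conormalDiag_iff hq, hc]
  constructor
  · rintro ⟨⟨h1, -⟩, -⟩
    have h2 := hg.disp_injOn hl.2.1 (mem_ball_of_mem_relDom hl) (Metric.mem_ball_self hg.pos)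
      (h1.trans (disp_zero hl.2.1.1).symm)
    exact (smul_eq_zero.1 h2).resolve_right (ne_zero_of_mem_relDom hl)
  · intro h
    have hm := (sol_of_fst_eq_zero (hg.mem_dom hl) h (right_mem_Icc.2 zero_le_one)).1
    refine ⟨⟨?_, ?_⟩, ?_⟩
    · change F.disp (l.2.1, l.1 • l.2.2) = 0
      rw [h, zero_smul, disp_zero hl.2.1.1]
    · change -l.2.2 = -F.mom l 1
      rw [hm]
    · rw [A.mem_SigmaL_iff hq.1.1]
      have h1 : cotangentCoord p (F.relPoint l).base.left (F.relPoint l).α = F.mom l 1 :=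
        congrArg (fun y => y.2.1) hc
      have h2 : (F.relPoint l).base.left = chartInv p l.2.1 := by
        refine (DoubleSpace.projInv_left (hg.mem_projTgt hl)).trans ?_
        simp only [h, zero_smul, disp_zero hl.2.1.1, smul_zero, add_zero]
      rw [h1, hm, h2, coord_chartInv (posDom_subset hl.2.1.1)]
      exact hl.2.2.2

/-- The base determines `v` and, by injectivity of the displacement, `w = t a`. Then `t² = |w|²_ḡ`,
and `a = w / t` unless `t = 0`. -/
theorem IsGoodRadius.relPoint_inj (hg : F.IsGoodRadius d c C d₁ d₂) {l' : ℝ × EMod n × EMod n} (hl : l ∈ F.relDom d)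
    (hl' : l' ∈ F.relDom d) (h : (F.relPoint l).base = (F.relPoint l').base) :
    l.1 = l'.1 ∧ (l.1 ≠ 0 → l = l') := by
  have h2 := congrArg (fun y => y.1) (hg.phiCoord_relPoint hl)
  have h3 := congrArg (fun y => y.1) (hg.phiCoord_relPoint hl')
  have h1 : (l.2.1, F.disp (l.2.1, l.1 • l.2.2)) = (l'.2.1, F.disp (l'.2.1, l'.1 • l'.2.2)) :=
    h2.symm.trans ((congrArg (DoubleSpace.projCoord p) h).trans h3)
  have hv : l.2.1 = l'.2.1 := (Prod.mk.inj h1).1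
  have hw : F.disp (l.2.1, l.1 • l.2.2) = F.disp (l.2.1, l'.1 • l'.2.2) := by
    rw [(Prod.mk.inj h1).2, hv]
  have h4 : l.1 • l.2.2 = l'.1 • l'.2.2 :=
    hg.disp_injOn hl.2.1 (mem_ball_of_mem_relDom hl) (mem_ball_of_mem_relDom hl') hw
  have h5 : l.1 ^ 2 = l'.1 ^ 2 := by
    have h6 := congrArg (A.quad p l.2.1) h4
    have e2 : A.quad p l.2.1 l'.2.2 = 1 := by rw [hv]; exact hl'.2.2.2
    rwa [quad_smul, quad_smul, hl.2.2.2, e2, mul_one, mul_one] at h6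
  have h6 : l.1 = l'.1 := (pow_left_inj₀ hl.1 hl'.1 two_ne_zero).1 h5
  refine ⟨h6, fun h0 => Prod.ext h6 (Prod.ext hv ?_)⟩
  rw [← h6] at h4
  exact smul_right_injective _ h0 h4

end LocalFlow

end AHMetric

/-! ### Identification of the parametrized set with `Λ₊`. -/

namespace AHMetric

variable {n : ℕ} {X : Type*} [TopologicalSpace X] [ChartedSpace (EuclideanHalfSpace (n + 1)) X]
  [IsManifold (halfModel n) ∞ X] {A : AHMetric n X}

namespace LocalFlow

variable {p : X} {F : A.LocalFlow p} {d c C d₁ d₂ : ℝ} {l : ℝ × EMod n × EMod n}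
  [T2Space X] [CompactSpace X]

/-- Over the interior the local flow is the Hamilton flow, so both points have the same coordinates:
`V` is the displacement divided by `x'`, and `x ζ` is the rescaled momentum. -/
theorem IsGoodRadius.phiPair_eq_relPoint (hg : F.IsGoodRadius d c C d₁ d₂) {s : CotBundle n X}
    (hs : A.IsState s) (hp : s.proj ∈ chartDom n p) {t : ℝ} (hl : A.param p t s ∈ F.relDom d) :
    A.phiPair (A.flow s t) s ((isSegment_flow hs).isState (mem_univ t)).1 =
      F.relPoint (A.param p t s) := by
  have hd := hg.mem_dom hl
  have h1 : (1 : ℝ) ∈ Icc (0 : ℝ) 1 := right_mem_Icc.2 zero_le_one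
  have hf : A.flow s t = F.point (A.param p t s) 1 :=
    flow_eq_point hs ⟨hp, hl.2.1.1.1⟩ hl.1 hd.1.2
  have hx : 0 < A.xc p (A.param p t s).2.1 := by
    change 0 < A.xc p (coord n p s.proj)
    rw [A.xc_coord hp]; exact hs.1
  have hm := point_mem_chartDom hd h1
  have hdom : A.phiPair (A.flow s t) s ((isSegment_flow hs).isState (mem_univ t)).1 ∈ A.phiDom p := by
    refine ⟨⟨?_, hp⟩, fun h => hs.1.ne' ((A.x_eq_zero _).2 h)⟩
    change (A.flow s t).proj ∈ chartDom n p
    rw [hf]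
    exact hm
  refine A.injOn_phiCoord p hdom (hg.relPoint_mem_phiDom hl) ?_
  · rw [phiCoord_phiPair, hg.phiCoord_relPoint hl]
    have e1 : (A.x s.proj)⁻¹ • (coord n p (A.flow s t).proj - coord n p s.proj) =
        F.disp ((A.param p t s).2.1, (A.param p t s).1 • (A.param p t s).2.2) := by
      rw [hf, coord_point hd h1, pos_eq_disp hd
        (hg.mem_dispDom hl.2.1.1 (mem_ball_of_mem_relDom hl))]
      change (A.x s.proj)⁻¹ • (coord n p s.proj + A.xc p (coord n p s.proj) • _ -
        coord n p s.proj) = _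
      rw [add_sub_cancel_left, A.xc_coord hp, inv_smul_smul₀ hs.1.ne']
    have e2 : A.scaledMom p (A.flow s t) = F.mom (A.param p t s) 1 := by
      rw [scaledMom, hf, cotangentCoord_point hd h1]
      exact smul_inv_smul₀ (xc_pos_pos hd h1 hx).ne' _
    rw [e1, e2]
    rfl

theorem IsGoodRadius.relPoint_mem_FBR (hg : F.IsGoodRadius d c C d₁ d₂) (hl : l ∈ F.relDom d)
    (hx : 0 < A.xc p l.2.1) : F.relPoint l ∈ A.FBR := by
  have hv := posDom_subset hl.2.1.1
  have hm := chartInv_mem hv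
  let s : CotBundle n X := ⟨chartInv p l.2.1, covec p _ ((A.xc p l.2.1)⁻¹ • l.2.2)⟩
  have hc : cotangentCoord p s.proj s.2 = (A.xc p l.2.1)⁻¹ • l.2.2 := cotangentCoord_covec hm _
  have hs : A.IsState s := by
    refine ⟨hx, ?_⟩
    rw [A.dualNormSq_metric hm hx, hc]
    change A.xc p l.2.1 ^ 2 * A.quad p (coord n p (chartInv p l.2.1)) _ = 1
    rw [coord_chartInv hv, quad_smul, hl.2.2.2]
    field_simp
  have hpar : A.param p l.1 s = l := by
    refine Prod.ext rfl (Prod.ext (coord_chartInv hv) ?_)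
    change A.xc p l.2.1 • cotangentCoord p s.proj s.2 = _
    rw [hc, smul_inv_smul₀ hx.ne']
  have h1 := hg.phiPair_eq_relPoint hs hm (t := l.1) (hpar.symm ▸ hl)
  rw [hpar] at h1
  exact mem_FBR_iff.2 ⟨s, l.1, hs, hl.1, h1.symm⟩

/-- Points over the front face are limits of points over the interior: move `v` inward along the
coordinate `0` and renormalize the momentum to keep it of unit length. -/
theorem IsGoodRadius.relPoint_mem_LambdaPlus (hg : F.IsGoodRadius d c C d₁ d₂)
    (hl : l ∈ F.relDom d) : F.relPoint l ∈ A.LambdaPlus := by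
  have ha := ne_zero_of_mem_relDom hl
  let v : ℝ → EMod n := fun η => l.2.1 + η • EuclideanSpace.single 0 1
  let k : ℝ → ℝ × EMod n × EMod n := fun η => (l.1, v η, (√(A.quad p (v η) l.2.2))⁻¹ • l.2.2)
  have hvc : Continuous v := by fun_prop
  have hv0 : v 0 = l.2.1 := by simp [v]
  have hvp : ∀ η > 0, v η ∈ halfSpace n ∧ 0 < v η 0 := fun η hη => by
    have h1 : 0 ≤ l.2.1 0 := hl.2.1.1.2
    have h2 : v η 0 = l.2.1 0 + η := by simp [v]
    have h3 : 0 < v η 0 := by rw [h2]; linarith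
    exact ⟨h3.le, h3⟩
  have hb : ∀ᶠ η in 𝓝[>] (0 : ℝ), v η ∈ F.posDom ∩ Metric.ball (coord n p p) d := by
    have h1 : ∀ᶠ η in 𝓝 (0 : ℝ), v η ∈ Metric.ball (coord n p p) F.δ ∩ Metric.ball (coord n p p) d :=
      hvc.continuousAt.eventually_mem ((Metric.isOpen_ball.inter Metric.isOpen_ball).mem_nhds
        (by rw [hv0]; exact ⟨hl.2.1.1.1, hl.2.1.2⟩))
    filter_upwards [nhdsWithin_le_nhds h1, self_mem_nhdsWithin] with η h1 h2
    exact ⟨⟨h1.1, (hvp η h2).1⟩, h1.2⟩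
  have hvt : Tendsto v (𝓝[>] 0) (𝓝[chartTgt n p] l.2.1) := by
    refine tendsto_nhdsWithin_iff.2 ⟨?_, hb.mono fun η h => posDom_subset h.1⟩
    have := hvc.tendsto 0
    rw [hv0] at this
    exact this.mono_left nhdsWithin_le_nhds
  have hq : Tendsto (fun η => A.quad p (v η) l.2.2) (𝓝[>] 0) (𝓝 1) := by
    have h1 : ContinuousWithinAt (fun w => A.quad p w l.2.2) (chartTgt n p) l.2.1 :=
      ((A.contDiffOn_quad p).continuousOn.comp (f := fun w => (w, l.2.2)) (by fun_prop)
        fun w hw => ⟨hw, mem_univ _⟩) _ (posDom_subset hl.2.1.1)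
    have h2 := h1.tendsto.comp hvt
    rw [hl.2.2.2] at h2
    exact h2
  have hkt : Tendsto k (𝓝[>] 0) (𝓝 l) := by
    have h1 : Tendsto (fun η => (√(A.quad p (v η) l.2.2))⁻¹ • l.2.2) (𝓝[>] 0) (𝓝 l.2.2) := by
      have := ((hq.sqrt.inv₀ (by simp)).smul_const l.2.2)
      simpa using this
    exact tendsto_const_nhds.prodMk_nhds ((hvt.mono_right nhdsWithin_le_nhds).prodMk_nhds h1)
  have hkd : ∀ᶠ η in 𝓝[>] (0 : ℝ), k η ∈ F.relDom d := by
    have h1 : ContinuousAt (fun l : ℝ × EMod n × EMod n => ‖l.1 • l.2.2‖) l := by fun_prop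
    have h2 := (h1.tendsto.comp hkt).eventually_lt_const hl.2.2.1
    filter_upwards [hb, h2] with η h3 h4
    have h5 := A.quad_pos (posDom_subset h3.1) ha
    refine ⟨hl.1, h3, h4, ?_⟩
    change A.quad p (v η) ((√(A.quad p (v η) l.2.2))⁻¹ • l.2.2) = 1
    rw [quad_smul, inv_pow, Real.sq_sqrt h5.le, inv_mul_cancel₀ h5.ne']
  have hlim : Tendsto (fun η => F.relPoint (k η)) (𝓝[>] 0) (𝓝 (F.relPoint l)) :=
    (hg.continuousOn_relPoint l hl).tendsto.comp (tendsto_nhdsWithin_iff.2 ⟨hkt, hkd⟩)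
  refine mem_closure_of_tendsto hlim ?_
  filter_upwards [hkd, self_mem_nhdsWithin] with η h1 h2
  exact hg.relPoint_mem_FBR h1 ((A.xc_pos_iff (posDom_subset h1.2.1.1)).2 (hvp η h2).2)

/-- Away from long trajectories `q` is a limit of points `relPoint (k b)` with times in the compact
interval `[0, ε]`, whose positions and momenta converge because they are among the coordinates. The
limit parameter is still in `relDom` since `ε R < d`, and `relPoint` is continuous. -/
theorem IsGoodRadius.exists_relPoint_eq (hg : F.IsGoodRadius d c C d₁ d₂) {ε : ℝ}
    (hεd : ε * F.R < d) {q : A.PhiCotangent} (hq : q ∈ A.LambdaPlus) (hqp : q ∈ A.phiDom p)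
    (hqr : coord n p q.base.right ∈ F.posDom ∩ Metric.ball (coord n p p) d)
    (hql : q ∉ closure (A.longFBR ε)) : ∃ l ∈ F.relDom d, F.relPoint l = q := by
  let V : Set A.PhiCotangent := {b | b ∈ A.phiDom p ∧
    coord n p b.base.right ∈ Metric.ball (coord n p p) F.δ ∩ Metric.ball (coord n p p) d}
  have hVq : V ∈ 𝓝 q := by
    have h1 : ContinuousAt (fun b : A.PhiCotangent => coord n p b.base.right) q :=
      ((A.continuousAt_phiCoord hqp).fst).fst
    exact inter_mem ((A.isOpen_phiDom p).mem_nhds hqp)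
      (h1 ((Metric.isOpen_ball.inter Metric.isOpen_ball).mem_nhds ⟨hqr.1.1, hqr.2⟩))
  have hcl : q ∈ closure (A.FBR ∩ (V ∩ (closure (A.longFBR ε))ᶜ)) := by
    rw [mem_closure_iff_nhdsWithin_neBot, nhdsWithin_inter_of_mem']
    · exact mem_closure_iff_nhdsWithin_neBot.1 hq
    · exact nhdsWithin_le_nhds (inter_mem hVq (isClosed_closure.isOpen_compl.mem_nhds hql))
  obtain ⟨u, huE, hu⟩ := mem_closure_iff_ultrafilter.1 hcl
  have hex : ∀ b : A.PhiCotangent, ∃ l : ℝ × EMod n × EMod n,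
      b ∈ A.FBR ∩ (V ∩ (closure (A.longFBR ε))ᶜ) → l ∈ F.relDom d ∧ l.1 ≤ ε ∧ F.relPoint l = b := by
    intro b
    by_cases hb : b ∈ A.FBR ∩ (V ∩ (closure (A.longFBR ε))ᶜ)
    · obtain ⟨s, T, hs, hT, rfl⟩ := mem_FBR_iff.1 hb.1
      have hTε : T < ε := by
        by_contra h
        push Not at h
        exact hb.2.2 (subset_closure ⟨s, T, hs, h, rfl⟩)
      have hp : s.proj ∈ chartDom n p := hb.2.1.1.1.2
      have hv : coord n p s.proj ∈ F.posDom ∩ Metric.ball (coord n p p) d :=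
        ⟨⟨hb.2.1.2.1, chartTgt_subset p (coord_mem hp)⟩, hb.2.1.2.2⟩
      have hq1 := quad_param hs hp T
      have hR := F.unit_lt _ ⟨Metric.ball_subset_closedBall (Metric.ball_subset_ball F.δ_le hv.1.1),
        hv.1.2⟩ _ hq1
      have hl : A.param p T s ∈ F.relDom d := by
        refine ⟨hT, hv, ?_, hq1⟩
        rw [norm_smul]
        change ‖T‖ * _ < d
        rw [Real.norm_eq_abs, abs_of_nonneg hT]
        exact (mul_le_mul hTε.le hR.le (norm_nonneg _) (hT.trans hTε.le)).trans_lt hεd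
      exact ⟨_, fun _ => ⟨hl, hTε.le, (hg.phiPair_eq_relPoint hs hp hl).symm⟩⟩
    · exact ⟨0, fun h => absurd h hb⟩
  choose k hk using hex
  have hkE : ∀ᶠ b in (u : Filter A.PhiCotangent), k b ∈ F.relDom d ∧ (k b).1 ≤ ε ∧
      F.relPoint (k b) = b := by
    filter_upwards [huE] with b hb using hk b hb
  obtain ⟨t, ht, htlim⟩ := isCompact_Icc.ultrafilter_le_nhds (u.map fun b => (k b).1)
    (s := Icc 0 ε) (le_principal_iff.2 (hkE.mono fun b hb => ⟨hb.1.1, hb.2.1⟩))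
  have htl : Tendsto (fun b => (k b).1) u (𝓝 t) := htlim
  have hφ : Tendsto (A.phiCoord p) u (𝓝 (A.phiCoord p q)) := (A.continuousAt_phiCoord hqp).mono_left hu
  have hφk : ∀ᶠ b in (u : Filter A.PhiCotangent), A.phiCoord p b =
      (((k b).2.1, F.disp ((k b).2.1, (k b).1 • (k b).2.2)), (F.mom (k b) 1, -(k b).2.2)) :=
    hkE.mono fun b hb => by
      rw [← hg.phiCoord_relPoint hb.1, hb.2.2]
  set v := coord n p q.base.right with hv
  set a := -(A.phiCoord p q).2.2 with ha
  have hvl : Tendsto (fun b => (k b).2.1) u (𝓝 v) :=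
    hφ.fst_nhds.fst_nhds.congr' (hφk.mono fun b hb => by rw [hb])
  have hal : Tendsto (fun b => (k b).2.2) u (𝓝 a) :=
    hφ.snd_nhds.snd_nhds.neg.congr' (hφk.mono fun b hb => by rw [hb, neg_neg])
  have hkl : Tendsto k u (𝓝 (t, v, a)) := htl.prodMk_nhds (hvl.prodMk_nhds hal)
  have hqa : A.quad p v a = 1 := by
    have h1 : ContinuousWithinAt (fun w : EMod n × EMod n => A.quad p w.1 w.2) (chartTgt n p ×ˢ univ)
        (v, a) := (A.contDiffOn_quad p).continuousOn _ ⟨posDom_subset hqr.1, mem_univ _⟩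
    have h2 : Tendsto (fun b => (k b).2) u (𝓝[chartTgt n p ×ˢ univ] (v, a)) :=
      tendsto_nhdsWithin_iff.2 ⟨hvl.prodMk_nhds hal,
        hkE.mono fun b hb => ⟨posDom_subset hb.1.2.1.1, mem_univ _⟩⟩
    have h3 := h1.tendsto.comp h2
    refine tendsto_nhds_unique h3 (tendsto_const_nhds.congr' (hkE.mono fun b hb => ?_))
    exact hb.1.2.2.2.symm
  have hR := F.unit_lt _ ⟨Metric.ball_subset_closedBall (Metric.ball_subset_ball F.δ_le hqr.1.1),
    hqr.1.2⟩ _ hqa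
  have hl : (t, v, a) ∈ F.relDom d := by
    refine ⟨ht.1, hqr, ?_, hqa⟩
    rw [norm_smul, Real.norm_eq_abs, abs_of_nonneg ht.1]
    exact (mul_le_mul ht.2 hR.le (norm_nonneg _) (ht.1.trans ht.2)).trans_lt hεd
  refine ⟨_, hl, ?_⟩
  refine A.injOn_phiCoord p (hg.relPoint_mem_phiDom hl) hqp ?_
  have h1 : Tendsto (fun b => F.relPoint (k b)) u (𝓝 (F.relPoint (t, v, a))) :=
    (hg.continuousOn_relPoint _ hl).tendsto.comp
      (tendsto_nhdsWithin_iff.2 ⟨hkl, hkE.mono fun b hb => hb.1⟩)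
  have h2 := (A.continuousAt_phiCoord (hg.relPoint_mem_phiDom hl)).tendsto.comp h1
  refine tendsto_nhds_unique h2 (hφ.congr' (hkE.mono fun b hb => ?_))
  change _ = A.phiCoord p (F.relPoint (k b))
  rw [hb.2.2]

end LocalFlow

end AHMetric

/-! ### Linear algebra of the polar map. -/

section LinearAlgebra

/-- After exchanging the two factors, which costs at most a sign, the map is block triangular with
diagonal blocks `K` and `1`. -/
theorem LinearMap.abs_det_swap_block {E : Type*} [AddCommGroup E] [Module ℝ E]
    [FiniteDimensional ℝ E] (K L : E →ₗ[ℝ] E) :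
    |LinearMap.det ((LinearMap.snd ℝ E E).prod (K.coprod L))| = |LinearMap.det K| := by
  let P : E × E →ₗ[ℝ] E × E := (LinearMap.snd ℝ E E).prod (LinearMap.fst ℝ E E)
  let Q : E × E →ₗ[ℝ] E × E := (K.coprod L).prod (LinearMap.snd ℝ E E)
  have hP : |LinearMap.det P| = 1 := by
    have h1 : P ∘ₗ P = LinearMap.id := by ext x <;> rfl
    have h2 := congrArg LinearMap.det h1
    rw [LinearMap.det_comp, LinearMap.det_id] at h2
    rcases mul_self_eq_one_iff.1 h2 with h | h <;> simp [h]
  have hPQ : (LinearMap.snd ℝ E E).prod (K.coprod L) = P ∘ₗ Q := by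
    ext x <;> rfl
  have hQ : LinearMap.det Q = LinearMap.det K := by
    classical
    let b := Module.finBasis ℝ E
    have h1 : LinearMap.toMatrix (b.prod b) (b.prod b) Q =
        Matrix.fromBlocks (LinearMap.toMatrix b b K) (LinearMap.toMatrix b b L) 0 1 := by
      ext (i | i) (j | j) <;>
        simp [Q, LinearMap.toMatrix_apply, Matrix.one_apply, Finsupp.single_apply, eq_comm]
    rw [← LinearMap.det_toMatrix (b.prod b), h1, Matrix.det_fromBlocks_zero₂₁, Matrix.det_one, mul_one,
      LinearMap.det_toMatrix]
  rw [hPQ, LinearMap.det_comp, abs_mul, hP, one_mul, hQ]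

variable {n : ℕ}

/-- The polar direction `σ = (1, u₁, …, uₙ)`. -/
def polarDir (u : EMod n) : EMod n := u + (1 - u 0) • EuclideanSpace.single 0 1

theorem polarDir_zero (u : EMod n) : polarDir u 0 = 1 := by simp [polarDir]

theorem contDiff_polarDir : ContDiff ℝ ∞ (polarDir : EMod n → EMod n) := by
  have h : ContDiff ℝ ∞ (fun u : EMod n => u 0) :=
    (EuclideanSpace.proj (𝕜 := ℝ) (0 : Fin (n + 1))).contDiff
  exact contDiff_id.add ((contDiff_const.sub h).smul contDiff_const)

/-- The derivative of `polarDir`. -/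
def polarDirDeriv : EMod n →L[ℝ] EMod n :=
  ContinuousLinearMap.id ℝ (EMod n) -
    (EuclideanSpace.proj (𝕜 := ℝ) (0 : Fin (n + 1))).smulRight (EuclideanSpace.single 0 1)

theorem polarDirDeriv_apply (v : EMod n) :
    polarDirDeriv v = v - v 0 • EuclideanSpace.single 0 1 := rfl

theorem hasFDerivAt_polarDir (u : EMod n) : HasFDerivAt polarDir (polarDirDeriv (n := n)) u := by
  have h : (polarDir : EMod n → EMod n) =
      fun u => polarDirDeriv u + EuclideanSpace.single 0 1 := by
    funext u
    rw [polarDirDeriv_apply, polarDir, sub_smul, one_smul]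
    abel
  rw [h]
  exact polarDirDeriv.hasFDerivAt.add_const _

/-- The derivative of the blow-down map `u ↦ u₀ σ(u)`. -/
def polarDeriv (u : EMod n) : EMod n →L[ℝ] EMod n :=
  u 0 • polarDirDeriv +
    (EuclideanSpace.proj (𝕜 := ℝ) (0 : Fin (n + 1))).smulRight (polarDir u)

theorem polarDeriv_apply (u v : EMod n) :
    polarDeriv u v = u 0 • polarDirDeriv v + v 0 • polarDir u := rfl

theorem hasFDerivAt_polar (u : EMod n) :
    HasFDerivAt (fun u : EMod n => u 0 • polarDir u) (polarDeriv u) u :=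
  HasFDerivAt.smul (EuclideanSpace.proj (𝕜 := ℝ) (0 : Fin (n + 1))).hasFDerivAt
    (hasFDerivAt_polarDir u)

/-- The matrix is lower triangular with first column `σ` and diagonal `1, u₀, …, u₀`. -/
theorem det_polarDeriv (u : EMod n) : (polarDeriv u).det = u 0 ^ n := by
  let b := (EuclideanSpace.basisFun (Fin (n + 1)) ℝ).toBasis
  have h1 : LinearMap.toMatrix b b (polarDeriv u).toLinearMap = Matrix.of (fun i j : Fin (n + 1) =>
      if j = 0 then polarDir u i else if i = j then u 0 else 0) := by
    ext i j
    rw [LinearMap.toMatrix_apply]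
    have hb : b j = EuclideanSpace.single j 1 := by simp [b]
    have hr : ∀ v : EMod n, b.repr v i = v i := fun v => by simp [b]
    rw [hr, hb]
    change (polarDeriv u (EuclideanSpace.single j 1)) i = _
    rw [polarDeriv_apply, polarDirDeriv_apply]
    by_cases hj : j = 0
    · subst hj
      simp
    · have : (0 : Fin (n + 1)) ≠ j := fun h => hj h.symm
      simp [hj, this, PiLp.single_apply]
  rw [ContinuousLinearMap.det, ← LinearMap.det_toMatrix b, h1, Matrix.det_of_isLowerTriangular]
  · rw [Fin.prod_univ_succ]
    simp [polarDir_zero, Fin.succ_ne_zero]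
  · intro i j hij
    have hij' : i < j := hij
    have h0 : j ≠ 0 := fun h => by simp [h] at hij'
    simp [h0, hij'.ne]

end LinearAlgebra

section Corner

variable {n : ℕ}

theorem uniqueDiffOn_modelCorner : UniqueDiffOn ℝ (modelCorner n) :=
  uniqueDiffOn_halfSpace.prod uniqueDiffOn_halfSpace

end Corner

/-! ### Corner coordinates and the differential of the projection. -/

namespace AHMetric

variable {n : ℕ} {X : Type*} [TopologicalSpace X] [ChartedSpace (EuclideanHalfSpace (n + 1)) X]
  [IsManifold (halfModel n) ∞ X] {A : AHMetric n X}

namespace LocalFlow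

variable {p : X} (F : A.LocalFlow p) (d : ℝ) (R : EMod n ≃L[ℝ] EMod n)

/-- The covector `w = r Rσ` given by the corner coordinates. -/
def cornerVec (u : EMod n × EMod n) : EMod n := R (u.1 0 • polarDir u.1)

/-- The parameters `(t, v, a)` given by the corner coordinates. -/
def cornerParam (_ : A.LocalFlow p) (u : EMod n × EMod n) : ℝ × EMod n × EMod n :=
  (u.1 0 * √(A.quad p u.2 (R (polarDir u.1))), u.2,
    (√(A.quad p u.2 (R (polarDir u.1))))⁻¹ • R (polarDir u.1))

/-- The open set on which the corner coordinates are defined. -/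
def cornerDom : Set (EMod n × EMod n) :=
  {u | u.2 ∈ Metric.ball (coord n p p) F.δ ∩ Metric.ball (coord n p p) d ∧ ‖cornerVec R u‖ < d}

variable {F d R} {c C d₁ d₂ : ℝ} {u : EMod n × EMod n}

theorem contDiff_cornerVec : ContDiff ℝ ∞ (cornerVec (n := n) R) := by
  have h : ContDiff ℝ ∞ (fun u : EMod n × EMod n => u.1 0) :=
    (EuclideanSpace.proj (𝕜 := ℝ) (0 : Fin (n + 1))).contDiff.comp contDiff_fst
  exact R.contDiff.comp (h.smul (contDiff_polarDir.comp contDiff_fst))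

theorem hasFDerivAt_cornerVec (u : EMod n × EMod n) : HasFDerivAt (cornerVec (n := n) R)
    (((R : EMod n →L[ℝ] EMod n).comp (polarDeriv u.1)).comp
      (ContinuousLinearMap.fst ℝ (EMod n) (EMod n))) u :=
  ((R : EMod n →L[ℝ] EMod n).hasFDerivAt.comp u.1 (hasFDerivAt_polar u.1)).comp u hasFDerivAt_fst

theorem isOpen_cornerDom : IsOpen (F.cornerDom d R) :=
  ((Metric.isOpen_ball.inter Metric.isOpen_ball).preimage continuous_snd).inter
    (isOpen_lt (contDiff_cornerVec (R := R)).continuous.norm continuous_const)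

theorem polarDir_image_ne_zero (u : EMod n) : R (polarDir u) ≠ 0 := fun h => by
  have h1 : polarDir u = 0 := R.injective (h.trans (map_zero R).symm)
  have h2 := polarDir_zero u
  rw [h1] at h2
  exact zero_ne_one h2

theorem mem_posDom_of_cornerDom (hu : u ∈ F.cornerDom d R ∩ modelCorner n) :
    u.2 ∈ F.posDom ∩ Metric.ball (coord n p p) d := ⟨⟨hu.1.1.1, hu.2.2⟩, hu.1.1.2⟩

theorem quad_polarDir_pos (hu : u ∈ F.cornerDom d R ∩ modelCorner n) :
    0 < A.quad p u.2 (R (polarDir u.1)) :=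
  A.quad_pos (posDom_subset (mem_posDom_of_cornerDom hu).1) (polarDir_image_ne_zero _)

theorem cornerParam_smul (hu : u ∈ F.cornerDom d R ∩ modelCorner n) :
    (F.cornerParam R u).1 • (F.cornerParam R u).2.2 = cornerVec R u := by
  have h := (Real.sqrt_pos.2 (quad_polarDir_pos hu)).ne'
  rw [cornerParam, cornerVec, map_smul, smul_smul, mul_assoc, mul_inv_cancel₀ h, mul_one]

theorem cornerParam_mem (hu : u ∈ F.cornerDom d R ∩ modelCorner n) :
    F.cornerParam R u ∈ F.relDom d := by
  have h := quad_polarDir_pos hu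
  refine ⟨mul_nonneg hu.2.1 (Real.sqrt_nonneg _), mem_posDom_of_cornerDom hu, ?_, ?_⟩
  · rw [cornerParam_smul hu]
    exact hu.1.2
  · change A.quad p u.2 ((√(A.quad p u.2 (R (polarDir u.1))))⁻¹ • R (polarDir u.1)) = 1
    rw [quad_smul, inv_pow, Real.sq_sqrt h.le, inv_mul_cancel₀ h.ne']

theorem cornerParam_fst_eq_zero (hu : u ∈ F.cornerDom d R ∩ modelCorner n) :
    (F.cornerParam R u).1 = 0 ↔ u.1 0 = 0 :=
  mul_eq_zero_iff_right (Real.sqrt_pos.2 (quad_polarDir_pos hu)).ne'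

theorem contDiffOn_cornerParam :
    ContDiffOn ℝ ∞ (F.cornerParam R) (F.cornerDom d R ∩ modelCorner n) := by
  have hσ : ContDiffOn ℝ ∞ (fun u : EMod n × EMod n => R (polarDir u.1))
      (F.cornerDom d R ∩ modelCorner n) :=
    (R.contDiff.comp (contDiff_polarDir.comp contDiff_fst)).contDiffOn
  have h0 : ContDiffOn ℝ ∞ (fun u : EMod n × EMod n => u.1 0) (F.cornerDom d R ∩ modelCorner n) :=
    ((EuclideanSpace.proj (𝕜 := ℝ) (0 : Fin (n + 1))).contDiff.comp contDiff_fst).contDiffOn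
  have hq : ContDiffOn ℝ ∞ (fun u : EMod n × EMod n => √(A.quad p u.2 (R (polarDir u.1))))
      (F.cornerDom d R ∩ modelCorner n) :=
    ((A.contDiffOn_quad p).comp (contDiffOn_snd.prodMk hσ) fun u hu =>
      ⟨posDom_subset (mem_posDom_of_cornerDom hu).1, mem_univ _⟩).sqrt
      fun u hu => (quad_polarDir_pos hu).ne'
  exact (h0.mul hq).prodMk (contDiffOn_snd.prodMk ((hq.inv fun u hu =>
    (Real.sqrt_pos.2 (quad_polarDir_pos hu)).ne').smul hσ))

/-- Solving for the corner coordinates: `σ` is `R⁻¹ a` divided by its coordinate `0`, and `r` is `t`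
times that coordinate. Positivity says that `a` lies in the patch of directions covered by `R`. -/
theorem exists_cornerParam_eq {l : ℝ × EMod n × EMod n} (hl : l ∈ F.relDom d)
    (h : 0 < R.symm l.2.2 0) : ∃ u ∈ F.cornerDom d R ∩ modelCorner n, F.cornerParam R u = l := by
  set b := R.symm l.2.2 with hb
  set κ := b 0 with hκ
  -- The vector `κ⁻¹ • b` has coordinate `0` equal to `1`; this entry is replaced by `r = t κ`.
  let s : EMod n := κ⁻¹ • b + (l.1 * κ - 1) • EuclideanSpace.single 0 1
  have hs0 : s 0 = l.1 * κ := by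
    have : κ⁻¹ * κ = 1 := inv_mul_cancel₀ h.ne'
    simp only [s, PiLp.add_apply, PiLp.smul_apply, smul_eq_mul, PiLp.single_apply, if_true, mul_one,
      ← hκ, this]
    ring
  have hσ : polarDir s = κ⁻¹ • b := by
    rw [polarDir, hs0]
    simp only [s, add_assoc, ← add_smul]
    simp
  have hRσ : R (polarDir s) = κ⁻¹ • l.2.2 := by rw [hσ, map_smul, hb, R.apply_symm_apply]
  have hN : √(A.quad p l.2.1 (R (polarDir s))) = κ⁻¹ := by
    rw [hRσ, quad_smul, hl.2.2.2, mul_one, Real.sqrt_sq (inv_nonneg.2 h.le)]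
  have hvec : cornerVec R (s, l.2.1) = l.1 • l.2.2 := by
    change R (s 0 • polarDir s) = _
    rw [map_smul, hRσ, hs0, smul_smul, mul_assoc, mul_inv_cancel₀ h.ne', mul_one]
  refine ⟨(s, l.2.1), ⟨⟨⟨hl.2.1.1.1, hl.2.1.2⟩, ?_⟩, ?_, hl.2.1.1.2⟩, ?_⟩
  · rw [hvec]
    exact hl.2.2.1
  · change 0 ≤ s 0
    rw [hs0]
    exact mul_nonneg hl.1 h.le
  · refine Prod.ext ?_ (Prod.ext rfl ?_)
    · change s 0 * √(A.quad p l.2.1 (R (polarDir s))) = _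
      rw [hN, hs0, mul_assoc, mul_inv_cancel₀ h.ne', mul_one]
    · change (√(A.quad p l.2.1 (R (polarDir s))))⁻¹ • R (polarDir s) = _
      rw [hN, hRσ, inv_inv, smul_smul, mul_inv_cancel₀ h.ne', one_smul]

/-- The corner coordinates in terms of the momentum. -/
theorem polarDir_eq (hu : u ∈ F.cornerDom d R ∩ modelCorner n) :
    0 < R.symm (F.cornerParam R u).2.2 0 ∧ polarDir u.1 =
      (R.symm (F.cornerParam R u).2.2 0)⁻¹ • R.symm (F.cornerParam R u).2.2 := by
  have h := inv_pos.2 (Real.sqrt_pos.2 (quad_polarDir_pos hu))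
  have h1 : R.symm (F.cornerParam R u).2.2 =
      (√(A.quad p u.2 (R (polarDir u.1))))⁻¹ • polarDir u.1 := by
    rw [cornerParam, map_smul, R.symm_apply_apply]
  have h2 : R.symm (F.cornerParam R u).2.2 0 = (√(A.quad p u.2 (R (polarDir u.1))))⁻¹ := by
    rw [h1, PiLp.smul_apply, polarDir_zero, smul_eq_mul, mul_one]
  rw [h2, h1, smul_smul, inv_mul_cancel₀ h.ne', one_smul]
  exact ⟨h, rfl⟩

variable (F R) in
/-- The parametrization of `Λ₊` by the corner. -/
def corner (u : EMod n × EMod n) : A.PhiCotangent := F.relPoint (F.cornerParam R u)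

theorem IsGoodRadius.phiCoord_corner (hg : F.IsGoodRadius d c C d₁ d₂)
    (hu : u ∈ F.cornerDom d R ∩ modelCorner n) : A.phiCoord p (F.corner R u) =
      ((u.2, F.disp (u.2, cornerVec R u)), (F.mom (F.cornerParam R u) 1, -(F.cornerParam R u).2.2)) := by
  rw [corner, hg.phiCoord_relPoint (cornerParam_mem hu), cornerParam_smul hu]
  rfl

theorem IsGoodRadius.continuousOn_corner (hg : F.IsGoodRadius d c C d₁ d₂) :
    ContinuousOn (F.corner R) (F.cornerDom d R ∩ modelCorner n) :=
  hg.continuousOn_relPoint.comp contDiffOn_cornerParam.continuousOn fun _ hu => cornerParam_mem hu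

theorem cornerVec_mem_ball (hu : u ∈ F.cornerDom d R) : cornerVec R u ∈ Metric.ball (0 : EMod n) d :=
  mem_ball_zero_iff.2 hu.2

theorem IsGoodRadius.contDiffOn_phiCoord_corner (hg : F.IsGoodRadius d c C d₁ d₂) :
    ContDiffOn ℝ ∞ (fun u => A.phiCoord p (F.corner R u)) (F.cornerDom d R ∩ modelCorner n) := by
  have h1 : ContDiffOn ℝ ∞ (fun u => F.disp (u.2, cornerVec R u)) (F.cornerDom d R ∩ modelCorner n) :=
    contDiffOn_disp.comp (contDiffOn_snd.prodMk contDiff_cornerVec.contDiffOn) fun u hu =>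
      hg.mem_dispDom (mem_posDom_of_cornerDom hu).1 (cornerVec_mem_ball hu.1)
  have h2 := contDiffOn_cornerParam (F := F) (d := d) (R := R)
  have h3 : ContDiffOn ℝ ∞ (fun u => F.mom (F.cornerParam R u) 1) (F.cornerDom d R ∩ modelCorner n) :=
    (contDiffOn_mom 1 (right_mem_Icc.2 zero_le_one)).comp h2 fun u hu =>
      hg.mem_dom (cornerParam_mem hu)
  exact ((contDiffOn_snd.prodMk h1).prodMk (h3.prodMk h2.snd.snd.neg)).congr
    fun u hu => hg.phiCoord_corner hu

variable (F R) in
/-- The differential of the projection in corner coordinates. -/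
def cornerProjDeriv (u : EMod n × EMod n) : EMod n × EMod n →L[ℝ] EMod n × EMod n :=
  (ContinuousLinearMap.snd ℝ (EMod n) (EMod n)).prod
    (((F.dispDeriv (u.2, cornerVec R u)).comp ((R : EMod n →L[ℝ] EMod n).comp
      (polarDeriv u.1))).coprod
      ((fderivWithin ℝ F.disp F.dispDom (u.2, cornerVec R u)).comp
        (ContinuousLinearMap.inl ℝ (EMod n) (EMod n))))

theorem IsGoodRadius.hasFDerivWithinAt_projCoord (hg : F.IsGoodRadius d c C d₁ d₂)
    (hu : u ∈ F.cornerDom d R ∩ modelCorner n) :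
    HasFDerivWithinAt (fun u => DoubleSpace.projCoord p (F.corner R u).base) (F.cornerProjDeriv R u)
      (F.cornerDom d R ∩ modelCorner n) u := by
  have hm : MapsTo (fun u : EMod n × EMod n => (u.2, cornerVec R u))
      (F.cornerDom d R ∩ modelCorner n) F.dispDom := fun w hw =>
    hg.mem_dispDom (mem_posDom_of_cornerDom hw).1 (cornerVec_mem_ball hw.1)
  have h1 : HasFDerivWithinAt F.disp (fderivWithin ℝ F.disp F.dispDom (u.2, cornerVec R u)) F.dispDom
      (u.2, cornerVec R u) :=
    (contDiffOn_disp.differentiableOn (by simp) _ (hm hu)).hasFDerivWithinAt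
  have h2 := h1.comp (f := fun u : EMod n × EMod n => (u.2, cornerVec R u)) u
    ((hasFDerivAt_snd.prodMk (hasFDerivAt_cornerVec (R := R) u)).hasFDerivWithinAt) hm
  refine ((hasFDerivWithinAt_snd.prodMk h2).congr (fun w hw => ?_) ?_).congr_fderiv ?_
  · exact congrArg Prod.fst (hg.phiCoord_corner hw)
  · exact congrArg Prod.fst (hg.phiCoord_corner hu)
  · refine ContinuousLinearMap.ext fun y => Prod.ext rfl ?_
    change fderivWithin ℝ F.disp F.dispDom (u.2, cornerVec R u) (y.2, R (polarDeriv u.1 y.1)) =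
      fderivWithin ℝ F.disp F.dispDom (u.2, cornerVec R u) (0, R (polarDeriv u.1 y.1)) +
      fderivWithin ℝ F.disp F.dispDom (u.2, cornerVec R u) (y.2, 0)
    rw [← map_add, Prod.mk_add_mk, zero_add, add_zero]

theorem uniqueDiffOn_corner {O : Set (EMod n × EMod n)} (hO : IsOpen O) :
    UniqueDiffOn ℝ (O ∩ modelCorner n) := by
  rw [inter_comm]
  exact uniqueDiffOn_modelCorner.inter hO

theorem IsGoodRadius.projDeriv_eq (hg : F.IsGoodRadius d c C d₁ d₂) {O : Set (EMod n × EMod n)}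
    (hO : IsOpen O) (hOd : O ⊆ F.cornerDom d R) (hu : u ∈ O ∩ modelCorner n) :
    A.projDeriv p O (F.corner R) u = F.cornerProjDeriv R u :=
  ((hg.hasFDerivWithinAt_projCoord ⟨hOd hu.1, hu.2⟩).mono
    (inter_subset_inter_left _ hOd)).fderivWithin (uniqueDiffOn_corner hO u hu)

/-- For fixed `v` the projection is the polar map, then `R`, then the displacement; only the polar
map degenerates, with determinant `r ^ n`. -/
theorem abs_det_cornerProjDeriv (u : EMod n × EMod n) : |(F.cornerProjDeriv R u).det| =
    |(F.dispDeriv (u.2, cornerVec R u)).det| * |(R : EMod n →L[ℝ] EMod n).det| * |u.1 0| ^ n := by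
  have h1 : (F.cornerProjDeriv R u).det = LinearMap.det ((LinearMap.snd ℝ (EMod n) (EMod n)).prod
      ((((F.dispDeriv (u.2, cornerVec R u)).comp ((R : EMod n →L[ℝ] EMod n).comp
      (polarDeriv u.1))) : EMod n →ₗ[ℝ] EMod n).coprod
      (((fderivWithin ℝ F.disp F.dispDom (u.2, cornerVec R u)).comp
        (ContinuousLinearMap.inl ℝ (EMod n) (EMod n))) : EMod n →ₗ[ℝ] EMod n))) := rfl
  have h2 : LinearMap.det (((F.dispDeriv (u.2, cornerVec R u)).comp
      ((R : EMod n →L[ℝ] EMod n).comp (polarDeriv u.1))) : EMod n →ₗ[ℝ] EMod n) =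
      (F.dispDeriv (u.2, cornerVec R u)).det * ((R : EMod n →L[ℝ] EMod n).det *
        (polarDeriv u.1).det) := by
    change LinearMap.det ((F.dispDeriv (u.2, cornerVec R u)).toLinearMap ∘ₗ
      ((R : EMod n →L[ℝ] EMod n).toLinearMap ∘ₗ (polarDeriv u.1).toLinearMap)) = _
    rw [LinearMap.det_comp, LinearMap.det_comp]
  rw [h1, LinearMap.abs_det_swap_block, h2, det_polarDeriv, abs_mul, abs_mul, abs_pow, mul_assoc]

theorem IsGoodRadius.dispDeriv_injective (hg : F.IsGoodRadius d c C d₁ d₂)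
    (hu : u ∈ F.cornerDom d R ∩ modelCorner n) :
    Function.Injective (F.dispDeriv (u.2, cornerVec R u)) := by
  have h1 := (hg.det _ (mem_posDom_of_cornerDom hu) _ (cornerVec_mem_ball hu.1)).1
  have h2 : LinearMap.ker (F.dispDeriv (u.2, cornerVec R u)).toLinearMap = ⊥ := by
    by_contra h
    have h3 := LinearMap.det_eq_zero_iff_ker_ne_bot.2 h
    change (F.dispDeriv (u.2, cornerVec R u)).det = 0 at h3
    rw [h3, abs_zero] at h1
    exact absurd hg.d₁_pos h1.not_gt
  exact LinearMap.ker_eq_bot.1 h2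

/-- At `r = 0` the derivative of the polar map is `dr σ`. So the differential factors through the
surjection to the components `(dr, dv)` followed by an injective map, and its rank is `1 + (n + 1)`.
-/
theorem IsGoodRadius.finrank_range (hg : F.IsGoodRadius d c C d₁ d₂)
    (hu : u ∈ F.cornerDom d R ∩ modelCorner n) (h0 : u.1 0 = 0) :
    Module.finrank ℝ (LinearMap.range (F.cornerProjDeriv R u).toLinearMap) + n = 2 * (n + 1) := by
  let f : EMod n × EMod n →ₗ[ℝ] ℝ × EMod n :=
    LinearMap.prodMap (EuclideanSpace.proj (𝕜 := ℝ) (0 : Fin (n + 1))).toLinearMap LinearMap.id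
  let w := F.dispDeriv (u.2, cornerVec R u) (R (polarDir u.1))
  let L := (fderivWithin ℝ F.disp F.dispDom (u.2, cornerVec R u)).comp
    (ContinuousLinearMap.inl ℝ (EMod n) (EMod n))
  let g : ℝ × EMod n →ₗ[ℝ] EMod n × EMod n :=
    (LinearMap.snd ℝ ℝ (EMod n)).prod ((LinearMap.toSpanSingleton ℝ (EMod n) w).coprod L.toLinearMap)
  have hw : w ≠ 0 := fun h => polarDir_image_ne_zero (R := R) u.1
    (hg.dispDeriv_injective hu (h.trans (map_zero _).symm))
  have hgf : (F.cornerProjDeriv R u).toLinearMap = g ∘ₗ f := by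
    refine LinearMap.ext fun y => Prod.ext rfl ?_
    change F.dispDeriv (u.2, cornerVec R u) (R (polarDeriv u.1 y.1)) + L y.2 = y.1 0 • w + L y.2
    rw [polarDeriv_apply, h0, zero_smul, zero_add, map_smul, map_smul]
  have hf : Function.Surjective f := fun y =>
    ⟨(y.1 • EuclideanSpace.single 0 1, y.2), Prod.ext (by simp [f]) rfl⟩
  have hgi : Function.Injective g := by
    refine (injective_iff_map_eq_zero g).2 fun y hy => ?_
    have h1 : y.2 = 0 := congrArg Prod.fst hy
    have h2 : y.1 • w + L y.2 = 0 := congrArg Prod.snd hy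
    rw [h1, map_zero, add_zero] at h2
    exact Prod.ext ((smul_eq_zero.1 h2).resolve_right hw) h1
  rw [hgf, LinearMap.range_comp_of_range_eq_top _ (LinearMap.range_eq_top.2 hf),
    LinearMap.finrank_range_of_inj hgi, Module.finrank_prod, Module.finrank_self,
    finrank_euclideanSpace_fin]
  ring

end LocalFlow

end AHMetric

/-! ### The corner parametrization is an embedding and an immersion. -/

namespace AHMetric

variable {n : ℕ} {X : Type*} [TopologicalSpace X] [ChartedSpace (EuclideanHalfSpace (n + 1)) X]
  [IsManifold (halfModel n) ∞ X] {A : AHMetric n X}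

namespace LocalFlow

variable {p : X} {F : A.LocalFlow p} {d c C d₁ d₂ : ℝ} {R : EMod n ≃L[ℝ] EMod n}
  {u : EMod n × EMod n} {O : Set (EMod n × EMod n)}

theorem symm_cornerVec_apply (u : EMod n × EMod n) : R.symm (cornerVec R u) 0 = u.1 0 := by
  rw [cornerVec, R.symm_apply_apply, PiLp.smul_apply, polarDir_zero, smul_eq_mul, mul_one]

theorem eq_polarDir_add (v : EMod n) : v = polarDir v + (v 0 - 1) • EuclideanSpace.single 0 1 := by
  rw [polarDir, add_assoc, ← add_smul]
  simp

/-- The coordinates of the point determine `u` continuously: `v` is one of them, `σ` comes from the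
momentum `a`, `w` from `W` by the bound of `IsGoodRadius`, and `r` is the coordinate `0` of `R⁻¹ w`.
The momentum is needed because `w` forgets `σ` at `r = 0`. -/
theorem IsGoodRadius.tendsto_of_corner (hg : F.IsGoodRadius d c C d₁ d₂) {ι : Type*} {l : Filter ι}
    {y : ι → EMod n × EMod n} (hy : ∀ i, y i ∈ F.cornerDom d R ∩ modelCorner n)
    (hu : u ∈ F.cornerDom d R ∩ modelCorner n)
    (h : Tendsto (fun i => A.phiCoord p (F.corner R (y i))) l (𝓝 (A.phiCoord p (F.corner R u)))) :
    Tendsto y l (𝓝 u) := by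
  simp only [fun i => hg.phiCoord_corner (hy i), hg.phiCoord_corner hu] at h
  have h2 : Tendsto (fun i => (y i).2) l (𝓝 u.2) := h.fst_nhds.fst_nhds
  have hW : Tendsto (fun i => F.disp ((y i).2, cornerVec R (y i))) l
      (𝓝 (F.disp (u.2, cornerVec R u))) := h.fst_nhds.snd_nhds
  have ha : Tendsto (fun i => (F.cornerParam R (y i)).2.2) l (𝓝 (F.cornerParam R u).2.2) := by
    simpa using h.snd_nhds.snd_nhds.neg
  have hRa := ((R.symm.continuous.tendsto _).comp ha)
  have hRa0 : Tendsto (fun i => R.symm (F.cornerParam R (y i)).2.2 0) l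
      (𝓝 (R.symm (F.cornerParam R u).2.2 0)) :=
    ((EuclideanSpace.proj (𝕜 := ℝ) (0 : Fin (n + 1))).continuous.tendsto _).comp hRa
  have hσ : Tendsto (fun i => polarDir (y i).1) l (𝓝 (polarDir u.1)) := by
    simp only [(polarDir_eq hu).2, fun i => (polarDir_eq (hy i)).2]
    exact (hRa0.inv₀ (polarDir_eq hu).1.ne').smul hRa
  have hw : Tendsto (fun i => cornerVec R (y i)) l (𝓝 (cornerVec R u)) := by
    rw [tendsto_iff_norm_sub_tendsto_zero] at h2 hW ⊢
    have h3 := (hW.add (h2.const_mul C)).const_mul c⁻¹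
    rw [mul_zero, add_zero, mul_zero] at h3
    refine squeeze_zero (fun i => norm_nonneg _) (fun i => ?_) h3
    rw [← div_eq_inv_mul, le_div_iff₀ hg.c_pos, mul_comm]
    exact hg.bound _ (mem_posDom_of_cornerDom (hy i)) _ (mem_posDom_of_cornerDom hu) _
      (cornerVec_mem_ball (hy i).1) _ (cornerVec_mem_ball hu.1)
  have hr : Tendsto (fun i => (y i).1 0) l (𝓝 (u.1 0)) := by
    have h4 : Tendsto (fun i => R.symm (cornerVec R (y i)) 0) l (𝓝 (R.symm (cornerVec R u) 0)) :=
      ((EuclideanSpace.proj (𝕜 := ℝ) (0 : Fin (n + 1))).continuous.tendsto _).comp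
        ((R.symm.continuous.tendsto _).comp hw)
    simpa only [symm_cornerVec_apply] using h4
  have h1 : Tendsto (fun i => (y i).1) l (𝓝 u.1) := by
    have h5 := hσ.add ((hr.sub_const 1).smul_const (EuclideanSpace.single (0 : Fin (n + 1)) (1 : ℝ)))
    simpa only [← eq_polarDir_add] using h5
  exact h1.prodMk_nhds h2

theorem IsGoodRadius.injOn_corner (hg : F.IsGoodRadius d c C d₁ d₂) :
    InjOn (F.corner R) (F.cornerDom d R ∩ modelCorner n) := by
  intro u hu w hw h
  -- A constant family with the same image as `u` converges to `u`, hence is equal to it.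
  have h1 := hg.tendsto_of_corner (l := pure ()) (y := fun _ => w) (fun _ => hw) hu (by
    rw [h]; exact tendsto_const_nhds)
  exact tendsto_nhds_unique h1 tendsto_const_nhds

theorem IsGoodRadius.isEmbedding_corner (hg : F.IsGoodRadius d c C d₁ d₂)
    (hOd : O ⊆ F.cornerDom d R) :
    Topology.IsEmbedding ((O ∩ modelCorner n).domRestrict (F.corner R)) := by
  have hsub : O ∩ modelCorner n ⊆ F.cornerDom d R ∩ modelCorner n := inter_subset_inter_left _ hOd
  have hcont : Continuous ((O ∩ modelCorner n).domRestrict (F.corner R)) :=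
    continuousOn_iff_continuous_domRestrict.1 (hg.continuousOn_corner.mono hsub)
  refine ⟨Topology.isInducing_iff_nhds.2 fun x => le_antisymm (hcont.tendsto x).le_comap ?_,
    (hg.injOn_corner.mono hsub).injective⟩
  rw [nhds_subtype_eq_comap, ← tendsto_iff_comap]
  refine hg.tendsto_of_corner (fun y => hsub y.2) (hsub x.2) ?_
  exact (A.continuousAt_phiCoord (hg.relPoint_mem_phiDom (cornerParam_mem (hsub x.2)))).tendsto.comp
    tendsto_comap

/-- A vector in the kernel has no `v` component. Invertibility of the displacement gives `r dσ + dr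
σ = 0`, and the momentum, from which the smooth map `G` recovers `σ`, gives `dσ = 0`. Hence `dr =
0`, also when `r = 0`. -/
theorem IsGoodRadius.immersion_corner (hg : F.IsGoodRadius d c C d₁ d₂) (hO : IsOpen O)
    (hOd : O ⊆ F.cornerDom d R) (hu : u ∈ O ∩ modelCorner n) : Function.Injective
      (fderivWithin ℝ (fun u => A.phiCoord p (F.corner R u)) (O ∩ modelCorner n) u) := by
  have hsub : O ∩ modelCorner n ⊆ F.cornerDom d R ∩ modelCorner n := inter_subset_inter_left _ hOd
  have hu' := hsub hu
  have huniq := uniqueDiffOn_corner hO u hu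
  have hf := ((hg.contDiffOn_phiCoord_corner (R := R)).mono hsub).differentiableOn (by simp) u hu
  set f' := fderivWithin ℝ (fun u => A.phiCoord p (F.corner R u)) (O ∩ modelCorner n) u with hf'
  have hd : HasFDerivWithinAt (fun u => A.phiCoord p (F.corner R u)) f' (O ∩ modelCorner n) u :=
    hf.hasFDerivWithinAt
  refine (injective_iff_map_eq_zero f').2 fun δ hδ => ?_
  have h1 : (ContinuousLinearMap.fst ℝ (EMod n × EMod n) (EMod n × EMod n)).comp f' =
      F.cornerProjDeriv R u :=
    huniq.eq hd.fst ((hg.hasFDerivWithinAt_projCoord hu').mono hsub)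
  have h2 : F.cornerProjDeriv R u δ = 0 := by
    rw [← h1]
    exact congrArg Prod.fst hδ
  have h3 : δ.2 = 0 := congrArg Prod.fst h2
  have h4 : F.dispDeriv (u.2, cornerVec R u) (R (polarDeriv u.1 δ.1)) = 0 := by
    have h5 : F.dispDeriv (u.2, cornerVec R u) (R (polarDeriv u.1 δ.1)) +
        (fderivWithin ℝ F.disp F.dispDom (u.2, cornerVec R u)) (δ.2, 0) = 0 := congrArg Prod.snd h2
    rw [h3, ← Prod.zero_eq_mk, map_zero, add_zero] at h5
    exact h5
  have h5 : polarDeriv u.1 δ.1 = 0 := R.injective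
    ((hg.dispDeriv_injective hu' (h4.trans (map_zero _).symm)).trans (map_zero R).symm)
  let G : EMod n → EMod n := fun b => (R.symm b 0)⁻¹ • R.symm b
  have ha : HasFDerivWithinAt (fun u => (F.cornerParam R u).2.2)
      (-((ContinuousLinearMap.snd ℝ (EMod n) (EMod n)).comp
        ((ContinuousLinearMap.snd ℝ (EMod n × EMod n) (EMod n × EMod n)).comp f')))
      (O ∩ modelCorner n) u := by
    refine hd.snd.snd.neg.congr (fun w hw => ?_) ?_
    · rw [Pi.neg_apply, hg.phiCoord_corner (hsub hw), neg_neg]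
    · rw [Pi.neg_apply, hg.phiCoord_corner hu', neg_neg]
  have hG : DifferentiableAt ℝ G (F.cornerParam R u).2.2 := by
    have e1 : DifferentiableAt ℝ (fun b : EMod n => R.symm b) (F.cornerParam R u).2.2 :=
      R.symm.differentiableAt
    have e2 : DifferentiableAt ℝ (fun b : EMod n => R.symm b 0) (F.cornerParam R u).2.2 :=
      (EuclideanSpace.proj (𝕜 := ℝ) (0 : Fin (n + 1))).differentiableAt.comp _ e1
    exact (e2.inv (polarDir_eq hu').1.ne').smul e1
  have h6 : (fderiv ℝ G (F.cornerParam R u).2.2).comp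
      (-((ContinuousLinearMap.snd ℝ (EMod n) (EMod n)).comp
        ((ContinuousLinearMap.snd ℝ (EMod n × EMod n) (EMod n × EMod n)).comp f'))) =
      polarDirDeriv.comp (ContinuousLinearMap.fst ℝ (EMod n) (EMod n)) := by
    refine huniq.eq (hG.hasFDerivAt.comp_hasFDerivWithinAt u ha) ?_
    refine ((hasFDerivAt_polarDir u.1).comp u hasFDerivAt_fst).hasFDerivWithinAt.congr
      (fun w hw => ?_) ?_
    · exact (polarDir_eq (hsub hw)).2.symm
    · exact (polarDir_eq hu').2.symm
  have h7 : polarDirDeriv δ.1 = 0 := by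
    have e1 := congrArg (fun L : EMod n × EMod n →L[ℝ] EMod n => L δ) h6
    have e2 : (-((ContinuousLinearMap.snd ℝ (EMod n) (EMod n)).comp
        ((ContinuousLinearMap.snd ℝ (EMod n × EMod n) (EMod n × EMod n)).comp f'))) δ = 0 := by
      change -(f' δ).2.2 = 0
      rw [hδ]
      exact neg_zero
    refine Eq.trans e1.symm ?_
    exact (congrArg (fderiv ℝ G _) e2).trans (map_zero _)
  rw [polarDeriv_apply, h7, smul_zero, zero_add, smul_eq_zero] at h5
  have h8 : δ.1 0 = 0 := h5.resolve_right fun h => by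
    have := polarDir_zero u.1
    rw [h] at this
    exact zero_ne_one this
  rw [polarDirDeriv_apply, h8, zero_smul, sub_zero] at h7
  exact Prod.ext h7 h3

variable [T2Space X] [CompactSpace X]

theorem IsGoodRadius.exists_isCornerParam (hg : F.IsGoodRadius d c C d₁ d₂)
    {U : Set A.PhiCotangent} (hU : IsOpen U)
    (hcov : ∀ q ∈ A.LambdaPlus ∩ U, q ∈ A.phiDom p →
      coord n p q.base.right ∈ F.posDom ∩ Metric.ball (coord n p p) d →
      ∃ l ∈ F.relDom d, F.relPoint l = q)
    {q : A.PhiCotangent} (hq : q ∈ A.LambdaPlus ∩ U) (hqp : q ∈ A.phiDom p)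
    (hqr : coord n p q.base.right ∈ F.posDom ∩ Metric.ball (coord n p p) d) :
    ∃ (R : EMod n ≃L[ℝ] EMod n) (O : Set (EMod n × EMod n)) (W : Set A.PhiCotangent),
      O ⊆ F.cornerDom d R ∧ A.IsCornerParam (A.LambdaPlus ∩ U) p O W (F.corner R) ∧ q ∈ W := by
  obtain ⟨l, hl, hlq⟩ := hcov q hq hqp hqr
  have he0 : (EuclideanSpace.single (0 : Fin (n + 1)) (1 : ℝ)) ≠ 0 := by simp
  -- `R` sends the first basis vector to the momentum of `q`, so the affine patch of directions
  -- contains that momentum.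
  obtain ⟨R, hR⟩ := SeparatingDual.exists_continuousLinearEquiv_apply_eq (R := ℝ) he0
    (ne_zero_of_mem_relDom hl)
  obtain ⟨O', hO', hOe⟩ := continuousOn_iff'.1 (hg.continuousOn_corner (R := R)) U hU
  -- `T` selects positions in the range of the flow and momenta in the open half-space of directions
  -- covered by the patch; it cuts out `W` in coordinates.
  let T : Set ((EMod n × EMod n) × (EMod n × EMod n)) :=
    {y | y.1.1 ∈ Metric.ball (coord n p p) F.δ ∩ Metric.ball (coord n p p) d ∧ 0 < R.symm (-y.2.2) 0}
  have hT : IsOpen T := by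
    have h1 : Continuous fun y : (EMod n × EMod n) × (EMod n × EMod n) => R.symm (-y.2.2) 0 :=
      (EuclideanSpace.proj (𝕜 := ℝ) (0 : Fin (n + 1))).continuous.comp
        (R.symm.continuous.comp continuous_snd.snd.neg)
    exact ((Metric.isOpen_ball.inter Metric.isOpen_ball).preimage continuous_fst.fst).inter
      (isOpen_lt continuous_const h1)
  have hφ : ContinuousOn (A.phiCoord p) (A.phiDom p) := fun b hb =>
    (A.continuousAt_phiCoord hb).continuousWithinAt
  have hTl : ∀ l ∈ F.relDom d, 0 < R.symm l.2.2 0 → A.phiCoord p (F.relPoint l) ∈ T := fun l hl h => by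
    rw [hg.phiCoord_relPoint hl]
    exact ⟨⟨hl.2.1.1.1, hl.2.1.2⟩, by rwa [neg_neg]⟩
  have hsub : (O' ∩ F.cornerDom d R) ∩ modelCorner n ⊆ F.cornerDom d R ∩ modelCorner n :=
    inter_subset_inter_left _ inter_subset_right
  refine ⟨R, O' ∩ F.cornerDom d R, (A.phiDom p ∩ A.phiCoord p ⁻¹' T) ∩ U, inter_subset_right, ?_, ?_⟩
  · refine ⟨hO'.inter isOpen_cornerDom, (hφ.isOpen_inter_preimage (A.isOpen_phiDom p) hT).inter hU,
      fun b hb => hb.1.1, ?_, hg.isEmbedding_corner inter_subset_right,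
      hg.contDiffOn_phiCoord_corner.mono hsub,
      fun u hu => hg.immersion_corner (hO'.inter isOpen_cornerDom) inter_subset_right hu⟩
    ext b
    constructor
    · rintro ⟨u, hu, rfl⟩
      have hu' := hsub hu
      have hm := cornerParam_mem hu'
      have hUu : F.corner R u ∈ U := by
        have : u ∈ O' ∩ (F.cornerDom d R ∩ modelCorner n) := ⟨hu.1.1, hu'⟩
        rw [← hOe] at this
        exact this.1
      exact ⟨⟨hg.relPoint_mem_LambdaPlus hm, hUu⟩,
        ⟨hg.relPoint_mem_phiDom hm, hTl _ hm (polarDir_eq hu').1⟩, hUu⟩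
    · rintro ⟨hb, ⟨hbp, hbT⟩, -⟩
      have hbr : coord n p b.base.right ∈ F.posDom ∩ Metric.ball (coord n p p) d :=
        ⟨⟨hbT.1.1, chartTgt_subset p (coord_mem hbp.1.2)⟩, hbT.1.2⟩
      obtain ⟨k, hk, rfl⟩ := hcov b hb hbp hbr
      have hpos : 0 < R.symm k.2.2 0 := by
        have h1 := hbT.2
        rwa [hg.phiCoord_relPoint hk, neg_neg] at h1
      obtain ⟨u, hu, rfl⟩ := exists_cornerParam_eq hk hpos
      have hOu : u ∈ F.corner R ⁻¹' U ∩ (F.cornerDom d R ∩ modelCorner n) := ⟨hb.2, hu⟩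
      rw [hOe] at hOu
      exact ⟨u, ⟨⟨hOu.1, hu.1⟩, hu.2⟩, rfl⟩
  · refine ⟨⟨hqp, ?_⟩, hq.2⟩
    rw [← hlq]
    refine hTl l hl ?_
    rw [← hR, R.symm_apply_apply]
    simp

end LocalFlow

end AHMetric

/-! ### The projection is a diffeomorphism off the two faces. -/

theorem contDiff_transposeApply {n : ℕ} :
    ContDiff ℝ ∞ (fun y : EMod n × (EMod n →L[ℝ] EMod n) => transposeApply y.1 y.2) := by
  refine contDiff_euclidean.2 fun i => ?_
  exact contDiff_fst.inner ℝ (contDiff_snd.clm_apply contDiff_const)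

namespace AHMetric

variable {n : ℕ} {X : Type*} [TopologicalSpace X] [ChartedSpace (EuclideanHalfSpace (n + 1)) X]
  [IsManifold (halfModel n) ∞ X] {A : AHMetric n X}

namespace LocalFlow

variable {p : X} {F : A.LocalFlow p} {d c C d₁ d₂ : ℝ} {l : ℝ × EMod n × EMod n}

/-- Away from `∂_diag Λ₊` and the front face, the parameters `(t, v, a)` are smooth functions of the
projective coordinates. -/
theorem IsGoodRadius.exists_section (hg : F.IsGoodRadius d c C d₁ d₂) (hl : l ∈ F.relDom d)
    (h0 : l.1 ≠ 0) (hv : 0 < l.2.1 0) : ∃ k : EMod n × EMod n → ℝ × EMod n × EMod n,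
    ContDiffAt ℝ ∞ k (l.2.1, F.disp (l.2.1, l.1 • l.2.2)) ∧
    k (l.2.1, F.disp (l.2.1, l.1 • l.2.2)) = l ∧
    ∀ᶠ y in 𝓝 (l.2.1, F.disp (l.2.1, l.1 • l.2.2)), k y ∈ F.relDom d ∧ (k y).1 ≠ 0 ∧
      0 < (k y).2.1 0 ∧ ((k y).2.1, F.disp ((k y).2.1, (k y).1 • (k y).2.2)) = y := by
  set x₀ : EMod n × EMod n := (l.2.1, l.1 • l.2.2) with hx₀
  set N : Set (EMod n × EMod n) := {x | x.1 ∈ Metric.ball (coord n p p) F.δ ∩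
    Metric.ball (coord n p p) d ∧ 0 < x.1 0 ∧ x.2 ∈ Metric.ball (0 : EMod n) d} with hN
  have hNo : IsOpen N :=
    ((Metric.isOpen_ball.inter Metric.isOpen_ball).preimage continuous_fst).inter
      ((isOpen_pos.preimage continuous_fst).inter (Metric.isOpen_ball.preimage continuous_snd))
  have hx₀N : x₀ ∈ N := ⟨⟨hl.2.1.1.1, hl.2.1.2⟩, hv, mem_ball_of_mem_relDom hl⟩
  have hNd : N ⊆ F.dispDom := fun x hx =>
    hg.mem_dispDom ⟨hx.1.1, le_of_lt hx.2.1⟩ hx.2.2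
  have hNT : N ⊆ chartTgt n p ×ˢ univ := fun x hx => ⟨posDom_subset (hNd hx).1, mem_univ _⟩
  have hW : ContDiffAt ℝ ∞ F.disp x₀ :=
    contDiffOn_disp.contDiffAt (mem_of_superset (hNo.mem_nhds hx₀N) hNd)
  -- Off the front face `Ψ` is smooth on an open set and the inverse function theorem applies. From
  -- `w` one recovers `t` as its `ḡ`-length and `a = w / t`, smoothly because `t ≠ 0`.
  let Ψ : EMod n × EMod n → EMod n × EMod n := fun x => (x.1, F.disp x)
  have hΨ : ContDiffAt ℝ ∞ Ψ x₀ := contDiffAt_fst.prodMk hW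
  let f' : EMod n × EMod n →L[ℝ] EMod n × EMod n :=
    (ContinuousLinearMap.fst ℝ (EMod n) (EMod n)).prod (fderiv ℝ F.disp x₀)
  have hD : fderivWithin ℝ F.disp F.dispDom x₀ = fderiv ℝ F.disp x₀ :=
    fderivWithin_of_mem_nhds (mem_of_superset (hNo.mem_nhds hx₀N) hNd)
  have hinj : Function.Injective f'.toLinearMap := by
    refine (injective_iff_map_eq_zero _).2 fun y hy => ?_
    have h1 : y.1 = 0 := congrArg Prod.fst hy
    have h2 : fderiv ℝ F.disp x₀ y = 0 := congrArg Prod.snd hy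
    have h3 : F.dispDeriv x₀ y.2 = 0 := by
      change fderivWithin ℝ F.disp F.dispDom x₀ (0, y.2) = 0
      have e : ((0 : EMod n), y.2) = y := Prod.ext h1.symm rfl
      rw [hD, e]
      exact h2
    have h4 := (hg.det _ hl.2.1 _ (mem_ball_of_mem_relDom hl)).1
    have h5 : LinearMap.ker (F.dispDeriv x₀).toLinearMap = ⊥ := by
      by_contra h
      have h6 : (F.dispDeriv x₀).det = 0 := LinearMap.det_eq_zero_iff_ker_ne_bot.2 h
      rw [h6, abs_zero] at h4
      exact absurd hg.d₁_pos h4.not_gt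
    exact Prod.ext h1 (LinearMap.ker_eq_bot.1 h5 (h3.trans (map_zero _).symm))
  let f'' : (EMod n × EMod n) ≃L[ℝ] EMod n × EMod n :=
    (LinearEquiv.ofInjectiveEndo f'.toLinearMap hinj).toContinuousLinearEquiv
  have hΨ' : HasFDerivAt Ψ (f'' : EMod n × EMod n →L[ℝ] EMod n × EMod n) x₀ := by
    refine (hasFDerivAt_fst.prodMk (hW.differentiableAt (by simp)).hasFDerivAt).congr_fderiv ?_
    exact ContinuousLinearMap.ext fun y => rfl
  have hn : (∞ : WithTop ℕ∞) ≠ 0 := by simp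
  let g := hΨ.localInverse hΨ' hn
  have hg0 : g (Ψ x₀) = x₀ := hΨ.localInverse_apply_image hΨ' hn
  have hgs : ContDiffAt ℝ ∞ g (Ψ x₀) := hΨ.to_localInverse hΨ' hn
  have hgr : ∀ᶠ y in 𝓝 (Ψ x₀), Ψ (g y) = y :=
    (hΨ.hasStrictFDerivAt' hΨ' hn).eventually_right_inverse
  have hgN : ∀ᶠ y in 𝓝 (Ψ x₀), g y ∈ N :=
    hgs.continuousAt.eventually_mem (by rw [hg0]; exact hNo.mem_nhds hx₀N)
  have hq : ContDiffAt ℝ ∞ (fun x : EMod n × EMod n => A.quad p x.1 x.2) (g (Ψ x₀)) := by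
    rw [hg0]
    exact (A.contDiffOn_quad p).contDiffAt (mem_of_superset (hNo.mem_nhds hx₀N) hNT)
  have hq0 : A.quad p x₀.1 x₀.2 = l.1 ^ 2 := by
    rw [hx₀, quad_smul, hl.2.2.2, mul_one]
  have hq0' : A.quad p (g (Ψ x₀)).1 (g (Ψ x₀)).2 ≠ 0 := by
    rw [hg0, hq0]
    exact pow_ne_zero 2 h0
  have hqg : ContDiffAt ℝ ∞ (fun y => √(A.quad p (g y).1 (g y).2)) (Ψ x₀) :=
    (ContDiffAt.comp (g := fun x : EMod n × EMod n => A.quad p x.1 x.2) (Ψ x₀) hq hgs).sqrt hq0'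
  have hsq : √(A.quad p (g (Ψ x₀)).1 (g (Ψ x₀)).2) = l.1 := by
    rw [hg0, hq0, Real.sqrt_sq hl.1]
  refine ⟨fun y => (√(A.quad p (g y).1 (g y).2), (g y).1, (√(A.quad p (g y).1 (g y).2))⁻¹ • (g y).2),
    ?_, ?_, ?_⟩
  · exact hqg.prodMk (hgs.fst.prodMk ((hqg.inv (by rw [hsq]; exact h0)).smul hgs.snd))
  · change (√(A.quad p (g (Ψ x₀)).1 (g (Ψ x₀)).2), (g (Ψ x₀)).1,
      (√(A.quad p (g (Ψ x₀)).1 (g (Ψ x₀)).2))⁻¹ • (g (Ψ x₀)).2) = l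
    rw [hsq, hg0]
    exact Prod.ext rfl (Prod.ext rfl (inv_smul_smul₀ h0 _))
  · have hqe : ∀ᶠ y in 𝓝 (Ψ x₀), A.quad p (g y).1 (g y).2 ≠ 0 :=
      (ContinuousAt.comp (g := fun x : EMod n × EMod n => A.quad p x.1 x.2) hq.continuousAt
        hgs.continuousAt).eventually_ne hq0'
    filter_upwards [hgr, hgN, hqe] with y h1 h2 h3
    have hT := (hNT h2).1
    have h4 : (g y).2 ≠ 0 := fun h => h3 (by rw [h]; simp [quad])
    have h5 := A.quad_pos hT h4
    have h6 := Real.sqrt_pos.2 h5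
    have h7 : √(A.quad p (g y).1 (g y).2) • (√(A.quad p (g y).1 (g y).2))⁻¹ • (g y).2 = (g y).2 :=
      smul_inv_smul₀ h6.ne' _
    refine ⟨⟨h6.le, ⟨⟨h2.1.1, le_of_lt h2.2.1⟩, h2.1.2⟩, ?_, ?_⟩, h6.ne', h2.2.1, ?_⟩
    · rw [h7]
      exact mem_ball_zero_iff.1 h2.2.2
    · simp only
      rw [quad_smul, inv_pow, Real.sq_sqrt h5.le, inv_mul_cancel₀ h5.ne']
    · simp only [h7]
      exact h1

end LocalFlow

end AHMetric

namespace AHMetric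

variable {n : ℕ} {X : Type*} [TopologicalSpace X] [ChartedSpace (EuclideanHalfSpace (n + 1)) X]
  [IsManifold (halfModel n) ∞ X] {A : AHMetric n X}

variable (A) in
/-- The part of `Λ₊ ∩ U` away from `∂_diag Λ₊` and the front face. -/
def regularPart (U : Set A.PhiCotangent) : Set A.PhiCotangent :=
  {q | q ∈ A.LambdaPlus ∩ U ∧ q ∉ A.diagFace ∧ q.base ∉ DoubleSpace.FF}

namespace DoubleSpace

theorem projCoord_add_smul {p : X} {b : A.DoubleSpace} (hb : b ∈ projDom p)
    (hx : 0 < A.x b.right) :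
    (projCoord p b).1 + A.xc p (projCoord p b).1 • (projCoord p b).2 = coord n p b.left := by
  cases b with
  | off z z' h =>
    have h1 : A.xc p (coord n p z') = A.x z' := A.xc_coord hb.1.2
    change coord n p z' + A.xc p (coord n p z') • ((A.x z')⁻¹ • (coord n p z - coord n p z')) =
      coord n p z
    have hx' : A.x z' ≠ 0 := ne_of_gt hx
    rw [h1, smul_inv_smul₀ hx']
    abel
  | front q hq a w ha hw hu => exact absurd ((A.x_eq_zero q).2 hq) (ne_of_gt hx)

theorem projCoord_mem_projTgt {p : X} {b : A.DoubleSpace} (hb : b ∈ projDom p)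
    (hx : 0 < A.x b.right) : projCoord p b ∈ projTgt A p := by
  refine ⟨coord_mem hb.1.2, ?_, fun h => ?_⟩
  · rw [projCoord_add_smul hb hx]
    exact coord_mem hb.1.1
  · have h1 : A.xc p (coord n p b.right) = 0 := h
    rw [A.xc_coord hb.1.2] at h1
    exact absurd h1 hx.ne'

theorem contDiffAt_left {p : X} {y : EMod n × EMod n} (hy : y.1 ∈ chartTgt n p) (h : 0 < y.1 0) :
    ContDiffAt ℝ ∞ (fun y : EMod n × EMod n => y.1 + A.xc p y.1 • y.2) y := by
  have h1 : ContDiffAt ℝ ∞ (fun y : EMod n × EMod n => A.xc p y.1) y :=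
    ((A.contDiffOn_xc p).contDiffAt (chartTgt_nhds hy h)).comp y contDiffAt_fst
  exact contDiffAt_fst.add (h1.smul contDiffAt_snd)

end DoubleSpace

namespace LocalFlow

variable {p : X} {F : A.LocalFlow p} {d c C d₁ d₂ : ℝ} {l : ℝ × EMod n × EMod n}

theorem IsGoodRadius.x_right_pos (hg : F.IsGoodRadius d c C d₁ d₂) (hl : l ∈ F.relDom d)
    (hv : 0 < l.2.1 0) : 0 < A.x (F.relPoint l).base.right := by
  have h1 : (F.relPoint l).base.right = chartInv p l.2.1 :=
    DoubleSpace.projInv_right (hg.mem_projTgt hl)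
  rw [h1]
  exact (A.xc_pos_iff (posDom_subset hl.2.1.1)).2 hv

theorem IsGoodRadius.x_left_pos (hg : F.IsGoodRadius d c C d₁ d₂) (hl : l ∈ F.relDom d)
    (hv : 0 < l.2.1 0) : 0 < A.x (F.relPoint l).base.left := by
  have h1 : (F.relPoint l).base.left = chartInv p (F.pos l 1) := by
    rw [pos_eq_disp (hg.mem_dom hl) (hg.mem_dispDom hl.2.1.1 (mem_ball_of_mem_relDom hl))]
    exact DoubleSpace.projInv_left (hg.mem_projTgt hl)
  rw [h1]
  exact xc_pos_pos (hg.mem_dom hl) (right_mem_Icc.2 zero_le_one)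
    ((A.xc_pos_iff (posDom_subset hl.2.1.1)).2 hv)

theorem IsGoodRadius.relPoint_mem_regularPart_iff (hg : F.IsGoodRadius d c C d₁ d₂)
    (hl : l ∈ F.relDom d) {U : Set A.PhiCotangent} : F.relPoint l ∈ A.regularPart U ↔
      F.relPoint l ∈ A.LambdaPlus ∩ U ∧ l.1 ≠ 0 ∧ 0 < l.2.1 0 := by
  have h1 : 0 ≤ l.2.1 0 := hl.2.1.1.2
  rw [h1.lt_iff_ne']
  exact and_congr_right fun _ => and_congr (not_congr (hg.relPoint_mem_diagFace hl))
    (not_congr (hg.relPoint_mem_FF hl))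

variable [T2Space X] [CompactSpace X]

theorem IsGoodRadius.exists_local_inverse (hg : F.IsGoodRadius d c C d₁ d₂) (hl : l ∈ F.relDom d)
    {U : Set A.PhiCotangent} (hU : IsOpen U) (hlU : F.relPoint l ∈ A.regularPart U) :
    ∃ k : EMod n × EMod n → ℝ × EMod n × EMod n,
    ContDiffAt ℝ ∞ k (DoubleSpace.projCoord p (F.relPoint l).base) ∧
    k (DoubleSpace.projCoord p (F.relPoint l).base) = l ∧
    ∀ᶠ y in 𝓝 (DoubleSpace.projCoord p (F.relPoint l).base), k y ∈ F.relDom d ∧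
      F.relPoint (k y) ∈ A.regularPart U ∧ DoubleSpace.projCoord p (F.relPoint (k y)).base = y := by
  have hy : ∀ {m : ℝ × EMod n × EMod n}, m ∈ F.relDom d →
      DoubleSpace.projCoord p (F.relPoint m).base = (m.2.1, F.disp (m.2.1, m.1 • m.2.2)) :=
    fun hm => congrArg Prod.fst (hg.phiCoord_relPoint hm)
  obtain ⟨h1, h2, h3⟩ := (hg.relPoint_mem_regularPart_iff hl).1 hlU
  obtain ⟨k, hk, hkl, hev⟩ := hg.exists_section hl h2 h3
  rw [hy hl]
  refine ⟨k, hk, hkl, ?_⟩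
  have hkt : Tendsto k (𝓝 (l.2.1, F.disp (l.2.1, l.1 • l.2.2))) (𝓝[F.relDom d] l) := by
    refine tendsto_nhdsWithin_iff.2 ⟨?_, hev.mono fun y hy => hy.1⟩
    have := hk.continuousAt.tendsto
    rwa [hkl] at this
  have hUe := ((hg.continuousOn_relPoint l hl).tendsto.comp hkt) (hU.mem_nhds h1.2)
  filter_upwards [hev, hUe] with y h4 h5
  refine ⟨h4.1, ?_, (hy h4.1).trans h4.2.2.2⟩
  exact (hg.relPoint_mem_regularPart_iff h4.1).2
    ⟨⟨hg.relPoint_mem_LambdaPlus h4.1, h5⟩, h4.2.1, h4.2.2.1⟩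

theorem IsGoodRadius.image_regularPart_mem_nhds (hg : F.IsGoodRadius d c C d₁ d₂)
    (hl : l ∈ F.relDom d) {U : Set A.PhiCotangent} (hU : IsOpen U)
    (hlU : F.relPoint l ∈ A.regularPart U) :
    PhiCotangent.base '' A.regularPart U ∈ 𝓝 (F.relPoint l).base := by
  obtain ⟨k, -, -, hev⟩ := hg.exists_local_inverse hl hU hlU
  have hd : (F.relPoint l).base ∈ DoubleSpace.projDom p := hg.relPoint_mem_phiDom hl
  have hdn := (DoubleSpace.isOpen_projDom p).mem_nhds hd
  have hc := (DoubleSpace.continuousOn_projCoord p).continuousAt hdn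
  filter_upwards [hc.eventually hev, hdn] with b hb hbd
  exact ⟨_, hb.2.1, DoubleSpace.injOn_projCoord p (hg.relPoint_mem_phiDom hb.1) hbd hb.2.2⟩

/-- The inverse of the projection is smooth in the coordinates attached to any chart. -/
theorem IsGoodRadius.exists_contDiffAt_inverse (hg : F.IsGoodRadius d c C d₁ d₂)
    (hl : l ∈ F.relDom d) {U : Set A.PhiCotangent} (hU : IsOpen U)
    (hlU : F.relPoint l ∈ A.regularPart U) {p₀ : X} (hp₀ : F.relPoint l ∈ A.phiDom p₀) :
    ∃ G : EMod n × EMod n → (EMod n × EMod n) × (EMod n × EMod n),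
      ContDiffAt ℝ ∞ G (DoubleSpace.projCoord p₀ (F.relPoint l).base) ∧
      ∀ᶠ y in 𝓝 (DoubleSpace.projCoord p₀ (F.relPoint l).base), ∃ q ∈ A.regularPart U,
        q.base ∈ DoubleSpace.projDom p₀ ∧ DoubleSpace.projCoord p₀ q.base = y ∧
        A.phiCoord p₀ q = G y := by
  have hvl := ((hg.relPoint_mem_regularPart_iff hl).1 hlU).2.2
  have hxr := hg.x_right_pos hl hvl
  have hxl := hg.x_left_pos hl hvl
  have hpp : F.relPoint l ∈ A.phiDom p := hg.relPoint_mem_phiDom hl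
  obtain ⟨k, hk, hkl, hev⟩ := hg.exists_local_inverse hl hU hlU
  set b := (F.relPoint l).base with hb
  set y₁ := DoubleSpace.projCoord p₀ b with hy₁
  have hbp₀ : b ∈ DoubleSpace.projDom p₀ := hp₀
  have hbp : b ∈ DoubleSpace.projDom p := hpp
  have hr0 : 0 < y₁.1 0 := (A.x_pos_iff hbp₀.1.2).1 hxr
  have hrT : y₁.1 ∈ chartTgt n p₀ := coord_mem hbp₀.1.2
  have hleft : y₁.1 + A.xc p₀ y₁.1 • y₁.2 = coord n p₀ b.left :=
    DoubleSpace.projCoord_add_smul hbp₀ hxr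
  have hl0 : 0 < (y₁.1 + A.xc p₀ y₁.1 • y₁.2) 0 := by
    rw [hleft]
    exact (A.x_pos_iff hbp₀.1.1).1 hxl
  have hlT : y₁.1 + A.xc p₀ y₁.1 • y₁.2 ∈ chartTgt n p₀ := by
    rw [hleft]
    exact coord_mem hbp₀.1.1
  have hrt : y₁.1 ∈ transDom n p₀ p := coord_mem_transDom hbp₀.1.2 hbp.1.2
  have hlt : y₁.1 + A.xc p₀ y₁.1 • y₁.2 ∈ transDom n p₀ p := by
    rw [hleft]
    exact coord_mem_transDom hbp₀.1.1 hbp.1.1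
  have hL : ContDiffAt ℝ ∞ (fun y : EMod n × EMod n => y.1 + A.xc p₀ y.1 • y.2) y₁ :=
    DoubleSpace.contDiffAt_left hrT hr0
  have hxc : ContDiffAt ℝ ∞ (fun y : EMod n × EMod n => A.xc p₀ y.1) y₁ :=
    ((A.contDiffOn_xc p₀).contDiffAt (chartTgt_nhds hrT hr0)).comp y₁ contDiffAt_fst
  have hxc0 : A.xc p₀ y₁.1 ≠ 0 := ((A.xc_pos_iff hrT).2 hr0).ne'
  have e1 : ∀ᶠ y : EMod n × EMod n in 𝓝 y₁, y.1 ∈ chartTgt n p₀ ∧ 0 < y.1 0 :=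
    continuousAt_fst.eventually (inter_mem (chartTgt_nhds hrT hr0) (isOpen_pos.mem_nhds hr0))
  have e2 : ∀ᶠ y : EMod n × EMod n in 𝓝 y₁, y.1 + A.xc p₀ y.1 • y.2 ∈ chartTgt n p₀ ∧
      0 < (y.1 + A.xc p₀ y.1 • y.2) 0 :=
    hL.continuousAt.eventually (inter_mem (chartTgt_nhds hlT hl0) (isOpen_pos.mem_nhds hl0))
  have e3 : ∀ᶠ y in 𝓝 y₁, y ∈ DoubleSpace.projTgt A p₀ := by
    filter_upwards [e1, e2] with y h1 h2
    exact ⟨h1.1, h2.1, fun h => absurd h ((A.xc_pos_iff h1.1).2 h1.2).ne'⟩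
  have hinv : DoubleSpace.projInv A p₀ y₁ = b := DoubleSpace.projInv_projCoord hbp₀
    (DoubleSpace.projCoord_mem_projTgt hbp₀ hxr)
  have hinvc : ContinuousAt (DoubleSpace.projInv A p₀) y₁ :=
    DoubleSpace.continuousOn_projInv.continuousAt e3
  have e4 : ∀ᶠ y in 𝓝 y₁, DoubleSpace.projInv A p₀ y ∈ DoubleSpace.projDom p :=
    hinvc.eventually ((DoubleSpace.isOpen_projDom p).mem_nhds (by rwa [hinv]))
  -- `θ` changes projective coordinates from the chart at `p₀` to that at `p` and is smooth off the
  -- front face. The inverse in the chart at `p₀` is the one at `p` composed with `θ`, with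
  -- covectors transported by transposed Jacobians.
  let θ : EMod n × EMod n → EMod n × EMod n := fun y => (chTrans p₀ p y.1,
    (A.xc p₀ y.1)⁻¹ • (chTrans p₀ p (y.1 + A.xc p₀ y.1 • y.2) - chTrans p₀ p y.1))
  have hTr : ContDiffAt ℝ ∞ (fun y : EMod n × EMod n => chTrans p₀ p y.1) y₁ :=
    (contDiffAt_chTrans hrt hr0).comp y₁ contDiffAt_fst
  have hTl : ContDiffAt ℝ ∞ (fun y : EMod n × EMod n => chTrans p₀ p (y.1 + A.xc p₀ y.1 • y.2)) y₁ :=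
    ContDiffAt.comp (g := chTrans p₀ p) y₁ (contDiffAt_chTrans hlt hl0) hL
  have hθ : ContDiffAt ℝ ∞ θ y₁ := hTr.prodMk ((hxc.inv hxc0).smul (hTl.sub hTr))
  have hθe : ∀ y : EMod n × EMod n, A.xc p₀ y.1 ≠ 0 →
      DoubleSpace.projCoord p (DoubleSpace.projInv A p₀ y) = θ y := fun y hy => by
    obtain ⟨hq, h1⟩ := DoubleSpace.projInv_of_ne_zero hy
    rw [h1]
    rfl
  have hθ₁ : θ y₁ = DoubleSpace.projCoord p b := by rw [← hθe y₁ hxc0, hinv]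
  have hkθ : ContDiffAt ℝ ∞ (fun y => k (θ y)) y₁ :=
    ContDiffAt.comp (g := k) y₁ (by rw [hθ₁]; exact hk) hθ
  have hkθ₁ : k (θ y₁) = l := by rw [hθ₁, hkl]
  have hdom : F.dom ∈ 𝓝 l := by
    have h1 := hg.mem_dom hl
    have h2 : F.posDom ∈ 𝓝 l.2.1 :=
      inter_mem (Metric.isOpen_ball.mem_nhds h1.2.1.1) (halfSpace_nhds hvl)
    exact prod_mem_nhds (isOpen_Ioo.mem_nhds h1.1)
      (prod_mem_nhds h2 (Metric.isOpen_ball.mem_nhds h1.2.2))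
  have hmom : ContDiffAt ℝ ∞ (fun y => F.mom (k (θ y)) 1) y₁ :=
    ContDiffAt.comp (g := fun l => F.mom l 1) y₁ (by
      rw [hkθ₁]; exact (contDiffOn_mom 1 (right_mem_Icc.2 zero_le_one)).contDiffAt hdom) hkθ
  have hDl : ContDiffAt ℝ ∞ (fun y : EMod n × EMod n =>
      fderiv ℝ (chTrans p₀ p) (y.1 + A.xc p₀ y.1 • y.2)) y₁ :=
    ContDiffAt.comp (g := fderiv ℝ (chTrans p₀ p)) y₁
      ((contDiffAt_chTrans hlt hl0).fderiv_right (by simp)) hL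
  have hDr : ContDiffAt ℝ ∞ (fun y : EMod n × EMod n => fderiv ℝ (chTrans p₀ p) y.1) y₁ :=
    ContDiffAt.comp (g := fderiv ℝ (chTrans p₀ p)) y₁
      ((contDiffAt_chTrans hrt hr0).fderiv_right (by simp)) contDiffAt_fst
  refine ⟨fun y => (y, (transposeApply (F.mom (k (θ y)) 1)
      (fderiv ℝ (chTrans p₀ p) (y.1 + A.xc p₀ y.1 • y.2)),
    transposeApply (-(k (θ y)).2.2) (fderiv ℝ (chTrans p₀ p) y.1))), ?_, ?_⟩
  · exact contDiffAt_id.prodMk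
      ((contDiff_transposeApply.contDiffAt.comp y₁ (hmom.prodMk hDl)).prodMk
        (contDiff_transposeApply.contDiffAt.comp y₁ (hkθ.snd.snd.neg.prodMk hDr)))
  · have e5 := hθ.continuousAt.eventually (p := fun y => k y ∈ F.relDom d ∧
      F.relPoint (k y) ∈ A.regularPart U ∧ DoubleSpace.projCoord p (F.relPoint (k y)).base = y)
      (by rw [hθ₁]; exact hev)
    filter_upwards [e1, e2, e3, e4, e5] with y h1 h2 h3 h4 h5
    have hx0 : A.xc p₀ y.1 ≠ 0 := ((A.xc_pos_iff h1.1).2 h1.2).ne'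
    have hbase : (F.relPoint (k (θ y))).base = DoubleSpace.projInv A p₀ y :=
      DoubleSpace.injOn_projCoord p (hg.relPoint_mem_phiDom h5.1) h4
        (h5.2.2.trans (hθe y hx0).symm)
    have hd0 : (F.relPoint (k (θ y))).base ∈ DoubleSpace.projDom p₀ := by
      rw [hbase]; exact DoubleSpace.projInv_mem_projDom h3
    have hdp : (F.relPoint (k (θ y))).base ∈ DoubleSpace.projDom p := by rw [hbase]; exact h4
    have hc0 : DoubleSpace.projCoord p₀ (F.relPoint (k (θ y))).base = y := by
      rw [hbase, DoubleSpace.projCoord_projInv h3]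
    refine ⟨_, h5.2.1, hd0, hc0, Prod.ext hc0 (Prod.ext ?_ ?_)⟩
    · have h6 : coord n p₀ (F.relPoint (k (θ y))).base.left = y.1 + A.xc p₀ y.1 • y.2 := by
        rw [hbase, DoubleSpace.projInv_left h3, coord_chartInv h2.1]
      have h7 : cotangentCoord p (F.relPoint (k (θ y))).base.left (F.relPoint (k (θ y))).α =
          F.mom (k (θ y)) 1 := congrArg (fun z => z.2.1) (hg.phiCoord_relPoint h5.1)
      refine (cotangentCoord_change hdp.1.1 hd0.1.1 _).trans ?_
      rw [h6, h7, fderivWithin_chTrans h2.2]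
    · have h6 : coord n p₀ (F.relPoint (k (θ y))).base.right = y.1 := congrArg Prod.fst hc0
      have h7 : cotangentCoord p (F.relPoint (k (θ y))).base.right (F.relPoint (k (θ y))).α' =
          -(k (θ y)).2.2 := congrArg (fun z => z.2.2) (hg.phiCoord_relPoint h5.1)
      refine (cotangentCoord_change hdp.1.2 hd0.1.2 _).trans ?_
      rw [h6, h7, fderivWithin_chTrans h1.2]

end LocalFlow

end AHMetric

/-! ### The neighbourhood `U` and the conclusion. -/

namespace AHMetric

variable {n : ℕ} {X : Type*} [TopologicalSpace X] [ChartedSpace (EuclideanHalfSpace (n + 1)) X]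
  [IsManifold (halfModel n) ∞ X] {A : AHMetric n X}

/-- `Λ₊ ∩ U` is parametrized, near `q` and in the chart centred at `p`, by a local flow. -/
def IsFlowChart (A : AHMetric n X) (U : Set A.PhiCotangent) (q : A.PhiCotangent) (p : X)
    (d : ℝ) : Prop :=
  q ∈ A.phiDom p ∧ coord n p q.base.right ∈ (A.localFlow p).posDom ∩ Metric.ball (coord n p p) d ∧
  ∀ q' ∈ A.LambdaPlus ∩ U, q' ∈ A.phiDom p →
    coord n p q'.base.right ∈ (A.localFlow p).posDom ∩ Metric.ball (coord n p p) d →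
    ∃ l ∈ (A.localFlow p).relDom d, (A.localFlow p).relPoint l = q'

theorem diagFace_subset_phiDom {q : A.PhiCotangent} (hq : q ∈ A.diagFace) {p : X}
    (hp : q.base.right ∈ chartDom n p) : q ∈ A.phiDom p := by
  obtain ⟨⟨z, h, α, rfl⟩ | ⟨z, hz, ha, hw, hunit, α, rfl⟩, -⟩ := hq
  · exact ⟨⟨hp, hp⟩, fun h1 => h ⟨rfl, h1⟩⟩
  · exact ⟨⟨hp, hp⟩, fun h => one_ne_zero (α := ℝ) h⟩

variable [T2Space X] [CompactSpace X]

/-- Finitely many charts cover `X`, so one `ε` serves all of them: trajectories shorter than `ε` are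
described by `relPoint`. Removing the closure of the longer ones leaves an open set that still
contains `∂_diag Λ₊`. -/
theorem exists_good_nhd (hA : A.Nontrapping) : ∃ (d : X → ℝ) (U : Set A.PhiCotangent),
    (∀ p, ∃ c C d₁ d₂, (A.localFlow p).IsGoodRadius (d p) c C d₁ d₂) ∧ IsOpen U ∧
    A.diagFace ⊆ U ∧ A.diagFace ⊆ A.LambdaPlus ∧
    ∀ q ∈ A.LambdaPlus ∩ U, ∃ p, A.IsFlowChart U q p (d p) := by
  choose d hd using fun p : X => (A.localFlow p).exists_isGoodRadius
  have hd0 : ∀ p, 0 < d p := fun p => by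
    obtain ⟨c, C, d₁, d₂, h⟩ := hd p
    exact h.pos
  let V : X → Set X := fun p => chartDom n p ∩ coord n p ⁻¹'
    (Metric.ball (coord n p p) (A.localFlow p).δ ∩ Metric.ball (coord n p p) (d p))
  have hVo : ∀ p, IsOpen (V p) := fun p => (continuousOn_coord p).isOpen_inter_preimage
    (isOpen_chartDom p) (Metric.isOpen_ball.inter Metric.isOpen_ball)
  have hVp : ∀ p, p ∈ V p := fun p => ⟨mem_chartDom_self p,
    Metric.mem_ball_self (A.localFlow p).δ_pos, Metric.mem_ball_self (hd0 p)⟩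
  have hVpos : ∀ p z, z ∈ V p → coord n p z ∈ (A.localFlow p).posDom ∩
      Metric.ball (coord n p p) (d p) := fun p z hz =>
    ⟨⟨hz.2.1, chartTgt_subset p (coord_mem hz.1)⟩, hz.2.2⟩
  obtain ⟨t, ht⟩ := isCompact_univ.elim_finite_subcover V hVo
    (fun z _ => mem_iUnion.2 ⟨z, hVp z⟩)
  obtain ⟨ε, hε, hεt⟩ : ∃ ε > 0, ∀ p ∈ t, ε * (A.localFlow p).R < d p := by
    have h1 : ∀ᶠ ε in 𝓝[>] (0 : ℝ), ∀ p ∈ t, ε * (A.localFlow p).R < d p := by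
      refine (Filter.eventually_all_finset t).2 fun p _ => nhdsWithin_le_nhds ?_
      have h2 : ContinuousAt (fun ε : ℝ => ε * (A.localFlow p).R) 0 := by fun_prop
      exact h2.eventually_lt_const (by change 0 * _ < d p; rw [zero_mul]; exact hd0 p)
    obtain ⟨ε, h2, h3⟩ := (h1.and self_mem_nhdsWithin).exists
    exact ⟨ε, h3, h2⟩
  have hbase : Continuous (PhiCotangent.base : A.PhiCotangent → A.DoubleSpace) := A.continuous_base
  have hmem : ∀ z : X, ∃ p ∈ t, z ∈ V p := fun z => by
    simpa using ht (mem_univ z)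
  refine ⟨d, (⋃ p ∈ t, A.phiDom p ∩ {q | q.base.right ∈ V p}) ∩ (closure (A.longFBR ε))ᶜ, hd,
    ?_, ?_, ?_, ?_⟩
  · refine (isOpen_biUnion fun p _ => (A.isOpen_phiDom p).inter ?_).inter isClosed_closure.isOpen_compl
    exact (hVo p).preimage (DoubleSpace.continuous_right.comp hbase)
  · intro q hq
    obtain ⟨p, hpt, hp⟩ := hmem q.base.right
    exact ⟨mem_biUnion hpt ⟨diagFace_subset_phiDom hq hp.1, hp⟩,
      disjoint_diagFace_closure_longFBR hA hε hq⟩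
  · intro q hq
    set p := q.base.right with hpdef
    obtain ⟨c, C, d₁, d₂, hg⟩ := hd p
    have hqp : q ∈ A.phiDom p := diagFace_subset_phiDom hq (mem_chartDom_self p)
    obtain ⟨h1, h2⟩ := (mem_conormalDiag_iff hqp).1 hq.1
    have h3 := (A.mem_SigmaL_iff hqp.1.1).1 hq.2
    have hlr : q.base.left = q.base.right := by
      obtain ⟨⟨z, h, α, rfl⟩ | ⟨z, hz, ha, hw, hunit, α, rfl⟩, -⟩ := hq <;> rfl
    -- A point of `∂_diag Λ₊` is the `relPoint` with time `0`.
    have hl : ((0 : ℝ), coord n p p, cotangentCoord p q.base.left q.α) ∈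
        (A.localFlow p).relDom (d p) := by
      refine ⟨le_rfl, hVpos p p (hVp p), ?_, ?_⟩
      · rw [zero_smul, norm_zero]
        exact hd0 p
      · have h5 : coord n p q.base.left = coord n p p := congrArg (coord n p) hlr
        rw [h5] at h3
        exact h3
    have heq : (A.localFlow p).relPoint (0, coord n p p, cotangentCoord p q.base.left q.α) = q := by
      refine A.injOn_phiCoord p (hg.relPoint_mem_phiDom hl) hqp ?_
      rw [hg.phiCoord_relPoint hl]
      have h4 := (LocalFlow.sol_of_fst_eq_zero (hg.mem_dom hl) rfl (right_mem_Icc.2 zero_le_one)).1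
      refine Prod.ext (Prod.ext rfl ?_) (Prod.ext h4 h2.symm)
      rw [h1]
      simp only [zero_smul]
      exact LocalFlow.disp_zero hl.2.1.1
    rw [← heq]
    exact hg.relPoint_mem_LambdaPlus hl
  · rintro q ⟨hq, hqU, hql⟩
    obtain ⟨p, hpt, hp, hpV⟩ := mem_iUnion₂.1 hqU
    obtain ⟨c, C, d₁, d₂, hg⟩ := hd p
    refine ⟨p, hp, hVpos p _ hpV, fun q' hq' hq'p hq'r => ?_⟩
    exact hg.exists_relPoint_eq (hεt p hpt) hq'.1 hq'p hq'r hq'.2.2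

theorem isProjDiffeo_regularPart {d : X → ℝ} {U : Set A.PhiCotangent}
    (hd : ∀ p, ∃ c C d₁ d₂, (A.localFlow p).IsGoodRadius (d p) c C d₁ d₂) (hU : IsOpen U)
    (hcov : ∀ q ∈ A.LambdaPlus ∩ U, ∃ p, A.IsFlowChart U q p (d p)) :
    A.IsProjDiffeo (A.regularPart U) := by
  have hinj : InjOn PhiCotangent.base (A.regularPart U) := by
    intro q hq q' hq' h
    obtain ⟨p, hp, hr, hc⟩ := hcov q hq.1
    obtain ⟨c, C, d₁, d₂, hg⟩ := hd p
    obtain ⟨l, hl, rfl⟩ := hc q hq.1 hp hr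
    have hp' : q'.base ∈ DoubleSpace.projDom p := h ▸ hp
    obtain ⟨l', hl', rfl⟩ := hc q' hq'.1 hp' (by rw [← h]; exact hr)
    rw [(hg.relPoint_inj hl hl' h).2 ((hg.relPoint_mem_regularPart_iff hl).1 hq).2.1]
  refine ⟨hinj, ?_, fun p₀ => ?_⟩
  · refine isOpen_iff_mem_nhds.2 ?_
    rintro _ ⟨q, hq, rfl⟩
    obtain ⟨p, hp, hr, hc⟩ := hcov q hq.1
    obtain ⟨c, C, d₁, d₂, hg⟩ := hd p
    obtain ⟨l, hl, rfl⟩ := hc q hq.1 hp hr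
    exact hg.image_regularPart_mem_nhds hl hU hq
  -- Injectivity makes the inverse well defined on the whole image; it is smooth because near each
  -- point it agrees with a local inverse.
  · have hex : ∀ y : EMod n × EMod n, ∃ z : (EMod n × EMod n) × (EMod n × EMod n),
        ∀ q ∈ A.regularPart U, q.base ∈ DoubleSpace.projDom p₀ →
          DoubleSpace.projCoord p₀ q.base = y → z = A.phiCoord p₀ q := by
      intro y
      by_cases h : ∃ q ∈ A.regularPart U, q.base ∈ DoubleSpace.projDom p₀ ∧
        DoubleSpace.projCoord p₀ q.base = y
      · obtain ⟨q, hq, hqd, rfl⟩ := h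
        refine ⟨A.phiCoord p₀ q, fun q' hq' hqd' h => ?_⟩
        rw [hinj hq' hq (DoubleSpace.injOn_projCoord p₀ hqd' hqd h)]
      · exact ⟨0, fun q hq hqd hy => absurd ⟨q, hq, hqd, hy⟩ h⟩
    choose G hG using hex
    refine ⟨G, ?_, fun q hq hqd => hG _ q hq hqd rfl⟩
    rintro _ ⟨_, ⟨⟨q, hq, rfl⟩, hqd⟩, rfl⟩
    obtain ⟨p, hp, hr, hc⟩ := hcov q hq.1
    obtain ⟨c, C, d₁, d₂, hg⟩ := hd p
    obtain ⟨l, hl, rfl⟩ := hc q hq.1 hp hr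
    obtain ⟨H, hH, hev⟩ := hg.exists_contDiffAt_inverse hl hU hq hqd
    refine (hH.congr_of_eventuallyEq ?_).contDiffWithinAt
    filter_upwards [hev] with y hy
    obtain ⟨q', h1, h2, h3, h4⟩ := hy
    rw [hG y q' h1 h2 h3, h4]

end AHMetric

end

theorem mainTheorem6 (n : ℕ) (X : Type*) [TopologicalSpace X] [T2Space X] [CompactSpace X]
    [ChartedSpace (EuclideanHalfSpace (n + 1)) X] [IsManifold (halfModel n) ∞ X]
    (A : AHMetric n X) (hA : A.Nontrapping) :
    ∃ U : Set A.PhiCotangent, IsOpen U ∧ A.diagFace ⊆ U ∧ A.diagFace ⊆ A.LambdaPlus ∧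
      -- near each point, `Λ₊ ∩ U` has a parametrization by the codimension two corner whose two
      -- faces are `∂_diag Λ₊` and the part of `Λ₊` over the front face
      (∀ q ∈ A.LambdaPlus ∩ U, ∃ (p₀ : X) (O : Set (EMod n × EMod n)) (W : Set A.PhiCotangent)
          (h : EMod n × EMod n → A.PhiCotangent),
        A.IsCornerParam (A.LambdaPlus ∩ U) p₀ O W h ∧ q ∈ W ∧
        (∀ u ∈ O ∩ modelCorner n,
          (h u ∈ A.diagFace ↔ u.1 0 = 0) ∧
          ((h u).base ∈ AHMetric.DoubleSpace.FF ↔ u.2 0 = 0)) ∧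
        -- the rank of the projection drops by `n` at `∂_diag Λ₊`
        (∀ u ∈ O ∩ modelCorner n, u.1 0 = 0 →
          Module.finrank ℝ (LinearMap.range (A.projDeriv p₀ O h u).toLinearMap) + n
            = 2 * (n + 1)) ∧
        -- the determinant vanishes to order precisely `n` at `∂_diag Λ₊`
        (∃ c C : ℝ, 0 < c ∧ ∀ u ∈ O ∩ modelCorner n,
          c * (u.1 0) ^ n ≤ |(A.projDeriv p₀ O h u).det| ∧
          |(A.projDeriv p₀ O h u).det| ≤ C * (u.1 0) ^ n)) ∧
      -- on the interior of `Λ₊ ∩ U` the projection is a diffeomorphism onto its image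
      A.IsProjDiffeo
        {q | q ∈ A.LambdaPlus ∩ U ∧ q ∉ A.diagFace ∧ q.base ∉ AHMetric.DoubleSpace.FF} := by
  obtain ⟨d, U, hd, hU, hdU, hdL, hcov⟩ := AHMetric.exists_good_nhd hA
  refine ⟨U, hU, hdU, hdL, fun q hq => ?_, AHMetric.isProjDiffeo_regularPart hd hU hcov⟩
  obtain ⟨p, hp, hr, hc⟩ := hcov q hq
  obtain ⟨c, C, d₁, d₂, hg⟩ := hd p
  obtain ⟨R, O, W, hOd, hparam, hqW⟩ := hg.exists_isCornerParam hU hc hq hp hr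
  have hsub : ∀ u ∈ O ∩ modelCorner n, u ∈ (A.localFlow p).cornerDom (d p) R ∩ modelCorner n :=
    fun u hu => ⟨hOd hu.1, hu.2⟩
  have hRdet : 0 < |(R : EMod n →L[ℝ] EMod n).det| := by
    refine abs_pos.2 fun h => ?_
    have h1 : LinearMap.ker (R : EMod n →L[ℝ] EMod n).toLinearMap = ⊥ :=
      LinearMap.ker_eq_bot.2 R.injective
    exact (LinearMap.det_eq_zero_iff_ker_ne_bot.1 h) h1
  -- The two constants bound the non-degenerate factors of the determinant, that of the displacement
  -- and that of `R`.
  refine ⟨p, O, W, (A.localFlow p).corner R, hparam, hqW, fun u hu => ⟨?_, ?_⟩, fun u hu h0 => ?_,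
    d₁ * |(R : EMod n →L[ℝ] EMod n).det|, d₂ * |(R : EMod n →L[ℝ] EMod n).det|,
    mul_pos hg.d₁_pos hRdet, fun u hu => ?_⟩
  · exact (hg.relPoint_mem_diagFace (AHMetric.LocalFlow.cornerParam_mem (hsub u hu))).trans
      (AHMetric.LocalFlow.cornerParam_fst_eq_zero (hsub u hu))
  · exact hg.relPoint_mem_FF (AHMetric.LocalFlow.cornerParam_mem (hsub u hu))
  · rw [hg.projDeriv_eq hparam.isOpen_source hOd hu]
    exact hg.finrank_range (hsub u hu) h0
  · have h1 := hg.det _ (AHMetric.LocalFlow.mem_posDom_of_cornerDom (hsub u hu)) _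
      (AHMetric.LocalFlow.cornerVec_mem_ball (hOd hu.1))
    have h2 : 0 ≤ u.1 0 ^ n := pow_nonneg hu.2.1 n
    rw [hg.projDeriv_eq hparam.isOpen_source hOd hu, AHMetric.LocalFlow.abs_det_cornerProjDeriv,
      abs_of_nonneg hu.2.1]
    exact ⟨mul_le_mul_of_nonneg_right (mul_le_mul_of_nonneg_right h1.1 hRdet.le) h2,
      mul_le_mul_of_nonneg_right (mul_le_mul_of_nonneg_right h1.2 hRdet.le) h2⟩
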